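/- Let $N\ge 1$ and let $\mathcal D=\Omega\setminus\bigcup_{i=1}^N\overline{\omega_i}\subset\mathbb R^2$, where $\Omega,\omega_1,\dots,\omega_N$ are bounded simply connected open sets with smooth boundary (each boundary being a smooth Jordan curve), $\overline{\omega_i}\subset\Omega$, and $\overline{\omega_i}\cap\overline{\omega_j}=\emptyset$ for $i\ne j$. For $z,w\in\mathbb C\simeq\mathbb R^2$ put $z\times w=z_1w_2-z_2w_1$. Let $V_i$ be the unique solution, harmonic in $\mathcal D$ and continuous on $\overline{\mathcal D}$, of $$-\Delta V_i=0\ \text{in }\mathcal D,\qquad V_i=1\ \text{on }\partial\mathcal D\setminus\partial\omega_i,\qquad V_i=0\ \text{on }\partial\omega_i .$$ Let $\mathcal J=\{u\in H^1(\mathcal D,\mathbb C): |u|=1\text{ on }\partial\mathcal D\}$ (in the sense of traces) and, for $\varepsilon>0$, $$E_\varepsilon(u)=\frac12\int_{\mathcal D}\Big\{|\nabla u|^2+\frac1{2\varepsilon^2}(1-|u|^2)^2\Big\}\,dx .$$ For $u\in H^1(\mathcal D,\mathbb C)$ let $$\mathrm{abdeg}_i(u)=\frac1{2\pi}\int_{\mathcal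 D}u\times(\partial_1V_i\,\partial_2u-\partial_2V_i\,\partial_1u)\,dx,\qquad \mathrm{abdeg}(u)=(\mathrm{abdeg}_1(u),\dots,\mathrm{abdeg}_N(u)),$$ and let $\|V_i\|_{C^1(\mathcal D)}=\max\big(\sup_{\mathcal D}|V_i|,\ \sup_{\mathcal D}|\partial_1V_i|,\ \sup_{\mathcal D}|\partial_2V_i|\big)$; this norm is finite and the integral converges absolutely. For $u$ with $|u|=1$ on $\partial\omega_i$ let $\deg_{\partial\omega_i}(u)=\frac1{2\pi}\int_{\partial\omega_i}u\times\partial_\tau u\,d\tau$, where $\partial\omega_i$ is oriented counterclockwise and the integral is understood as the duality between $H^{1/2}(\partial\omega_i)$ and $H^{-1/2}(\partial\omega_i)$ applied to the trace of $u$. Then: 1. If $u\in H^1(\mathcal D,\mathbb S^1)$, i.e. $u\in H^1(\mathcal D,\mathbb C)$ and $|u|=1$ a.e. in $\mathcal D$, then $\mathrm{abdeg}_i(u)=\deg_{\partial\omega_i}(u)$ for every $i$. 2. If $\Lambda,\varepsilon>0$ and $u,v\in\mathcal J$ satisfy $E_\varepsilon(u)\le\Lambda$ and $E_\varepsilon(v)\le\Lambda$,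 then for every $i$ $$|\mathrm{abdeg}_i(u)-\mathrm{abdeg}_i(v)|\le\frac2\pi\,\|V_i\|_{C^1(\mathcal D)}\,\Lambda^{1/2}\,\|u-v\|_{L^2(\mathcal D)} .$$ 3. If $\Lambda>0$ and $(u_\varepsilon)_{\varepsilon>0}\subset\mathcal J$ satisfies $E_\varepsilon(u_\varepsilon)\le\Lambda$ for all $\varepsilon>0$, then $\mathrm{dist}(\mathrm{abdeg}(u_\varepsilon),\mathbb Z^N)\to0$ as $\varepsilon\to0^+$. -/

import Mathlib

open MeasureTheory Set Filter Topology
open scoped ContDiff ComplexConjugate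

noncomputable section

namespace GinzburgLandau

/-! The plane `ℝ²` is identified with `ℂ` (same norm, same Lebesgue measure); the coordinate
directions are `1` and `Complex.I`. -/

/-- The vectorial product `z × w = z₁ w₂ - z₂ w₁` of two complex numbers. -/
def cross (z w : ℂ) : ℝ := z.re * w.im - z.im * w.re

/-! ### Domains -/

/-- `γ` is a smooth, regular, simple, closed, positively oriented (counterclockwise)
parametrisation with period `2π` of the whole boundary of `U`: the set `U` lies on the left of `γ`
(in the direction `i γ'`) and its exterior lies on the right. -/
structure IsBoundaryParam (U : Set ℂ) (γ : ℝ → ℂ) : Prop where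
  contDiff : ContDiff ℝ ∞ γ
  periodic : Function.Periodic γ (2 * Real.pi)
  injOn : InjOn γ (Ico 0 (2 * Real.pi))
  deriv_ne_zero : ∀ t, deriv γ t ≠ 0
  range_eq : range γ = frontier U
  left_mem : ∀ t, ∀ᶠ s : ℝ in 𝓝[>] 0, γ t + s * (Complex.I * deriv γ t) ∈ U
  right_not_mem : ∀ t, ∀ᶠ s : ℝ in 𝓝[>] 0, γ t - s * (Complex.I * deriv γ t) ∉ closure U

/-- `U` is a bounded, simply connected open set of the plane with smooth boundary, the boundary
being the smooth Jordan curve parametrised by `γ`. -/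
structure IsSmoothSimplyConnected (U : Set ℂ) (γ : ℝ → ℂ) : Prop where
  isOpen : IsOpen U
  isBounded : Bornology.IsBounded U
  isSimplyConnected : IsSimplyConnected U
  isBoundaryParam : IsBoundaryParam U γ

/-- The data of a smooth perforated domain with `N` holes: a bounded simply connected smooth open
set `Ω` and `N` bounded simply connected smooth open sets `hole i` whose closures are contained in `Ω`
and pairwise disjoint. The (arbitrary) positively oriented parametrisations of the boundary
curves are recorded, so that a statement about every `PerforatedDomain` is in particular
a statement about every choice of them. -/
structure PerforatedDomain (N : ℕ) where
  Ω : Set ℂ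
  outer : ℝ → ℂ
  hole : Fin N → Set ℂ
  inner : Fin N → ℝ → ℂ
  smooth_Ω : IsSmoothSimplyConnected Ω outer
  smooth_hole : ∀ i, IsSmoothSimplyConnected (hole i) (inner i)
  closure_subset : ∀ i, closure (hole i) ⊆ Ω
  disjoint_closure : ∀ i j, i ≠ j → Disjoint (closure (hole i)) (closure (hole j))

/-- The domain `Ω ∖ ⋃ᵢ closure (hole i)`. -/
def PerforatedDomain.dom {N : ℕ} (P : PerforatedDomain N) : Set ℂ :=
  P.Ω \ ⋃ i, closure (P.hole i)

/-! ### The Sobolev space `H¹` -/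

/-- `g` is square integrable on the open set `U` and is the weak (distributional) derivative of `u`
on `U` in the direction `e`. -/
def IsWeakDeriv (U : Set ℂ) (e : ℂ) (u g : ℂ → ℂ) : Prop :=
  MemLp g 2 (volume.restrict U) ∧
    ∀ φ : ℂ → ℝ, ContDiff ℝ ∞ φ → HasCompactSupport φ → tsupport φ ⊆ U →
      ∫ x in U, (fderiv ℝ φ x e) • u x = -∫ x in U, φ x • g x

/-- `u` belongs to `H¹(U, ℂ)`. -/
def MemH1 (U : Set ℂ) (u : ℂ → ℂ) : Prop :=
  MemLp u 2 (volume.restrict U) ∧ (∃ g, IsWeakDeriv U 1 u g) ∧ ∃ g, IsWeakDeriv U Complex.I u g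

open Classical in
/-- The weak derivative of `u` on `U` in the direction `e` (unique up to null sets of `U`; the zero
function if there is none). -/
def weakDeriv (U : Set ℂ) (e : ℂ) (u : ℂ → ℂ) : ℂ → ℂ :=
  if h : ∃ g, IsWeakDeriv U e u g then h.choose else 0

/-- `u` belongs to `H¹(U, 𝕊¹)`. -/
def MemH1Circle (U : Set ℂ) (u : ℂ → ℂ) : Prop :=
  MemH1 U u ∧ ∀ᵐ x ∂volume.restrict U, ‖u x‖ = 1

/-! ### Traces and degrees on boundary curves -/

/-- Lebesgue measure on one period of the parameter of a boundary curve. -/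
def periodMeasure : Measure ℝ := volume.restrict (Ioc 0 (2 * Real.pi))

/-- The square integrable function `g` of the parameter is the trace of `u ∈ H¹(U, ℂ)` along the
curve `γ`: the limit of the restrictions to `γ` of smooth functions which converge to `u`
in `H¹(U)`. -/
def IsTrace (U : Set ℂ) (γ : ℝ → ℂ) (u : ℂ → ℂ) (g : ℝ → ℂ) : Prop :=
  MemLp g 2 periodMeasure ∧
    ∃ φ : ℕ → ℂ → ℂ, (∀ n, ContDiff ℝ ∞ (φ n)) ∧
      Tendsto (fun n => eLpNorm (fun x => φ n x - u x) 2 (volume.restrict U)) atTop (𝓝 0) ∧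
      (∀ e ∈ ({1, Complex.I} : Set ℂ),
        Tendsto (fun n => eLpNorm (fun x => fderiv ℝ (φ n) x e - weakDeriv U e u x) 2
          (volume.restrict U)) atTop (𝓝 0)) ∧
      Tendsto (fun n => eLpNorm (fun t => φ n (γ t) - g t) 2 periodMeasure) atTop (𝓝 0)

/-- The `k`-th Fourier coefficient of `g` on `(0, 2π)`. -/
def fcoeff (g : ℝ → ℂ) (k : ℤ) : ℂ := fourierCoeffOn Real.two_pi_pos g k

/-- `g` belongs to `H^{1/2}(ℝ/2πℤ, ℂ)`. -/
def MemHHalf (g : ℝ → ℂ) : Prop :=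
  MemLp g 2 periodMeasure ∧ Summable fun k : ℤ => (1 + |(k : ℝ)|) * ‖fcoeff g k‖ ^ 2

/-- The Fourier coefficients `i k ĝ(k)` of the derivative of `g ∈ H^{1/2}(ℝ/2πℤ, ℂ)`, an element of
`H^{-1/2}(ℝ/2πℤ, ℂ)`. -/
def derivCoeff (g : ℝ → ℂ) (k : ℤ) : ℂ := Complex.I * k * fcoeff g k

/-- The duality `∫₀^{2π} f × w dt` between `f ∈ H^{1/2}` and `w ∈ H^{-1/2}`, both given by their
Fourier coefficients. -/
def crossDuality (f w : ℤ → ℂ) : ℝ := 2 * Real.pi * ∑' k, cross (f k) (w k)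

/-- The degree `(1/2π) ∫ g × g' dt` of `g ∈ H^{1/2}(ℝ/2πℤ, ℂ)`, the integral being the duality
between `H^{1/2}` and `H^{-1/2}`. -/
def curveDegree (g : ℝ → ℂ) : ℝ :=
  1 / (2 * Real.pi) * crossDuality (fcoeff g) (derivCoeff g)

namespace PerforatedDomain

variable {N : ℕ} (P : PerforatedDomain N)

/-- The degree on `∂(hole i)` of `u : dom → ℂ` is well defined and equal to `d`: `u` has a trace on
`∂(hole i)`, and every trace is in `H^{1/2}` and has degree `d`. -/
def HasDegree (i : Fin N) (u : ℂ → ℂ) (d : ℝ) : Prop :=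
  (∃ g, IsTrace P.dom (P.inner i) u g) ∧
    ∀ g, IsTrace P.dom (P.inner i) u g → MemHHalf g ∧ curveDegree g = d

/-- The trace of `u` along the curve `γ` has modulus one almost everywhere. -/
def HasUnitTrace (γ : ℝ → ℂ) (u : ℂ → ℂ) : Prop :=
  ∃ g, IsTrace P.dom γ u g ∧ ∀ᵐ t ∂periodMeasure, ‖g t‖ = 1

/-- The class `𝓙` of the maps `u ∈ H¹(dom, ℂ)` with `|u| = 1` on the boundary of the domain. -/
def MemJ (u : ℂ → ℂ) : Prop :=
  MemH1 P.dom u ∧ P.HasUnitTrace P.outer u ∧ ∀ i, P.HasUnitTrace (P.inner i) u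

/-- The Ginzburg–Landau energy
`E_ε(u) = 1/2 ∫ (|∇u|² + (1/(2ε²)) (1 - |u|²)²)`. -/
def energy (ε : ℝ) (u : ℂ → ℂ) : ENNReal :=
  1 / 2 * ∫⁻ x in P.dom, ENNReal.ofReal
    (‖weakDeriv P.dom 1 u x‖ ^ 2 + ‖weakDeriv P.dom Complex.I u x‖ ^ 2
      + 1 / (2 * ε ^ 2) * (1 - ‖u x‖ ^ 2) ^ 2)

/-- `V` is the classical solution of `-ΔV = 0` in the domain, `V = 0` on `∂(hole i)`, `V = 1` on the rest
of the boundary. -/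
structure IsPotential (i : Fin N) (V : ℂ → ℝ) : Prop where
  continuousOn : ContinuousOn V (closure P.dom)
  harmonic : InnerProductSpace.HarmonicOnNhd V P.dom
  eq_zero : ∀ x ∈ frontier (P.hole i), V x = 0
  eq_one : ∀ x ∈ frontier P.dom \ frontier (P.hole i), V x = 1

/-- `max (|V|, |∂₁V|, |∂₂V|)` at the point `x`. -/
def c1Size (V : ℂ → ℝ) (x : ℂ) : ℝ :=
  max |V x| (max |fderiv ℝ V x 1| |fderiv ℝ V x Complex.I|)

/-- `V` and its first derivatives are bounded on the domain. -/
def C1Bounded (V : ℂ → ℝ) : Prop := BddAbove (c1Size V '' P.dom)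

/-- The norm `‖V‖_{C¹} = max (sup |V|, sup |∂₁V|, sup |∂₂V|)` over the domain. -/
def c1Norm (V : ℂ → ℝ) : ℝ := sSup (c1Size V '' P.dom)

/-- The function `u × (∂₁V ∂₂u - ∂₂V ∂₁u)`. -/
def abdegIntegrand (V : ℂ → ℝ) (u : ℂ → ℂ) (x : ℂ) : ℝ :=
  cross (u x) (fderiv ℝ V x 1 • weakDeriv P.dom Complex.I u x
    - fderiv ℝ V x Complex.I • weakDeriv P.dom 1 u x)

/-- The approximate bulk degree
`abdeg_i(u) = (1/2π) ∫ u × (∂₁Vᵢ ∂₂u - ∂₂Vᵢ ∂₁u)`, as a vector indexed by `i`. -/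
def abdeg (V : Fin N → ℂ → ℝ) (u : ℂ → ℂ) (i : Fin N) : ℝ :=
  1 / (2 * Real.pi) * ∫ x in P.dom, P.abdegIntegrand (V i) u x

end PerforatedDomain

/-- The lattice `ℤ^N` in `ℝ^N` (with Euclidean distance). -/
def intLattice (N : ℕ) : Set (EuclideanSpace ℝ (Fin N)) :=
  {y | ∃ d : Fin N → ℤ, ∀ i, y i = d i}

end GinzburgLandau

end

/-! Everything rests on the bilinear form `bulkForm V u v = ∫ u × (∂₁V ∂₂v - ∂₂V ∂₁v)`, whose
diagonal is `2π` times the approximate bulk degree. The rotated gradient of `V` is divergence free,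
and it is tangent to the boundary because `V` is constant on each boundary curve. Integration by
parts therefore leaves no boundary term and the form is symmetric (`bulkForm_symm`). Hence the
difference of its values at `(u, u)` and `(v, v)` is the sum of its values at `(u - v, u)` and `(u -
v, v)`, and Cauchy-Schwarz gives the second assertion.

No regularity of `V` up to the boundary is needed for this. Let `χₙ` be a cutoff that vanishes near
`0` and `1` and tends to `1` between them, with primitive `Xₙ`. Then `χₙ(V) ∇V = ∇(Xₙ(V))` is curl
free and compactly supported in the domain, and dominated convergence removes the cutoff. Only a
bound for `∇V` enters: logarithmic barriers on exterior discs make `V` Lipschitz at boundary points,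
and interior gradient estimates on balls reaching the boundary turn this into a uniform bound.

For a circle valued `u` both weak derivatives are orthogonal to `u`, so the Jacobian of `u`
vanishes. Then `∫ u × (∂₁ψ ∂₂u - ∂₂ψ ∂₁u) = -2 ∫ ψ ∂₁u × ∂₂u = 0` for compactly supported `ψ`, and
`V` may be replaced by `-η`, where the smooth function `η` is `1` near the hole and `0` near the
other boundary curves (`bulkForm_eq_neg`). For smooth approximations of `u`, Green's formula in a
collar of the hole turns the integral against `η` into the boundary integral of `φ × ∂ₜφ`, up to a
Jacobian term that tends to zero. Convergence in `H¹` forces convergence of the boundary values in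
`H^{1/2}`, where the degree is the series `∑ k |ĝ(k)|²`. This is the first assertion; density of
smooth functions comes from the cone property of the domain.

The third assertion needs that the bulk degree of a circle valued map is an integer
(`exists_int_abdeg_eq`). For a good smooth approximation the degree integral hardly varies between
the slices of the collar, because the Jacobian is small in `L¹`. An averaging argument selects a
slice of bounded energy on which the modulus is close to `1` in `L²`. In one dimension this keeps
the curve away from the origin, so its degree integral is close to a winding number.

Finally, along any sequence `ε → 0`, bounded energy gives a subsequence converging weakly in `H¹`
and strongly in `L²` to a circle valued map (`exists_subseq_tendsto_circle`). The Lipschitz estimate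
carries the bulk degrees to that of the limit, which is a lattice point. -/

noncomputable section

namespace GinzburgLandau

/-! ### Tubular coordinates along a boundary curve -/

/-- Tubular coordinates along the curve `γ`: `(t, s)` is sent to `γ(t) + s i γ'(t)`. -/
def tube (γ : ℝ → ℂ) (p : ℝ × ℝ) : ℂ := γ p.1 + p.2 * (Complex.I * deriv γ p.1)

namespace IsBoundaryParam

variable {U : Set ℂ} {γ : ℝ → ℂ}

theorem contDiff_deriv (h : IsBoundaryParam U γ) : ContDiff ℝ ∞ (deriv γ) :=
  ((contDiff_infty_iff_deriv (𝕜 := ℝ)).1 h.contDiff).2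

theorem contDiff_tube (h : IsBoundaryParam U γ) : ContDiff ℝ ∞ (tube γ) := by
  have h1 := h.contDiff
  have h2 := h.contDiff_deriv
  unfold tube
  refine (h1.comp contDiff_fst).add (ContDiff.mul ?_ (contDiff_const.mul (h2.comp contDiff_fst)))
  exact Complex.ofRealCLM.contDiff.comp contDiff_snd

theorem periodic_deriv (h : IsBoundaryParam U γ) : Function.Periodic (deriv γ) (2 * Real.pi) := by
  intro t
  have : (fun x => γ (x + 2 * Real.pi)) = γ := funext h.periodic
  rw [← deriv_comp_add_const, this]

theorem tube_add_period (h : IsBoundaryParam U γ) (t s : ℝ) :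
    tube γ (t + 2 * Real.pi, s) = tube γ (t, s) := by
  simp only [tube, h.periodic t, h.periodic_deriv t]

theorem tube_add_int_period (h : IsBoundaryParam U γ) (t s : ℝ) (k : ℤ) :
    tube γ (t + k * (2 * Real.pi), s) = tube γ (t, s) := by
  have h1 := (h.periodic.int_mul k) t
  have h2 := (h.periodic_deriv.int_mul k) t
  simp only [tube, h1, h2]

theorem hasDerivAt (h : IsBoundaryParam U γ) (t : ℝ) : HasDerivAt γ (deriv γ t) t :=
  (h.contDiff.differentiable (by simp) t).hasDerivAt

theorem fderiv_tube_fst (h : IsBoundaryParam U γ) (t s : ℝ) :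
    fderiv ℝ (tube γ) (t, s) (1, 0) =
      deriv γ t + s * (Complex.I * deriv (deriv γ) t) := by
  have hd : HasDerivAt (fun x : ℝ => tube γ (x, s))
      (deriv γ t + s * (Complex.I * deriv (deriv γ) t)) t := by
    have h2 : HasDerivAt (deriv γ) (deriv (deriv γ) t) t :=
      (h.contDiff_deriv.differentiable (by simp) t).hasDerivAt
    exact (h.hasDerivAt t).add ((h2.const_mul Complex.I).const_mul (s : ℂ))
  have hc : HasDerivAt (fun x : ℝ => ((x, s) : ℝ × ℝ)) (1, 0) t :=
    (hasDerivAt_id t).prodMk (hasDerivAt_const t s)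
  have hf := (h.contDiff_tube.differentiable (by simp) (t, s)).hasFDerivAt.comp_hasDerivAt t hc
  exact hf.unique hd

theorem fderiv_tube_snd (h : IsBoundaryParam U γ) (t s : ℝ) :
    fderiv ℝ (tube γ) (t, s) (0, 1) = Complex.I * deriv γ t := by
  have hd : HasDerivAt (fun x : ℝ => tube γ (t, x)) (Complex.I * deriv γ t) s := by
    have h2 : HasDerivAt (fun x : ℝ => (x : ℂ)) 1 s := Complex.ofRealCLM.hasDerivAt
    simpa [tube] using (h2.mul_const (Complex.I * deriv γ t)).const_add (γ t)
  have hc : HasDerivAt (fun x : ℝ => ((t, x) : ℝ × ℝ)) (0, 1) s :=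
    (hasDerivAt_const s t).prodMk (hasDerivAt_id s)
  have hf := (h.contDiff_tube.differentiable (by simp) (t, s)).hasFDerivAt.comp_hasDerivAt s hc
  exact hf.unique hd

end IsBoundaryParam

/-- The Jacobian determinant of the tubular coordinates. -/
def tubeJac (γ : ℝ → ℂ) (p : ℝ × ℝ) : ℝ :=
  cross (fderiv ℝ (tube γ) p (1, 0)) (fderiv ℝ (tube γ) p (0, 1))

theorem fderiv_prod_apply {E : Type*} [NormedAddCommGroup E] [NormedSpace ℝ E]
    (L : ℝ × ℝ →L[ℝ] E) (v : ℝ × ℝ) : L v = v.1 • L (1, 0) + v.2 • L (0, 1) := by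
  rw [← L.map_smul, ← L.map_smul, ← L.map_add]
  congr 1
  ext <;> simp

theorem cross_ne_zero_injective {a b : ℂ} (hab : cross a b ≠ 0) {x y : ℝ}
    (h : x • a + y • b = 0) : x = 0 ∧ y = 0 := by
  have h1 := congrArg Complex.re h
  have h2 := congrArg Complex.im h
  simp only [Complex.add_re, Complex.smul_re, smul_eq_mul, Complex.zero_re, Complex.add_im,
    Complex.smul_im, Complex.zero_im] at h1 h2
  unfold cross at hab
  constructor
  · have : x * (a.re * b.im - a.im * b.re) = 0 := by linear_combination b.im * h1 - b.re * h2
    exact (mul_eq_zero.1 this).resolve_right hab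
  · have : y * (a.re * b.im - a.im * b.re) = 0 := by linear_combination a.re * h2 - a.im * h1
    exact (mul_eq_zero.1 this).resolve_right hab

/-- A linear map `ℝ² → ℂ` with nonzero determinant, as a continuous linear equivalence. -/
theorem exists_equiv_of_cross_ne_zero (L : ℝ × ℝ →L[ℝ] ℂ) (hL : cross (L (1, 0)) (L (0, 1)) ≠ 0) :
    ∃ e : (ℝ × ℝ) ≃L[ℝ] ℂ, (e : ℝ × ℝ →L[ℝ] ℂ) = L := by
  have hinj : Function.Injective (L : ℝ × ℝ →ₗ[ℝ] ℂ) := by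
    rw [← LinearMap.ker_eq_bot, LinearMap.ker_eq_bot']
    intro v hv
    have hv' : L v = 0 := hv
    rw [fderiv_prod_apply] at hv'
    have := cross_ne_zero_injective hL hv'
    exact Prod.ext this.1 this.2
  have hfr : Module.finrank ℝ (ℝ × ℝ) = Module.finrank ℝ ℂ := by
    simp [Complex.finrank_real_complex]
  let e := (LinearEquiv.ofInjectiveOfFinrankEq (L : ℝ × ℝ →ₗ[ℝ] ℂ) hinj hfr)
  refine ⟨e.toContinuousLinearEquiv, ?_⟩
  ext <;> simp [e, LinearEquiv.ofInjectiveOfFinrankEq]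

namespace IsBoundaryParam

variable {U : Set ℂ} {γ : ℝ → ℂ}

/-- On the curve the coordinate directions are `γ'` and `i γ'`, which span area `‖γ'‖²`. Off the
curve the correction is linear in `s`, with a coefficient given by the curvature. -/
theorem tubeJac_eq (h : IsBoundaryParam U γ) (t s : ℝ) :
    tubeJac γ (t, s) = ‖deriv γ t‖ ^ 2 - s * cross (deriv γ t) (deriv (deriv γ) t) := by
  rw [tubeJac, h.fderiv_tube_fst, h.fderiv_tube_snd, ← Complex.normSq_eq_norm_sq,
    Complex.normSq_apply]
  simp [cross]
  ring

theorem exists_norm_deriv_bounds (h : IsBoundaryParam U γ) :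
    ∃ m M : ℝ, 0 < m ∧ (∀ t, m ≤ ‖deriv γ t‖) ∧ ∀ t, ‖deriv γ t‖ ≤ M := by
  have hc : Continuous fun t => ‖deriv γ t‖ := (h.contDiff.continuous_deriv (by simp)).norm
  have hp : Function.Periodic (fun t => ‖deriv γ t‖) (2 * Real.pi) := fun t => by
    simp only [h.periodic_deriv t]
  have hne : (Icc 0 (2 * Real.pi)).Nonempty := nonempty_Icc.2 Real.two_pi_pos.le
  obtain ⟨a, -, ha⟩ := isCompact_Icc.exists_isMinOn hne hc.continuousOn
  obtain ⟨b, -, hb⟩ := isCompact_Icc.exists_isMaxOn hne hc.continuousOn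
  refine ⟨‖deriv γ a‖, ‖deriv γ b‖, norm_pos_iff.2 (h.deriv_ne_zero a), fun t => ?_, fun t => ?_⟩
  · obtain ⟨y, hy, hy'⟩ := hp.exists_mem_Ico₀ Real.two_pi_pos t
    rw [hy']; exact ha (Ico_subset_Icc_self hy)
  · obtain ⟨y, hy, hy'⟩ := hp.exists_mem_Ico₀ Real.two_pi_pos t
    rw [hy']; exact hb (Ico_subset_Icc_self hy)

theorem hasStrictFDerivAt_tube (h : IsBoundaryParam U γ) (p : ℝ × ℝ) :
    HasStrictFDerivAt (tube γ) (fderiv ℝ (tube γ) p) p :=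
  h.contDiff_tube.contDiffAt.hasStrictFDerivAt (by simp)

theorem exists_tubeJac_bound (h : IsBoundaryParam U γ) :
    ∃ δ c : ℝ, 0 < δ ∧ 0 < c ∧ ∀ t s, |s| ≤ δ → c ≤ tubeJac γ (t, s) := by
  obtain ⟨m, M, hm, hlo, hhi⟩ := h.exists_norm_deriv_bounds
  have h1 := h.contDiff.continuous_deriv (by simp)
  have h2 := h.contDiff_deriv.continuous_deriv (by simp)
  have hc : Continuous fun t => |cross (deriv γ t) (deriv (deriv γ) t)| := by
    unfold cross; fun_prop
  have hp2 : Function.Periodic (deriv (deriv γ)) (2 * Real.pi) := by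
    intro t
    have : (fun x => deriv γ (x + 2 * Real.pi)) = deriv γ := funext h.periodic_deriv
    rw [← deriv_comp_add_const, this]
  have hp : Function.Periodic (fun t => |cross (deriv γ t) (deriv (deriv γ) t)|)
      (2 * Real.pi) := fun t => by
    simp only [h.periodic_deriv t, hp2 t]
  have hne : (Icc 0 (2 * Real.pi)).Nonempty := nonempty_Icc.2 Real.two_pi_pos.le
  obtain ⟨b, -, hb⟩ := isCompact_Icc.exists_isMaxOn hne hc.continuousOn
  set K := |cross (deriv γ b) (deriv (deriv γ) b)| with hK
  have hK0 : 0 ≤ K := abs_nonneg _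
  have hbd : ∀ t, |cross (deriv γ t) (deriv (deriv γ) t)| ≤ K := fun t => by
    obtain ⟨y, hy, hy'⟩ := hp.exists_mem_Ico₀ Real.two_pi_pos t
    rw [hy']; exact hb (Ico_subset_Icc_self hy)
  -- The width makes the curvature term at most half of the lower bound `m²` for `‖γ'‖²`. Using `K +
  -- 1` rather than `K` covers the case `K = 0`.
  refine ⟨m ^ 2 / (2 * (K + 1)), m ^ 2 / 2, by positivity, by positivity, fun t s hs => ?_⟩
  rw [h.tubeJac_eq]
  have e1 : m ^ 2 ≤ ‖deriv γ t‖ ^ 2 := by gcongr; exact hlo t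
  have e2 : |s * cross (deriv γ t) (deriv (deriv γ) t)| ≤ m ^ 2 / (2 * (K + 1)) * K := by
    rw [abs_mul]; gcongr; exact hbd t
  have e3 : m ^ 2 / (2 * (K + 1)) * K ≤ m ^ 2 / 2 := by
    rw [div_mul_eq_mul_div, div_le_div_iff₀ (by positivity) (by positivity)]
    nlinarith [sq_nonneg m]
  have := le_abs_self (s * cross (deriv γ t) (deriv (deriv γ) t))
  linarith

theorem eq_add_int_of_eq (h : IsBoundaryParam U γ) {t t' : ℝ} (e : γ t = γ t') :
    ∃ k : ℤ, t' = t + k * (2 * Real.pi) := by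
  have key : ∀ x, γ (toIcoMod Real.two_pi_pos 0 x) = γ x := fun x => by
    rw [toIcoMod]
    exact h.periodic.sub_zsmul_eq _
  have hmem : ∀ x, toIcoMod Real.two_pi_pos 0 x ∈ Ico 0 (2 * Real.pi) := fun x => by
    simpa using toIcoMod_mem_Ico Real.two_pi_pos 0 x
  have := h.injOn (hmem t) (hmem t') (by rw [key, key, e])
  have e1 := self_sub_toIcoDiv_zsmul Real.two_pi_pos 0 t
  have e2 := self_sub_toIcoDiv_zsmul Real.two_pi_pos 0 t'
  refine ⟨toIcoDiv Real.two_pi_pos 0 t' - toIcoDiv Real.two_pi_pos 0 t, ?_⟩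
  rw [zsmul_eq_mul] at e1 e2
  push_cast
  linarith

/-- Compactness: if injectivity failed for all widths `1 / (n + 1)`, the offending pairs, reduced to
one period, would accumulate at two parameters with the same image under `γ`. These differ by a
multiple of the period, since `γ` is simple. After subtracting it both points approach the same `(q,
0)`, where the inverse function theorem makes `tube γ` injective, a contradiction. -/
theorem exists_tube_injective (h : IsBoundaryParam U γ) :
    ∃ δ : ℝ, 0 < δ ∧ ∀ t s t' s', |s| < δ → |s'| < δ → tube γ (t, s) = tube γ (t', s') →
      s = s' ∧ ∃ k : ℤ, t' = t + k * (2 * Real.pi) := by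
  by_contra! hcon
  have hpos : ∀ n : ℕ, (0 : ℝ) < 1 / (n + 1) := fun n => Nat.one_div_pos_of_nat
  choose t s t' s' hs hs' heq hne using fun n => hcon _ (hpos n)
  -- reduction to one period
  have hred : ∀ x : ℝ, ∃ k : ℤ, x + k * (2 * Real.pi) ∈ Icc 0 (2 * Real.pi) := fun x => by
    obtain ⟨k, hk, -⟩ := existsUnique_add_zsmul_mem_Ico Real.two_pi_pos x 0
    refine ⟨k, ?_⟩
    rw [zsmul_eq_mul] at hk
    simpa using Ico_subset_Icc_self hk
  choose k hk using fun n => hred (t n)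
  choose k' hk' using fun n => hred (t' n)
  obtain ⟨q, -, σ, hσ, hq⟩ := (isCompact_Icc.prod isCompact_Icc).tendsto_subseq
    (x := fun n => (t n + k n * (2 * Real.pi), t' n + k' n * (2 * Real.pi)))
    (fun n => ⟨hk n, hk' n⟩)
  have hs0 : Tendsto s atTop (𝓝 0) :=
    squeeze_zero_norm (fun n => (hs n).le) tendsto_one_div_add_atTop_nhds_zero_nat
  have hs0' : Tendsto s' atTop (𝓝 0) :=
    squeeze_zero_norm (fun n => (hs' n).le) tendsto_one_div_add_atTop_nhds_zero_nat
  have hq1 : Tendsto (fun n => t (σ n) + k (σ n) * (2 * Real.pi)) atTop (𝓝 q.1) :=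
    (continuous_fst.tendsto q).comp hq
  have hq2 : Tendsto (fun n => t' (σ n) + k' (σ n) * (2 * Real.pi)) atTop (𝓝 q.2) :=
    (continuous_snd.tendsto q).comp hq
  have c1 := (h.contDiff_tube.continuous.tendsto (q.1, 0)).comp
    (hq1.prodMk_nhds (hs0.comp hσ.tendsto_atTop))
  have c2 := (h.contDiff_tube.continuous.tendsto (q.2, 0)).comp
    (hq2.prodMk_nhds (hs0'.comp hσ.tendsto_atTop))
  have hγ : γ q.1 = γ q.2 := by
    have : tube γ (q.1, 0) = tube γ (q.2, 0) := by
      refine tendsto_nhds_unique c1 (c2.congr fun n => ?_)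
      simp only [Function.comp_apply, h.tube_add_int_period]
      exact (heq (σ n)).symm
    simpa [tube] using this
  obtain ⟨l, hl⟩ := h.eq_add_int_of_eq hγ
  have hJ : tubeJac γ (q.1, 0) ≠ 0 := by
    rw [h.tubeJac_eq]; simpa using h.deriv_ne_zero q.1
  obtain ⟨e, he⟩ := exists_equiv_of_cross_ne_zero _ hJ
  have hst : HasStrictFDerivAt (tube γ) (e : ℝ × ℝ →L[ℝ] ℂ) (q.1, 0) := by
    rw [he]; exact h.hasStrictFDerivAt_tube _
  have hinj := (hst.toOpenPartialHomeomorph (tube γ)).injOn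
  have hnb := (hst.toOpenPartialHomeomorph (tube γ)).open_source.mem_nhds
    hst.mem_toOpenPartialHomeomorph_source
  have hq3 : Tendsto (fun n => t' (σ n) + k' (σ n) * (2 * Real.pi) - l * (2 * Real.pi))
      atTop (𝓝 q.1) := by
    have := hq2.sub_const (l * (2 * Real.pi))
    rwa [hl, add_sub_cancel_right] at this
  have m1 := (hq1.prodMk_nhds (hs0.comp hσ.tendsto_atTop)).eventually hnb
  have m2 := (hq3.prodMk_nhds (hs0'.comp hσ.tendsto_atTop)).eventually hnb
  obtain ⟨n, hn1, hn2⟩ := (m1.and m2).exists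
  have := hinj hn1 hn2 (by
    simp only [HasStrictFDerivAt.toOpenPartialHomeomorph_coe, Function.comp_apply]
    have e1 := h.tube_add_int_period (t' (σ n)) (s' (σ n)) (k' (σ n) - l)
    push_cast at e1
    rw [h.tube_add_int_period, heq (σ n), ← e1]
    congr 2; ring)
  simp only [Function.comp_apply, Prod.mk.injEq] at this
  refine hne (σ n) this.2 (k (σ n) - k' (σ n) + l) ?_
  push_cast
  linarith [this.1]

end IsBoundaryParam

/-- `δ` is a width for which the tubular coordinates along `γ` are nondegenerate and injective up to
the period, and parametrise on each side of `γ` points of `U` and of its exterior. -/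
structure IsTubeWidth (U : Set ℂ) (γ : ℝ → ℂ) (δ : ℝ) : Prop where
  pos : 0 < δ
  exists_jac : ∃ c : ℝ, 0 < c ∧ ∀ t s, |s| ≤ δ → c ≤ tubeJac γ (t, s)
  inj : ∀ t s t' s', |s| < δ → |s'| < δ → tube γ (t, s) = tube γ (t', s') →
    s = s' ∧ ∃ k : ℤ, t' = t + k * (2 * Real.pi)
  mem : ∀ t s, 0 < s → s < δ → tube γ (t, s) ∈ U
  not_mem : ∀ t s, -δ < s → s < 0 → tube γ (t, s) ∉ closure U

theorem IsTubeWidth.mono {U : Set ℂ} {γ : ℝ → ℂ} {δ δ' : ℝ} (h : IsTubeWidth U γ δ)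
    (h0 : 0 < δ') (hle : δ' ≤ δ) : IsTubeWidth U γ δ' where
  pos := h0
  exists_jac := by
    obtain ⟨c, hc, hJ⟩ := h.exists_jac
    exact ⟨c, hc, fun t s hs => hJ t s (hs.trans hle)⟩
  inj t s t' s' hs hs' := h.inj t s t' s' (hs.trans_le hle) (hs'.trans_le hle)
  mem t s hs hs' := h.mem t s hs (hs'.trans_le hle)
  not_mem t s hs hs' := h.not_mem t s (by linarith) hs'

theorem frontier_closure_subset' {X : Type*} [TopologicalSpace X] (s : Set X) :
    frontier (closure s) ⊆ frontier s := by
  rw [frontier, frontier, closure_closure]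
  exact sdiff_subset_sdiff_right (interior_mono subset_closure)

theorem preconnected_inter_frontier_nonempty {X : Type*} [TopologicalSpace X] {s t : Set X}
    (hs : IsPreconnected s) (h1 : (s ∩ t).Nonempty) (h2 : (s ∩ tᶜ).Nonempty) :
    (s ∩ frontier t).Nonempty := by
  by_contra hcon
  have hsub : s ⊆ interior t ∪ (closure t)ᶜ := fun x hx => by
    by_contra hn
    simp only [mem_union, mem_compl_iff, not_or, not_not] at hn
    exact hcon ⟨x, hx, hn.2, hn.1⟩
  have hd : Disjoint (interior t) (closure t)ᶜ :=
    Set.disjoint_compl_right_iff_subset.2 (interior_subset.trans subset_closure)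
  rcases hs.subset_or_subset isOpen_interior isClosed_closure.isOpen_compl hd hsub with h | h
  · obtain ⟨x, hx, hxt⟩ := h2
    exact hxt (interior_subset (h hx))
  · obtain ⟨x, hx, hxt⟩ := h1
    exact h hx (subset_closure hxt)

namespace IsBoundaryParam

variable {U : Set ℂ} {γ : ℝ → ℂ}

theorem mem_frontier (h : IsBoundaryParam U γ) (t : ℝ) : γ t ∈ frontier U :=
  h.range_eq ▸ mem_range_self t

/-- Each open half of the tube has a connected image which, by injectivity, misses the frontier.
Hence it lies entirely on one side as soon as a single point does, and such a point is supplied by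
`left_mem` or `right_not_mem` at the parameter `0`. -/
theorem exists_isTubeWidth (h : IsBoundaryParam U γ) : ∃ δ, IsTubeWidth U γ δ := by
  obtain ⟨δ₁, c, hδ₁, hc, hJ⟩ := h.exists_tubeJac_bound
  obtain ⟨δ₂, hδ₂, hinj⟩ := h.exists_tube_injective
  set δ := min δ₁ δ₂ with hδ
  have hpos : 0 < δ := lt_min hδ₁ hδ₂
  have hle2 : δ ≤ δ₂ := min_le_right _ _
  have hmiss : ∀ t s, s ≠ 0 → |s| < δ → tube γ (t, s) ∉ frontier U := by
    intro t s hs0 hs hmem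
    rw [← h.range_eq] at hmem
    obtain ⟨t', ht'⟩ := hmem
    have := (hinj t s t' 0 (hs.trans_le hle2) (by simpa using hδ₂) (by simpa [tube] using ht'.symm)).1
    exact hs0 this
  have hconn : ∀ a b : ℝ, IsPreconnected (tube γ '' (univ ×ˢ Ioo a b)) := fun a b =>
    (isPreconnected_univ.prod isPreconnected_Ioo).image _ h.contDiff_tube.continuous.continuousOn
  refine ⟨δ, hpos, ⟨c, hc, fun t s hs => hJ t s (hs.trans (min_le_left _ _))⟩,
    fun t s t' s' hs hs' => hinj t s t' s' (hs.trans_le hle2) (hs'.trans_le hle2), ?_, ?_⟩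
  · by_contra! hcon
    obtain ⟨t, s, hs, hs', hn⟩ := hcon
    obtain ⟨s₁, hs₁, hs₁'⟩ := ((h.left_mem 0).and (Ioo_mem_nhdsGT hpos)).exists
    obtain ⟨z, ⟨⟨t₂, s₂⟩, ⟨-, hs₂⟩, rfl⟩, hz⟩ := preconnected_inter_frontier_nonempty (hconn 0 δ) (t := U)
      ⟨_, ⟨(0, s₁), ⟨mem_univ _, hs₁'⟩, rfl⟩, hs₁⟩ ⟨_, ⟨(t, s), ⟨mem_univ _, hs, hs'⟩, rfl⟩, hn⟩
    exact hmiss t₂ s₂ hs₂.1.ne' (by rw [abs_of_pos hs₂.1]; exact hs₂.2) hz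
  · by_contra! hcon
    obtain ⟨t, s, hs, hs', hn⟩ := hcon
    obtain ⟨s₁, hs₁, hs₁'⟩ := ((h.right_not_mem 0).and (Ioo_mem_nhdsGT hpos)).exists
    obtain ⟨z, ⟨⟨t₂, s₂⟩, ⟨-, hs₂⟩, rfl⟩, hz⟩ := preconnected_inter_frontier_nonempty (hconn (-δ) 0)
      (t := closure U) ⟨_, ⟨(t, s), ⟨mem_univ _, hs, hs'⟩, rfl⟩, hn⟩
      ⟨_, ⟨(0, -s₁), ⟨mem_univ _, by linarith [hs₁'.2], by linarith [hs₁'.1]⟩, rfl⟩, by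
        simp only [tube, mem_compl_iff]; convert hs₁ using 2; push_cast; ring⟩
    exact hmiss t₂ s₂ hs₂.2.ne (by rw [abs_of_neg hs₂.2]; linarith [hs₂.1])
      (frontier_closure_subset' _ hz)

end IsBoundaryParam

namespace IsTubeWidth

variable {U : Set ℂ} {γ : ℝ → ℂ} {δ : ℝ}

theorem jac_pos (h : IsTubeWidth U γ δ) (t : ℝ) {s : ℝ} (hs : |s| ≤ δ) : 0 < tubeJac γ (t, s) := by
  obtain ⟨c, hc, hJ⟩ := h.exists_jac
  exact hc.trans_le (hJ t s hs)

theorem isOpen_image (h : IsTubeWidth U γ δ) (hγ : IsBoundaryParam U γ) :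
    IsOpen (tube γ '' (univ ×ˢ Ioo (-δ) δ)) := by
  rw [isOpen_iff_mem_nhds]
  rintro _ ⟨⟨t, s⟩, ⟨-, hs⟩, rfl⟩
  obtain ⟨e, he⟩ := exists_equiv_of_cross_ne_zero _ (h.jac_pos t (abs_le.2 ⟨hs.1.le, hs.2.le⟩)).ne'
  have hst : HasStrictFDerivAt (tube γ) (e : ℝ × ℝ →L[ℝ] ℂ) (t, s) := by
    rw [he]; exact hγ.hasStrictFDerivAt_tube _
  rw [← hst.map_nhds_eq_of_equiv]
  exact image_mem_map (prod_mem_nhds univ_mem (Ioo_mem_nhds hs.1 hs.2))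

/-- A defining function of `U` near a boundary point. -/
theorem exists_defining (h : IsTubeWidth U γ δ) (hγ : IsBoundaryParam U γ) (t : ℝ) :
    ∃ (σ : ℂ → ℝ) (σ' : ℂ →L[ℝ] ℝ), HasStrictFDerivAt σ σ' (γ t) ∧
      σ' (Complex.I * deriv γ t) = 1 ∧
      ∀ᶠ x in 𝓝 (γ t), (x ∈ U → 0 ≤ σ x) ∧ (0 < σ x → x ∈ U) ∧
        (x ∉ closure U → σ x ≤ 0) ∧ (σ x < 0 → x ∉ closure U) ∧ (σ x = 0 → x ∈ frontier U) := by
  obtain ⟨e, he⟩ := exists_equiv_of_cross_ne_zero _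
    (h.jac_pos t (s := 0) (by simpa using h.pos.le)).ne'
  have hst : HasStrictFDerivAt (tube γ) (e : ℝ × ℝ →L[ℝ] ℂ) (t, 0) := by
    rw [he]; exact hγ.hasStrictFDerivAt_tube _
  have h0 : tube γ (t, 0) = γ t := by simp [tube]
  have hinv := hst.to_localInverse
  have htend := hst.localInverse_tendsto
  have hright := hst.eventually_right_inverse
  rw [h0] at hinv htend hright
  set g := hst.localInverse (tube γ) e (t, 0) with hg
  -- The defining function is the normal coordinate `s`, read off from the local inverse of `tube γ`
  -- at `(t, 0)`.
  refine ⟨fun x => (g x).2, (ContinuousLinearMap.snd ℝ ℝ ℝ).comp (e.symm : ℂ →L[ℝ] ℝ × ℝ),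
    (hasStrictFDerivAt_snd (p := g (γ t))).comp (γ t) hinv, ?_, ?_⟩
  · have : Complex.I * deriv γ t = e (0, 1) := by
      rw [← hγ.fderiv_tube_snd t 0, ← he]; rfl
    rw [this]; simp
  · have hsm : ∀ᶠ x in 𝓝 (γ t), |(g x).2| < δ := by
      have : Tendsto (fun x => |(g x).2|) (𝓝 (γ t)) (𝓝 |(0 : ℝ)|) :=
        ((continuous_snd.tendsto (t, (0 : ℝ))).comp htend).abs
      exact this.eventually_lt_const (by simpa using h.pos)
    filter_upwards [hsm, hright] with x hx hrx
    have hx' := abs_lt.1 hx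
    have p1 : 0 < (g x).2 → x ∈ U := fun hp => hrx ▸ h.mem (g x).1 (g x).2 hp hx'.2
    have p2 : (g x).2 < 0 → x ∉ closure U := fun hp => hrx ▸ h.not_mem (g x).1 (g x).2 hx'.1 hp
    refine ⟨fun hU => ?_, p1, fun hU => ?_, p2, fun hz => ?_⟩
    · by_contra! hlt; exact p2 hlt (subset_closure hU)
    · by_contra! hlt; exact hU (subset_closure (p1 hlt))
    · rw [← hrx]
      have : g x = ((g x).1, 0) := Prod.ext rfl hz
      rw [this]
      simpa [tube] using hγ.mem_frontier (g x).1

end IsTubeWidth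

/-- If `σ` increases strictly in the direction `e` near `p`, it increases along all small
translations in directions close to `e`. -/
theorem HasStrictFDerivAt.eventually_lt_add {σ : ℂ → ℝ} {σ' : ℂ →L[ℝ] ℝ} {p e : ℂ}
    (h : HasStrictFDerivAt σ σ' p) (he : 0 < σ' e) :
    ∃ r > 0, ∃ c > 0, ∀ x ∈ Metric.ball p r, ∀ τ : ℝ, 0 < τ → τ < r → ∀ z ∈ Metric.ball e c,
      σ x < σ (x + τ * z) := by
  -- The error allowed in strict differentiability is chosen so that `κ (‖e‖ + 1)` is half of `σ'
  -- e`. It is therefore beaten by `σ' z` for all `z` close to `e`.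
  set κ := σ' e / (2 * (‖e‖ + 1)) with hκ
  have hκ0 : 0 < κ := by positivity
  have hev := h.isLittleO.def hκ0
  rw [Metric.eventually_nhds_iff_ball] at hev
  obtain ⟨r₀, hr₀, hb⟩ := hev
  have hcont : ∀ᶠ z in 𝓝 e, κ * (‖e‖ + 1) < σ' z ∧ ‖z‖ < ‖e‖ + 1 := by
    have h1 : Tendsto (fun z => σ' z) (𝓝 e) (𝓝 (σ' e)) := σ'.continuous.tendsto e
    refine (h1.eventually_const_lt ?_).and (continuous_norm.tendsto e |>.eventually_lt_const (by simp))
    rw [hκ]; field_simp; linarith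
  obtain ⟨c, hc, hcb⟩ := Metric.eventually_nhds_iff_ball.1 hcont
  refine ⟨r₀ / (2 * (‖e‖ + 2)), by positivity, c, hc, fun x hx τ hτ hτr z hz => ?_⟩
  obtain ⟨hz1, hz2⟩ := hcb z hz
  have hbd : r₀ / (2 * (‖e‖ + 2)) * (‖e‖ + 2) = r₀ / 2 := by field_simp
  have hr1 : r₀ / (2 * (‖e‖ + 2)) ≤ r₀ / 2 := by
    gcongr; nlinarith [norm_nonneg e]
  have hn : ‖(τ : ℂ) * z‖ = τ * ‖z‖ := by simp [abs_of_pos hτ]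
  have hxm : x ∈ Metric.ball p r₀ := Metric.ball_subset_ball (by linarith) hx
  have hle : τ * ‖z‖ < r₀ / 2 := by
    calc τ * ‖z‖ ≤ τ * (‖e‖ + 2) := by gcongr; linarith
      _ < r₀ / (2 * (‖e‖ + 2)) * (‖e‖ + 2) := by gcongr
      _ = r₀ / 2 := hbd
  have hym : x + τ * z ∈ Metric.ball p r₀ := by
    rw [mem_ball_iff_norm] at hx ⊢
    calc ‖x + τ * z - p‖ ≤ ‖x - p‖ + ‖(τ : ℂ) * z‖ := by
          rw [show x + τ * z - p = (x - p) + τ * z by ring]; exact norm_add_le _ _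
      _ < r₀ := by rw [hn]; linarith
  have hdiff := hb (x + τ * z, x) (by
    rw [← ball_prod_same]; exact ⟨hym, hxm⟩)
  simp only [add_sub_cancel_left] at hdiff
  have hlin : σ' ((τ : ℂ) * z) = τ * σ' z := by
    rw [← smul_eq_mul (τ : ℝ), ← σ'.map_smul]; simp
  rw [hlin, hn, Real.norm_eq_abs] at hdiff
  have h3 := (abs_le.1 hdiff).1
  have : κ * (τ * ‖z‖) < τ * σ' z := by
    calc κ * (τ * ‖z‖) = τ * (κ * ‖z‖) := by ring
      _ ≤ τ * (κ * (‖e‖ + 1)) := by gcongr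
      _ < τ * σ' z := by gcongr
  linarith

namespace IsBoundaryParam

variable {U : Set ℂ} {γ : ℝ → ℂ}

/-- The uniform interior and exterior disc property. -/
theorem exists_discs (h : IsBoundaryParam U γ) :
    ∃ ρ > 0, ∀ p ∈ frontier U,
      (∃ c, dist p c = ρ ∧ Metric.ball c ρ ⊆ U) ∧
      ∃ c, dist p c = ρ ∧ Metric.ball c ρ ⊆ (closure U)ᶜ := by
  obtain ⟨δ, hδ⟩ := h.exists_isTubeWidth
  obtain ⟨m, M, hm, hlo, -⟩ := h.exists_norm_deriv_bounds
  have hδ0 := hδ.pos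
  -- Since `‖γ'‖ ≥ m`, a normal segment of length at most `ρ` has parameter `|s| ≤ δ / 2`, inside
  -- the range of injectivity.
  set ρ := δ * m / 2 with hρ
  have hρ0 : 0 < ρ := by positivity
  have hcpt : IsCompact (frontier U) := by
    have : frontier U = γ '' Icc 0 (2 * Real.pi) := by
      rw [← h.range_eq]
      refine Subset.antisymm ?_ (image_subset_range _ _)
      rintro _ ⟨t, rfl⟩
      obtain ⟨y, hy, hy'⟩ := h.periodic.exists_mem_Ico₀ Real.two_pi_pos t
      exact ⟨y, Ico_subset_Icc_self hy, hy'.symm⟩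
    rw [this]
    exact isCompact_Icc.image h.contDiff.continuous
  -- a disc centred on the normal does not meet the boundary
  have key : ∀ t s, |s| * ‖deriv γ t‖ = ρ →
      Disjoint (Metric.ball (tube γ (t, s)) ρ) (frontier U) := by
    intro t s hs
    have hslt : |s| < δ := by
      have : |s| * m ≤ ρ := by rw [← hs]; gcongr; exact hlo t
      have h2 : |s| * m < δ * m := by rw [hρ] at this; nlinarith
      exact lt_of_mul_lt_mul_right h2 hm.le
    set c := tube γ (t, s) with hc
    obtain ⟨q, hq, hmin⟩ := hcpt.exists_isMinOn ⟨_, h.mem_frontier t⟩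
      (f := fun x => dist x c) (by fun_prop)
    obtain ⟨t', rfl⟩ : q ∈ range γ := h.range_eq ▸ hq
    have hdt : dist (γ t) c = ρ := by
      rw [dist_eq_norm, hc, tube]
      simp only [sub_add_cancel_left, norm_neg, norm_mul, Complex.norm_real, Complex.norm_I, one_mul,
        Real.norm_eq_abs]
      exact hs
    have hle : dist (γ t') c ≤ ρ := hdt ▸ hmin (h.mem_frontier t)
    -- orthogonality at the nearest point
    have horth : inner ℝ (γ t' - c) (deriv γ t') = 0 := by
      have hd : HasDerivAt (fun τ => ‖γ τ - c‖ ^ 2) (2 * inner ℝ (γ t' - c) (deriv γ t')) t' :=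
        ((h.hasDerivAt t').sub_const c).norm_sq
      have hloc : IsLocalMin (fun τ => ‖γ τ - c‖ ^ 2) t' := by
        refine Filter.Eventually.of_forall fun τ => ?_
        have : dist (γ t') c ≤ dist (γ τ) c := hmin (h.mem_frontier τ)
        simp only [dist_eq_norm] at this
        exact pow_le_pow_left₀ (norm_nonneg _) this 2
      have := hloc.hasDerivAt_eq_zero hd
      linarith
    obtain ⟨s', hs'⟩ : ∃ s' : ℝ, c = tube γ (t', s') := by
      have hne := h.deriv_ne_zero t'
      refine ⟨((c - γ t') / (Complex.I * deriv γ t')).re, ?_⟩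
      have hreal : (((c - γ t') / (Complex.I * deriv γ t')).re : ℂ) =
          (c - γ t') / (Complex.I * deriv γ t') := by
        rw [Complex.ext_iff]
        refine ⟨by simp, ?_⟩
        rw [Complex.inner] at horth
        simp only [Complex.ofReal_im, Complex.div_im, Complex.mul_re, Complex.mul_im, Complex.I_re,
          Complex.I_im]
        simp at horth
        rw [← sub_div, eq_comm]
        apply div_eq_zero_iff.2
        left
        simp
        linarith
      simp only [tube]
      rw [hreal, div_mul_cancel₀ _ (mul_ne_zero Complex.I_ne_zero hne)]
      ring
    have hds : dist (γ t') c = |s'| * ‖deriv γ t'‖ := by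
      rw [dist_eq_norm, hs', tube]
      simp only [sub_add_cancel_left, norm_neg, norm_mul, Complex.norm_real, Complex.norm_I, one_mul,
        Real.norm_eq_abs]
    have hslt' : |s'| < δ := by
      have : |s'| * m ≤ ρ := by
        refine le_trans ?_ hle; rw [hds]; gcongr; exact hlo t'
      have h2 : |s'| * m < δ * m := by rw [hρ] at this; nlinarith
      exact lt_of_mul_lt_mul_right h2 hm.le
    -- The centre lies on the normal at its nearest boundary point as well as on the normal at `γ
    -- t`. Injectivity of the tube identifies the two feet, so the distance from the centre to the
    -- frontier is exactly `ρ`.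
    obtain ⟨-, k, hk⟩ := hδ.inj t s t' s' hslt hslt' hs'
    have hγeq : γ t' = γ t := by rw [hk]; exact h.periodic.int_mul k t
    rw [Set.disjoint_left]
    intro x hx hxf
    have : dist (γ t') c ≤ dist x c := hmin hxf
    rw [hγeq, hdt] at this
    exact absurd (Metric.mem_ball.1 hx) (not_lt.2 this)
  refine ⟨ρ, hρ0, fun p hp => ?_⟩
  obtain ⟨t, rfl⟩ : p ∈ range γ := h.range_eq ▸ hp
  have hγt : 0 < ‖deriv γ t‖ := norm_pos_iff.2 (h.deriv_ne_zero t)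
  set s := ρ / ‖deriv γ t‖ with hs
  have hs0 : 0 < s := by positivity
  have hslt : s < δ := by
    rw [hs, div_lt_iff₀ hγt, hρ]
    have := hlo t
    nlinarith
  have hsρ : s * ‖deriv γ t‖ = ρ := by rw [hs]; field_simp
  have hdist : ∀ a : ℝ, |a| = s → dist (γ t) (tube γ (t, a)) = ρ := by
    intro a ha
    rw [dist_eq_norm, tube]
    simp only [sub_add_cancel_left, norm_neg, norm_mul, Complex.norm_real, Complex.norm_I, one_mul,
      Real.norm_eq_abs]
    rw [ha, hsρ]
  refine ⟨⟨tube γ (t, s), hdist s (abs_of_pos hs0), ?_⟩,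
    ⟨tube γ (t, -s), hdist (-s) (by rw [abs_neg, abs_of_pos hs0]), ?_⟩⟩
  · by_contra hcon
    obtain ⟨x, hx, hxU⟩ := not_subset.1 hcon
    obtain ⟨z, hz1, hz2⟩ := preconnected_inter_frontier_nonempty (convex_ball (tube γ (t, s)) ρ).isPreconnected
      (t := U) ⟨_, Metric.mem_ball_self hρ0, hδ.mem t s hs0 hslt⟩ ⟨x, hx, hxU⟩
    exact Set.disjoint_left.1 (key t s (by rw [abs_of_pos hs0, hsρ])) hz1 hz2
  · by_contra hcon
    obtain ⟨x, hx, hxU⟩ := not_subset.1 hcon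
    obtain ⟨z, hz1, hz2⟩ := preconnected_inter_frontier_nonempty (convex_ball (tube γ (t, -s)) ρ).isPreconnected
      (t := closure U) ⟨x, hx, not_not.1 hxU⟩
      ⟨_, Metric.mem_ball_self hρ0, hδ.not_mem t (-s) (by linarith) (by linarith)⟩
    exact Set.disjoint_left.1 (key t (-s) (by rw [abs_neg, abs_of_pos hs0, hsρ])) hz1
      (frontier_closure_subset' _ hz2)

end IsBoundaryParam

/-! ### Harmonic functions: maximum principle, interior and boundary gradient estimates -/

-- Near `x` the function is the real part of a holomorphic `F`, and `‖exp F‖ = exp f`. The maximum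
-- modulus principle applies to `exp F`.
open InnerProductSpace in
theorem HarmonicAt.eventually_eq_of_isLocalMax {f : ℂ → ℝ} {x : ℂ}
    (hf : HarmonicAt f x) (hmax : IsLocalMax f x) : ∀ᶠ y in 𝓝 x, f y = f x := by
  obtain ⟨R, hR, hball⟩ := Metric.eventually_nhds_iff_ball.1 hf.eventually
  obtain ⟨F, hF, hre⟩ := HarmonicOnNhd.exists_analyticOnNhd_ball_re_eq (f := f) (z := x) (R := R)
    fun y hy => hball y hy
  have hbx := Metric.ball_mem_nhds x hR
  have hnorm : ∀ y ∈ Metric.ball x R, ‖Complex.exp (F y)‖ = Real.exp (f y) := fun y hy => by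
    rw [Complex.norm_exp]; congr 1; exact hre hy
  have hev := Complex.eventually_eq_of_isLocalMax_norm (f := fun y => Complex.exp (F y)) (c := x)
    (by
      filter_upwards [hbx] with y hy
      exact (hF y hy).differentiableAt.cexp)
    (by
      filter_upwards [hbx, hmax] with y hy hle
      simp only [Function.comp_apply]
      rw [hnorm y hy, hnorm x (Metric.mem_ball_self hR)]
      exact Real.exp_le_exp.2 hle)
  filter_upwards [hev, hbx] with y hy hyb
  have := congrArg norm hy
  rw [hnorm y hyb, hnorm x (Metric.mem_ball_self hR)] at this
  exact Real.exp_injective this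

open InnerProductSpace in
/-- The maximum principle. -/
theorem harmonic_le_of_frontier_le {D : Set ℂ} (hDo : IsOpen D) (hDb : Bornology.IsBounded D)
    {f : ℂ → ℝ} (hc : ContinuousOn f (closure D)) (hf : HarmonicOnNhd f D) {M : ℝ}
    (hM : ∀ x ∈ frontier D, f x ≤ M) : ∀ x ∈ closure D, f x ≤ M := by
  intro x₀ hx₀
  have hcpt : IsCompact (closure D) := hDb.isCompact_closure
  obtain ⟨x, hx, hmax⟩ := hcpt.exists_isMaxOn ⟨x₀, hx₀⟩ hc
  refine (hmax hx₀).trans ?_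
  by_contra! hlt
  -- If the maximum exceeded `M`, the set where it is attained would avoid the frontier. It would
  -- then be open by the local maximum principle and also closed, hence the whole plane, although it
  -- is bounded.
  set A := closure D ∩ f ⁻¹' {f x} with hA
  have hAclosed : IsClosed A := hc.preimage_isClosed_of_isClosed isClosed_closure isClosed_singleton
  have hAD : A ⊆ D := by
    rintro y ⟨hy, hfy⟩
    by_contra hyD
    have : y ∈ frontier D := by rw [hDo.frontier_eq]; exact ⟨hy, hyD⟩
    have h1 := hM y this
    have h2 : f y = f x := hfy
    linarith
  have hAopen : IsOpen A := by
    rw [isOpen_iff_mem_nhds]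
    intro y hy
    have hyD := hAD hy
    have hfy : f y = f x := hy.2
    have hloc : IsLocalMax f y := by
      filter_upwards [hDo.mem_nhds hyD] with z hz
      rw [hfy]; exact hmax (subset_closure hz)
    filter_upwards [HarmonicAt.eventually_eq_of_isLocalMax (hf y hyD) hloc,
      hDo.mem_nhds hyD] with z hz hzD
    exact ⟨subset_closure hzD, by rw [mem_preimage, mem_singleton_iff, hz, hfy]⟩
  have huniv : A = univ := IsClopen.eq_univ ⟨hAclosed, hAopen⟩ ⟨x, hx, rfl⟩
  have hb : Bornology.IsBounded (univ : Set ℂ) := huniv ▸ hcpt.isBounded.subset inter_subset_left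
  exact NormedSpace.unbounded_univ ℝ ℂ hb

open InnerProductSpace in
/-- The interior gradient estimate. -/
theorem norm_fderiv_le_of_harmonicOnNhd_ball {f : ℂ → ℝ} {x : ℂ} {R K v : ℝ} (hR : 0 < R)
    (hK : 0 < K) (hf : HarmonicOnNhd f (Metric.ball x R))
    (hv : ∀ y ∈ Metric.ball x R, |f y - v| ≤ K) : ‖fderiv ℝ f x‖ ≤ 8 * K / R := by
  obtain ⟨F, hF, hre⟩ := HarmonicOnNhd.exists_analyticOnNhd_ball_re_eq hf
  have hmem : ∀ z ∈ Metric.ball (0 : ℂ) R, x + z ∈ Metric.ball x R := fun z hz => by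
    simpa [mem_ball_iff_norm] using hz
  have hxm := Metric.mem_ball_self (x := x) hR
  have hre' : ∀ z ∈ Metric.ball (0 : ℂ) R, (F (x + z)).re = f (x + z) := fun z hz => hre (hmem z hz)
  have hre0 : (F x).re = f x := hre hxm
  have hG : DifferentiableOn ℂ (fun z => F (x + z) - F x) (Metric.ball 0 R) := by
    intro z hz
    have h1 : DifferentiableAt ℂ F (x + z) := (hF _ (hmem z hz)).differentiableAt
    have h2 : DifferentiableAt ℂ (fun z => F (x + z)) z :=
      h1.comp z ((differentiableAt_const x).add differentiableAt_id)
    exact (h2.sub_const _).differentiableWithinAt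
  -- Borel-Carathéodory: the real part of `F (x + z) - F x` is at most `2 * K`. On the half ball `R
  -- - ‖z‖ ≥ R / 2`, which produces the constant `8`.
  have hb : ∀ z ∈ Metric.ball (0 : ℂ) R, ‖F (x + z) - F x‖ ≤ 2 * (2 * K) * ‖z‖ / (R - ‖z‖) := by
    intro z hz
    refine Complex.borelCaratheodory_zero (f := fun z => F (x + z) - F x) (by positivity) hG ?_ hR hz
      (by simp)
    intro w hw
    simp only [mem_ofPred_eq, Complex.sub_re, hre' w hw, hre0]
    have h1 := (abs_le.1 (hv _ (hmem w hw))).2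
    have h2 := (abs_le.1 (hv _ hxm)).1
    linarith
  refine norm_fderiv_le_of_lip' ℝ (by positivity) ?_
  filter_upwards [Metric.ball_mem_nhds x (half_pos hR)] with y hy
  rw [mem_ball_iff_norm] at hy
  have hz : y - x ∈ Metric.ball (0 : ℂ) R := by
    rw [mem_ball_zero_iff]; linarith
  have h1 := hb _ hz
  have h2 := hre' _ hz
  rw [add_sub_cancel] at h1 h2
  have h3 : ‖f y - f x‖ ≤ ‖F y - F x‖ := by
    rw [Real.norm_eq_abs, ← h2, ← hre0, ← Complex.sub_re]
    exact Complex.abs_re_le_norm _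
  refine (h3.trans h1).trans ?_
  rw [div_mul_eq_mul_div, div_le_div_iff₀ (by linarith) hR]
  nlinarith [norm_nonneg (y - x), mul_nonneg hK.le (norm_nonneg (y - x))]

open InnerProductSpace in
/-- A barrier argument: if the harmonic function `f` is constant on a part `K` of the boundary which
satisfies a uniform exterior disc condition, it is close to this constant near that part. -/
theorem exists_boundary_lipschitz {D K Γ : Set ℂ} (hDo : IsOpen D) (hDb : Bornology.IsBounded D)
    {f : ℂ → ℝ} (hc : ContinuousOn f (closure D)) (hf : HarmonicOnNhd f D)
    (hK : IsClosed K) (hKD : Disjoint K D) {ρ m v : ℝ} (hρ : 0 < ρ) (hm : 0 < m)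
    (hdisc : ∀ p ∈ Γ, ∃ c, dist p c = ρ ∧ Metric.ball c ρ ⊆ K)
    (hv : ∀ x ∈ frontier D ∩ K, f x = v)
    (hfar : ∀ x ∈ frontier D \ K, ∀ y ∈ K, m ≤ dist x y) :
    ∃ C, 0 < C ∧ ∀ p ∈ Γ, ∀ x ∈ closure D, |f x - v| ≤ C * dist x p := by
  have hcpt : IsCompact (closure D) := hDb.isCompact_closure
  obtain ⟨M, hM⟩ := (hcpt.image_of_continuousOn hc).isBounded.exists_norm_le
  have hM' : ∀ x ∈ closure D, |f x - v| ≤ |M| + |v| := fun x hx => by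
    have h1 : |f x| ≤ M := hM _ (mem_image_of_mem f hx)
    have := abs_sub (f x) v
    linarith [le_abs_self M]
  set β := Real.log ((ρ + m) / ρ) with hβ
  have hβ0 : 0 < β := Real.log_pos (by rw [lt_div_iff₀ hρ]; linarith)
  -- `β` is the smallest value the barrier can take on the far part of the frontier. With this `A`
  -- the multiple `A * b` dominates `|f - v|` there.
  set A := (|M| + |v| + 1) / β with hA
  have hA0 : 0 < A := by positivity
  refine ⟨A / ρ, by positivity, fun p hp => ?_⟩
  obtain ⟨c, hpc, hcK⟩ := hdisc p hp
  have hcK' : Metric.closedBall c ρ ⊆ K := by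
    rw [← closure_ball c hρ.ne']
    exact hK.closure_subset_iff.2 hcK
  have hlow : ∀ x ∈ closure D, ρ ≤ dist x c := by
    have hd : Disjoint (Metric.ball c ρ) (closure D) :=
      (hKD.mono_left hcK).closure_right Metric.isOpen_ball
    intro x hx
    by_contra! hlt
    exact Set.disjoint_left.1 hd hlt hx
  have hne : ∀ x ∈ closure D, x - c ≠ 0 := fun x hx => by
    rw [← norm_pos_iff, ← dist_eq_norm]; exact hρ.trans_le (hlow x hx)
  -- The barrier is harmonic off the centre and zero on the circle through `p`. By `log y ≤ y - 1`
  -- it grows at most linearly in `dist x p`.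
  set b : ℂ → ℝ := fun x => Real.log ‖x - c‖ - Real.log ρ with hb
  have hb0 : ∀ x ∈ closure D, 0 ≤ b x := fun x hx => by
    have := Real.log_le_log hρ (hlow x hx)
    rw [dist_eq_norm] at this
    simp only [hb]; linarith
  have hbup : ∀ x ∈ closure D, b x ≤ dist x p / ρ := fun x hx => by
    have h1 := norm_pos_iff.2 (hne x hx)
    have h2 : b x = Real.log (‖x - c‖ / ρ) := by rw [Real.log_div h1.ne' hρ.ne']
    have h3 := Real.log_le_sub_one_of_pos (div_pos h1 hρ)
    rw [h2]
    refine h3.trans ?_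
    rw [div_sub_one hρ.ne', ← dist_eq_norm]
    gcongr
    have := dist_triangle x p c
    linarith
  have hbfar : ∀ x ∈ frontier D \ K, β ≤ b x := fun x hx => by
    have hxc : x ∈ closure D := frontier_subset_closure hx.1
    have h1 := norm_pos_iff.2 (hne x hxc)
    have h2 : ρ + m ≤ ‖x - c‖ := by
      -- The radial projection of `x` onto the circle belongs to `K`. Being at distance at least `m`
      -- from it, `x` is at distance at least `ρ + m` from the centre.
      set y := c + (ρ / ‖x - c‖ : ℝ) * (x - c) with hy
      have hyK : y ∈ K := hcK' (by
        rw [mem_closedBall_iff_norm, hy, add_sub_cancel_left, norm_mul, Complex.norm_real,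
          Real.norm_of_nonneg (by positivity), div_mul_cancel₀ _ h1.ne'])
      have h3 := hfar x hx y hyK
      have h4 : x - y = ((1 - ρ / ‖x - c‖ : ℝ) : ℂ) * (x - c) := by
        rw [hy]; push_cast; ring
      have h5 := hlow x hxc
      rw [dist_eq_norm] at h5
      rw [dist_eq_norm, h4, norm_mul, Complex.norm_real, Real.norm_of_nonneg
        (sub_nonneg.2 ((div_le_one h1).2 h5)), sub_mul, div_mul_cancel₀ _ h1.ne'] at h3
      linarith
    rw [hβ, Real.log_div (by positivity) hρ.ne']
    exact sub_le_sub_right (Real.log_le_log (by positivity) h2) _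
  have hbh : HarmonicOnNhd b D := fun x hx =>
    (AnalyticAt.harmonicAt_log_norm (f := fun x => x - c) (analyticAt_id.sub analyticAt_const)
      (hne x (subset_closure hx))).sub (harmonicAt_const _)
  have hbc : ContinuousOn b (closure D) := fun x hx => by
    refine ContinuousAt.continuousWithinAt ?_
    have : ContinuousAt (fun x => ‖x - c‖) x := by fun_prop
    exact (this.log (norm_ne_zero_iff.2 (hne x hx))).sub continuousAt_const
  have hbd : ∀ x ∈ frontier D, |f x - v| ≤ A * b x := fun x hx => by
    have hxc : x ∈ closure D := frontier_subset_closure hx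
    by_cases hxK : x ∈ K
    · rw [hv x ⟨hx, hxK⟩, sub_self, abs_zero]
      exact mul_nonneg hA0.le (hb0 x hxc)
    · calc |f x - v| ≤ |M| + |v| + 1 := by linarith [hM' x hxc]
        _ = A * β := by rw [hA, div_mul_cancel₀ _ hβ0.ne']
        _ ≤ A * b x := by gcongr; exact hbfar x ⟨hx, hxK⟩
  have up := harmonic_le_of_frontier_le hDo hDb (f := f - A • b) (M := v)
    (hc.sub (hbc.const_smul A)) (hf.sub hbh.const_smul) (fun x hx => by
      have := (abs_le.1 (hbd x hx)).2
      simp only [Pi.sub_apply, Pi.smul_apply, smul_eq_mul]; linarith)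
  have lo := harmonic_le_of_frontier_le hDo hDb (f := -f - A • b) (M := -v)
    (hc.neg.sub (hbc.const_smul A)) (hf.neg.sub hbh.const_smul) (fun x hx => by
      have := (abs_le.1 (hbd x hx)).1
      simp only [Pi.sub_apply, Pi.neg_apply, Pi.smul_apply, smul_eq_mul]; linarith)
  intro x hx
  have h1 := up x hx
  have h2 := lo x hx
  simp only [Pi.sub_apply, Pi.neg_apply, Pi.smul_apply, smul_eq_mul] at h1 h2
  have h3 : A * b x ≤ A / ρ * dist x p := by
    rw [show A / ρ * dist x p = A * (dist x p / ρ) by ring]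
    exact mul_le_mul_of_nonneg_left (hbup x hx) hA0.le
  rw [abs_le]
  constructor <;> linarith

/-! ### The boundary of a perforated domain and the gradient bound for the potentials -/

namespace PerforatedDomain

variable {N : ℕ} (P : PerforatedDomain N)

theorem isClosed_iUnion_closure_hole : IsClosed (⋃ i, closure (P.hole i)) :=
  isClosed_iUnion_of_finite fun _ => isClosed_closure

theorem isOpen_dom : IsOpen P.dom :=
  P.smooth_Ω.isOpen.sdiff P.isClosed_iUnion_closure_hole

theorem isBounded_dom : Bornology.IsBounded P.dom :=
  P.smooth_Ω.isBounded.subset sdiff_subset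

theorem disjoint_closure_hole_dom (i : Fin N) : Disjoint (closure (P.hole i)) P.dom :=
  Set.disjoint_left.2 fun _ hx hxD => hxD.2 (mem_iUnion.2 ⟨i, hx⟩)

theorem isCompact_closure_hole (i : Fin N) : IsCompact (closure (P.hole i)) :=
  (P.smooth_hole i).isBounded.isCompact_closure

theorem frontier_dom_subset : frontier P.dom ⊆ frontier P.Ω ∪ ⋃ i, frontier (P.hole i) := by
  intro x hx
  have hxc : x ∈ closure P.dom := frontier_subset_closure hx
  have hxΩ : x ∈ closure P.Ω := closure_mono sdiff_subset hxc
  have hxn : x ∉ P.dom := by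
    rw [P.isOpen_dom.frontier_eq] at hx; exact hx.2
  by_cases hxO : x ∈ P.Ω
  · right
    have : x ∈ ⋃ i, closure (P.hole i) := by
      by_contra hn; exact hxn ⟨hxO, hn⟩
    obtain ⟨i, hi⟩ := mem_iUnion.1 this
    refine mem_iUnion.2 ⟨i, ?_⟩
    rw [(P.smooth_hole i).isOpen.frontier_eq]
    refine ⟨hi, fun hxh => ?_⟩
    have hd := ((P.disjoint_closure_hole_dom i).mono_left subset_closure).closure_right
      (P.smooth_hole i).isOpen
    exact Set.disjoint_left.1 hd hxh hxc
  · left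
    rw [P.smooth_Ω.isOpen.frontier_eq]
    exact ⟨hxΩ, hxO⟩

theorem not_mem_hole_of_mem_closure {x : ℂ} (hx : x ∈ closure P.dom) (i : Fin N) :
    x ∉ P.hole i := fun hxh =>
  Set.disjoint_left.1 (((P.disjoint_closure_hole_dom i).mono_left subset_closure).closure_right
      (P.smooth_hole i).isOpen) hxh hx

theorem mem_frontier_hole {x : ℂ} (hx : x ∈ closure P.dom) {i : Fin N}
    (hi : x ∈ closure (P.hole i)) : x ∈ frontier (P.hole i) := by
  rw [(P.smooth_hole i).isOpen.frontier_eq]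
  exact ⟨hi, P.not_mem_hole_of_mem_closure hx i⟩

/-- The holes are at a positive distance from the rest of the boundary. -/
theorem exists_dist_hole (j : Fin N) : ∃ m > 0, ∀ x ∈ frontier P.dom \ closure (P.hole j),
    ∀ y ∈ closure (P.hole j), m ≤ dist x y := by
  set R := frontier P.Ω ∪ ⋃ l : {l : Fin N // l ≠ j}, closure (P.hole l)
  have hR : IsClosed R := isClosed_frontier.union
    (isClosed_iUnion_of_finite fun _ => isClosed_closure)
  have hd : Disjoint (closure (P.hole j)) R := by
    rw [Set.disjoint_union_right]
    refine ⟨Set.disjoint_left.2 fun x hx hxf => ?_, disjoint_iUnion_right.2 fun l =>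
      P.disjoint_closure j l l.2.symm⟩
    rw [P.smooth_Ω.isOpen.frontier_eq] at hxf
    exact hxf.2 (P.closure_subset j hx)
  obtain ⟨r, hr, h⟩ := Metric.exists_pos_forall_lt_edist (P.isCompact_closure_hole j) hR hd
  refine ⟨r, hr, fun x hx y hy => ?_⟩
  have hxR : x ∈ R := by
    rcases P.frontier_dom_subset hx.1 with h1 | h1
    · exact Or.inl h1
    · obtain ⟨l, hl⟩ := mem_iUnion.1 h1
      have hlj : l ≠ j := by
        rintro rfl; exact hx.2 (frontier_subset_closure hl)
      exact Or.inr (mem_iUnion.2 ⟨⟨l, hlj⟩, frontier_subset_closure hl⟩)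
  have := (h y hy x hxR).le
  rw [edist_comm, edist_dist, ENNReal.le_ofReal_iff_toReal_le (by simp) dist_nonneg] at this
  simpa using this

theorem exists_dist_outer : ∃ m > 0, ∀ x ∈ frontier P.dom \ P.Ωᶜ,
    ∀ y ∈ P.Ωᶜ, m ≤ dist x y := by
  have hcpt : IsCompact (⋃ i, closure (P.hole i)) := isCompact_iUnion P.isCompact_closure_hole
  have hd : Disjoint (⋃ i, closure (P.hole i)) P.Ωᶜ :=
    Set.disjoint_compl_right_iff_subset.2 (iUnion_subset P.closure_subset)
  obtain ⟨r, hr, h⟩ := Metric.exists_pos_forall_lt_edist hcpt P.smooth_Ω.isOpen.isClosed_compl hd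
  refine ⟨r, hr, fun x hx y hy => ?_⟩
  have hxR : x ∈ ⋃ i, closure (P.hole i) := by
    rcases P.frontier_dom_subset hx.1 with h1 | h1
    · rw [P.smooth_Ω.isOpen.frontier_eq] at h1
      exact absurd h1.2 hx.2
    · obtain ⟨l, hl⟩ := mem_iUnion.1 h1
      exact mem_iUnion.2 ⟨l, frontier_subset_closure hl⟩
  have := (h x hxR y hy).le
  rw [edist_dist, ENNReal.le_ofReal_iff_toReal_le (by simp) dist_nonneg] at this
  simpa using this

namespace IsPotential

variable {P} {i : Fin N} {V : ℂ → ℝ}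

theorem mem_frontier_zero_or_one (h : P.IsPotential i V) {x : ℂ} (hx : x ∈ frontier P.dom) :
    V x = 0 ∨ V x = 1 := by
  by_cases hi : x ∈ frontier (P.hole i)
  · exact Or.inl (h.eq_zero x hi)
  · exact Or.inr (h.eq_one x ⟨hx, hi⟩)

theorem nonneg (h : P.IsPotential i V) {x : ℂ} (hx : x ∈ closure P.dom) : 0 ≤ V x := by
  have := harmonic_le_of_frontier_le P.isOpen_dom P.isBounded_dom (f := -V) (M := 0)
    h.continuousOn.neg h.harmonic.neg (fun x hx => by
      rcases h.mem_frontier_zero_or_one hx with h0 | h0 <;> simp [h0]) x hx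
  simpa using this

theorem le_one (h : P.IsPotential i V) {x : ℂ} (hx : x ∈ closure P.dom) : V x ≤ 1 :=
  harmonic_le_of_frontier_le P.isOpen_dom P.isBounded_dom h.continuousOn h.harmonic (fun x hx => by
    rcases h.mem_frontier_zero_or_one hx with h0 | h0 <;> simp [h0]) x hx

theorem contDiffOn (h : P.IsPotential i V) : ContDiffOn ℝ 2 V P.dom := h.harmonic.contDiffOn

/-- The barrier argument is applied to each boundary curve separately, `V` being constant on each.
For a hole, the discs inside the hole are exterior to the domain; for the outer curve, the discs
outside `Ω` are used. The constants are summed so that one of them serves all curves. -/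
theorem exists_boundary_lipschitz (h : P.IsPotential i V) :
    ∃ C, 0 < C ∧ ∀ p ∈ frontier P.dom, ∀ x ∈ closure P.dom, |V x - V p| ≤ C * dist x p := by
  have hole : ∀ j, ∃ C, 0 < C ∧ ∀ p ∈ frontier (P.hole j) ∩ frontier P.dom, ∀ x ∈ closure P.dom,
      |V x - V p| ≤ C * dist x p := by
    intro j
    obtain ⟨ρ, hρ, hdisc⟩ := (P.smooth_hole j).isBoundaryParam.exists_discs
    obtain ⟨m, hm, hfar⟩ := P.exists_dist_hole j
    obtain ⟨v, hv⟩ : ∃ v, ∀ x ∈ frontier P.dom ∩ closure (P.hole j), V x = v := by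
      by_cases hij : j = i
      · subst hij
        exact ⟨0, fun x hx => h.eq_zero x (P.mem_frontier_hole (frontier_subset_closure hx.1) hx.2)⟩
      · refine ⟨1, fun x hx => h.eq_one x ⟨hx.1, fun hxi => ?_⟩⟩
        exact Set.disjoint_left.1 (P.disjoint_closure j i hij) hx.2 (frontier_subset_closure hxi)
    obtain ⟨C, hC, hb⟩ := GinzburgLandau.exists_boundary_lipschitz P.isOpen_dom P.isBounded_dom
      h.continuousOn h.harmonic isClosed_closure (P.disjoint_closure_hole_dom j) hρ hm
      (Γ := frontier (P.hole j) ∩ frontier P.dom) (fun p hp => by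
        obtain ⟨⟨c, hc1, hc2⟩, -⟩ := hdisc p hp.1
        exact ⟨c, hc1, hc2.trans subset_closure⟩) hv hfar
    refine ⟨C, hC, fun p hp x hx => ?_⟩
    rw [hv p ⟨hp.2, frontier_subset_closure hp.1⟩]
    exact hb p hp x hx
  have outer : ∃ C, 0 < C ∧ ∀ p ∈ frontier P.Ω ∩ frontier P.dom, ∀ x ∈ closure P.dom,
      |V x - V p| ≤ C * dist x p := by
    obtain ⟨ρ, hρ, hdisc⟩ := P.smooth_Ω.isBoundaryParam.exists_discs
    obtain ⟨m, hm, hfar⟩ := P.exists_dist_outer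
    have hv : ∀ x ∈ frontier P.dom ∩ P.Ωᶜ, V x = 1 := fun x hx =>
      h.eq_one x ⟨hx.1, fun hxi => hx.2 (P.closure_subset i (frontier_subset_closure hxi))⟩
    obtain ⟨C, hC, hb⟩ := GinzburgLandau.exists_boundary_lipschitz P.isOpen_dom P.isBounded_dom
      h.continuousOn h.harmonic P.smooth_Ω.isOpen.isClosed_compl
      (Set.disjoint_left.2 fun x hx hxD => hx hxD.1) hρ hm
      (Γ := frontier P.Ω ∩ frontier P.dom) (fun p hp => by
        obtain ⟨-, ⟨c, hc1, hc2⟩⟩ := hdisc p hp.1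
        exact ⟨c, hc1, hc2.trans (compl_subset_compl.2 subset_closure)⟩) hv hfar
    refine ⟨C, hC, fun p hp x hx => ?_⟩
    rw [hv p ⟨hp.2, by
      have := hp.1; rw [P.smooth_Ω.isOpen.frontier_eq] at this; exact this.2⟩]
    exact hb p hp x hx
  choose C hC hb using hole
  obtain ⟨C', hC', hb'⟩ := outer
  have hsum : 0 ≤ ∑ j, C j := Finset.sum_nonneg fun j _ => (hC j).le
  refine ⟨C' + ∑ j, C j, by positivity, fun p hp x hx => ?_⟩
  rcases P.frontier_dom_subset hp with h1 | h1
  · refine (hb' p ⟨h1, hp⟩ x hx).trans ?_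
    gcongr; linarith
  · obtain ⟨j, hj⟩ := mem_iUnion.1 h1
    refine (hb j p ⟨hj, hp⟩ x hx).trans ?_
    gcongr
    have := Finset.single_le_sum (f := C) (fun j _ => (hC j).le) (Finset.mem_univ j)
    linarith

/-- Let `R` be the distance of `x` to the boundary and `p` a nearest boundary point. On the ball of
radius `R` about `x` the function stays within `2 * C * R` of `V p`. The interior estimate divides
this oscillation by `R`, so the bound does not depend on `x`. -/
theorem exists_norm_fderiv_le (h : P.IsPotential i V) :
    ∃ C, ∀ x ∈ P.dom, ‖fderiv ℝ V x‖ ≤ C := by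
  obtain ⟨C, hC, hb⟩ := h.exists_boundary_lipschitz
  refine ⟨8 * (2 * C), fun x hx => ?_⟩
  have hne : (frontier P.dom).Nonempty := by
    by_contra hn
    have := isClopen_iff_frontier_eq_empty.2 (not_nonempty_iff_eq_empty.1 hn)
    have huniv := this.eq_univ ⟨x, hx⟩
    exact NormedSpace.unbounded_univ ℝ ℂ (huniv ▸ P.isBounded_dom)
  obtain ⟨p, hp, hdist⟩ := isClosed_frontier.exists_infDist_eq_dist hne x
  set R := dist x p with hR
  have hR0 : 0 < R := dist_pos.2 fun he => by
    rw [← he, P.isOpen_dom.frontier_eq] at hp; exact hp.2 hx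
  have hball : Metric.ball x R ⊆ P.dom := by
    by_contra hcon
    obtain ⟨y, hy, hyn⟩ := not_subset.1 hcon
    obtain ⟨z, hz1, hz2⟩ := preconnected_inter_frontier_nonempty (convex_ball x R).isPreconnected
      ⟨x, Metric.mem_ball_self hR0, hx⟩ ⟨y, hy, hyn⟩
    have h1 := Metric.infDist_le_dist_of_mem (x := x) hz2
    rw [hdist, dist_comm] at h1
    exact absurd (Metric.mem_ball.1 hz1) (not_lt.2 h1)
  have := norm_fderiv_le_of_harmonicOnNhd_ball hR0 (K := C * (2 * R)) (v := V p) (by positivity)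
    (h.harmonic.mono hball) (fun y hy => (hb p hp y (subset_closure (hball hy))).trans (by
      gcongr
      have := dist_triangle y x p
      have h2 := Metric.mem_ball.1 hy
      linarith))
  refine this.trans (le_of_eq ?_)
  field_simp

theorem c1Bounded (h : P.IsPotential i V) : C1Bounded P V := by
  obtain ⟨C, hC⟩ := h.exists_norm_fderiv_le
  refine ⟨max 1 C, ?_⟩
  rintro _ ⟨x, hx, rfl⟩
  have h1 := hC x hx
  have h2 : ∀ e : ℂ, ‖e‖ = 1 → |fderiv ℝ V x e| ≤ C := fun e he => by
    have := (fderiv ℝ V x).le_opNorm e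
    rw [he, mul_one] at this
    exact this.trans h1
  refine max_le (le_max_of_le_left ?_) (max_le (le_max_of_le_right (h2 1 (by simp)))
    (le_max_of_le_right (h2 _ (by simp))))
  rw [abs_of_nonneg (h.nonneg (subset_closure hx))]
  exact h.le_one (subset_closure hx)

end IsPotential

end PerforatedDomain

/-! ### Square integrable functions: bilinear limits and mollification -/

theorem eLpNorm_two_sq {α E : Type*} [MeasurableSpace α] [NormedAddCommGroup E] (f : α → E)
    (μ : Measure α) : eLpNorm f 2 μ ^ 2 = ∫⁻ x, ‖f x‖ₑ ^ 2 ∂μ := by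
  rw [eLpNorm_eq_lintegral_rpow_enorm_toReal (by norm_num) (by norm_num)]
  rw [← ENNReal.rpow_natCast, ← ENNReal.rpow_mul]
  norm_num

theorem tendsto_eLpNorm_two_iff {α E ι : Type*} [MeasurableSpace α] [NormedAddCommGroup E]
    {f : ι → α → E} {μ : Measure α} {l : Filter ι} :
    Tendsto (fun i => eLpNorm (f i) 2 μ) l (𝓝 0) ↔
      Tendsto (fun i => ∫⁻ x, ‖f i x‖ₑ ^ 2 ∂μ) l (𝓝 0) := by
  simp_rw [← eLpNorm_two_sq]
  constructor
  · intro h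
    simpa [Function.comp_def] using ((ENNReal.continuous_pow 2).tendsto 0).comp h
  · intro h
    have := (ENNReal.continuous_rpow_const (y := 1 / 2)).tendsto 0 |>.comp h
    simp only [Function.comp_def, ← ENNReal.rpow_natCast, ← ENNReal.rpow_mul] at this
    norm_num at this
    exact this

/-- The cross product as a continuous bilinear map. -/
def crossL : ℂ →L[ℝ] ℂ →L[ℝ] ℝ :=
  LinearMap.mkContinuous₂ (LinearMap.mk₂ ℝ cross (by intros; simp [cross]; ring)
    (by intros; simp [cross]; ring) (by intros; simp [cross]; ring) (by intros; simp [cross]; ring))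
    1 (fun z w => by
      have : cross z w = (conj z * w).im := by simp [cross]; ring
      simp only [LinearMap.mk₂_apply]
      rw [this, Real.norm_eq_abs, one_mul]
      calc |(conj z * w).im| ≤ ‖conj z * w‖ := Complex.abs_im_le_norm _
        _ = ‖z‖ * ‖w‖ := by simp)

@[simp] theorem crossL_apply (z w : ℂ) : crossL z w = cross z w := rfl

theorem abs_cross_le (z w : ℂ) : |cross z w| ≤ ‖z‖ * ‖w‖ := by
  have : cross z w = (conj z * w).im := by simp [cross]; ring
  rw [this]
  calc |(conj z * w).im| ≤ ‖conj z * w‖ := Complex.abs_im_le_norm _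
    _ = ‖z‖ * ‖w‖ := by simp

theorem cross_swap (z w : ℂ) : cross w z = -cross z w := by simp [cross]; ring

section Bilinear

variable {α : Type*} [MeasurableSpace α] {μ : Measure α} (B : ℂ →L[ℝ] ℂ →L[ℝ] ℝ)

theorem eLpNorm_bilin_le {u v : α → ℂ} (hu : AEStronglyMeasurable u μ)
    (hv : AEStronglyMeasurable v μ) :
    eLpNorm (fun x => B (u x) (v x)) 1 μ ≤ ‖B‖₊ * eLpNorm u 2 μ * eLpNorm v 2 μ :=
  eLpNorm_le_eLpNorm_mul_eLpNorm_of_nnnorm hu hv (fun a b => B a b) ‖B‖₊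
    (Eventually.of_forall fun x => B.le_opNorm₂ (u x) (v x))

theorem memLp_one_bilin {u v : α → ℂ} (hu : MemLp u 2 μ) (hv : MemLp v 2 μ) :
    MemLp (fun x => B (u x) (v x)) 1 μ := by
  refine ⟨?_, (eLpNorm_bilin_le B hu.1 hv.1).trans_lt ?_⟩
  · exact B.aestronglyMeasurable_comp₂ hu.1 hv.1
  · exact ENNReal.mul_lt_top (ENNReal.mul_lt_top ENNReal.coe_lt_top hu.2) hv.2

theorem integrable_bilin {u v : α → ℂ} (hu : MemLp u 2 μ) (hv : MemLp v 2 μ) :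
    Integrable (fun x => B (u x) (v x)) μ := memLp_one_iff_integrable.1 (memLp_one_bilin B hu hv)

theorem abs_integral_bilin_le {u v : α → ℂ} (hu : MemLp u 2 μ) (hv : MemLp v 2 μ) :
    |∫ x, B (u x) (v x) ∂μ| ≤ ‖B‖ * (eLpNorm u 2 μ).toReal * (eLpNorm v 2 μ).toReal := by
  have h1 : |∫ x, B (u x) (v x) ∂μ| ≤ (eLpNorm (fun x => B (u x) (v x)) 1 μ).toReal := by
    rw [← Real.norm_eq_abs, eLpNorm_one_eq_lintegral_enorm,
      ← integral_norm_eq_lintegral_enorm (integrable_bilin B hu hv).1]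
    exact norm_integral_le_integral_norm _
  refine h1.trans ((ENNReal.toReal_mono ?_ (eLpNorm_bilin_le B hu.1 hv.1)).trans_eq ?_)
  · exact (ENNReal.mul_lt_top (ENNReal.mul_lt_top ENNReal.coe_lt_top hu.2) hv.2).ne
  · simp

/-- With `a = un n - u` and `b = vn n - v`, the difference of the integrands is `B a b + B u b + B a
v`, and each term is small by Cauchy-Schwarz. -/
theorem tendsto_integral_bilin {ι : Type*} {l : Filter ι} {u v : α → ℂ} {un vn : ι → α → ℂ}
    (hu : MemLp u 2 μ) (hv : MemLp v 2 μ) (hun : ∀ n, MemLp (un n) 2 μ)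
    (hvn : ∀ n, MemLp (vn n) 2 μ)
    (htu : Tendsto (fun n => eLpNorm (fun x => un n x - u x) 2 μ) l (𝓝 0))
    (htv : Tendsto (fun n => eLpNorm (fun x => vn n x - v x) 2 μ) l (𝓝 0)) :
    Tendsto (fun n => ∫ x, B (un n x) (vn n x) ∂μ) l (𝓝 (∫ x, B (u x) (v x) ∂μ)) := by
  rw [tendsto_iff_norm_sub_tendsto_zero]
  have hdu : ∀ n, MemLp (fun x => un n x - u x) 2 μ := fun n => (hun n).sub hu
  have hdv : ∀ n, MemLp (fun x => vn n x - v x) 2 μ := fun n => (hvn n).sub hv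
  have tu : Tendsto (fun n => (eLpNorm (fun x => un n x - u x) 2 μ).toReal) l (𝓝 0) := by
    simpa [Function.comp_def] using (ENNReal.tendsto_toReal ENNReal.zero_ne_top).comp htu
  have tv : Tendsto (fun n => (eLpNorm (fun x => vn n x - v x) 2 μ).toReal) l (𝓝 0) := by
    simpa [Function.comp_def] using (ENNReal.tendsto_toReal ENNReal.zero_ne_top).comp htv
  refine squeeze_zero (fun n => norm_nonneg _) (g := fun n =>
    ‖B‖ * (eLpNorm (fun x => un n x - u x) 2 μ).toReal *
        (eLpNorm (fun x => vn n x - v x) 2 μ).toReal +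
      ‖B‖ * (eLpNorm u 2 μ).toReal * (eLpNorm (fun x => vn n x - v x) 2 μ).toReal +
      ‖B‖ * (eLpNorm (fun x => un n x - u x) 2 μ).toReal * (eLpNorm v 2 μ).toReal)
    (fun n => ?_) ?_
  · have e : ∫ x, B (un n x) (vn n x) ∂μ - ∫ x, B (u x) (v x) ∂μ =
        ∫ x, B (un n x - u x) (vn n x - v x) ∂μ + ∫ x, B (u x) (vn n x - v x) ∂μ +
          ∫ x, B (un n x - u x) (v x) ∂μ := by
      rw [← integral_sub (integrable_bilin B (hun n) (hvn n)) (integrable_bilin B hu hv),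
        ← integral_add (integrable_bilin B (hdu n) (hdv n)) (integrable_bilin B hu (hdv n)),
        ← integral_add (f := fun x => B (un n x - u x) (vn n x - v x) + B (u x) (vn n x - v x))
          ((integrable_bilin B (hdu n) (hdv n)).add (integrable_bilin B hu (hdv n)))
          (integrable_bilin B (hdu n) hv)]
      congr 1
      ext x
      simp only [map_sub, sub_apply]
      ring
    rw [e]
    refine (norm_add_le _ _).trans (add_le_add ((norm_add_le _ _).trans (add_le_add ?_ ?_)) ?_)
    · exact abs_integral_bilin_le B (hdu n) (hdv n)
    · exact abs_integral_bilin_le B hu (hdv n)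
    · exact abs_integral_bilin_le B (hdu n) hv
  · have := (((tu.mul tv).const_mul ‖B‖).add (tv.const_mul (‖B‖ * (eLpNorm u 2 μ).toReal))).add
      ((tu.const_mul ‖B‖).mul_const (eLpNorm v 2 μ).toReal)
    simp only [mul_zero, zero_mul, add_zero] at this
    refine this.congr fun n => by ring

theorem memLp_bdd_smul {u : α → ℂ} (hu : MemLp u 2 μ) {a : α → ℝ} {C : ℝ}
    (ha : AEStronglyMeasurable a μ) (hC : ∀ᵐ x ∂μ, |a x| ≤ C) :
    MemLp (fun x => a x • u x) 2 μ :=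
  hu.of_le_mul (c := C) (ha.smul hu.1) (hC.mono fun x hx => by
    rw [norm_smul]
    gcongr
    exact hx)

theorem tendsto_bdd_smul {ι : Type*} {l : Filter ι} {u : α → ℂ} {un : ι → α → ℂ} {a : α → ℝ}
    {C : ℝ} (hC : ∀ᵐ x ∂μ, |a x| ≤ C)
    (h : Tendsto (fun n => eLpNorm (fun x => un n x - u x) 2 μ) l (𝓝 0)) :
    Tendsto (fun n => eLpNorm (fun x => a x • un n x - a x • u x) 2 μ) l (𝓝 0) := by
  have hb : ∀ n, eLpNorm (fun x => a x • un n x - a x • u x) 2 μ ≤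
      ENNReal.ofReal C * eLpNorm (fun x => un n x - u x) 2 μ := fun n =>
    eLpNorm_le_mul_eLpNorm_of_ae_le_mul (hC.mono fun x hx => by
      rw [← smul_sub, norm_smul]
      gcongr
      exact hx) 2
  refine tendsto_of_tendsto_of_tendsto_of_le_of_le tendsto_const_nhds ?_ (fun _ => zero_le) hb
  simpa using ENNReal.Tendsto.const_mul h (Or.inr ENNReal.ofReal_ne_top)

end Bilinear

/-! ### Mollification in `L²` by general, possibly off-centre, kernels -/

section Mollification

open Convolution ContinuousLinearMap

variable {k : ℂ → ℝ} {g : ℂ → ℂ}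

/-- `k` is a continuous, compactly supported probability density. -/
structure IsKernel (k : ℂ → ℝ) : Prop where
  continuous : Continuous k
  hasCompactSupport : HasCompactSupport k
  nonneg : ∀ y, 0 ≤ k y
  integral_eq_one : ∫ y, k y = 1

theorem IsKernel.lintegral_eq_one (hk : IsKernel k) : ∫⁻ y, ENNReal.ofReal (k y) = 1 := by
  rw [← ofReal_integral_eq_lintegral_ofReal
    (hk.continuous.integrable_of_hasCompactSupport hk.hasCompactSupport)
    (Eventually.of_forall hk.nonneg), hk.integral_eq_one, ENNReal.ofReal_one]

/-- Jensen's inequality for the probability measure `k(y) dy`: the left side is the squared norm of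
the mean of `g (x - y) - g x`. -/
theorem IsKernel.enorm_convolution_sub_sq_le (hk : IsKernel k) (hg : LocallyIntegrable g) (x : ℂ) :
    ‖(k ⋆[lsmul ℝ ℝ, volume] g) x - g x‖ₑ ^ 2 ≤
      ∫⁻ y, ENNReal.ofReal (k y) * ‖g (x - y) - g x‖ₑ ^ 2 := by
  set μ : Measure ℂ := volume.withDensity fun y => ENNReal.ofReal (k y) with hμ
  have hkm : Measurable fun y => ENNReal.ofReal (k y) := hk.continuous.measurable.ennreal_ofReal
  have hprob : IsProbabilityMeasure μ := ⟨by
    rw [hμ, withDensity_apply _ MeasurableSet.univ, Measure.restrict_univ, hk.lintegral_eq_one]⟩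
  have hmeas : AEStronglyMeasurable (fun y => g (x - y) - g x) volume :=
    (hg.aestronglyMeasurable.comp_measurePreserving
      (Measure.measurePreserving_sub_left volume x)).sub aestronglyMeasurable_const
  have hmeas' : AEStronglyMeasurable (fun y => g (x - y) - g x) μ :=
    hmeas.mono_ac (withDensity_absolutelyContinuous _ _)
  have hint : Integrable (fun y => k y • g (x - y)) :=
    hk.hasCompactSupport.convolutionExists_left (lsmul ℝ ℝ) hk.continuous hg x
  have hint2 : Integrable (fun y => k y • g x) :=
    (hk.continuous.integrable_of_hasCompactSupport hk.hasCompactSupport).smul_const _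
  have heq : (k ⋆[lsmul ℝ ℝ, volume] g) x - g x = ∫ y, k y • (g (x - y) - g x) := by
    simp_rw [smul_sub]
    rw [integral_sub hint hint2, integral_smul_const, hk.integral_eq_one, one_smul]
    rfl
  have hw : ∀ f : ℂ → ENNReal, ∫⁻ y, f y ∂μ = ∫⁻ y, ENNReal.ofReal (k y) * f y := fun f => by
    rw [hμ, lintegral_withDensity_eq_lintegral_mul_non_measurable _ hkm
      (Eventually.of_forall fun y => ENNReal.ofReal_lt_top)]
    rfl
  have h1 : ‖(k ⋆[lsmul ℝ ℝ, volume] g) x - g x‖ₑ ≤ eLpNorm (fun y => g (x - y) - g x) 1 μ := by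
    rw [heq, eLpNorm_one_eq_lintegral_enorm, hw]
    refine (enorm_integral_le_lintegral_enorm _).trans_eq (lintegral_congr fun y => ?_)
    rw [enorm_smul, Real.enorm_of_nonneg (hk.nonneg y)]
  have h2 := eLpNorm_le_eLpNorm_of_exponent_le (p := 1) (q := 2) (by norm_num) hmeas'
  calc ‖(k ⋆[lsmul ℝ ℝ, volume] g) x - g x‖ₑ ^ 2
      ≤ eLpNorm (fun y => g (x - y) - g x) 2 μ ^ 2 := by gcongr; exact h1.trans h2
    _ = _ := by rw [eLpNorm_two_sq, hw]

/-- After the pointwise Jensen bound, Tonelli reduces the error to translates by single vectors in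
the support of the kernel. The set `S` lets the estimate be used away from a boundary, where only
the translates of interior points are controlled. -/
theorem IsKernel.lintegral_convolution_sub_le (hk : IsKernel k) (hg : LocallyIntegrable g)
    (S : Set ℂ) {C : ENNReal}
    (hC : ∀ y, k y ≠ 0 → ∫⁻ x in S, ‖g (x - y) - g x‖ₑ ^ 2 ≤ C) :
    ∫⁻ x in S, ‖(k ⋆[lsmul ℝ ℝ, volume] g) x - g x‖ₑ ^ 2 ≤ C := by
  have hg1 : AEStronglyMeasurable (fun p : ℂ × ℂ => g (p.1 - p.2))
      ((volume.restrict S).prod volume) :=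
    (hg.aestronglyMeasurable.comp_quasiMeasurePreserving
      (quasiMeasurePreserving_sub_of_right_invariant volume volume)).mono_ac
      (Measure.restrict_le_self.absolutelyContinuous.prod .rfl)
  have hg2 : AEStronglyMeasurable (fun p : ℂ × ℂ => g p.1) ((volume.restrict S).prod volume) :=
    hg.aestronglyMeasurable.restrict.comp_fst
  have hm : AEMeasurable (Function.uncurry fun x y : ℂ =>
      ENNReal.ofReal (k y) * ‖g (x - y) - g x‖ₑ ^ 2) ((volume.restrict S).prod volume) := by
    refine AEMeasurable.mul ?_ ((hg1.sub hg2).enorm.pow_const 2)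
    exact (hk.continuous.measurable.ennreal_ofReal.comp measurable_snd).aemeasurable
  calc ∫⁻ x in S, ‖(k ⋆[lsmul ℝ ℝ, volume] g) x - g x‖ₑ ^ 2
      ≤ ∫⁻ x in S, ∫⁻ y, ENNReal.ofReal (k y) * ‖g (x - y) - g x‖ₑ ^ 2 :=
        lintegral_mono fun x => hk.enorm_convolution_sub_sq_le hg x
    _ = ∫⁻ y, ∫⁻ x in S, ENNReal.ofReal (k y) * ‖g (x - y) - g x‖ₑ ^ 2 :=
        lintegral_lintegral_swap hm
    _ ≤ ∫⁻ y, ENNReal.ofReal (k y) * C := by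
        refine lintegral_mono fun y => ?_
        rw [lintegral_const_mul' _ _ ENNReal.ofReal_ne_top]
        by_cases hy : k y = 0
        · simp [hy]
        · gcongr; exact hC y hy
    _ = C := by
        rw [lintegral_mul_const _ hk.continuous.measurable.ennreal_ofReal, hk.lintegral_eq_one,
          one_mul]

theorem tendsto_lintegral_translate_sub (hg : MemLp g 2 volume) :
    Tendsto (fun y : ℂ => ∫⁻ x, ‖g (x - y) - g x‖ₑ ^ 2) (𝓝 0) (𝓝 0) := by
  rw [← tendsto_eLpNorm_two_iff]
  let F : C(ℂ, C(ℂ, ℂ)) := ContinuousMap.curry ⟨fun p : ℂ × ℂ => p.2 - p.1, by fun_prop⟩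
  have hF : ∀ y, MeasurePreserving (F y) (volume : Measure ℂ) volume := fun y =>
    measurePreserving_sub_right volume y
  have hcont : Continuous fun y => Lp.compMeasurePreserving (F y) (hF y) hg.toLp :=
    continuous_const.compMeasurePreservingLp F.continuous hF (by norm_num)
  have ht := hcont.tendsto 0
  rw [tendsto_iff_edist_tendsto_0] at ht
  refine ht.congr fun y => ?_
  rw [Lp.edist_def]
  refine eLpNorm_congr_ae ?_
  have e1 : ∀ y, ⇑(Lp.compMeasurePreserving (F y) (hF y) hg.toLp) =ᵐ[volume]
      fun x => g (x - y) := fun y =>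
    (Lp.coeFn_compMeasurePreserving _ (hF y)).trans
      ((hF y).quasiMeasurePreserving.ae_eq_comp hg.coeFn_toLp)
  filter_upwards [e1 y, e1 0] with x h1 h2
  simp only [Pi.sub_apply, h1, h2, sub_zero]

/-- Mollifications converge in `L²`. -/
theorem tendsto_convolution_L2 (hg : MemLp g 2 volume) {k : ℕ → ℂ → ℝ} (hk : ∀ n, IsKernel (k n))
    {r : ℕ → ℝ} (hr : Tendsto r atTop (𝓝 0)) (hsupp : ∀ n y, k n y ≠ 0 → ‖y‖ ≤ r n) :
    Tendsto (fun n => eLpNorm (fun x => (k n ⋆[lsmul ℝ ℝ, volume] g) x - g x) 2 volume) atTop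
      (𝓝 0) := by
  rw [tendsto_eLpNorm_two_iff, ENNReal.tendsto_nhds_zero]
  intro ε hε
  have h1 := ENNReal.tendsto_nhds_zero.1 (tendsto_lintegral_translate_sub hg) ε hε
  obtain ⟨δ, hδ, hball⟩ := Metric.eventually_nhds_iff_ball.1 h1
  filter_upwards [hr.eventually_lt_const hδ] with n hn
  have := (hk n).lintegral_convolution_sub_le (hg.locallyIntegrable (by norm_num)) univ (C := ε)
    (fun y hy => by
      rw [Measure.restrict_univ]
      exact hball y (by rw [mem_ball_zero_iff]; exact (hsupp n y hy).trans_lt hn))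
  rwa [Measure.restrict_univ] at this

end Mollification

/-! ### Density of smooth functions in `H¹` -/

theorem integrable_test {U : Set ℂ} {u : ℂ → ℂ} (hu : MemLp u 2 (volume.restrict U)) {φ : ℂ → ℝ}
    (hc : Continuous φ) (hs : HasCompactSupport φ) :
    Integrable (fun x => φ x • u x) (volume.restrict U) :=
  (hu.locallyIntegrable (by norm_num)).integrable_smul_left_of_hasCompactSupport hc hs

theorem continuous_fderiv_apply_of_contDiff {F : Type*} [NormedAddCommGroup F] [NormedSpace ℝ F]
    {φ : ℂ → F} {n : ℕ∞} (h : ContDiff ℝ n φ) (hn : n ≠ 0) (e : ℂ) :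
    Continuous fun x => fderiv ℝ φ x e :=
  (h.continuous_fderiv (by exact_mod_cast hn)).clm_apply continuous_const

theorem exists_bound_of_compactSupport {φ : ℂ → ℝ} (hc : Continuous φ) (hs : HasCompactSupport φ) :
    ∃ C, ∀ x, |φ x| ≤ C := hs.exists_bound_of_continuous hc

theorem memLp_smul_test {U : Set ℂ} {u : ℂ → ℂ} (hu : MemLp u 2 (volume.restrict U)) {φ : ℂ → ℝ}
    (hc : Continuous φ) (hs : HasCompactSupport φ) :
    MemLp (fun x => φ x • u x) 2 (volume.restrict U) := by
  obtain ⟨C, hC⟩ := exists_bound_of_compactSupport hc hs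
  exact memLp_bdd_smul hu hc.aestronglyMeasurable (Eventually.of_forall hC)

/-- The product `φ * ζ` is again an admissible test function, and its derivative splits by the
Leibniz rule. -/
theorem IsWeakDeriv.smul {U : Set ℂ} {e : ℂ} {u g : ℂ → ℂ} (h : IsWeakDeriv U e u g)
    (hu : MemLp u 2 (volume.restrict U)) {ζ : ℂ → ℝ} (hζ : ContDiff ℝ ∞ ζ)
    (hζs : HasCompactSupport ζ) :
    IsWeakDeriv U e (fun x => ζ x • u x) (fun x => fderiv ℝ ζ x e • u x + ζ x • g x) := by
  have hζd := continuous_fderiv_apply_of_contDiff hζ (by simp) e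
  have hζds : HasCompactSupport fun x => fderiv ℝ ζ x e := hζs.fderiv_apply ℝ e
  refine ⟨(memLp_smul_test hu hζd hζds).add (memLp_smul_test h.1 hζ.continuous hζs), ?_⟩
  intro φ hφ hφs hφU
  have hφd := continuous_fderiv_apply_of_contDiff hφ (by simp) e
  have hφds : HasCompactSupport fun x => fderiv ℝ φ x e := hφs.fderiv_apply ℝ e
  have key := h.2 (fun x => φ x * ζ x) (hφ.mul hζ) hφs.mul_right
    ((tsupport_mul_subset_left).trans hφU)
  have hd : ∀ x, fderiv ℝ (fun x => φ x * ζ x) x e = φ x * fderiv ℝ ζ x e + ζ x * fderiv ℝ φ x e :=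
    fun x => by
      rw [fderiv_fun_mul (hφ.differentiable (by simp) x) (hζ.differentiable (by simp) x)]
      simp
  simp only [hd] at key
  have i1 : Integrable (fun x => (φ x * fderiv ℝ ζ x e) • u x) (volume.restrict U) :=
    integrable_test hu (hφ.continuous.mul hζd) hφs.mul_right
  have i2 : Integrable (fun x => (ζ x * fderiv ℝ φ x e) • u x) (volume.restrict U) :=
    integrable_test hu (hζ.continuous.mul hφd) hζs.mul_right
  have i3 : Integrable (fun x => (φ x * ζ x) • g x) (volume.restrict U) :=
    integrable_test h.1 (hφ.continuous.mul hζ.continuous) hφs.mul_right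
  simp only [add_smul] at key
  rw [integral_add i1 i2] at key
  have e1 : ∫ x in U, fderiv ℝ φ x e • ζ x • u x = ∫ x in U, (ζ x * fderiv ℝ φ x e) • u x :=
    integral_congr_ae (Eventually.of_forall fun x => by simp only [smul_smul, mul_comm])
  have e2 : ∫ x in U, φ x • (fderiv ℝ ζ x e • u x + ζ x • g x) =
      (∫ x in U, (φ x * fderiv ℝ ζ x e) • u x) + ∫ x in U, (φ x * ζ x) • g x := by
    rw [← integral_add i1 i3]
    exact integral_congr_ae (Eventually.of_forall fun x => by simp only [smul_add, smul_smul])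
  rw [e1, e2, eq_sub_of_add_eq' key]
  abel

section LocalApprox

open Convolution ContinuousLinearMap

/-- Convolution of a weakly differentiable function, extended by zero, with a kernel for which
the translates stay in the open set. -/
theorem fderiv_convolution_of_isWeakDeriv {U : Set ℂ} (hU : IsOpen U) {e : ℂ} {v g : ℂ → ℂ}
    (hv : MemLp v 2 (volume.restrict U)) (h : IsWeakDeriv U e v g) {k : ℂ → ℝ}
    (hk : ContDiff ℝ ∞ k) (hks : HasCompactSupport k) {x : ℂ}
    (hx : ∀ y ∈ tsupport k, x - y ∈ U) :
    fderiv ℝ (k ⋆[lsmul ℝ ℝ, volume] U.indicator v) x e =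
      (k ⋆[lsmul ℝ ℝ, volume] U.indicator g) x := by
  have hvi : LocallyIntegrable (U.indicator v) :=
    ((memLp_indicator_iff_restrict hU.measurableSet).2 hv).locallyIntegrable (by norm_num)
  have hd := (hks.hasFDerivAt_convolution_left (lsmul ℝ ℝ) (hk.of_le (by simp)) hvi x).fderiv
  have hce := (hks.fderiv ℝ).convolutionExists_left ((lsmul ℝ ℝ : ℝ →L[ℝ] ℂ →L[ℝ] ℂ).precompL ℂ)
    (hk.continuous_fderiv (by simp)) hvi x
  rw [hd, convolution_def, ContinuousLinearMap.integral_apply hce]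
  simp only [precompL_apply, lsmul_apply]
  have hsub : ∀ F : ℂ → ℂ → ℂ, ∫ y, F y (x - y) = ∫ y, F (x - y) y := fun F => by
    rw [← integral_sub_left_eq_self _ volume x]
    simp
  rw [hsub fun a b => fderiv ℝ k a e • U.indicator v b]
  rw [convolution_lsmul_swap]
  have hind : ∀ (a : ℂ → ℝ) (w : ℂ → ℂ), ∫ y, a y • U.indicator w y = ∫ y in U, a y • w y :=
    fun a w => by
      rw [← integral_indicator hU.measurableSet]
      congr 1
      ext y
      by_cases hy : y ∈ U <;> simp [hy]
  rw [hind (fun y => fderiv ℝ k (x - y) e), hind (fun y => k (x - y))]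
  have hψ : ContDiff ℝ ∞ fun y => k (x - y) := hk.comp (contDiff_const.sub contDiff_id)
  have hts : tsupport (fun y => k (x - y)) ⊆ (fun y => x - y) ⁻¹' tsupport k :=
    closure_minimal (fun y hy => subset_tsupport k hy)
      ((isClosed_tsupport k).preimage (by fun_prop))
  have hψs : HasCompactSupport fun y => k (x - y) :=
    hks.comp_homeomorph (Homeomorph.subLeft x)
  have hψU : tsupport (fun y => k (x - y)) ⊆ U := fun y hy => by
    have := hx _ (hts hy)
    simpa using this
  -- The reflected and translated kernel `y ↦ k (x - y)` is itself a test function supported in `U`,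
  -- so the weak derivative may be tested against it. The two minus signs cancel.
  have key := h.2 _ hψ hψs hψU
  have hder : ∀ y, fderiv ℝ (fun y => k (x - y)) y e = -fderiv ℝ k (x - y) e := fun y => by
    have h1 : HasFDerivAt (fun y => k (x - y)) ((fderiv ℝ k (x - y)).comp (-ContinuousLinearMap.id ℝ ℂ)) y :=
      ((hk.differentiable (by simp) (x - y)).hasFDerivAt).comp y
        ((hasFDerivAt_id y).const_sub x)
    rw [h1.fderiv]
    simp
  simp only [hder, neg_smul, integral_neg, neg_inj] at key
  exact key

theorem convolution_eq_zero_of_forall {k : ℂ → ℝ} {w : ℂ → ℂ} {x : ℂ}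
    (h : ∀ y, k y ≠ 0 → w (x - y) = 0) : (k ⋆[lsmul ℝ ℝ, volume] w) x = 0 := by
  rw [convolution_lsmul]
  refine integral_eq_zero_of_ae (Eventually.of_forall fun y => ?_)
  by_cases hy : k y = 0
  · simp [hy]
  · simp [h y hy]

/-- Small translations in directions close to `e` map the part of `U` near `p` into `U`. -/
def HasCone (U : Set ℂ) (p e : ℂ) (r c : ℝ) : Prop :=
  ∀ x ∈ U, x ∈ Metric.ball p r → ∀ τ : ℝ, 0 < τ → τ < r → ∀ z ∈ Metric.ball e c, x + τ * z ∈ U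

/-- The mollifying kernels are shifted by `-τ e₀`. The value at a point `x` of `U` near `p` then
averages over points `x + τ z` with `z` close to `e₀`, all of which lie in `U` by the cone property.
Extension by zero across the boundary is thus never seen, and differentiation commutes with the
convolution up to the boundary. -/
theorem exists_local_approx {U : Set ℂ} (hU : IsOpen U) {p e₀ : ℂ} {r c : ℝ} (hr : 0 < r)
    (hc : 0 < c) (hcone : HasCone U p e₀ r c) {u : ℂ → ℂ} {g : ℂ → ℂ → ℂ} {s : Set ℂ}
    (hu : MemLp u 2 (volume.restrict U)) (hg : ∀ e ∈ s, IsWeakDeriv U e u (g e)) {ζ : ℂ → ℝ}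
    (hζ : ContDiff ℝ ∞ ζ) (hζs : tsupport ζ ⊆ Metric.ball p r) :
    ∃ φ : ℕ → ℂ → ℂ, (∀ n, ContDiff ℝ ∞ (φ n)) ∧
      Tendsto (fun n => eLpNorm (fun x => φ n x - ζ x • u x) 2 (volume.restrict U)) atTop (𝓝 0) ∧
      ∀ e ∈ s, Tendsto (fun n => eLpNorm (fun x => fderiv ℝ (φ n) x e -
        (fderiv ℝ ζ x e • u x + ζ x • g e x)) 2 (volume.restrict U)) atTop (𝓝 0) := by
  have hζc : HasCompactSupport ζ :=
    Metric.isCompact_of_isClosed_isBounded (isClosed_tsupport ζ) (Metric.isBounded_ball.subset hζs)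
  obtain ⟨d, hd, hthick⟩ := IsCompact.exists_thickening_subset_open hζc Metric.isOpen_ball hζs
  -- A scale `τ ≤ T` is admissible in the cone property. It also moves points by less than `d`, so
  -- the support of `ζ` stays inside the ball where the cone property holds.
  set T := min r (d / (‖e₀‖ + c)) / 2 with hT
  have hT0 : 0 < T := by positivity
  have hTr : T < r := by
    have := min_le_left r (d / (‖e₀‖ + c)); linarith
  have hTd : T * (‖e₀‖ + c) < d := by
    have h1 := min_le_right r (d / (‖e₀‖ + c))
    have h2 : T < d / (‖e₀‖ + c) := by
      have : 0 < d / (‖e₀‖ + c) := by positivity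
      have h3 : min r (d / (‖e₀‖ + c)) / 2 < min r (d / (‖e₀‖ + c)) := half_lt_self (by positivity)
      linarith
    rwa [lt_div_iff₀ (by positivity)] at h2
  set τ : ℕ → ℝ := fun n => T / (n + 1) with hτ
  have hτ0 : ∀ n, 0 < τ n := fun n => by positivity
  have hτT : ∀ n, τ n ≤ T := fun n => div_le_self hT0.le (by linarith [n.cast_nonneg (α := ℝ)])
  have hτlim : Tendsto τ atTop (𝓝 0) := by
    have := tendsto_one_div_add_atTop_nhds_zero_nat (𝕜 := ℝ) |>.const_mul T
    rw [mul_zero] at this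
    exact this.congr fun n => by rw [hτ]; ring
  -- The outer radius `τ c / 2` keeps the support within `-(τ z)` for `z` in the ball of radius `c`
  -- about `e₀`.
  let f : ∀ n, ContDiffBump (-(τ n : ℂ) * e₀) := fun n =>
    ⟨τ n * c / 4, τ n * c / 2, by have := hτ0 n; positivity, by
      have := mul_pos (hτ0 n) hc; linarith⟩
  set k : ℕ → ℂ → ℝ := fun n => (f n).normed volume with hk
  have hkker : ∀ n, IsKernel (k n) := fun n =>
    ⟨(f n).continuous_normed, (f n).hasCompactSupport_normed, (f n).nonneg_normed,
      (f n).integral_normed⟩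
  have hksm : ∀ n, ContDiff ℝ ∞ (k n) := fun n => (f n).contDiff_normed
  -- elements of the support
  have hts : ∀ n, ∀ y ∈ tsupport (k n), ∃ z ∈ Metric.ball e₀ c, y = -(τ n * z) := fun n y hy => by
    rw [hk] at hy
    simp only [(f n).tsupport_normed_eq] at hy
    rw [mem_closedBall_iff_norm] at hy
    have hτn : (τ n : ℂ) ≠ 0 := by exact_mod_cast (hτ0 n).ne'
    refine ⟨-(y / τ n), ?_, by field_simp; try ring⟩
    rw [mem_ball_iff_norm]
    have e1 : -(y / τ n) - e₀ = -((y - -(τ n : ℂ) * e₀) / τ n) := by field_simp; ring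
    rw [e1, norm_neg, norm_div, Complex.norm_real, Real.norm_of_nonneg (hτ0 n).le,
      div_lt_iff₀ (hτ0 n)]
    have h2 : ‖y - -(τ n : ℂ) * e₀‖ ≤ τ n * c / 2 := hy
    have := mul_pos (hτ0 n) hc
    linarith
  have hnorm : ∀ n, ∀ y ∈ tsupport (k n), ‖y‖ ≤ τ n * (‖e₀‖ + c) := fun n y hy => by
    obtain ⟨z, hz, rfl⟩ := hts n y hy
    rw [norm_neg, norm_mul, Complex.norm_real, Real.norm_of_nonneg (hτ0 n).le]
    have h0 := (hτ0 n).le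
    gcongr
    rw [mem_ball_iff_norm] at hz
    have := norm_le_norm_add_norm_sub' z e₀
    linarith
  have hv : MemLp (fun x => ζ x • u x) 2 (volume.restrict U) :=
    memLp_smul_test hu hζ.continuous hζc
  have hvi : MemLp (U.indicator fun x => ζ x • u x) 2 volume :=
    (memLp_indicator_iff_restrict hU.measurableSet).2 hv
  have hlim : ∀ w : ℂ → ℂ, MemLp w 2 (volume.restrict U) →
      Tendsto (fun n => eLpNorm (fun x => (k n ⋆[lsmul ℝ ℝ, volume] U.indicator w) x - w x) 2
        (volume.restrict U)) atTop (𝓝 0) := fun w hw => by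
    have hwi := (memLp_indicator_iff_restrict hU.measurableSet).2 hw
    have := tendsto_convolution_L2 hwi hkker (r := fun n => τ n * (‖e₀‖ + c))
      (by simpa using hτlim.mul_const (‖e₀‖ + c))
      (fun n y hy => hnorm n y (subset_tsupport _ hy))
    refine tendsto_of_tendsto_of_tendsto_of_le_of_le tendsto_const_nhds this (fun _ => zero_le)
      fun n => ?_
    refine le_trans (le_of_eq (eLpNorm_congr_ae ?_)) (eLpNorm_mono_measure _ Measure.restrict_le_self)
    filter_upwards [ae_restrict_mem hU.measurableSet] with x hx
    simp [hx]
  refine ⟨fun n => k n ⋆[lsmul ℝ ℝ, volume] U.indicator fun x => ζ x • u x, fun n => ?_,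
    hlim _ hv, fun e he => ?_⟩
  · exact (hkker n).hasCompactSupport.contDiff_convolution_left (n := ⊤) _ (hksm n)
      (hvi.locallyIntegrable (by norm_num))
  · have hwd := (hg e he).smul hu hζ hζc
    refine (hlim _ hwd.1).congr fun n => eLpNorm_congr_ae ?_
    filter_upwards [ae_restrict_mem hU.measurableSet] with x hx
    congr 1
    by_cases hxb : x ∈ Metric.ball p r
    · refine (fderiv_convolution_of_isWeakDeriv hU hv hwd (hksm n) (hkker n).hasCompactSupport
        fun y hy => ?_).symm
      obtain ⟨z, hz, rfl⟩ := hts n y hy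
      rw [sub_neg_eq_add]
      exact hcone x hx hxb (τ n) (hτ0 n) ((hτT n).trans_lt hTr) z hz
    · -- far from the support of `ζ` everything vanishes
      have hfar : ∀ x' ∉ Metric.ball p r, ∀ y, k n y ≠ 0 → x' - y ∉ tsupport ζ := by
        intro x' hx' y hy hmem
        refine hx' (hthick ?_)
        rw [Metric.mem_thickening_iff]
        refine ⟨x' - y, hmem, ?_⟩
        rw [dist_eq_norm, sub_sub_cancel]
        refine (hnorm n y (subset_tsupport _ hy)).trans_lt (lt_of_le_of_lt ?_ hTd)
        gcongr
        exact hτT n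
      have hder0 : ∀ y ∉ tsupport ζ, fderiv ℝ ζ y e = 0 := fun y hy => by
        have : fderiv ℝ ζ y = 0 := image_eq_zero_of_notMem_tsupport fun hy' =>
          hy (tsupport_fderiv_subset ℝ hy')
        rw [this]; rfl
      have hz : (k n ⋆[lsmul ℝ ℝ, volume] U.indicator fun x => fderiv ℝ ζ x e • u x + ζ x • g e x) x
          = 0 := convolution_eq_zero_of_forall fun y hy => by
        have h1 := hfar x hxb y hy
        by_cases hyU : x - y ∈ U
        · simp [hyU, hder0 _ h1, image_eq_zero_of_notMem_tsupport h1]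
        · simp [hyU]
      rw [hz]
      -- the convolution vanishes near `x`: use the thickened set
      have hev : (k n ⋆[lsmul ℝ ℝ, volume] U.indicator fun x => ζ x • u x) =ᶠ[𝓝 x] 0 := by
        have hd' : 0 < d - T * (‖e₀‖ + c) := by linarith
        filter_upwards [Metric.ball_mem_nhds x hd'] with x' hx'
        refine convolution_eq_zero_of_forall fun y hy => ?_
        have h1 : x' - y ∉ tsupport ζ := fun hmem => hxb (hthick (by
          rw [Metric.mem_thickening_iff]
          refine ⟨x' - y, hmem, ?_⟩
          have h2 := hnorm n y (subset_tsupport _ hy)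
          have h3 : τ n * (‖e₀‖ + c) ≤ T * (‖e₀‖ + c) := by gcongr; exact hτT n
          rw [Metric.mem_ball, dist_comm, dist_eq_norm] at hx'
          rw [dist_eq_norm, show x - (x' - y) = (x - x') + y by ring]
          exact (norm_add_le _ _).trans_lt (by linarith)))
        by_cases hyU : x' - y ∈ U
        · simp [hyU, image_eq_zero_of_notMem_tsupport h1]
        · simp [hyU]
      rw [hev.fderiv_eq]
      simp
end LocalApprox

/-- `φ n` are smooth functions on the plane which converge to `u` in `H¹(U)`. -/
def H1Tendsto (U : Set ℂ) (φ : ℕ → ℂ → ℂ) (u : ℂ → ℂ) : Prop :=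
  (∀ n, ContDiff ℝ ∞ (φ n)) ∧
    Tendsto (fun n => eLpNorm (fun x => φ n x - u x) 2 (volume.restrict U)) atTop (𝓝 0) ∧
    ∀ e ∈ ({1, Complex.I} : Set ℂ),
      Tendsto (fun n => eLpNorm (fun x => fderiv ℝ (φ n) x e - weakDeriv U e u x) 2
        (volume.restrict U)) atTop (𝓝 0)

theorem MemH1.isWeakDeriv {U : Set ℂ} {u : ℂ → ℂ} (h : MemH1 U u) {e : ℂ}
    (he : e ∈ ({1, Complex.I} : Set ℂ)) : IsWeakDeriv U e u (weakDeriv U e u) := by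
  have hex : ∃ g, IsWeakDeriv U e u g := by
    rcases he with rfl | rfl
    · exact h.2.1
    · exact h.2.2
  rw [weakDeriv, dif_pos hex]
  exact hex.choose_spec

theorem MemH1.isWeakDeriv_one {U : Set ℂ} {u : ℂ → ℂ} (h : MemH1 U u) :
    IsWeakDeriv U 1 u (weakDeriv U 1 u) := h.isWeakDeriv (by simp)

theorem MemH1.isWeakDeriv_I {U : Set ℂ} {u : ℂ → ℂ} (h : MemH1 U u) :
    IsWeakDeriv U Complex.I u (weakDeriv U Complex.I u) := h.isWeakDeriv (by simp)

theorem tendsto_eLpNorm_finset_sum {ι : Type*} {μ : Measure ℂ} (t : Finset ι) {f : ι → ℕ → ℂ → ℂ}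
    (hf : ∀ i n, AEStronglyMeasurable (f i n) μ)
    (h : ∀ i, Tendsto (fun n => eLpNorm (f i n) 2 μ) atTop (𝓝 0)) :
    Tendsto (fun n => eLpNorm (∑ i ∈ t, f i n) 2 μ) atTop (𝓝 0) := by
  refine tendsto_of_tendsto_of_tendsto_of_le_of_le tendsto_const_nhds ?_ (fun _ => zero_le)
    fun n => eLpNorm_sum_le (fun i _ => hf i n) (by norm_num)
  simpa using tendsto_finsetSum t fun i _ => h i

/-- Smooth functions are dense in `H¹(U)` if `U` is bounded and has the cone property. -/
theorem MemH1.exists_h1Tendsto {U : Set ℂ} (hU : IsOpen U) (hb : Bornology.IsBounded U)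
    (hcone : ∀ p ∈ closure U, ∃ e r c, 0 < r ∧ 0 < c ∧ HasCone U p e r c) {u : ℂ → ℂ}
    (hu : MemH1 U u) : ∃ φ, H1Tendsto U φ u := by
  choose! e r c hr hc hco using hcone
  obtain ⟨t, ht, hcov⟩ := hb.isCompact_closure.elim_nhds_subcover (fun p => Metric.ball p (r p))
    fun p hp => Metric.ball_mem_nhds p (hr p hp)
  obtain ⟨f, hf⟩ := SmoothPartitionOfUnity.exists_isSubordinate (modelWithCornersSelf ℝ ℂ)
    isClosed_closure (fun p : t => Metric.ball (p : ℂ) (r p)) (fun p => Metric.isOpen_ball)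
    (s := closure U) (by simpa [iUnion_subtype] using hcov)
  have hsm : ∀ i, ContDiff ℝ ∞ (f i) := fun i => (f i).contMDiff.contDiff
  have hcs : ∀ i, HasCompactSupport (f i) := fun i =>
    Metric.isCompact_of_isClosed_isBounded (isClosed_tsupport _)
      (Metric.isBounded_ball.subset (hf i))
  have hsum : ∀ x ∈ closure U, ∑ i, f i x = 1 := fun x hx => by
    rw [← finsum_eq_sum_of_fintype]; exact f.sum_eq_one hx
  -- The functions of the partition sum to one near `x`, so the Leibniz terms of the localised
  -- pieces cancel after summation.
  have hdsum : ∀ x ∈ U, ∀ v : ℂ, ∑ i, fderiv ℝ (f i) x v = 0 := fun x hx v => by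
    have hev : (fun y => ∑ i, f i y) =ᶠ[𝓝 x] fun _ => 1 := by
      filter_upwards [hU.mem_nhds hx] with y hy
      exact hsum y (subset_closure hy)
    have h1 := hev.fderiv_eq (𝕜 := ℝ)
    rw [fderiv_fun_sum fun i _ => (hsm i).differentiable (by simp) x] at h1
    have := congrArg (fun L => L v) h1
    simpa using this
  choose φ hφs hφ0 hφ1 using fun i : t => exists_local_approx hU (hr i (ht i i.2)) (hc i (ht i i.2))
    (hco i (ht i i.2)) (g := fun e => weakDeriv U e u) (s := {1, Complex.I}) hu.1
    (fun e he => hu.isWeakDeriv he) (hsm i) (hf i)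
  refine ⟨fun n x => ∑ i, φ i n x, fun n => ContDiff.sum fun i _ => hφs i n, ?_, fun v hv => ?_⟩
  · refine (tendsto_eLpNorm_finset_sum Finset.univ (fun i n => ?_) hφ0).congr fun n =>
      eLpNorm_congr_ae ?_
    · exact (hφs i n).continuous.aestronglyMeasurable.sub
        (memLp_smul_test hu.1 (hsm i).continuous (hcs i)).1
    · filter_upwards [ae_restrict_mem hU.measurableSet] with x hx
      rw [Finset.sum_apply, Finset.sum_sub_distrib, ← Finset.sum_smul,
        hsum x (subset_closure hx), one_smul]
  · refine (tendsto_eLpNorm_finset_sum Finset.univ (fun i n => ?_) fun i => hφ1 i v hv).congr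
      fun n => eLpNorm_congr_ae ?_
    · exact (continuous_fderiv_apply_of_contDiff (hφs i n) (by simp) v).aestronglyMeasurable.sub
        ((hu.isWeakDeriv hv).smul hu.1 (hsm i) (hcs i)).1.1
    · filter_upwards [ae_restrict_mem hU.measurableSet] with x hx
      rw [Finset.sum_apply, Finset.sum_sub_distrib, Finset.sum_add_distrib, ← Finset.sum_smul,
        ← Finset.sum_smul, hsum x (subset_closure hx), one_smul, hdsum x hx, zero_smul, zero_add,
        fderiv_fun_sum fun i _ => (hφs i n).differentiable (by simp) x]
      simp

/-! ### The cone property of perforated domains -/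

/-- Points of `U` near `p` satisfy `σ ≥ 0`, and a small move in a direction close to `e` makes `σ`
strictly positive, which forces membership. The radius is reduced so that the moved point stays
where `σ` describes `U`. -/
theorem exists_hasCone_of_defining {U : Set ℂ} {σ : ℂ → ℝ} {σ' : ℂ →L[ℝ] ℝ} {p e : ℂ}
    (h : HasStrictFDerivAt σ σ' p) (he : 0 < σ' e)
    (hσ : ∀ᶠ x in 𝓝 p, (x ∈ U → 0 ≤ σ x) ∧ (0 < σ x → x ∈ U)) :
    ∃ r c, 0 < r ∧ 0 < c ∧ HasCone U p e r c := by
  obtain ⟨r₁, hr₁, c, hc, hlt⟩ := HasStrictFDerivAt.eventually_lt_add h he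
  obtain ⟨r₂, hr₂, hball⟩ := Metric.eventually_nhds_iff_ball.1 hσ
  refine ⟨min r₁ (r₂ / (1 + ‖e‖ + c)), c, by positivity, hc, fun x hx hxb τ hτ hτr z hz => ?_⟩
  have hb1 := lt_min_iff.1 (Metric.mem_ball.1 hxb)
  have ht1 := lt_min_iff.1 hτr
  have hz' : ‖z‖ ≤ ‖e‖ + c := by
    rw [mem_ball_iff_norm] at hz
    have := norm_le_norm_add_norm_sub' z e
    linarith
  have hden : 0 < 1 + ‖e‖ + c := by positivity
  have hr2 : r₂ / (1 + ‖e‖ + c) * (1 + ‖e‖ + c) = r₂ := by field_simp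
  have hx2 : x ∈ Metric.ball p r₂ := by
    refine Metric.mem_ball.2 (hb1.2.trans_le ?_)
    exact div_le_self hr₂.le (by linarith [norm_nonneg e])
  have hy2 : x + τ * z ∈ Metric.ball p r₂ := by
    rw [mem_ball_iff_norm]
    have h1 := hb1.2
    rw [dist_eq_norm] at h1
    calc ‖x + τ * z - p‖ ≤ ‖x - p‖ + ‖(τ : ℂ) * z‖ := by
          rw [show x + τ * z - p = (x - p) + τ * z by ring]; exact norm_add_le _ _
      _ = ‖x - p‖ + τ * ‖z‖ := by simp [abs_of_pos hτ]
      _ ≤ ‖x - p‖ + τ * (‖e‖ + c) := by gcongr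
      _ < r₂ / (1 + ‖e‖ + c) + r₂ / (1 + ‖e‖ + c) * (‖e‖ + c) := by
          have := mul_le_mul_of_nonneg_right ht1.2.le (by positivity : 0 ≤ ‖e‖ + c)
          linarith
      _ = r₂ := by rw [← hr2]; field_simp; ring
  exact (hball _ hy2).2 (((hball _ hx2).1 hx).trans_lt (hlt x hb1.1 τ hτ ht1.1 z hz))

namespace PerforatedDomain

variable {N : ℕ} (P : PerforatedDomain N)

/-- At an interior point every small move is allowed, so `e = 0` serves. At the outer curve the
direction is the inner normal of `Ω`; at a hole it is the outer normal, with `-σ` as defining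
function. The other boundary curves stay at a distance. -/
theorem exists_hasCone : ∀ p ∈ closure P.dom, ∃ e r c, 0 < r ∧ 0 < c ∧ HasCone P.dom p e r c := by
  intro p hp
  by_cases hpD : p ∈ P.dom
  · obtain ⟨r, hr, hb⟩ := Metric.isOpen_iff.1 P.isOpen_dom p hpD
    refine ⟨0, r / 2, 1, by positivity, one_pos, fun x _ hx τ hτ hτr z hz => hb ?_⟩
    rw [mem_ball_iff_norm] at hx ⊢
    rw [mem_ball_zero_iff] at hz
    calc ‖x + τ * z - p‖ ≤ ‖x - p‖ + ‖(τ : ℂ) * z‖ := by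
          rw [show x + τ * z - p = (x - p) + τ * z by ring]; exact norm_add_le _ _
      _ = ‖x - p‖ + τ * ‖z‖ := by simp [abs_of_pos hτ]
      _ ≤ ‖x - p‖ + τ * 1 := by gcongr
      _ < r := by linarith
  · have hpf : p ∈ frontier P.dom := by rw [P.isOpen_dom.frontier_eq]; exact ⟨hp, hpD⟩
    rcases P.frontier_dom_subset hpf with h1 | h1
    · have hγ := P.smooth_Ω.isBoundaryParam
      obtain ⟨δ, hδ⟩ := hγ.exists_isTubeWidth
      obtain ⟨t, rfl⟩ : p ∈ range P.outer := hγ.range_eq ▸ h1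
      obtain ⟨σ, σ', hσ, hσ1, hev⟩ := hδ.exists_defining hγ t
      refine ⟨_, exists_hasCone_of_defining hσ (e := Complex.I * deriv P.outer t) (by rw [hσ1]; simp) ?_⟩
      have hout : ∀ᶠ x in 𝓝 (P.outer t), x ∉ ⋃ i, closure (P.hole i) := by
        refine P.isClosed_iUnion_closure_hole.isOpen_compl.mem_nhds fun hmem => ?_
        obtain ⟨i, hi⟩ := mem_iUnion.1 hmem
        rw [P.smooth_Ω.isOpen.frontier_eq] at h1
        exact h1.2 (P.closure_subset i hi)
      filter_upwards [hev, hout] with x hx hxo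
      exact ⟨fun hxD => hx.1 hxD.1, fun hpos => ⟨hx.2.1 hpos, hxo⟩⟩
    · obtain ⟨j, hj⟩ := mem_iUnion.1 h1
      have hγ := (P.smooth_hole j).isBoundaryParam
      obtain ⟨δ, hδ⟩ := hγ.exists_isTubeWidth
      obtain ⟨t, rfl⟩ : p ∈ range (P.inner j) := hγ.range_eq ▸ hj
      obtain ⟨σ, σ', hσ, hσ1, hev⟩ := hδ.exists_defining hγ t
      refine ⟨_, exists_hasCone_of_defining hσ.neg (e := -(Complex.I * deriv (P.inner j) t))
        (by simp [hσ1]) ?_⟩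
      have hΩ : ∀ᶠ x in 𝓝 (P.inner j t), x ∈ P.Ω :=
        P.smooth_Ω.isOpen.mem_nhds (P.closure_subset j (frontier_subset_closure hj))
      have hoth : ∀ᶠ x in 𝓝 (P.inner j t), ∀ l, l ≠ j → x ∉ closure (P.hole l) := by
        rw [eventually_all]
        intro l
        by_cases hl : l = j
        · simp [hl]
        · filter_upwards [isClosed_closure.isOpen_compl.mem_nhds (show P.inner j t ∈
            (closure (P.hole l))ᶜ from fun hmem => Set.disjoint_left.1 (P.disjoint_closure l j hl)
              hmem (frontier_subset_closure hj))] with x hx _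
          exact hx
      filter_upwards [hev, hΩ, hoth] with x hx hxΩ hxo
      refine ⟨fun hxD => neg_nonneg.2 (hx.2.2.1 fun hxj => hxD.2 (mem_iUnion.2 ⟨j, hxj⟩)),
        fun hpos => ⟨hxΩ, fun hmem => ?_⟩⟩
      obtain ⟨l, hl⟩ := mem_iUnion.1 hmem
      by_cases hlj : l = j
      · subst hlj
        exact hx.2.2.2.1 (neg_pos.1 hpos) hl
      · exact hxo l hlj hl

theorem exists_h1Tendsto {u : ℂ → ℂ} (hu : MemH1 P.dom u) : ∃ φ, H1Tendsto P.dom φ u :=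
  hu.exists_h1Tendsto P.isOpen_dom P.isBounded_dom P.exists_hasCone

end PerforatedDomain

/-! ### Integration by parts in `H¹` -/

theorem memLp_of_continuous {E : Type*} [NormedAddCommGroup E] {U : Set ℂ}
    (hb : Bornology.IsBounded U) {f : ℂ → E} (hf : Continuous f)
    (p : ENNReal) : MemLp f p (volume.restrict U) := by
  have hfin : IsFiniteMeasure (volume.restrict U) :=
    ⟨by rw [Measure.restrict_apply_univ]; exact hb.measure_lt_top⟩
  obtain ⟨C, hC⟩ := (hb.isCompact_closure.image hf).isBounded.exists_norm_le
  have hm : AEStronglyMeasurable f (volume.restrict (closure U)) :=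
    hf.continuousOn.aestronglyMeasurable_of_isCompact hb.isCompact_closure
      isClosed_closure.measurableSet
  refine MemLp.of_bound (hm.mono_measure (Measure.restrict_mono subset_closure le_rfl)) C ?_
  have h1 : ∀ᵐ x ∂volume.restrict (closure U), ‖f x‖ ≤ C := by
    filter_upwards [ae_restrict_mem isClosed_closure.measurableSet] with x hx
    exact hC _ (mem_image_of_mem f hx)
  exact ae_mono (Measure.restrict_mono subset_closure le_rfl) h1

/-- `a` is a `C¹` function with compact support in `U`. -/
structure IsTest (U : Set ℂ) (a : ℂ → ℝ) : Prop where
  contDiff : ContDiff ℝ 1 a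
  hasCompactSupport : HasCompactSupport a
  tsupport_subset : tsupport a ⊆ U

namespace IsTest

variable {U : Set ℂ} {a : ℂ → ℝ}

theorem continuous_fderiv_apply (h : IsTest U a) (e : ℂ) : Continuous fun x => fderiv ℝ a x e :=
  (h.contDiff.continuous_fderiv (by simp)).clm_apply continuous_const

theorem hasCompactSupport_fderiv_apply (h : IsTest U a) (e : ℂ) :
    HasCompactSupport fun x => fderiv ℝ a x e := h.hasCompactSupport.fderiv_apply ℝ e

theorem exists_bound (h : IsTest U a) : ∃ C, ∀ x, |a x| ≤ C :=
  exists_bound_of_compactSupport h.contDiff.continuous h.hasCompactSupport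

theorem exists_bound_fderiv (h : IsTest U a) (e : ℂ) : ∃ C, ∀ x, |fderiv ℝ a x e| ≤ C :=
  exists_bound_of_compactSupport (h.continuous_fderiv_apply e) (h.hasCompactSupport_fderiv_apply e)

theorem eq_zero (h : IsTest U a) {x : ℂ} (hx : x ∉ U) : a x = 0 :=
  image_eq_zero_of_notMem_tsupport fun hx' => hx (h.tsupport_subset hx')

theorem fderiv_eq_zero (h : IsTest U a) {x : ℂ} (hx : x ∉ U) : fderiv ℝ a x = 0 :=
  image_eq_zero_of_notMem_tsupport fun hx' => hx (h.tsupport_subset (tsupport_fderiv_subset ℝ hx'))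

end IsTest

theorem hasFDerivAt_bilin (B : ℂ →L[ℝ] ℂ →L[ℝ] ℝ) {u v : ℂ → ℂ} {x : ℂ}
    (hu : DifferentiableAt ℝ u x) (hv : DifferentiableAt ℝ v x) (e : ℂ) :
    fderiv ℝ (fun x => B (u x) (v x)) x e = B (fderiv ℝ u x e) (v x) + B (u x) (fderiv ℝ v x e) := by
  rw [(B.hasFDerivAt_of_bilinear hu.hasFDerivAt hv.hasFDerivAt).fderiv]
  simp [add_comm]

/-- Integration by parts for a bilinear expression in smooth functions. -/
theorem integral_bilin_smooth (B : ℂ →L[ℝ] ℂ →L[ℝ] ℝ) {U : Set ℂ} {a : ℂ → ℝ} (ha : IsTest U a)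
    {u v : ℂ → ℂ} (hu : ContDiff ℝ ∞ u) (hv : ContDiff ℝ ∞ v) (e : ℂ) :
    ∫ x in U, fderiv ℝ a x e * B (u x) (v x) =
      -∫ x in U, a x * (B (fderiv ℝ u x e) (v x) + B (u x) (fderiv ℝ v x e)) := by
  have hu1 := hu.differentiable (by simp)
  have hv1 := hv.differentiable (by simp)
  have hud := continuous_fderiv_apply_of_contDiff hu (by simp) e
  have hvd := continuous_fderiv_apply_of_contDiff hv (by simp) e
  have hBc : Continuous fun x => B (u x) (v x) :=
    (B.continuous.comp hu.continuous).clm_apply hv.continuous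
  have hBd : Continuous fun x => fderiv ℝ (fun x => B (u x) (v x)) x e := by
    simp_rw [fun x => hasFDerivAt_bilin B (hu1 x) (hv1 x) e]
    exact ((B.continuous.comp hud).clm_apply hv.continuous).add
      ((B.continuous.comp hu.continuous).clm_apply hvd)
  have hac := ha.contDiff.continuous
  have key := integral_mul_fderiv_eq_neg_fderiv_mul_of_integrable (μ := volume) (f := a)
    (g := fun x => B (u x) (v x)) (v := e)
    (((ha.continuous_fderiv_apply e).mul hBc).integrable_of_hasCompactSupport
      (ha.hasCompactSupport_fderiv_apply e).mul_right)
    ((hac.mul hBd).integrable_of_hasCompactSupport ha.hasCompactSupport.mul_right)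
    ((hac.mul hBc).integrable_of_hasCompactSupport ha.hasCompactSupport.mul_right)
    (fun x _ => ha.contDiff.differentiable (by simp) x)
    (fun x _ => by
      exact (B.hasFDerivAt_of_bilinear (hu1 x).hasFDerivAt (hv1 x).hasFDerivAt).differentiableAt)
  simp_rw [fun x => hasFDerivAt_bilin B (hu1 x) (hv1 x) e] at key
  rw [setIntegral_eq_integral_of_forall_compl_eq_zero fun x hx => by simp [ha.fderiv_eq_zero hx],
    setIntegral_eq_integral_of_forall_compl_eq_zero fun x hx => by simp [ha.eq_zero hx], key, neg_neg]

namespace H1Tendsto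

variable {U : Set ℂ} {u : ℂ → ℂ} {φ : ℕ → ℂ → ℂ}

theorem memLp (h : H1Tendsto U φ u) (hb : Bornology.IsBounded U) (n : ℕ) :
    MemLp (φ n) 2 (volume.restrict U) := memLp_of_continuous hb (h.1 n).continuous 2

theorem memLp_fderiv (h : H1Tendsto U φ u) (hb : Bornology.IsBounded U) (n : ℕ) (e : ℂ) :
    MemLp (fun x => fderiv ℝ (φ n) x e) 2 (volume.restrict U) :=
  memLp_of_continuous hb (continuous_fderiv_apply_of_contDiff (h.1 n) (by simp) e) 2

end H1Tendsto

section TestLimits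

variable {U : Set ℂ} (B : ℂ →L[ℝ] ℂ →L[ℝ] ℝ)

theorem integrable_bdd_bilin {a : ℂ → ℝ} {C : ℝ} {μ : Measure ℂ} (ha : AEStronglyMeasurable a μ)
    (hC : ∀ᵐ x ∂μ, |a x| ≤ C) {u v : ℂ → ℂ} (hu : MemLp u 2 μ) (hv : MemLp v 2 μ) :
    Integrable (fun x => a x * B (u x) (v x)) μ := by
  have := integrable_bilin B hu (memLp_bdd_smul hv ha hC)
  simpa only [map_smul, smul_eq_mul] using this

theorem tendsto_integral_bdd_bilin {a : ℂ → ℝ} {C : ℝ} {μ : Measure ℂ}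
    (ha : AEStronglyMeasurable a μ) (hC : ∀ᵐ x ∂μ, |a x| ≤ C) {u v : ℂ → ℂ} {un vn : ℕ → ℂ → ℂ}
    (hu : MemLp u 2 μ) (hv : MemLp v 2 μ) (hun : ∀ n, MemLp (un n) 2 μ)
    (hvn : ∀ n, MemLp (vn n) 2 μ)
    (htu : Tendsto (fun n => eLpNorm (fun x => un n x - u x) 2 μ) atTop (𝓝 0))
    (htv : Tendsto (fun n => eLpNorm (fun x => vn n x - v x) 2 μ) atTop (𝓝 0)) :
    Tendsto (fun n => ∫ x, a x * B (un n x) (vn n x) ∂μ) atTop (𝓝 (∫ x, a x * B (u x) (v x) ∂μ)) := by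
  have := tendsto_integral_bilin B hu (memLp_bdd_smul hv ha hC) hun
    (fun n => memLp_bdd_smul (hvn n) ha hC) htu (tendsto_bdd_smul hC htv)
  simpa only [map_smul, smul_eq_mul] using this

/-- Integration by parts for a bilinear expression in functions of `H¹`. -/
theorem integral_bilin_h1 (hb : Bornology.IsBounded U) {a : ℂ → ℝ} (ha : IsTest U a) {u v : ℂ → ℂ}
    (hu : MemH1 U u) (hv : MemH1 U v) {φ ψ : ℕ → ℂ → ℂ} (hφ : H1Tendsto U φ u)
    (hψ : H1Tendsto U ψ v) {e : ℂ} (he : e ∈ ({1, Complex.I} : Set ℂ)) :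
    ∫ x in U, fderiv ℝ a x e * B (u x) (v x) =
      -∫ x in U, a x * (B (weakDeriv U e u x) (v x) + B (u x) (weakDeriv U e v x)) := by
  obtain ⟨C, hC⟩ := ha.exists_bound
  obtain ⟨C', hC'⟩ := ha.exists_bound_fderiv e
  have am : AEStronglyMeasurable a (volume.restrict U) :=
    ha.contDiff.continuous.aestronglyMeasurable
  have dm : AEStronglyMeasurable (fun x => fderiv ℝ a x e) (volume.restrict U) :=
    (ha.continuous_fderiv_apply e).aestronglyMeasurable
  have hdu := (hu.isWeakDeriv he).1
  have hdv := (hv.isWeakDeriv he).1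
  have t1 := tendsto_integral_bdd_bilin B dm (Eventually.of_forall hC') hu.1 hv.1 (hφ.memLp hb)
    (hψ.memLp hb) hφ.2.1 hψ.2.1
  have t2 := tendsto_integral_bdd_bilin B am (Eventually.of_forall hC) hdu hv.1
    (fun n => hφ.memLp_fderiv hb n e) (hψ.memLp hb) (hφ.2.2 e he) hψ.2.1
  have t3 := tendsto_integral_bdd_bilin B am (Eventually.of_forall hC) hu.1 hdv (hφ.memLp hb)
    (fun n => hψ.memLp_fderiv hb n e) hφ.2.1 (hψ.2.2 e he)
  refine tendsto_nhds_unique t1 ?_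
  simp_rw [mul_add]
  rw [integral_add (integrable_bdd_bilin B am (Eventually.of_forall hC) hdu hv.1)
    (integrable_bdd_bilin B am (Eventually.of_forall hC) hu.1 hdv)]
  refine (t2.add t3).neg.congr fun n => ?_
  rw [integral_bilin_smooth B ha (hφ.1 n) (hψ.1 n) e]
  simp_rw [mul_add]
  rw [integral_add (integrable_bdd_bilin B am (Eventually.of_forall hC) (hφ.memLp_fderiv hb n e)
    (hψ.memLp hb n)) (integrable_bdd_bilin B am (Eventually.of_forall hC) (hφ.memLp hb n)
    (hψ.memLp_fderiv hb n e))]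

end TestLimits

/-- A function which is `C¹` in a bounded open set and vanishes near the boundary. -/
theorem isTest_indicator {D : Set ℂ} (hD : IsOpen D) (hb : Bornology.IsBounded D) {f : ℂ → ℝ}
    (hf : ContDiffOn ℝ 1 f D) (h0 : ∀ p ∈ frontier D, ∀ᶠ x in 𝓝 p, x ∈ D → f x = 0) :
    IsTest D (D.indicator f) := by
  have hloc : ∀ x ∉ D, D.indicator f =ᶠ[𝓝 x] 0 := by
    intro x hx
    by_cases hxc : x ∈ closure D
    · filter_upwards [h0 x (by rw [hD.frontier_eq]; exact ⟨hxc, hx⟩)] with y hy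
      by_cases hyD : y ∈ D
      · simp [hyD, hy hyD]
      · simp [hyD]
    · filter_upwards [isClosed_closure.isOpen_compl.mem_nhds hxc] with y hy
      simp [show y ∉ D from fun h => hy (subset_closure h)]
  have hts : tsupport (D.indicator f) ⊆ D := by
    intro x hx
    by_contra hxD
    exact (notMem_tsupport_iff_eventuallyEq.2 (hloc x hxD)) hx
  refine ⟨contDiff_iff_contDiffAt.2 fun x => ?_, ?_, hts⟩
  · by_cases hx : x ∈ D
    · refine (hf.contDiffAt (hD.mem_nhds hx)).congr_of_eventuallyEq ?_
      filter_upwards [hD.mem_nhds hx] with y hy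
      simp [hy]
    · exact contDiffAt_const.congr_of_eventuallyEq (hloc x hx)
  · exact Metric.isCompact_of_isClosed_isBounded (isClosed_tsupport _) (hb.subset hts)

/-! ### The form `∫ u × (∂₁ψ ∂₂v - ∂₂ψ ∂₁v)` -/

/-- Symmetry of the second derivative of a `C²` function. -/
theorem fderiv_fderiv_comm {F : Type*} [NormedAddCommGroup F] [NormedSpace ℝ F] {f : ℂ → F} {x : ℂ}
    (hf : ContDiffAt ℝ 2 f x) (v w : ℂ) :
    fderiv ℝ (fun y => fderiv ℝ f y v) x w = fderiv ℝ (fun y => fderiv ℝ f y w) x v := by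
  have hd : DifferentiableAt ℝ (fderiv ℝ f) x :=
    (hf.fderiv_right (m := 1) (by norm_num)).differentiableAt (by simp)
  have h1 : ∀ v w, fderiv ℝ (fun y => fderiv ℝ f y v) x w = fderiv ℝ (fderiv ℝ f) x w v := by
    intro v w
    rw [fderiv_clm_apply hd (differentiableAt_const v)]
    simp
  rw [h1, h1]
  exact (hf.isSymmSndFDerivAt (by simp)).eq w v

section Forms

variable {U : Set ℂ}

/-- For a closed pair of test functions, the form is symmetric. -/
theorem integral_cross_symm (hb : Bornology.IsBounded U) {a b : ℂ → ℝ} (ha : IsTest U a)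
    (hbt : IsTest U b) (hab : ∀ x, fderiv ℝ a x Complex.I = fderiv ℝ b x 1) {u v : ℂ → ℂ}
    (hu : MemH1 U u) (hv : MemH1 U v) {φ ψ : ℕ → ℂ → ℂ} (hφ : H1Tendsto U φ u)
    (hψ : H1Tendsto U ψ v) :
    ∫ x in U, (a x * cross (u x) (weakDeriv U Complex.I v x) - b x * cross (u x) (weakDeriv U 1 v x)) =
      ∫ x in U, (a x * cross (v x) (weakDeriv U Complex.I u x) -
        b x * cross (v x) (weakDeriv U 1 u x)) := by
  have h1 := integral_bilin_h1 crossL hb ha hu hv hφ hψ (e := Complex.I) (by simp)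
  have h2 := integral_bilin_h1 crossL hb hbt hu hv hφ hψ (e := 1) (by simp)
  obtain ⟨C, hC⟩ := ha.exists_bound
  obtain ⟨C', hC'⟩ := hbt.exists_bound
  have am : AEStronglyMeasurable a (volume.restrict U) := ha.contDiff.continuous.aestronglyMeasurable
  have bm : AEStronglyMeasurable b (volume.restrict U) :=
    hbt.contDiff.continuous.aestronglyMeasurable
  have hu1 := hu.isWeakDeriv_one.1
  have huI := hu.isWeakDeriv_I.1
  have hv1 := hv.isWeakDeriv_one.1
  have hvI := hv.isWeakDeriv_I.1
  have ia : ∀ {f g : ℂ → ℂ}, MemLp f 2 (volume.restrict U) → MemLp g 2 (volume.restrict U) →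
      Integrable (fun x => a x * cross (f x) (g x)) (volume.restrict U) := fun hf hg =>
    integrable_bdd_bilin crossL am (Eventually.of_forall hC) hf hg
  have ib : ∀ {f g : ℂ → ℂ}, MemLp f 2 (volume.restrict U) → MemLp g 2 (volume.restrict U) →
      Integrable (fun x => b x * cross (f x) (g x)) (volume.restrict U) := fun hf hg =>
    integrable_bdd_bilin crossL bm (Eventually.of_forall hC') hf hg
  simp only [crossL_apply, mul_add] at h1 h2
  rw [integral_add (ia huI hv.1) (ia hu.1 hvI)] at h1
  rw [integral_add (ib hu1 hv.1) (ib hu.1 hv1)] at h2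
  -- This is where closedness enters: the zero order terms of the two integrations by parts coincide
  -- and cancel. Antisymmetry of the cross product then exchanges `u` and `v`.
  have h3 : ∫ x in U, fderiv ℝ a x Complex.I * cross (u x) (v x) =
      ∫ x in U, fderiv ℝ b x 1 * cross (u x) (v x) := by simp_rw [hab]
  rw [integral_sub (ia hu.1 hvI) (ib hu.1 hv1), integral_sub (ia hv.1 huI) (ib hv.1 hu1)]
  have e1 : ∫ x in U, a x * cross (v x) (weakDeriv U Complex.I u x) =
      -∫ x in U, a x * cross (weakDeriv U Complex.I u x) (v x) := by
    rw [← integral_neg]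
    exact integral_congr_ae (Eventually.of_forall fun x => by
      simp only [cross_swap (weakDeriv U Complex.I u x) (v x)]; ring)
  have e2 : ∫ x in U, b x * cross (v x) (weakDeriv U 1 u x) =
      -∫ x in U, b x * cross (weakDeriv U 1 u x) (v x) := by
    rw [← integral_neg]
    exact integral_congr_ae (Eventually.of_forall fun x => by
      simp only [cross_swap (weakDeriv U 1 u x) (v x)]; ring)
  rw [e1, e2]
  linarith

/-- When the derivative is moved off `ψ`, the terms with mixed second derivatives of `u` cancel. The
two Jacobian terms have equal sign by antisymmetry, which gives the factor `-2`. -/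
theorem integral_cross_eq_jacobian_smooth {ψ : ℂ → ℝ} (hψ : IsTest U ψ) {u : ℂ → ℂ}
    (hu : ContDiff ℝ ∞ u) :
    (∫ x in U, fderiv ℝ ψ x 1 * cross (u x) (fderiv ℝ u x Complex.I)) -
        ∫ x in U, fderiv ℝ ψ x Complex.I * cross (u x) (fderiv ℝ u x 1) =
      -2 * ∫ x in U, ψ x * cross (fderiv ℝ u x 1) (fderiv ℝ u x Complex.I) := by
  have hd : ∀ e, ContDiff ℝ ∞ fun x => fderiv ℝ u x e := fun e =>
    (hu.fderiv_right (m := ∞) (by simp)).clm_apply contDiff_const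
  have h1 := integral_bilin_smooth crossL hψ hu (hd Complex.I) 1
  have h2 := integral_bilin_smooth crossL hψ hu (hd 1) Complex.I
  have ii : ∀ f g : ℂ → ℂ, Continuous f → Continuous g →
      Integrable (fun x => ψ x * cross (f x) (g x)) (volume.restrict U) := fun f g hf hg => by
    have hc : Continuous fun x => cross (f x) (g x) := by unfold cross; fun_prop
    exact ((hψ.contDiff.continuous.mul hc).integrable_of_hasCompactSupport
      hψ.hasCompactSupport.mul_right).restrict
  have hdd : ∀ e e', Continuous fun x => fderiv ℝ (fun x => fderiv ℝ u x e) x e' := fun e e' =>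
    continuous_fderiv_apply_of_contDiff (hd e) (by simp) e'
  simp only [crossL_apply, mul_add] at h1 h2
  rw [integral_add (ii _ _ (hd 1).continuous (hd Complex.I).continuous)
    (ii _ _ hu.continuous (hdd _ _))] at h1
  rw [integral_add (ii _ _ (hd Complex.I).continuous (hd 1).continuous)
    (ii _ _ hu.continuous (hdd _ _))] at h2
  have h3 : ∀ x, fderiv ℝ (fun x => fderiv ℝ u x Complex.I) x 1 =
      fderiv ℝ (fun x => fderiv ℝ u x 1) x Complex.I := fun x =>
    fderiv_fderiv_comm (hu.contDiffAt.of_le (WithTop.coe_le_coe.2 le_top)) _ _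
  simp_rw [h3] at h1
  have e2 : ∫ x in U, ψ x * cross (fderiv ℝ u x Complex.I) (fderiv ℝ u x 1) =
      -∫ x in U, ψ x * cross (fderiv ℝ u x 1) (fderiv ℝ u x Complex.I) := by
    rw [← integral_neg]
    exact integral_congr_ae (Eventually.of_forall fun x => by
      simp only [cross_swap (fderiv ℝ u x 1) (fderiv ℝ u x Complex.I)]; ring)
  rw [e2] at h2
  rw [h1, h2]
  ring

/-- Only first derivatives of `u` survive in the smooth identity, and both sides are bilinear in
`L²` functions with bounded coefficients. The identity therefore passes to `H¹` limits. -/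
theorem integral_cross_eq_jacobian (hb : Bornology.IsBounded U) {ψ : ℂ → ℝ} (hψ : IsTest U ψ)
    {u : ℂ → ℂ} (hu : MemH1 U u) {φ : ℕ → ℂ → ℂ} (hφ : H1Tendsto U φ u) :
    (∫ x in U, fderiv ℝ ψ x 1 * cross (u x) (weakDeriv U Complex.I u x)) -
        ∫ x in U, fderiv ℝ ψ x Complex.I * cross (u x) (weakDeriv U 1 u x) =
      -2 * ∫ x in U, ψ x * cross (weakDeriv U 1 u x) (weakDeriv U Complex.I u x) := by
  obtain ⟨C, hC⟩ := hψ.exists_bound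
  obtain ⟨C1, hC1⟩ := hψ.exists_bound_fderiv 1
  obtain ⟨C2, hC2⟩ := hψ.exists_bound_fderiv Complex.I
  have m : AEStronglyMeasurable ψ (volume.restrict U) := hψ.contDiff.continuous.aestronglyMeasurable
  have m1 : ∀ e, AEStronglyMeasurable (fun x => fderiv ℝ ψ x e) (volume.restrict U) := fun e =>
    (hψ.continuous_fderiv_apply e).aestronglyMeasurable
  have hu1 := hu.isWeakDeriv_one.1
  have huI := hu.isWeakDeriv_I.1
  have t1 := tendsto_integral_bdd_bilin crossL (m1 1) (Eventually.of_forall hC1) hu.1 huI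
    (hφ.memLp hb) (fun n => hφ.memLp_fderiv hb n Complex.I) hφ.2.1 (hφ.2.2 _ (by simp))
  have t2 := tendsto_integral_bdd_bilin crossL (m1 Complex.I) (Eventually.of_forall hC2) hu.1 hu1
    (hφ.memLp hb) (fun n => hφ.memLp_fderiv hb n 1) hφ.2.1 (hφ.2.2 _ (by simp))
  have t3 := tendsto_integral_bdd_bilin crossL m (Eventually.of_forall hC) hu1 huI
    (fun n => hφ.memLp_fderiv hb n 1) (fun n => hφ.memLp_fderiv hb n Complex.I)
    (hφ.2.2 _ (by simp)) (hφ.2.2 _ (by simp))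
  simp only [crossL_apply] at t1 t2 t3
  exact tendsto_nhds_unique (t1.sub t2) ((t3.const_mul (-2)).congr fun n =>
    (integral_cross_eq_jacobian_smooth hψ (hφ.1 n)).symm)

/-- Maps with values in the unit circle have vanishing Jacobian determinant. -/
theorem MemH1Circle.jacobian_ae_eq_zero (hU : IsOpen U) (hb : Bornology.IsBounded U) {u : ℂ → ℂ}
    (hu : MemH1Circle U u) {φ : ℕ → ℂ → ℂ} (hφ : H1Tendsto U φ u) :
    ∀ᵐ x ∂volume.restrict U, cross (weakDeriv U 1 u x) (weakDeriv U Complex.I u x) = 0 := by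
  -- Weak form of `∂(|u|²) = 0`: as `|u|² = 1`, integration by parts against a test function gives
  -- the same result as for the constant function `1`, namely zero.
  have horth : ∀ e ∈ ({1, Complex.I} : Set ℂ), ∀ᵐ x ∂volume.restrict U,
      inner ℝ (u x) (weakDeriv U e u x) = 0 := by
    intro e he
    rw [ae_restrict_iff' hU.measurableSet]
    have hi : Integrable (fun x => inner ℝ (u x) (weakDeriv U e u x)) (volume.restrict U) :=
      integrable_bilin (innerSL ℝ) hu.1.1 (hu.1.isWeakDeriv he).1
    refine hU.ae_eq_zero_of_integral_contDiff_smul_eq_zero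
      (IntegrableOn.locallyIntegrableOn hi) fun a ha has haU => ?_
    have hat : IsTest U a := ⟨ha.of_le (by exact_mod_cast le_top), has, haU⟩
    have h1 := integral_bilin_h1 (innerSL ℝ) hb hat hu.1 hu.1 hφ hφ he
    have h2 := integral_bilin_smooth (innerSL ℝ) hat (u := fun _ => 1) (v := fun _ => 1)
      contDiff_const contDiff_const e
    have h3 : ∫ x in U, fderiv ℝ a x e * innerSL ℝ (u x) (u x) =
        ∫ x in U, fderiv ℝ a x e * innerSL ℝ (1 : ℂ) (1 : ℂ) := by
      refine integral_congr_ae (hu.2.mono fun x hx => ?_)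
      simp [hx]
    rw [h3, h2] at h1
    have h4 : ∫ x in U, a x * (innerSL ℝ (weakDeriv U e u x) (u x) +
        innerSL ℝ (u x) (weakDeriv U e u x)) =
        2 * ∫ x in U, a x * inner ℝ (u x) (weakDeriv U e u x) := by
      rw [← integral_const_mul]
      refine integral_congr_ae (Eventually.of_forall fun x => ?_)
      simp only [innerSL_apply_apply, real_inner_comm (u x) (weakDeriv U e u x)]
      ring
    rw [h4] at h1
    simp at h1
    rw [← setIntegral_eq_integral_of_forall_compl_eq_zero (s := U)
      fun x hx => by simp [hat.eq_zero hx]]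
    simpa using h1
  filter_upwards [hu.2, horth 1 (by simp), horth Complex.I (by simp)] with x h0 h1 h2
  set a := u x
  set b := weakDeriv U 1 u x
  set c := weakDeriv U Complex.I u x
  rw [Complex.inner] at h1 h2
  simp at h1 h2
  have h3 : a.re * a.re + a.im * a.im = 1 := by
    have := Complex.sq_norm a
    rw [h0, Complex.normSq_apply] at this
    linarith
  unfold cross
  -- Two plane vectors orthogonal to the same unit vector are parallel.
  linear_combination (b.im * c.re - b.re * c.im) * h3 + (a.re * c.im - a.im * c.re) * h1 +
    (a.im * b.re - a.re * b.im) * h2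

end Forms

/-! ### Cutting off near the boundary -/

/-- A smooth function vanishing near `(-∞, 0]` and `[1, ∞)`, which tends to `1` on `(0, 1)`. -/
def cutoff (n : ℕ) (y : ℝ) : ℝ :=
  Real.smoothTransition (n * y - 1) * Real.smoothTransition (n * (1 - y) - 1)

theorem contDiff_cutoff (n : ℕ) : ContDiff ℝ ∞ (cutoff n) := by
  unfold cutoff
  exact (Real.smoothTransition.contDiff.comp (by fun_prop)).mul
    (Real.smoothTransition.contDiff.comp (by fun_prop))

theorem cutoff_nonneg (n : ℕ) (y : ℝ) : 0 ≤ cutoff n y :=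
  mul_nonneg (Real.smoothTransition.nonneg _) (Real.smoothTransition.nonneg _)

theorem cutoff_le_one (n : ℕ) (y : ℝ) : cutoff n y ≤ 1 :=
  mul_le_one₀ (Real.smoothTransition.le_one _) (Real.smoothTransition.nonneg _)
    (Real.smoothTransition.le_one _)

theorem cutoff_eq_zero_left {n : ℕ} {y : ℝ} (h : n * y ≤ 1) : cutoff n y = 0 := by
  rw [cutoff, Real.smoothTransition.zero_of_nonpos (by linarith), zero_mul]

theorem cutoff_eq_zero_right {n : ℕ} {y : ℝ} (h : n * (1 - y) ≤ 1) : cutoff n y = 0 := by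
  rw [cutoff, Real.smoothTransition.zero_of_nonpos (x := n * (1 - y) - 1) (by linarith), mul_zero]

theorem tendsto_cutoff {y : ℝ} (h0 : 0 < y) (h1 : y < 1) :
    Tendsto (fun n => cutoff n y) atTop (𝓝 1) := by
  refine tendsto_const_nhds.congr' ?_
  have e1 : ∀ z : ℝ, 0 < z → ∀ᶠ n : ℕ in atTop, 2 ≤ n * z := fun z hz =>
    (tendsto_natCast_atTop_atTop.atTop_mul_const hz).eventually_ge_atTop 2
  filter_upwards [e1 y h0, e1 (1 - y) (by linarith)] with n hn hn'
  rw [cutoff, Real.smoothTransition.one_of_one_le (by linarith),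
    Real.smoothTransition.one_of_one_le (by linarith), mul_one]

/-- The primitive of the cutoff function. -/
def cutoffInt (n : ℕ) (y : ℝ) : ℝ := ∫ t in (0 : ℝ)..y, cutoff n t

theorem hasDerivAt_cutoffInt (n : ℕ) (y : ℝ) : HasDerivAt (cutoffInt n) (cutoff n y) y :=
  (contDiff_cutoff n).continuous.integral_hasStrictDerivAt 0 y |>.hasDerivAt

theorem contDiff_cutoffInt (n : ℕ) : ContDiff ℝ 1 (cutoffInt n) := by
  rw [contDiff_one_iff_deriv]
  have : deriv (cutoffInt n) = cutoff n := funext fun y => (hasDerivAt_cutoffInt n y).deriv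
  exact ⟨fun y => (hasDerivAt_cutoffInt n y).differentiableAt, this ▸ (contDiff_cutoff n).continuous⟩

theorem cutoffInt_eq_zero {n : ℕ} {y : ℝ} (h0 : 0 ≤ y) (h : n * y ≤ 1) : cutoffInt n y = 0 := by
  refine intervalIntegral.integral_zero_ae (Eventually.of_forall fun t ht => ?_)
  rw [uIoc_of_le h0] at ht
  refine cutoff_eq_zero_left (le_trans ?_ h)
  gcongr
  exact ht.2

theorem cutoffInt_eq_cutoffInt_one {n : ℕ} {y : ℝ} (h1 : y ≤ 1) (h : n * (1 - y) ≤ 1) :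
    cutoffInt n y = cutoffInt n 1 := by
  have hi : ∀ a b, IntervalIntegrable (cutoff n) volume a b := fun a b =>
    (contDiff_cutoff n).continuous.intervalIntegrable a b
  rw [cutoffInt, cutoffInt, ← intervalIntegral.integral_add_adjacent_intervals (hi 0 y) (hi y 1)]
  rw [left_eq_add]
  refine intervalIntegral.integral_zero_ae (Eventually.of_forall fun t ht => ?_)
  rw [uIoc_of_le h1] at ht
  refine cutoff_eq_zero_right (le_trans ?_ h)
  gcongr
  exact ht.1.le

/-- The total increment of the modified potential is `cutoffInt n 1` instead of `1`. This limit
restores the normalisation. -/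
theorem tendsto_cutoffInt_one : Tendsto (fun n => cutoffInt n 1) atTop (𝓝 1) := by
  suffices h : Tendsto (fun n => ∫ t in (0 : ℝ)..1, cutoff n t) atTop
      (𝓝 (∫ _ in (0 : ℝ)..1, (1 : ℝ))) by simpa [cutoffInt] using h
  refine intervalIntegral.tendsto_integral_filter_of_dominated_convergence (fun _ => 1)
    (Eventually.of_forall fun n => (contDiff_cutoff n).continuous.aestronglyMeasurable)
    (Eventually.of_forall fun n => Eventually.of_forall fun y _ => ?_)
    intervalIntegrable_const ?_
  · rw [Real.norm_of_nonneg (cutoff_nonneg n y)]; exact cutoff_le_one n y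
  · have : ∀ᵐ y : ℝ, y ≠ 1 := compl_mem_ae_iff.2 (measure_singleton 1)
    filter_upwards [this] with y hy hmem
    rw [uIoc_of_le zero_le_one] at hmem
    exact tendsto_cutoff hmem.1 (lt_of_le_of_ne hmem.2 hy)

/-! ### The bulk form: symmetry, replacement of the potential, Lipschitz estimate -/

namespace PerforatedDomain

variable {N : ℕ} (P : PerforatedDomain N)

/-- The bilinear form whose quadratic form is `2π` times the approximate bulk degree. -/
def bulkForm (V : ℂ → ℝ) (u v : ℂ → ℂ) : ℝ :=
  ∫ x in P.dom, cross (u x) (fderiv ℝ V x 1 • weakDeriv P.dom Complex.I v x -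
    fderiv ℝ V x Complex.I • weakDeriv P.dom 1 v x)

theorem abdeg_eq (V : Fin N → ℂ → ℝ) (u : ℂ → ℂ) (i : Fin N) :
    P.abdeg V u i = 1 / (2 * Real.pi) * P.bulkForm (V i) u u := rfl

namespace IsPotential

variable {P} {i : Fin N} {V : ℂ → ℝ}

theorem abs_fderiv_le_c1Norm (h : P.IsPotential i V) {x : ℂ} (hx : x ∈ P.dom) {e : ℂ}
    (he : e ∈ ({1, Complex.I} : Set ℂ)) : |fderiv ℝ V x e| ≤ P.c1Norm V := by
  have h1 : c1Size V x ≤ P.c1Norm V := le_csSup h.c1Bounded (mem_image_of_mem _ hx)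
  refine le_trans ?_ h1
  rcases he with rfl | rfl
  · exact (le_max_left _ _).trans (le_max_right _ _)
  · exact (le_max_right _ _).trans (le_max_right _ _)

theorem ae_abs_fderiv_le (h : P.IsPotential i V) {e : ℂ} (he : e ∈ ({1, Complex.I} : Set ℂ)) :
    ∀ᵐ x ∂volume.restrict P.dom, |fderiv ℝ V x e| ≤ P.c1Norm V := by
  filter_upwards [ae_restrict_mem P.isOpen_dom.measurableSet] with x hx
  exact h.abs_fderiv_le_c1Norm hx he

theorem memLp_fderiv_smul (h : P.IsPotential i V) {e : ℂ} (he : e ∈ ({1, Complex.I} : Set ℂ))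
    {g : ℂ → ℂ} (hg : MemLp g 2 (volume.restrict P.dom)) :
    MemLp (fun x => fderiv ℝ V x e • g x) 2 (volume.restrict P.dom) :=
  memLp_bdd_smul hg (measurable_fderiv_apply_const ℝ V e).aestronglyMeasurable
    (h.ae_abs_fderiv_le he)

theorem memLp_rotated (h : P.IsPotential i V) {v : ℂ → ℂ} (hv : MemH1 P.dom v) :
    MemLp (fun x => fderiv ℝ V x 1 • weakDeriv P.dom Complex.I v x -
      fderiv ℝ V x Complex.I • weakDeriv P.dom 1 v x) 2 (volume.restrict P.dom) :=
  (h.memLp_fderiv_smul (by simp) hv.isWeakDeriv_I.1).sub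
    (h.memLp_fderiv_smul (by simp) hv.isWeakDeriv_one.1)

theorem integrable_bulk (h : P.IsPotential i V) {u v : ℂ → ℂ} (hu : MemH1 P.dom u)
    (hv : MemH1 P.dom v) :
    Integrable (fun x => cross (u x) (fderiv ℝ V x 1 • weakDeriv P.dom Complex.I v x -
      fderiv ℝ V x Complex.I • weakDeriv P.dom 1 v x)) (volume.restrict P.dom) :=
  integrable_bilin crossL hu.1 (h.memLp_rotated hv)

theorem integrableOn_abdegIntegrand (h : P.IsPotential i V) {u : ℂ → ℂ} (hu : MemH1 P.dom u) :
    IntegrableOn (P.abdegIntegrand V u) P.dom := h.integrable_bulk hu hu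

/-- Since `0 ≤ V ≤ 1`, such a point is an interior extremum. These are the only points where `cutoff
n (V x)` fails to tend to `1`, and there the integrand of the form vanishes anyway. -/
theorem fderiv_eq_zero_of_eq (h : P.IsPotential i V) {x : ℂ} (hx : x ∈ P.dom)
    (hV : V x = 0 ∨ V x = 1) : fderiv ℝ V x = 0 := by
  rcases hV with h0 | h0
  · refine IsLocalMin.fderiv_eq_zero ?_
    filter_upwards [P.isOpen_dom.mem_nhds hx] with y hy
    rw [h0]; exact h.nonneg (subset_closure hy)
  · refine IsLocalMax.fderiv_eq_zero ?_
    filter_upwards [P.isOpen_dom.mem_nhds hx] with y hy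
    rw [h0]; exact h.le_one (subset_closure hy)

theorem eventually_near_zero (h : P.IsPotential i V) {p : ℂ} (hp : p ∈ frontier P.dom)
    (h0 : V p = 0) (n : ℕ) : ∀ᶠ x in 𝓝 p, x ∈ P.dom → n * V x ≤ 1 := by
  have hc : Tendsto (fun x => (n : ℝ) * V x) (𝓝[closure P.dom] p) (𝓝 (n * V p)) :=
    ((h.continuousOn p (frontier_subset_closure hp)).tendsto).const_mul _
  have := hc.eventually_lt_const (show (n : ℝ) * V p < 1 by rw [h0]; simp)
  rw [eventually_nhdsWithin_iff] at this
  exact this.mono fun x hx hxD => (hx (subset_closure hxD)).le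

theorem eventually_near_one (h : P.IsPotential i V) {p : ℂ} (hp : p ∈ frontier P.dom)
    (h0 : V p = 1) (n : ℕ) : ∀ᶠ x in 𝓝 p, x ∈ P.dom → n * (1 - V x) ≤ 1 := by
  have hc : Tendsto (fun x => (n : ℝ) * (1 - V x)) (𝓝[closure P.dom] p) (𝓝 (n * (1 - V p))) :=
    (((h.continuousOn p (frontier_subset_closure hp)).tendsto).const_sub _).const_mul _
  have := hc.eventually_lt_const (show (n : ℝ) * (1 - V p) < 1 by rw [h0]; simp)
  rw [eventually_nhdsWithin_iff] at this
  exact this.mono fun x hx hxD => (hx (subset_closure hxD)).le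

theorem contDiffOn_fderiv_apply (h : P.IsPotential i V) (e : ℂ) :
    ContDiffOn ℝ 1 (fun x => fderiv ℝ V x e) P.dom :=
  (h.contDiffOn.fderiv_of_isOpen P.isOpen_dom (m := 1) (by norm_num)).clm_apply contDiffOn_const

/-- By continuity up to the boundary `V` is close to `0` or to `1` near every frontier point, where
the cutoff is zero. No control of `∇V` at the boundary is required. -/
theorem isTest_cutoff (h : P.IsPotential i V) (n : ℕ) (e : ℂ) :
    IsTest P.dom (P.dom.indicator fun x => cutoff n (V x) * fderiv ℝ V x e) := by
  refine isTest_indicator P.isOpen_dom P.isBounded_dom ?_ fun p hp => ?_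
  · refine ContDiffOn.mul ?_ (h.contDiffOn_fderiv_apply e)
    exact ((contDiff_cutoff n).of_le (by simp)).comp_contDiffOn (h.contDiffOn.of_le (by norm_num))
  · rcases h.mem_frontier_zero_or_one hp with h0 | h0
    · filter_upwards [h.eventually_near_zero hp h0 n] with x hx hxD
      rw [cutoff_eq_zero_left (hx hxD), zero_mul]
    · filter_upwards [h.eventually_near_one hp h0 n] with x hx hxD
      rw [cutoff_eq_zero_right (hx hxD), zero_mul]

/-- The field `cutoff n (V) ∇V` is the gradient of a function of `V`: the derivative of the cutoff
contributes a term symmetric in the two directions. -/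
theorem curl_cutoff (h : P.IsPotential i V) (n : ℕ) (x : ℂ) :
    fderiv ℝ (P.dom.indicator fun x => cutoff n (V x) * fderiv ℝ V x 1) x Complex.I =
      fderiv ℝ (P.dom.indicator fun x => cutoff n (V x) * fderiv ℝ V x Complex.I) x 1 := by
  by_cases hx : x ∈ P.dom
  · have hV : ContDiffAt ℝ 2 V x := h.contDiffOn.contDiffAt (P.isOpen_dom.mem_nhds hx)
    have key : ∀ e e', fderiv ℝ (P.dom.indicator fun x => cutoff n (V x) * fderiv ℝ V x e) x e' =
        cutoff n (V x) * fderiv ℝ (fun y => fderiv ℝ V y e) x e' +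
          fderiv ℝ V x e * (deriv (cutoff n) (V x) * fderiv ℝ V x e') := fun e e' => by
      have hev : (P.dom.indicator fun x => cutoff n (V x) * fderiv ℝ V x e) =ᶠ[𝓝 x]
          fun x => cutoff n (V x) * fderiv ℝ V x e := by
        filter_upwards [P.isOpen_dom.mem_nhds hx] with y hy
        simp [hy]
      have hd1 : HasFDerivAt (fun y => cutoff n (V y)) (deriv (cutoff n) (V x) • fderiv ℝ V x) x :=
        (((contDiff_cutoff n).differentiable (by simp) (V x)).hasDerivAt).comp_hasFDerivAt x
          (hV.differentiableAt (by simp)).hasFDerivAt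
      have hd2 : DifferentiableAt ℝ (fun y => fderiv ℝ V y e) x :=
        ((h.contDiffOn_fderiv_apply e).contDiffAt (P.isOpen_dom.mem_nhds hx)).differentiableAt
          (by simp)
      rw [hev.fderiv_eq, (hd1.fun_mul hd2.hasFDerivAt).fderiv]
      simp
    rw [key, key, fderiv_fderiv_comm hV]
    ring
  · rw [(h.isTest_cutoff n 1).fderiv_eq_zero hx, (h.isTest_cutoff n Complex.I).fderiv_eq_zero hx]
    rfl

/-- The cut off forms converge. -/
theorem tendsto_bulkForm (h : P.IsPotential i V) {u v : ℂ → ℂ} (hu : MemH1 P.dom u)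
    (hv : MemH1 P.dom v) :
    Tendsto (fun n => ∫ x in P.dom, cutoff n (V x) *
      cross (u x) (fderiv ℝ V x 1 • weakDeriv P.dom Complex.I v x -
        fderiv ℝ V x Complex.I • weakDeriv P.dom 1 v x)) atTop (𝓝 (P.bulkForm V u v)) := by
  have hi := h.integrable_bulk hu hv
  have hVm : AEStronglyMeasurable V (volume.restrict P.dom) :=
    (h.continuousOn.mono subset_closure).aestronglyMeasurable P.isOpen_dom.measurableSet
  refine tendsto_integral_of_dominated_convergence _ (fun n => ?_) hi.norm (fun n => ?_) ?_
  · exact ((contDiff_cutoff n).continuous.comp_aestronglyMeasurable hVm).mul hi.1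
  · refine Eventually.of_forall fun x => ?_
    rw [norm_mul, Real.norm_of_nonneg (cutoff_nonneg n _)]
    exact mul_le_of_le_one_left (norm_nonneg _) (cutoff_le_one n _)
  · filter_upwards [ae_restrict_mem P.isOpen_dom.measurableSet] with x hx
    by_cases hV : V x = 0 ∨ V x = 1
    · simp [h.fderiv_eq_zero_of_eq hx hV, cross]
    · push Not at hV
      have h0 := lt_of_le_of_ne (h.nonneg (subset_closure hx)) (Ne.symm hV.1)
      have h1 := lt_of_le_of_ne (h.le_one (subset_closure hx)) hV.2
      simpa using (tendsto_cutoff h0 h1).mul_const _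

theorem setIntegral_cutoff_eq (V : ℂ → ℝ) (n : ℕ) (u v : ℂ → ℂ) :
    ∫ x in P.dom, cutoff n (V x) * cross (u x) (fderiv ℝ V x 1 • weakDeriv P.dom Complex.I v x -
        fderiv ℝ V x Complex.I • weakDeriv P.dom 1 v x) =
      ∫ x in P.dom, ((P.dom.indicator fun x => cutoff n (V x) * fderiv ℝ V x 1) x *
        cross (u x) (weakDeriv P.dom Complex.I v x) -
        (P.dom.indicator fun x => cutoff n (V x) * fderiv ℝ V x Complex.I) x *
        cross (u x) (weakDeriv P.dom 1 v x)) := by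
  refine setIntegral_congr_fun P.isOpen_dom.measurableSet fun x hx => ?_
  simp only [indicator_of_mem hx, cross, Complex.sub_re, Complex.sub_im, Complex.smul_re,
    Complex.smul_im, smul_eq_mul]
  ring

/-- The cut off field is closed and compactly supported, so the cut off forms are exactly symmetric.
Symmetry survives the limit. -/
theorem bulkForm_symm (h : P.IsPotential i V) {u v : ℂ → ℂ} (hu : MemH1 P.dom u)
    (hv : MemH1 P.dom v) : P.bulkForm V u v = P.bulkForm V v u := by
  obtain ⟨φ, hφ⟩ := P.exists_h1Tendsto hu
  obtain ⟨ψ, hψ⟩ := P.exists_h1Tendsto hv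
  refine tendsto_nhds_unique (h.tendsto_bulkForm hu hv) ((h.tendsto_bulkForm hv hu).congr fun n => ?_)
  rw [setIntegral_cutoff_eq, setIntegral_cutoff_eq]
  exact (integral_cross_symm P.isBounded_dom (h.isTest_cutoff n 1) (h.isTest_cutoff n Complex.I)
    (h.curl_cutoff n) hu hv hφ hψ).symm

/-- For maps with values in the circle the potential may be replaced by a smooth function with the
opposite boundary values. -/
theorem bulkForm_eq_neg (h : P.IsPotential i V) {u : ℂ → ℂ} (hu : MemH1Circle P.dom u) {η : ℂ → ℝ}
    (hη : ContDiff ℝ 1 η) (hηs : HasCompactSupport η)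
    (h1 : ∀ p ∈ frontier (P.hole i), ∀ᶠ x in 𝓝 p, η x = 1)
    (h0 : ∀ p ∈ frontier P.dom \ frontier (P.hole i), ∀ᶠ x in 𝓝 p, η x = 0) :
    P.bulkForm V u u = -∫ x in P.dom, (fderiv ℝ η x 1 * cross (u x) (weakDeriv P.dom Complex.I u x) -
      fderiv ℝ η x Complex.I * cross (u x) (weakDeriv P.dom 1 u x)) := by
  obtain ⟨φ, hφ⟩ := P.exists_h1Tendsto hu.1
  set Q := ∫ x in P.dom, (fderiv ℝ η x 1 * cross (u x) (weakDeriv P.dom Complex.I u x) -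
      fderiv ℝ η x Complex.I * cross (u x) (weakDeriv P.dom 1 u x)) with hQ
  have hcu := hu.1
  have hηd : ∀ e, Continuous fun x => fderiv ℝ η x e := fun e =>
    (hη.continuous_fderiv (by simp)).clm_apply continuous_const
  have hηi : ∀ e, ∀ f : ℂ → ℂ, MemLp f 2 (volume.restrict P.dom) →
      Integrable (fun x => fderiv ℝ η x e * cross (u x) (f x)) (volume.restrict P.dom) :=
    fun e f hf => by
      obtain ⟨C, hC⟩ := exists_bound_of_compactSupport (hηd e) (hηs.fderiv_apply ℝ e)
      exact integrable_bdd_bilin crossL (hηd e).aestronglyMeasurable (Eventually.of_forall hC)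
        hcu.1 hf
  have hn : ∀ n, ∫ x in P.dom, cutoff n (V x) *
      cross (u x) (fderiv ℝ V x 1 • weakDeriv P.dom Complex.I u x -
        fderiv ℝ V x Complex.I • weakDeriv P.dom 1 u x) = -(cutoffInt n 1 * Q) := by
    intro n
    -- The two summands cancel near the boundary: near the hole the primitive is `0` and `η = 1`;
    -- near the other curves the primitive has its full value `cutoffInt n 1` and `η = 0`. So `f` is
    -- a test function, and the vanishing Jacobian kills its form.
    set f : ℂ → ℝ := fun x => cutoffInt n (V x) + cutoffInt n 1 * (η x - 1) with hf
    have htest : IsTest P.dom (P.dom.indicator f) := by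
      refine isTest_indicator P.isOpen_dom P.isBounded_dom ?_ fun p hp => ?_
      · exact ((contDiff_cutoffInt n).comp_contDiffOn (h.contDiffOn.of_le (by norm_num))).add
          (contDiff_const.mul (hη.sub contDiff_const)).contDiffOn
      · by_cases hpi : p ∈ frontier (P.hole i)
        · filter_upwards [h.eventually_near_zero hp (h.eq_zero p hpi) n, h1 p hpi] with x hx hηx hxD
          simp only [hf, cutoffInt_eq_zero (h.nonneg (subset_closure hxD)) (hx hxD), hηx]
          ring
        · filter_upwards [h.eventually_near_one hp (h.eq_one p ⟨hp, hpi⟩) n, h0 p ⟨hp, hpi⟩]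
            with x hx hηx hxD
          simp only [hf, cutoffInt_eq_cutoffInt_one (h.le_one (subset_closure hxD)) (hx hxD), hηx]
          ring
    have hder : ∀ x ∈ P.dom, ∀ e, fderiv ℝ (P.dom.indicator f) x e =
        cutoff n (V x) * fderiv ℝ V x e + cutoffInt n 1 * fderiv ℝ η x e := fun x hx e => by
      have hV : ContDiffAt ℝ 2 V x := h.contDiffOn.contDiffAt (P.isOpen_dom.mem_nhds hx)
      have hev : P.dom.indicator f =ᶠ[𝓝 x] f := by
        filter_upwards [P.isOpen_dom.mem_nhds hx] with y hy
        simp [hy]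
      have hd1 : HasFDerivAt (fun y => cutoffInt n (V y)) (cutoff n (V x) • fderiv ℝ V x) x :=
        (hasDerivAt_cutoffInt n (V x)).comp_hasFDerivAt x
          (hV.differentiableAt (by simp)).hasFDerivAt
      have hd2 : HasFDerivAt (fun y => cutoffInt n 1 * (η y - 1)) (cutoffInt n 1 • fderiv ℝ η x) x :=
        ((hη.differentiable (by simp) x).hasFDerivAt.sub_const 1).const_mul _
      rw [hev.fderiv_eq, (hd1.fun_add hd2).fderiv]
      simp
    have key := integral_cross_eq_jacobian P.isBounded_dom htest hcu hφ
    have hjac : ∫ x in P.dom, P.dom.indicator f x * cross (weakDeriv P.dom 1 u x)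
        (weakDeriv P.dom Complex.I u x) = 0 := by
      refine integral_eq_zero_of_ae ?_
      filter_upwards [hu.jacobian_ae_eq_zero P.isOpen_dom P.isBounded_dom hφ] with x hx
      simp [hx]
    rw [hjac, mul_zero] at key
    have hti : ∀ e, ∀ g : ℂ → ℂ, MemLp g 2 (volume.restrict P.dom) → Integrable (fun x =>
        fderiv ℝ (P.dom.indicator f) x e * cross (u x) (g x)) (volume.restrict P.dom) :=
      fun e g hg => by
        obtain ⟨C, hC⟩ := htest.exists_bound_fderiv e
        exact integrable_bdd_bilin crossL (htest.continuous_fderiv_apply e).aestronglyMeasurable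
          (Eventually.of_forall hC) hcu.1 hg
    have hVi := (h.integrable_bulk hcu hcu).bdd_mul (c := 1)
      (f := fun x => cutoff n (V x)) ((contDiff_cutoff n).continuous.comp_aestronglyMeasurable
        ((h.continuousOn.mono subset_closure).aestronglyMeasurable P.isOpen_dom.measurableSet))
      (Eventually.of_forall fun x => by
        rw [Real.norm_of_nonneg (cutoff_nonneg n _)]; exact cutoff_le_one n _)
    rw [← integral_sub (hti 1 _ hcu.isWeakDeriv_I.1) (hti Complex.I _ hcu.isWeakDeriv_one.1)] at key
    have hηQ : Integrable (fun x => cutoffInt n 1 *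
        (fderiv ℝ η x 1 * cross (u x) (weakDeriv P.dom Complex.I u x) -
          fderiv ℝ η x Complex.I * cross (u x) (weakDeriv P.dom 1 u x))) (volume.restrict P.dom) :=
      ((hηi 1 _ hcu.isWeakDeriv_I.1).sub (hηi Complex.I _ hcu.isWeakDeriv_one.1)).const_mul _
    rw [hQ, ← integral_const_mul, eq_neg_iff_add_eq_zero, ← integral_add hVi hηQ, ← key]
    refine setIntegral_congr_fun P.isOpen_dom.measurableSet fun x hx => ?_
    simp only [hder x hx, cross, Complex.sub_re, Complex.sub_im, Complex.smul_re,
      Complex.smul_im, smul_eq_mul]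
    ring
  refine tendsto_nhds_unique (h.tendsto_bulkForm hcu hcu) ?_
  simp_rw [hn]
  simpa using (tendsto_cutoffInt_one.mul_const Q).neg

/-- The Lipschitz estimate for the form. -/
theorem abs_bulkForm_le (h : P.IsPotential i V) {u v : ℂ → ℂ} (hu : MemLp u 2 (volume.restrict P.dom))
    (hv : MemH1 P.dom v) :
    |P.bulkForm V u v| ≤ P.c1Norm V * (eLpNorm u 2 (volume.restrict P.dom)).toReal *
      (Real.sqrt 2 * Real.sqrt (∫ x in P.dom, (‖weakDeriv P.dom 1 v x‖ ^ 2 +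
        ‖weakDeriv P.dom Complex.I v x‖ ^ 2))) := by
  set G : ℂ → ℝ := fun x => ‖weakDeriv P.dom 1 v x‖ + ‖weakDeriv P.dom Complex.I v x‖ with hG
  have hv1 := hv.isWeakDeriv_one.1
  have hvI := hv.isWeakDeriv_I.1
  have hGm : MemLp G 2 (volume.restrict P.dom) := hv1.norm.add hvI.norm
  have hun : MemLp (fun x => ‖u x‖) 2 (volume.restrict P.dom) := hu.norm
  have hconv : ENNReal.ofReal 2 = 2 := by norm_num
  have hne : 0 ≤ P.c1Norm V := by
    by_cases hD : P.dom.Nonempty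
    · obtain ⟨x, hx⟩ := hD
      exact (abs_nonneg _).trans (h.abs_fderiv_le_c1Norm hx (e := 1) (by simp))
    · rw [not_nonempty_iff_eq_empty] at hD
      simp [c1Norm, hD]
  have hsq : ∀ {f : ℂ → ℝ}, MemLp f 2 (volume.restrict P.dom) →
      Integrable (fun x => f x ^ 2) (volume.restrict P.dom) := fun hf => hf.integrable_sq
  have hCS := integral_mul_norm_le_Lp_mul_Lq (μ := volume.restrict P.dom) (f := fun x => ‖u x‖)
    (g := G) (p := 2) (q := 2) Real.HolderConjugate.two_two (by rwa [hconv]) (by rwa [hconv])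
  have e1 : ∀ f : ℂ → ℝ, (∫ x in P.dom, ‖f x‖ ^ (2 : ℝ)) ^ (1 / (2 : ℝ)) =
      Real.sqrt (∫ x in P.dom, f x ^ 2) := fun f => by
    rw [← Real.sqrt_eq_rpow]
    congr 1
    refine integral_congr_ae (Eventually.of_forall fun x => ?_)
    simp
  rw [e1, e1] at hCS
  have hu2 : Real.sqrt (∫ x in P.dom, ‖u x‖ ^ 2) = (eLpNorm u 2 (volume.restrict P.dom)).toReal := by
    rw [Real.sqrt_eq_iff_mul_self_eq (integral_nonneg fun x => by positivity) ENNReal.toReal_nonneg,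
      ← ENNReal.toReal_mul, ← sq, eLpNorm_two_sq,
      integral_eq_lintegral_of_nonneg_ae (Eventually.of_forall fun x => by positivity)
        (hsq hun).1]
    congr 1
    refine lintegral_congr fun x => ?_
    rw [← ofReal_norm, ENNReal.ofReal_pow (norm_nonneg _)]
  have hG2 : Real.sqrt (∫ x in P.dom, G x ^ 2) ≤ Real.sqrt 2 * Real.sqrt (∫ x in P.dom,
      (‖weakDeriv P.dom 1 v x‖ ^ 2 + ‖weakDeriv P.dom Complex.I v x‖ ^ 2)) := by
    rw [← Real.sqrt_mul (by norm_num)]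
    refine Real.sqrt_le_sqrt ?_
    rw [← integral_const_mul]
    refine integral_mono (hsq hGm) (((hsq hv1.norm).add (hsq hvI.norm)).const_mul 2) fun x => ?_
    simp only [hG]
    nlinarith [sq_nonneg (‖weakDeriv P.dom 1 v x‖ - ‖weakDeriv P.dom Complex.I v x‖)]
  have hprod : Integrable (fun x => ‖u x‖ * G x) (volume.restrict P.dom) :=
    hGm.integrable_mul hun |>.congr (Eventually.of_forall fun x => by
      simp only [Pi.mul_apply]; ring)
  have hfin : |P.bulkForm V u v| ≤ P.c1Norm V * ∫ x in P.dom, ‖u x‖ * G x := by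
    rw [← integral_const_mul, bulkForm, ← Real.norm_eq_abs]
    refine norm_integral_le_of_norm_le (hprod.const_mul _) ?_
    filter_upwards [h.ae_abs_fderiv_le (e := 1) (by simp),
      h.ae_abs_fderiv_le (e := Complex.I) (by simp)] with x h1 h2
    rw [Real.norm_eq_abs]
    refine (abs_cross_le _ _).trans ?_
    have h3 : ‖fderiv ℝ V x 1 • weakDeriv P.dom Complex.I v x -
        fderiv ℝ V x Complex.I • weakDeriv P.dom 1 v x‖ ≤ P.c1Norm V * G x := by
      refine (norm_sub_le _ _).trans ?_
      rw [norm_smul, norm_smul, Real.norm_eq_abs, Real.norm_eq_abs, hG, mul_add, add_comm]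
      gcongr
    calc ‖u x‖ * _ ≤ ‖u x‖ * (P.c1Norm V * G x) := by gcongr
      _ = P.c1Norm V * (‖u x‖ * G x) := by ring
  have hprod_le : ∫ x in P.dom, ‖u x‖ * G x ≤ (eLpNorm u 2 (volume.restrict P.dom)).toReal *
      (Real.sqrt 2 * Real.sqrt (∫ x in P.dom, (‖weakDeriv P.dom 1 v x‖ ^ 2 +
        ‖weakDeriv P.dom Complex.I v x‖ ^ 2))) := by
    have e3 : ∫ x in P.dom, ‖u x‖ * G x = ∫ x in P.dom, ‖(‖u x‖)‖ * ‖G x‖ :=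
      integral_congr_ae (Eventually.of_forall fun x => by
        have : 0 ≤ G x := by simp only [hG]; positivity
        simp [Real.norm_of_nonneg this])
    rw [e3]
    refine hCS.trans ?_
    rw [hu2]
    gcongr
  calc |P.bulkForm V u v| ≤ _ := hfin
    _ ≤ P.c1Norm V * _ := mul_le_mul_of_nonneg_left hprod_le hne
    _ = _ := by ring

/-- The Lipschitz estimate for the approximate bulk degree. -/
theorem abs_bulkForm_sub_le (h : P.IsPotential i V) {u v : ℂ → ℂ} (hu : MemH1 P.dom u)
    (hv : MemH1 P.dom v) {M : ℝ}
    (hMu : ∫ x in P.dom, (‖weakDeriv P.dom 1 u x‖ ^ 2 + ‖weakDeriv P.dom Complex.I u x‖ ^ 2) ≤ 2 * M)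
    (hMv : ∫ x in P.dom, (‖weakDeriv P.dom 1 v x‖ ^ 2 + ‖weakDeriv P.dom Complex.I v x‖ ^ 2) ≤ 2 * M) :
    |P.bulkForm V u u - P.bulkForm V v v| ≤ 4 * P.c1Norm V * Real.sqrt M *
      (eLpNorm (fun x => u x - v x) 2 (volume.restrict P.dom)).toReal := by
  have hw : MemLp (fun x => u x - v x) 2 (volume.restrict P.dom) := hu.1.sub hv.1
  -- By symmetry the mixed terms cancel, and no derivative of `u - v` appears. This is why the `L²`
  -- distance alone controls the difference.
  have e : P.bulkForm V u u - P.bulkForm V v v =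
      P.bulkForm V (fun x => u x - v x) u + P.bulkForm V (fun x => u x - v x) v := by
    have hlin : ∀ {w : ℂ → ℂ}, MemH1 P.dom w → P.bulkForm V (fun x => u x - v x) w =
        P.bulkForm V u w - P.bulkForm V v w := fun hw => by
      rw [bulkForm, bulkForm, bulkForm, ← integral_sub (h.integrable_bulk hu hw)
        (h.integrable_bulk hv hw)]
      refine integral_congr_ae (Eventually.of_forall fun x => ?_)
      simp only [cross, Complex.sub_re, Complex.sub_im]
      ring
    rw [hlin hu, hlin hv, h.bulkForm_symm hu hv]
    ring
  -- The first root comes from `(x + y)² ≤ 2 (x² + y²)`, the second from the factor `1/2` in the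
  -- energy. The two terms of the decomposition double the result to `4`.
  have hs : Real.sqrt 2 * Real.sqrt (2 * M) = 2 * Real.sqrt M := by
    rw [Real.sqrt_mul (by norm_num), ← mul_assoc, Real.mul_self_sqrt (by norm_num)]
  have hne : 0 ≤ P.c1Norm V := by
    by_cases hD : P.dom.Nonempty
    · obtain ⟨x, hx⟩ := hD
      exact (abs_nonneg _).trans (h.abs_fderiv_le_c1Norm hx (e := 1) (by simp))
    · rw [not_nonempty_iff_eq_empty] at hD
      simp [c1Norm, hD]
  have hb : ∀ {w : ℂ → ℂ}, MemH1 P.dom w → (∫ x in P.dom, (‖weakDeriv P.dom 1 w x‖ ^ 2 +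
      ‖weakDeriv P.dom Complex.I w x‖ ^ 2) ≤ 2 * M) → |P.bulkForm V (fun x => u x - v x) w| ≤
      P.c1Norm V * (eLpNorm (fun x => u x - v x) 2 (volume.restrict P.dom)).toReal *
        (2 * Real.sqrt M) := fun hw1 hM => by
    refine (h.abs_bulkForm_le hw hw1).trans ?_
    rw [← hs]
    gcongr
  rw [e]
  refine (abs_add_le _ _).trans ((add_le_add (hb hu hMu) (hb hv hMv)).trans_eq ?_)
  ring

end IsPotential

/-- The Dirichlet part of the energy. -/
theorem integral_norm_sq_le_of_energy_le {Λ ε : ℝ} (hΛ : 0 < Λ) {u : ℂ → ℂ}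
    (hu : MemH1 P.dom u) (h : P.energy ε u ≤ ENNReal.ofReal Λ) :
    ∫ x in P.dom, (‖weakDeriv P.dom 1 u x‖ ^ 2 + ‖weakDeriv P.dom Complex.I u x‖ ^ 2) ≤ 2 * Λ := by
  have h1 := hu.isWeakDeriv_one.1.norm.integrable_sq
  have h2 := hu.isWeakDeriv_I.1.norm.integrable_sq
  have h12 : Integrable (fun x => ‖weakDeriv P.dom 1 u x‖ ^ 2 +
      ‖weakDeriv P.dom Complex.I u x‖ ^ 2) (volume.restrict P.dom) := h1.add h2
  rw [integral_eq_lintegral_of_nonneg_ae (Eventually.of_forall fun x => by positivity) h12.1]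
  refine ENNReal.toReal_le_of_le_ofReal (by positivity) ?_
  have h3 : ∫⁻ x in P.dom, ENNReal.ofReal (‖weakDeriv P.dom 1 u x‖ ^ 2 +
      ‖weakDeriv P.dom Complex.I u x‖ ^ 2) ≤ 2 * P.energy ε u := by
    rw [energy, ← mul_assoc, one_div, ENNReal.mul_inv_cancel (by norm_num) (by norm_num), one_mul]
    refine lintegral_mono fun x => ENNReal.ofReal_le_ofReal ?_
    have : 0 ≤ 1 / (2 * ε ^ 2) * (1 - ‖u x‖ ^ 2) ^ 2 := by positivity
    linarith
  refine h3.trans ?_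
  rw [ENNReal.ofReal_mul (by norm_num)]
  have : ENNReal.ofReal 2 = 2 := by norm_num
  rw [this]
  gcongr

/-- The Lipschitz estimate for the approximate bulk degree in terms of the energy. -/
theorem abs_abdeg_sub_le {V : Fin N → ℂ → ℝ} {i : Fin N} (hV : P.IsPotential i (V i)) {Λ ε : ℝ}
    (hΛ : 0 < Λ) {u v : ℂ → ℂ} (hu : MemH1 P.dom u) (hv : MemH1 P.dom v)
    (hEu : P.energy ε u ≤ ENNReal.ofReal Λ) (hEv : P.energy ε v ≤ ENNReal.ofReal Λ) :
    |P.abdeg V u i - P.abdeg V v i| ≤ 2 / Real.pi * P.c1Norm (V i) * Real.sqrt Λ *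
      (eLpNorm (fun x => u x - v x) 2 (volume.restrict P.dom)).toReal := by
  have := hV.abs_bulkForm_sub_le hu hv (P.integral_norm_sq_le_of_energy_le hΛ hu hEu)
    (P.integral_norm_sq_le_of_energy_le hΛ hv hEv)
  rw [abdeg_eq, abdeg_eq, ← mul_sub, abs_mul, abs_of_pos (by positivity)]
  have hpi := Real.pi_pos
  calc 1 / (2 * Real.pi) * |P.bulkForm (V i) u u - P.bulkForm (V i) v v| ≤
      1 / (2 * Real.pi) * (4 * P.c1Norm (V i) * Real.sqrt Λ *
      (eLpNorm (fun x => u x - v x) 2 (volume.restrict P.dom)).toReal) := by gcongr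
    _ = _ := by field_simp; ring

end PerforatedDomain

/-! ### Collars of boundary curves -/

/-- The points `tube γ (t, s)`, `-δ < s < 0`, form a one-sided neighbourhood in `D` of the closed curve
`γ`, with coordinates which are nondegenerate, and injective up to the period. -/
structure IsCollar (D : Set ℂ) (γ : ℝ → ℂ) (δ : ℝ) : Prop where
  pos : 0 < δ
  contDiff : ContDiff ℝ ∞ (tube γ)
  periodic : ∀ t s, tube γ (t + 2 * Real.pi, s) = tube γ (t, s)
  exists_jac : ∃ c : ℝ, 0 < c ∧ ∀ t s, -δ ≤ s → s ≤ 0 → c ≤ tubeJac γ (t, s)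
  injOn : InjOn (tube γ) (Ico 0 (2 * Real.pi) ×ˢ Ioo (-δ) 0)
  mem : ∀ t s, -δ < s → s < 0 → tube γ (t, s) ∈ D

/-- The domain of the collar coordinates. -/
def collarRect (δ : ℝ) : Set (ℝ × ℝ) := Ico 0 (2 * Real.pi) ×ˢ Ioo (-δ) 0

theorem measurableSet_collarRect (δ : ℝ) : MeasurableSet (collarRect δ) :=
  measurableSet_Ico.prod measurableSet_Ioo

theorem det_prod_clm (L : ℝ × ℝ →L[ℝ] ℝ × ℝ) :
    L.det = (L (1, 0)).1 * (L (0, 1)).2 - (L (1, 0)).2 * (L (0, 1)).1 := by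
  rw [ContinuousLinearMap.det, ← LinearMap.det_toMatrix (Module.Basis.finTwoProd ℝ),
    Matrix.det_fin_two]
  simp [LinearMap.toMatrix_apply]
  ring

namespace IsCollar

variable {D : Set ℂ} {γ : ℝ → ℂ} {δ : ℝ}

theorem hasFDerivAt (h : IsCollar D γ δ) (p : ℝ × ℝ) :
    HasFDerivAt (tube γ) (fderiv ℝ (tube γ) p) p :=
  (h.contDiff.differentiable (by simp) p).hasFDerivAt

theorem image_subset (h : IsCollar D γ δ) : tube γ '' collarRect δ ⊆ D := by
  rintro _ ⟨⟨t, s⟩, hp, rfl⟩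
  exact h.mem t s hp.2.1 hp.2.2

theorem hasFDerivWithinAt_real (h : IsCollar D γ δ) (p : ℝ × ℝ) :
    HasFDerivWithinAt (fun q => Complex.measurableEquivRealProd (tube γ q))
      ((Complex.equivRealProdCLM : ℂ →L[ℝ] ℝ × ℝ) ∘L fderiv ℝ (tube γ) p) (collarRect δ) p :=
  (Complex.equivRealProdCLM.hasFDerivAt.comp p (h.hasFDerivAt p)).hasFDerivWithinAt

theorem abs_det_eq (h : IsCollar D γ δ) {p : ℝ × ℝ} (hp : p ∈ collarRect δ) :
    |((Complex.equivRealProdCLM : ℂ →L[ℝ] ℝ × ℝ) ∘L fderiv ℝ (tube γ) p).det| = tubeJac γ p := by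
  obtain ⟨c, hc, hJ⟩ := h.exists_jac
  have h0 : 0 < tubeJac γ p := hc.trans_le (hJ p.1 p.2 hp.2.1.le hp.2.2.le)
  rw [← abs_of_pos h0, det_prod_clm]
  rfl

theorem injOn_real (h : IsCollar D γ δ) :
    InjOn (fun q => Complex.measurableEquivRealProd (tube γ q)) (collarRect δ) :=
  fun _ hp _ hq e => h.injOn hp hq (Complex.measurableEquivRealProd.injective e)

theorem image_real (γ : ℝ → ℂ) (δ : ℝ) :
    (fun q => Complex.measurableEquivRealProd (tube γ q)) '' collarRect δ =
      Complex.measurableEquivRealProd.symm ⁻¹' (tube γ '' collarRect δ) := by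
  rw [← MeasurableEquiv.image_eq_preimage_symm, image_image]

/-- Change of variables in a collar. -/
theorem setIntegral_image (h : IsCollar D γ δ) (f : ℂ → ℝ) :
    ∫ x in tube γ '' collarRect δ, f x = ∫ p in collarRect δ, tubeJac γ p * f (tube γ p) := by
  have h1 := integral_image_eq_integral_abs_det_fderiv_smul volume (measurableSet_collarRect δ)
    (fun p _ => h.hasFDerivWithinAt_real p) h.injOn_real
    (fun q => f (Complex.measurableEquivRealProd.symm q))
  rw [image_real, (Complex.volume_preserving_equiv_real_prod.symm).setIntegral_preimage_emb
    Complex.measurableEquivRealProd.symm.measurableEmbedding] at h1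
  rw [h1]
  refine setIntegral_congr_fun (measurableSet_collarRect δ) fun p hp => ?_
  simp only [h.abs_det_eq hp, MeasurableEquiv.symm_apply_apply, smul_eq_mul]

theorem setLIntegral_image (h : IsCollar D γ δ) (f : ℂ → ENNReal) :
    ∫⁻ x in tube γ '' collarRect δ, f x =
      ∫⁻ p in collarRect δ, ENNReal.ofReal (tubeJac γ p) * f (tube γ p) := by
  have h1 := lintegral_image_eq_lintegral_abs_det_fderiv_mul volume (measurableSet_collarRect δ)
    (fun p _ => h.hasFDerivWithinAt_real p) h.injOn_real
    (fun q => f (Complex.measurableEquivRealProd.symm q))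
  rw [image_real, (Complex.volume_preserving_equiv_real_prod.symm).setLIntegral_comp_preimage_emb
    Complex.measurableEquivRealProd.symm.measurableEmbedding] at h1
  rw [h1]
  refine setLIntegral_congr_fun (measurableSet_collarRect δ) fun p hp => ?_
  simp only [h.abs_det_eq hp, MeasurableEquiv.symm_apply_apply]

/-- The Jacobian is bounded below on the collar, so its weight can be dropped at the price of a
constant. -/
theorem exists_setLIntegral_comp_le (h : IsCollar D γ δ) :
    ∃ C : NNReal, ∀ f : ℂ → ENNReal,
      ∫⁻ p in collarRect δ, f (tube γ p) ≤ C * ∫⁻ x in D, f x := by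
  obtain ⟨c, hc, hJ⟩ := h.exists_jac
  refine ⟨(Real.toNNReal c)⁻¹, fun f => ?_⟩
  have hc' : ((Real.toNNReal c : NNReal) : ENNReal) ≠ 0 := by simpa using hc
  rw [ENNReal.coe_inv (by simpa using hc), ← ENNReal.mul_le_iff_le_inv hc' (by simp)]
  calc (Real.toNNReal c : ENNReal) * ∫⁻ p in collarRect δ, f (tube γ p)
      = ∫⁻ p in collarRect δ, Real.toNNReal c * f (tube γ p) :=
        (lintegral_const_mul' _ _ (by simp)).symm
    _ ≤ ∫⁻ p in collarRect δ, ENNReal.ofReal (tubeJac γ p) * f (tube γ p) := by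
        refine setLIntegral_mono' (measurableSet_collarRect δ) fun p hp => ?_
        gcongr
        exact ENNReal.ofReal_le_ofReal (hJ p.1 p.2 hp.2.1.le hp.2.2.le)
    _ = ∫⁻ x in tube γ '' collarRect δ, f x := (h.setLIntegral_image f).symm
    _ ≤ ∫⁻ x in D, f x := lintegral_mono_set h.image_subset

end IsCollar

namespace PerforatedDomain

variable {N : ℕ} (P : PerforatedDomain N)

/-- A hole has a collar in the domain, and a cutoff function supported in the hole and the collar. -/
theorem exists_collar (i : Fin N) : ∃ (δ : ℝ) (η : ℂ → ℝ), IsCollar P.dom (P.inner i) δ ∧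
    ContDiff ℝ ∞ η ∧ HasCompactSupport η ∧
    (∀ p ∈ frontier (P.hole i), ∀ᶠ x in 𝓝 p, η x = 1) ∧
    (∀ p ∈ frontier P.dom \ frontier (P.hole i), ∀ᶠ x in 𝓝 p, η x = 0) ∧
    (∀ t, η (tube (P.inner i) (t, -δ)) = 0) ∧
    ∀ x ∈ P.dom \ tube (P.inner i) '' collarRect δ, ∀ᶠ y in 𝓝 x, η y = 0 := by
  have hγ := (P.smooth_hole i).isBoundaryParam
  obtain ⟨δ₀, hδ₀⟩ := hγ.exists_isTubeWidth
  obtain ⟨m, M, hm, hlo, hhi⟩ := hγ.exists_norm_deriv_bounds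
  have hM : 0 < M := hm.trans_le ((hlo 0).trans (hhi 0))
  -- a neighbourhood of the closed hole
  set R := P.Ωᶜ ∪ ⋃ l : {l : Fin N // l ≠ i}, closure (P.hole l) with hRdef
  have hR : IsClosed R := P.smooth_Ω.isOpen.isClosed_compl.union
    (isClosed_iUnion_of_finite fun _ => isClosed_closure)
  have hd : Disjoint (closure (P.hole i)) R := by
    rw [Set.disjoint_union_right]
    exact ⟨Set.disjoint_compl_right_iff_subset.2 (P.closure_subset i), disjoint_iUnion_right.2
      fun l => P.disjoint_closure i l l.2.symm⟩
  obtain ⟨r, hr, hdist⟩ := Metric.exists_pos_forall_lt_edist (P.isCompact_closure_hole i) hR hd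
  -- The strict inequality keeps the closed end `s = -δ` inside the range of injectivity. The bound
  -- `r / M` limits the displacement `|s| ‖γ'‖` to `r`, so the tube misses the other boundary
  -- curves.
  obtain ⟨δ, hδ0, hδδ₀, hδr⟩ : ∃ δ > 0, δ < δ₀ ∧ δ ≤ r / M :=
    ⟨min δ₀ (r / M) / 2, half_pos (lt_min hδ₀.pos (div_pos hr hM)),
      (half_lt_self (lt_min hδ₀.pos (div_pos hr hM))).trans_le (min_le_left _ _),
      (half_lt_self (lt_min hδ₀.pos (div_pos hr hM))).le.trans (min_le_right _ _)⟩
  have hδ := hδ₀.mono hδ0 hδδ₀.le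
  have hnear : ∀ t s, |s| ≤ δ → tube (P.inner i) (t, s) ∉ R := by
    intro t s hs hmem
    have h1 := hdist _ (frontier_subset_closure (hγ.mem_frontier t)) _ hmem
    have h2 : dist (P.inner i t) (tube (P.inner i) (t, s)) ≤ r := by
      rw [dist_eq_norm, tube]
      simp only [sub_add_cancel_left, norm_neg, norm_mul, Complex.norm_I, one_mul,
        Complex.norm_real, Real.norm_eq_abs]
      calc |s| * ‖deriv (P.inner i) t‖ ≤ r / M * M :=
            mul_le_mul (hs.trans hδr) (hhi t) (norm_nonneg _) (by positivity)
        _ = r := by field_simp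
    rw [edist_dist] at h1
    have h3 : (r : ENNReal) < ENNReal.ofReal r :=
      h1.trans_le (ENNReal.ofReal_le_ofReal h2)
    simp at h3
  have hmemdom : ∀ t s, -δ < s → s < 0 → tube (P.inner i) (t, s) ∈ P.dom := by
    intro t s h1 h2
    have hn := hnear t s (abs_le.2 ⟨h1.le, by linarith⟩)
    rw [hRdef, mem_union, not_or, notMem_compl_iff] at hn
    refine ⟨hn.1, fun hmem => ?_⟩
    obtain ⟨l, hl⟩ := mem_iUnion.1 hmem
    by_cases hli : l = i
    · subst hli; exact hδ.not_mem t s h1 h2 hl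
    · exact hn.2 (mem_iUnion.2 ⟨⟨l, hli⟩, hl⟩)
  have hcollar : IsCollar P.dom (P.inner i) δ := by
    refine ⟨hδ0, hγ.contDiff_tube, hγ.tube_add_period, ?_, ?_, hmemdom⟩
    · obtain ⟨c, hc, hJ⟩ := hδ.exists_jac
      exact ⟨c, hc, fun t s h1 h2 => hJ t s (abs_le.2 ⟨h1, by linarith⟩)⟩
    · rintro ⟨t, s⟩ ⟨ht, hs⟩ ⟨t', s'⟩ ⟨ht', hs'⟩ e
      simp only [mem_Ico, mem_Ioo] at ht hs ht' hs'
      obtain ⟨rfl, k, hk⟩ := hδ.inj t s t' s' (abs_lt.2 ⟨hs.1, by linarith⟩)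
        (abs_lt.2 ⟨hs'.1, by linarith⟩) e
      have hpi := Real.two_pi_pos
      have h1 : (k : ℝ) < 1 := by
        by_contra hcon
        push Not at hcon
        nlinarith
      have h2 : (-1 : ℝ) < k := by
        by_contra hcon
        push Not at hcon
        nlinarith
      have hk0 : k = 0 := by
        have h3 : k < 1 := by exact_mod_cast h1
        have h4 : -1 < k := by exact_mod_cast h2
        omega
      rw [hk, hk0]
      simp
  -- the cutoff
  set T := P.hole i ∪ tube (P.inner i) '' (univ ×ˢ Icc (-(δ / 2)) (δ / 2)) with hT
  have hTper : tube (P.inner i) '' (univ ×ˢ Icc (-(δ / 2)) (δ / 2)) =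
      tube (P.inner i) '' (Icc 0 (2 * Real.pi) ×ˢ Icc (-(δ / 2)) (δ / 2)) := by
    refine Subset.antisymm ?_ (image_mono (prod_mono_left (subset_univ _)))
    rintro _ ⟨⟨t, s⟩, ⟨-, hs⟩, rfl⟩
    refine ⟨(toIcoMod Real.two_pi_pos 0 t, s), ⟨?_, hs⟩, ?_⟩
    · have := toIcoMod_mem_Ico Real.two_pi_pos 0 t
      rw [zero_add] at this
      exact Ico_subset_Icc_self this
    · have h1 := toIcoMod_add_toIcoDiv_zsmul Real.two_pi_pos 0 t
      have h2 := hγ.tube_add_int_period (toIcoMod Real.two_pi_pos 0 t) s (toIcoDiv Real.two_pi_pos 0 t)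
      rw [← h2]
      congr 2
      rw [← h1]
      simp
  have hcptI : IsCompact (tube (P.inner i) '' (univ ×ˢ Icc (-(δ / 2)) (δ / 2))) := by
    rw [hTper]
    exact (isCompact_Icc.prod isCompact_Icc).image hγ.contDiff_tube.continuous
  -- The frontier of the hole is the slice `s = 0` and is already in `T`. This description shows
  -- that `T` is compact.
  have hTeq : T = closure (P.hole i) ∪ tube (P.inner i) '' (univ ×ˢ Icc (-(δ / 2)) (δ / 2)) := by
    refine Subset.antisymm (union_subset_union_left _ subset_closure) (union_subset ?_ subset_union_right)
    rw [closure_eq_self_union_frontier]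
    refine union_subset subset_union_left fun x hx => Or.inr ?_
    obtain ⟨t, rfl⟩ : x ∈ range (P.inner i) := hγ.range_eq ▸ hx
    exact ⟨(t, 0), ⟨mem_univ _, by constructor <;> linarith⟩, by simp [tube]⟩
  have hTcpt : IsCompact T := by
    rw [hTeq]; exact (P.isCompact_closure_hole i).union hcptI
  have hKT : closure (P.hole i) ⊆ interior T := by
    have hw := (hδ.mono (half_pos hδ0) (by linarith)).isOpen_image hγ
    have h1 : P.hole i ∪ tube (P.inner i) '' (univ ×ˢ Ioo (-(δ / 2)) (δ / 2)) ⊆ interior T :=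
      interior_maximal (union_subset_union_right _ (image_mono (prod_mono_right Ioo_subset_Icc_self)))
        ((P.smooth_hole i).isOpen.union hw)
    refine Subset.trans ?_ h1
    rw [closure_eq_self_union_frontier]
    refine union_subset_union_right _ fun x hx => ?_
    obtain ⟨t, rfl⟩ : x ∈ range (P.inner i) := hγ.range_eq ▸ hx
    exact ⟨(t, 0), ⟨mem_univ _, by constructor <;> linarith⟩, by simp [tube]⟩
  obtain ⟨η, hη1, hη0, -⟩ := exists_contMDiffMap_one_nhds_of_subset_interior (n := (⊤ : ℕ∞))
    (modelWithCornersSelf ℝ ℂ) isClosed_closure hKT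
  have hev0 : ∀ x ∉ T, ∀ᶠ y in 𝓝 x, η y = 0 := fun x hx => by
    filter_upwards [hTcpt.isClosed.isOpen_compl.mem_nhds hx] with y hy using hη0 y hy
  refine ⟨δ, η, hcollar, η.contMDiff.contDiff, HasCompactSupport.intro hTcpt fun x hx => hη0 x hx,
    fun p hp => eventually_nhdsSet_iff_forall.1 hη1 p (frontier_subset_closure hp),
    fun p hp => hev0 p fun hpT => ?_, fun t => hη0 _ fun hpT => ?_, fun x hx => hev0 x fun hxT => ?_⟩
  · have hpc := frontier_subset_closure hp.1
    rw [P.isOpen_dom.frontier_eq] at hp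
    rcases hTeq ▸ hpT with h | ⟨⟨t, s⟩, ⟨-, hs⟩, rfl⟩
    · exact hp.2 (P.mem_frontier_hole hpc h)
    · rcases lt_trichotomy s 0 with h0 | h0 | h0
      · exact hp.1.2 (hmemdom t s (by have := hs.1; linarith) h0)
      · refine hp.2 ?_
        rw [h0]
        simpa [tube] using hγ.mem_frontier t
      · exact P.not_mem_hole_of_mem_closure hpc i (hδ.mem t s h0 (by have := hs.2; linarith))
  · have hcl : tube (P.inner i) (t, -δ) ∈ closure P.dom := by
      have hten : Tendsto (fun s : ℝ => tube (P.inner i) (t, s)) (𝓝[>] (-δ))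
          (𝓝 (tube (P.inner i) (t, -δ))) :=
        (hγ.contDiff_tube.continuous.comp (by fun_prop : Continuous fun s : ℝ => (t, s))).continuousWithinAt
      refine mem_closure_of_tendsto hten ?_
      filter_upwards [Ioo_mem_nhdsGT (show -δ < 0 by linarith)] with s hs using hmemdom t s hs.1 hs.2
    have hnh := P.not_mem_hole_of_mem_closure hcl i
    rcases hpT with h | ⟨⟨t', s⟩, ⟨-, hs⟩, e⟩
    · exact hnh h
    · simp only [mem_Icc] at hs
      have := (hδ₀.inj t' s t (-δ) (abs_lt.2 ⟨by linarith, by linarith⟩)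
        (abs_lt.2 ⟨by linarith, by linarith⟩) e).1
      linarith
  · have hxd := hx.1
    rcases hTeq ▸ hxT with h | ⟨⟨t, s⟩, ⟨-, hs⟩, rfl⟩
    · exact hxd.2 (mem_iUnion.2 ⟨i, h⟩)
    · simp only [mem_Icc] at hs
      rcases lt_or_ge s 0 with h0 | h0
      · refine hx.2 ⟨(toIcoMod Real.two_pi_pos 0 t, s), ⟨?_, by linarith, h0⟩, ?_⟩
        · simpa using toIcoMod_mem_Ico Real.two_pi_pos 0 t
        · have h1 := toIcoMod_add_toIcoDiv_zsmul Real.two_pi_pos 0 t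
          have h2 := hγ.tube_add_int_period (toIcoMod Real.two_pi_pos 0 t) s
            (toIcoDiv Real.two_pi_pos 0 t)
          rw [← h2]
          congr 2
          rw [← h1]
          simp
      · refine hxd.2 (mem_iUnion.2 ⟨i, ?_⟩)
        rcases h0.eq_or_lt with h0 | h0
        · rw [← h0]
          simpa [tube] using frontier_subset_closure (hγ.mem_frontier t)
        · exact subset_closure (hδ.mem t s h0 (by linarith))

end PerforatedDomain

/-! ### Green's formula in a collar -/

theorem hasFDerivAt_cross {E : Type*} [NormedAddCommGroup E] [NormedSpace ℝ E] {f g : E → ℂ}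
    {f' g' : E →L[ℝ] ℂ} {x : E} (hf : HasFDerivAt f f' x) (hg : HasFDerivAt g g' x) :
    HasFDerivAt (fun y => cross (f y) (g y))
      (crossL.precompR E (f x) g' + crossL.precompL E f' (g x)) x := by
  simpa only [crossL_apply] using crossL.hasFDerivAt_of_bilinear hf hg

/-- The derivative along `t` of a function of `(t, s)`. -/
def partialFst {E : Type*} [NormedAddCommGroup E] [NormedSpace ℝ E] (F : ℝ × ℝ → E) (p : ℝ × ℝ) : E :=
  fderiv ℝ F p (1, 0)

/-- The derivative along `s` of a function of `(t, s)`. -/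
def partialSnd {E : Type*} [NormedAddCommGroup E] [NormedSpace ℝ E] (F : ℝ × ℝ → E) (p : ℝ × ℝ) : E :=
  fderiv ℝ F p (0, 1)

section partials

variable {E : Type*} [NormedAddCommGroup E] [NormedSpace ℝ E] {F : ℝ × ℝ → E}

theorem contDiff_partialFst (hF : ContDiff ℝ ∞ F) : ContDiff ℝ ∞ (partialFst F) :=
  (hF.fderiv_right (m := ∞) (by simp)).clm_apply contDiff_const

theorem contDiff_partialSnd (hF : ContDiff ℝ ∞ F) : ContDiff ℝ ∞ (partialSnd F) :=
  (hF.fderiv_right (m := ∞) (by simp)).clm_apply contDiff_const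

theorem partialFst_partialSnd (hF : ContDiff ℝ ∞ F) (p : ℝ × ℝ) :
    partialFst (partialSnd F) p = partialSnd (partialFst F) p := by
  have hd : DifferentiableAt ℝ (fderiv ℝ F) p :=
    ((hF.fderiv_right (m := ∞) (by simp)).differentiable (by simp)) p
  have h1 : ∀ v w, fderiv ℝ (fun q => fderiv ℝ F q v) p w = fderiv ℝ (fderiv ℝ F) p w v := by
    intro v w
    rw [(hd.hasFDerivAt.clm_apply (hasFDerivAt_const v p)).fderiv]
    simp
  have hsymm : IsSymmSndFDerivAt ℝ F p :=
    hF.contDiffAt.isSymmSndFDerivAt (by simp; exact WithTop.coe_le_coe.2 le_top)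
  change fderiv ℝ (fun q => fderiv ℝ F q (0, 1)) p (1, 0) =
    fderiv ℝ (fun q => fderiv ℝ F q (1, 0)) p (0, 1)
  rw [h1, h1, hsymm.eq]

theorem hasDerivAt_partialFst (hF : ContDiff ℝ ∞ F) (t s : ℝ) :
    HasDerivAt (fun t => F (t, s)) (partialFst F (t, s)) t := by
  have h := (hF.differentiable (by simp) (t, s)).hasFDerivAt
  exact h.comp_hasDerivAt t ((hasDerivAt_id t).prodMk (hasDerivAt_const t s))

theorem hasDerivAt_partialSnd (hF : ContDiff ℝ ∞ F) (t s : ℝ) :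
    HasDerivAt (fun s => F (t, s)) (partialSnd F (t, s)) s := by
  have h := (hF.differentiable (by simp) (t, s)).hasFDerivAt
  exact h.comp_hasDerivAt s ((hasDerivAt_const s t).prodMk (hasDerivAt_id s))

theorem periodic_partialFst (hF : ContDiff ℝ ∞ F) {T : ℝ} (hp : ∀ t s, F (t + T, s) = F (t, s))
    (t s : ℝ) : partialFst F (t + T, s) = partialFst F (t, s) := by
  have h3 : HasDerivAt (fun t => F (t, s)) (partialFst F (t, s)) (t + T - T) := by
    rw [add_sub_cancel_right]
    exact hasDerivAt_partialFst hF t s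
  refine (hasDerivAt_partialFst hF (t + T) s).unique
    ((h3.comp_sub_const (t + T) T).congr_of_eventuallyEq (Eventually.of_forall fun x => ?_))
  have := hp (x - T) s
  rwa [sub_add_cancel] at this

theorem periodic_partialSnd (hF : ContDiff ℝ ∞ F) {T : ℝ} (hp : ∀ t s, F (t + T, s) = F (t, s))
    (t s : ℝ) : partialSnd F (t + T, s) = partialSnd F (t, s) :=
  (hasDerivAt_partialSnd hF (t + T) s).unique
    ((hasDerivAt_partialSnd hF t s).congr_of_eventuallyEq (Eventually.of_forall fun x => hp t x))

end partials

theorem continuous_cross {X : Type*} [TopologicalSpace X] {f g : X → ℂ} (hf : Continuous f)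
    (hg : Continuous g) : Continuous fun x => cross (f x) (g x) := by
  unfold cross; fun_prop

/-- Green's formula on a periodic strip. -/
theorem integral_strip {F : ℝ × ℝ → ℂ} {χ : ℝ × ℝ → ℝ} (hF : ContDiff ℝ ∞ F) (hχ : ContDiff ℝ ∞ χ)
    {T : ℝ} (hT : 0 ≤ T) (hFp : ∀ t s, F (t + T, s) = F (t, s))
    (hχp : ∀ t s, χ (t + T, s) = χ (t, s)) {a b : ℝ} (hab : a ≤ b) :
    ∫ p in Icc 0 T ×ˢ Icc a b, (partialSnd χ p * cross (F p) (partialFst F p) -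
        partialFst χ p * cross (F p) (partialSnd F p) +
        2 * (χ p * cross (partialSnd F p) (partialFst F p))) =
      (∫ t in (0)..T, χ (t, b) * cross (F (t, b)) (partialFst F (t, b))) -
        ∫ t in (0)..T, χ (t, a) * cross (F (t, a)) (partialFst F (t, a)) := by
  have hF1 := contDiff_partialFst hF
  have hF2 := contDiff_partialSnd hF
  have hdF : ∀ p, HasFDerivAt F (fderiv ℝ F p) p := fun p => (hF.differentiable (by simp) p).hasFDerivAt
  have hdχ : ∀ p, HasFDerivAt χ (fderiv ℝ χ p) p := fun p => (hχ.differentiable (by simp) p).hasFDerivAt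
  have hd1 : ∀ p, HasFDerivAt (partialFst F) (fderiv ℝ (partialFst F) p) p :=
    fun p => (hF1.differentiable (by simp) p).hasFDerivAt
  have hd2 : ∀ p, HasFDerivAt (partialSnd F) (fderiv ℝ (partialSnd F) p) p :=
    fun p => (hF2.differentiable (by simp) p).hasFDerivAt
  have hf := fun p => ((hdχ p).fun_mul (hasFDerivAt_cross (hdF p) (hd2 p))).fun_neg
  have hg := fun p => (hdχ p).fun_mul (hasFDerivAt_cross (hdF p) (hd1 p))
  have hcf : Continuous fun p => -(χ p * cross (F p) (partialSnd F p)) :=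
    (hχ.continuous.mul (continuous_cross hF.continuous hF2.continuous)).neg
  have hcg : Continuous fun p => χ p * cross (F p) (partialFst F p) :=
    hχ.continuous.mul (continuous_cross hF.continuous hF1.continuous)
  have key : ∀ p, (-(χ p • (crossL.precompR (ℝ × ℝ) (F p) (fderiv ℝ (partialSnd F) p) +
        crossL.precompL (ℝ × ℝ) (fderiv ℝ F p) (partialSnd F p)) +
        cross (F p) (partialSnd F p) • fderiv ℝ χ p) : ℝ × ℝ →L[ℝ] ℝ) (1, 0) +
      (χ p • (crossL.precompR (ℝ × ℝ) (F p) (fderiv ℝ (partialFst F) p) +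
        crossL.precompL (ℝ × ℝ) (fderiv ℝ F p) (partialFst F p)) +
        cross (F p) (partialFst F p) • fderiv ℝ χ p : ℝ × ℝ →L[ℝ] ℝ) (0, 1) =
      partialSnd χ p * cross (F p) (partialFst F p) -
        partialFst χ p * cross (F p) (partialSnd F p) +
        2 * (χ p * cross (partialSnd F p) (partialFst F p)) := by
    intro p
    have hs : fderiv ℝ (partialSnd F) p (1, 0) = fderiv ℝ (partialFst F) p (0, 1) :=
      partialFst_partialSnd hF p
    simp only [neg_apply, add_apply, smul_apply, ContinuousLinearMap.precompR_apply,
      ContinuousLinearMap.compL_apply, ContinuousLinearMap.comp_apply,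
      ContinuousLinearMap.precompL_apply, crossL_apply, hs, smul_eq_mul]
    rw [cross_swap (partialSnd F p) (fderiv ℝ F p (1, 0))]
    simp only [partialFst, partialSnd, cross]
    ring
  have hcont : Continuous fun p => partialSnd χ p * cross (F p) (partialFst F p) -
        partialFst χ p * cross (F p) (partialSnd F p) +
        2 * (χ p * cross (partialSnd F p) (partialFst F p)) :=
    ((((contDiff_partialSnd hχ).continuous.mul (continuous_cross hF.continuous hF1.continuous)).sub
      ((contDiff_partialFst hχ).continuous.mul (continuous_cross hF.continuous hF2.continuous))).add
      (continuous_const.mul (hχ.continuous.mul (continuous_cross hF2.continuous hF1.continuous))))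
  -- The divergence theorem for the field `(-χ F × ∂ₛF, χ F × ∂ₜF)`: mixed second derivatives cancel
  -- and the products of first derivatives add up. The sides `t = 0` and `t = T` cancel by
  -- periodicity.
  have h := integral_divergence_prod_Icc_of_hasFDerivAt_of_le
    (fun p => -(χ p * cross (F p) (partialSnd F p))) (fun p => χ p * cross (F p) (partialFst F p))
    _ _ (0, a) (T, b) (Prod.mk_le_mk.2 ⟨hT, hab⟩) hcf.continuousOn hcg.continuousOn
    (fun p _ => hf p) (fun p _ => hg p)
    (by
      simp only [key]
      exact hcont.continuousOn.integrableOn_compact isCompact_Icc)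
  simp only [key] at h
  rw [Icc_prod_Icc, h]
  have hp : ∀ s, F (T, s) = F (0, s) := fun s => by simpa using hFp 0 s
  have hχ' : ∀ s, χ (T, s) = χ (0, s) := fun s => by simpa using hχp 0 s
  have hp2 : ∀ s, partialSnd F (T, s) = partialSnd F (0, s) := fun s => by
    simpa using periodic_partialSnd hF hFp 0 s
  simp only [hp, hχ', hp2]
  ring

/-- The integral `∫ F × ∂ₜF dt` over a period of the slice at height `s`. -/
def sliceDegree (F : ℝ × ℝ → ℂ) (s : ℝ) : ℝ :=
  ∫ t in (0)..(2 * Real.pi), cross (F (t, s)) (partialFst F (t, s))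

theorem collarRect_ae_eq (δ : ℝ) :
    (collarRect δ : Set (ℝ × ℝ)) =ᵐ[volume] Icc 0 (2 * Real.pi) ×ˢ Icc (-δ) 0 :=
  Measure.set_prod_ae_eq Ico_ae_eq_Icc Ioo_ae_eq_Icc

namespace IsCollar

variable {D : Set ℂ} {γ : ℝ → ℂ} {δ : ℝ} {φ : ℂ → ℂ}

theorem contDiff_comp {E : Type*} [NormedAddCommGroup E] [NormedSpace ℝ E] {φ : ℂ → E}
    (h : IsCollar D γ δ) (hφ : ContDiff ℝ ∞ φ) : ContDiff ℝ ∞ fun p => φ (tube γ p) :=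
  hφ.comp h.contDiff

theorem fderiv_comp {E : Type*} [NormedAddCommGroup E] [NormedSpace ℝ E] {φ : ℂ → E}
    (h : IsCollar D γ δ) (hφ : ContDiff ℝ ∞ φ) (p v : ℝ × ℝ) :
    fderiv ℝ (fun q => φ (tube γ q)) p v =
      (fderiv ℝ (tube γ) p v).re • fderiv ℝ φ (tube γ p) 1 +
        (fderiv ℝ (tube γ) p v).im • fderiv ℝ φ (tube γ p) Complex.I := by
  have h1 := ((hφ.differentiable (by simp) (tube γ p)).hasFDerivAt.comp p (h.hasFDerivAt p)).fderiv
  rw [Function.comp_def] at h1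
  rw [h1, ContinuousLinearMap.comp_apply, ← map_smul, ← map_smul, ← map_add]
  congr 1
  apply Complex.ext <;> simp

/-- Multiplicativity of the determinant under the chain rule. -/
theorem cross_partial (h : IsCollar D γ δ) (hφ : ContDiff ℝ ∞ φ) (p : ℝ × ℝ) :
    cross (partialFst (fun q => φ (tube γ q)) p) (partialSnd (fun q => φ (tube γ q)) p) =
      tubeJac γ p * cross (fderiv ℝ φ (tube γ p) 1) (fderiv ℝ φ (tube γ p) Complex.I) := by
  rw [partialFst, partialSnd, h.fderiv_comp hφ, h.fderiv_comp hφ, tubeJac]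
  simp only [cross, Complex.add_re, Complex.add_im, Complex.real_smul, Complex.re_ofReal_mul,
    Complex.im_ofReal_mul]
  ring

/-- Green's formula in a collar, with a cutoff function `η` which vanishes outside of the collar and
is equal to one on the boundary curve. -/
theorem integral_green (h : IsCollar D γ δ) (hD : MeasurableSet D) (hφ : ContDiff ℝ ∞ φ)
    {η : ℂ → ℝ} (hη : ContDiff ℝ ∞ η) (h1 : ∀ t, η (γ t) = 1) (h0 : ∀ t, η (tube γ (t, -δ)) = 0)
    (hz : ∀ x ∈ D \ tube γ '' collarRect δ, ∀ᶠ y in 𝓝 x, η y = 0) :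
    ∫ x in D, (fderiv ℝ η x 1 * cross (φ x) (fderiv ℝ φ x Complex.I) -
        fderiv ℝ η x Complex.I * cross (φ x) (fderiv ℝ φ x 1) +
        2 * (η x * cross (fderiv ℝ φ x 1) (fderiv ℝ φ x Complex.I))) =
      -sliceDegree (fun p => φ (tube γ p)) 0 := by
  set F := fun p => φ (tube γ p) with hFdef
  set χ := fun p => η (tube γ p) with hχdef
  have hF : ContDiff ℝ ∞ F := h.contDiff_comp hφ
  have hχ : ContDiff ℝ ∞ χ := h.contDiff_comp hη
  have hs := integral_strip hF hχ Real.two_pi_pos.le (fun t s => congrArg φ (h.periodic t s))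
    (fun t s => congrArg η (h.periodic t s)) (neg_nonpos.2 h.pos.le)
  rw [← setIntegral_congr_set (collarRect_ae_eq δ)] at hs
  -- Outside the collar `η` and its gradient vanish. In the collar coordinates the integrand times
  -- the Jacobian is the negative of the integrand of `integral_strip`, whence the sign of the
  -- result.
  rw [setIntegral_eq_of_subset_of_forall_sdiff_eq_zero hD h.image_subset, h.setIntegral_image,
    sliceDegree, ← neg_eq_iff_eq_neg, ← integral_neg]
  · have e1 : ∀ t, χ (t, 0) = 1 := fun t => by simpa [hχdef, tube] using h1 t
    have e0 : ∀ t, χ (t, -δ) = 0 := fun t => h0 t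
    simp only [e1, e0, zero_mul, one_mul, intervalIntegral.integral_zero, sub_zero] at hs
    rw [← hs]
    refine integral_congr_ae (Eventually.of_forall fun p => ?_)
    simp only [partialFst, partialSnd, hFdef, hχdef]
    rw [h.fderiv_comp hφ, h.fderiv_comp hφ, h.fderiv_comp hη, h.fderiv_comp hη, tubeJac]
    simp only [cross, Complex.add_re, Complex.add_im, Complex.real_smul, Complex.re_ofReal_mul,
      Complex.im_ofReal_mul, smul_eq_mul]
    ring
  · intro x hx
    have hev := hz x hx
    have hd : fderiv ℝ η x = 0 := by
      have : η =ᶠ[𝓝 x] fun _ => (0 : ℝ) := hev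
      rw [this.fderiv_eq]; simp
    simp [hd, hev.self_of_nhds]

/-- The slice integrals vary at most by the integral of the Jacobian. -/
theorem abs_sliceDegree_sub_le (h : IsCollar D γ δ) (hφ : ContDiff ℝ ∞ φ)
    (hi : IntegrableOn (fun x => cross (fderiv ℝ φ x 1) (fderiv ℝ φ x Complex.I)) D) {s : ℝ}
    (hs : -δ < s) (hs0 : s < 0) :
    |sliceDegree (fun p => φ (tube γ p)) 0 - sliceDegree (fun p => φ (tube γ p)) s| ≤
      2 * ∫ x in D, |cross (fderiv ℝ φ x 1) (fderiv ℝ φ x Complex.I)| := by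
  set F := fun p => φ (tube γ p) with hFdef
  have hF : ContDiff ℝ ∞ F := h.contDiff_comp hφ
  -- With `χ = 1` only the Jacobian term is left in the interior, and the boundary terms are the two
  -- slice integrals.
  have hst := integral_strip hF (χ := fun _ => 1) contDiff_const Real.two_pi_pos.le
    (fun t s => congrArg φ (h.periodic t s)) (fun t s => rfl) hs0.le
  have hz : ∀ p, partialFst (fun _ : ℝ × ℝ => (1 : ℝ)) p = 0 ∧
      partialSnd (fun _ : ℝ × ℝ => (1 : ℝ)) p = 0 := fun p => by simp [partialFst, partialSnd]
  simp only [(hz _).1, (hz _).2, zero_mul, one_mul, sub_zero, zero_add] at hst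
  rw [sliceDegree, sliceDegree, ← hst, integral_const_mul, abs_mul, abs_two]
  have hc : Continuous fun p => cross (partialSnd F p) (partialFst F p) :=
    continuous_cross (contDiff_partialSnd hF).continuous (contDiff_partialFst hF).continuous
  have hint : IntegrableOn (fun p => |cross (partialSnd F p) (partialFst F p)|)
      (Icc 0 (2 * Real.pi) ×ˢ Icc (-δ) 0) :=
    hc.abs.continuousOn.integrableOn_compact (isCompact_Icc.prod isCompact_Icc)
  gcongr
  calc |∫ p in Icc 0 (2 * Real.pi) ×ˢ Icc s 0, cross (partialSnd F p) (partialFst F p)|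
      ≤ ∫ p in Icc 0 (2 * Real.pi) ×ˢ Icc s 0, |cross (partialSnd F p) (partialFst F p)| :=
        abs_integral_le_integral_abs
    _ ≤ ∫ p in Icc 0 (2 * Real.pi) ×ˢ Icc (-δ) 0, |cross (partialSnd F p) (partialFst F p)| :=
        setIntegral_mono_set hint (Eventually.of_forall fun _ => abs_nonneg _)
          (prod_mono_right (Icc_subset_Icc_left hs.le)).eventuallyLE
    _ = ∫ p in collarRect δ, |cross (partialSnd F p) (partialFst F p)| :=
        (setIntegral_congr_set (collarRect_ae_eq δ)).symm
    _ = ∫ p in collarRect δ, tubeJac γ p *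
          |cross (fderiv ℝ φ (tube γ p) 1) (fderiv ℝ φ (tube γ p) Complex.I)| := by
        obtain ⟨c, hc0, hJ⟩ := h.exists_jac
        refine setIntegral_congr_fun (measurableSet_collarRect δ) fun p hp => ?_
        rw [cross_swap (partialFst F p), abs_neg, h.cross_partial hφ, abs_mul,
          abs_of_pos (hc0.trans_le (hJ p.1 p.2 hp.2.1.le hp.2.2.le))]
    _ = ∫ x in tube γ '' collarRect δ, |cross (fderiv ℝ φ x 1) (fderiv ℝ φ x Complex.I)| :=
        (h.setIntegral_image fun x => |cross (fderiv ℝ φ x 1) (fderiv ℝ φ x Complex.I)|).symm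
    _ ≤ ∫ x in D, |cross (fderiv ℝ φ x 1) (fderiv ℝ φ x Complex.I)| :=
        setIntegral_mono_set hi.abs (Eventually.of_forall fun _ => abs_nonneg _)
          h.image_subset.eventuallyLE

end IsCollar

/-! ### Fourier coefficients along a boundary curve -/

theorem memLp_period_of_continuous {g : ℝ → ℂ} (hg : Continuous g) (p : ENNReal) :
    MemLp g p periodMeasure := by
  obtain ⟨C, hC⟩ := ((isCompact_Icc (a := (0 : ℝ)) (b := 2 * Real.pi)).image hg).isBounded.exists_norm_le
  have hfin : IsFiniteMeasure periodMeasure := by unfold periodMeasure; infer_instance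
  refine MemLp.of_bound hg.aestronglyMeasurable C ?_
  filter_upwards [ae_restrict_mem measurableSet_Ioc] with t ht
  exact hC _ ⟨t, Ioc_subset_Icc_self ht, rfl⟩

theorem hasSum_sq_fcoeff {g : ℝ → ℂ} (hg : MemLp g 2 periodMeasure) :
    HasSum (fun k => ‖fcoeff g k‖ ^ 2) ((2 * Real.pi)⁻¹ * ∫ t in (0)..(2 * Real.pi), ‖g t‖ ^ 2) := by
  have h := hasSum_sq_fourierCoeffOn Real.two_pi_pos hg
  rwa [sub_zero, smul_eq_mul] at h

theorem fcoeff_eq_integral (g : ℝ → ℂ) (k : ℤ) :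
    fcoeff g k = (2 * Real.pi)⁻¹ • ∫ t in (0)..(2 * Real.pi),
      fourier (-k) (t : AddCircle (2 * Real.pi - 0)) • g t := by
  rw [fcoeff, fourierCoeffOn_eq_integral, sub_zero, one_div]

theorem norm_fourier_apply {T : ℝ} (k : ℤ) (x : AddCircle T) : ‖(fourier k x : ℂ)‖ = 1 := by
  rw [fourier_apply]; exact Circle.norm_coe _

theorem continuous_fourier_coe (k : ℤ) :
    Continuous fun t : ℝ => (fourier k (t : AddCircle (2 * Real.pi - 0)) : ℂ) :=
  (fourier k).continuous.comp (AddCircle.continuous_mk' _)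

theorem intervalIntegrable_fourier_smul {g : ℝ → ℂ} (hg : MemLp g 2 periodMeasure) (k : ℤ) :
    IntervalIntegrable (fun t : ℝ => fourier k (t : AddCircle (2 * Real.pi - 0)) • g t) volume
      0 (2 * Real.pi) := by
  have hfin : IsFiniteMeasure periodMeasure := by unfold periodMeasure; infer_instance
  rw [intervalIntegrable_iff_integrableOn_Ioc_of_le Real.two_pi_pos.le]
  refine (hg.integrable (by norm_num)).bdd_mul (c := 1)
    (continuous_fourier_coe k).aestronglyMeasurable ?_
  exact Eventually.of_forall fun t => (norm_fourier_apply k _).le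

theorem fcoeff_add {f g : ℝ → ℂ} (hf : MemLp f 2 periodMeasure) (hg : MemLp g 2 periodMeasure)
    (k : ℤ) : fcoeff (fun t => f t + g t) k = fcoeff f k + fcoeff g k := by
  simp only [fcoeff_eq_integral, smul_add]
  rw [intervalIntegral.integral_add (intervalIntegrable_fourier_smul hf _)
    (intervalIntegrable_fourier_smul hg _), smul_add]

theorem fcoeff_const_mul (f : ℝ → ℂ) (c : ℂ) (k : ℤ) :
    fcoeff (fun t => c * f t) k = c * fcoeff f k :=
  fourierCoeffOn.const_mul f c k _

theorem fcoeff_sub {f g : ℝ → ℂ} (hf : MemLp f 2 periodMeasure) (hg : MemLp g 2 periodMeasure)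
    (k : ℤ) : fcoeff (fun t => f t - g t) k = fcoeff f k - fcoeff g k := by
  have h := fcoeff_add hf (hg.const_mul (-1)) k
  rw [fcoeff_const_mul] at h
  simpa [sub_eq_add_neg] using h

theorem fcoeff_deriv {f f' : ℝ → ℂ} (hf : ∀ t, HasDerivAt f (f' t) t) (hf' : Continuous f')
    (hp : f (2 * Real.pi) = f 0) (k : ℤ) : fcoeff f' k = Complex.I * k * fcoeff f k := by
  by_cases hk : k = 0
  · subst hk
    rw [fcoeff_eq_integral]
    simp only [neg_zero, fourier_zero, one_smul, Int.cast_zero, mul_zero, zero_mul]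
    rw [intervalIntegral.integral_eq_sub_of_hasDerivAt (fun t _ => hf t)
      (hf'.intervalIntegrable _ _), hp, sub_self, smul_zero]
  · rw [fcoeff, fcoeff, fourierCoeffOn_of_hasDerivAt Real.two_pi_pos hk (fun t _ => hf t)
      (hf'.intervalIntegrable _ _), hp, sub_self, mul_zero, zero_sub]
    have hk' : (k : ℂ) ≠ 0 := by exact_mod_cast hk
    have hpi : (Real.pi : ℂ) ≠ 0 := by exact_mod_cast Real.pi_ne_zero
    push_cast
    field_simp
    ring

theorem norm_fcoeff_sub_sq_le {f g : ℝ → ℂ} (hf : MemLp f 2 periodMeasure)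
    (hg : MemLp g 2 periodMeasure) (k : ℤ) :
    ENNReal.ofReal (‖fcoeff f k - fcoeff g k‖ ^ 2) ≤
      ENNReal.ofReal (2 * Real.pi)⁻¹ * eLpNorm (fun t => f t - g t) 2 periodMeasure ^ 2 := by
  have h := hasSum_sq_fcoeff (hf.sub hg)
  have h1 : ‖fcoeff (f - g) k‖ ^ 2 ≤ _ := le_hasSum h k fun _ _ => by positivity
  have h2 : fcoeff (f - g) k = fcoeff f k - fcoeff g k := fcoeff_sub hf hg k
  rw [h2] at h1
  refine (ENNReal.ofReal_le_ofReal h1).trans ?_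
  rw [ENNReal.ofReal_mul (by positivity), intervalIntegral.integral_of_le Real.two_pi_pos.le,
    eLpNorm_two_sq, ofReal_integral_eq_lintegral_ofReal]
  · refine le_of_eq ?_
    congr 1
    refine lintegral_congr fun t => ?_
    rw [ENNReal.ofReal_pow (norm_nonneg _), ofReal_norm]
    rfl
  · exact (memLp_two_iff_integrable_sq_norm (hf.sub hg).1).1 (hf.sub hg)
  · exact Eventually.of_forall fun _ => by positivity

theorem tendsto_fcoeff {ι : Type*} {l : Filter ι} {f : ι → ℝ → ℂ} {g : ℝ → ℂ}
    (hf : ∀ n, MemLp (f n) 2 periodMeasure) (hg : MemLp g 2 periodMeasure)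
    (h : Tendsto (fun n => eLpNorm (fun t => f n t - g t) 2 periodMeasure) l (𝓝 0)) (k : ℤ) :
    Tendsto (fun n => fcoeff (f n) k) l (𝓝 (fcoeff g k)) := by
  rw [tendsto_iff_norm_sub_tendsto_zero]
  have h1 : Tendsto (fun n => ENNReal.ofReal (2 * Real.pi)⁻¹ *
      eLpNorm (fun t => f n t - g t) 2 periodMeasure ^ 2) l (𝓝 0) := by
    have := ENNReal.Tendsto.const_mul (a := ENNReal.ofReal (2 * Real.pi)⁻¹)
      (((ENNReal.continuous_pow 2).tendsto 0).comp h) (Or.inr ENNReal.ofReal_ne_top)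
    simpa using this
  have h2 := tendsto_of_tendsto_of_tendsto_of_le_of_le tendsto_const_nhds h1
    (fun _ => zero_le) (fun n => norm_fcoeff_sub_sq_le (hf n) hg k)
  have h3 := (ENNReal.continuousAt_toReal (by simp)).tendsto.comp h2
  simp only [Function.comp_def, ENNReal.toReal_zero] at h3
  have h4 := (Real.continuous_sqrt.tendsto 0).comp h3
  simp only [Function.comp_def, Real.sqrt_zero] at h4
  refine h4.congr fun n => ?_
  rw [ENNReal.toReal_ofReal (by positivity), Real.sqrt_sq (norm_nonneg _)]

theorem hasSum_of_eq {ι : Type*} {f : ι → ℝ} {a b : ℝ} (h : HasSum f a) (e : b = a) : HasSum f b :=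
  e ▸ h

/-- The degree integral of a smooth closed curve in terms of Fourier coefficients. -/
theorem hasSum_int_mul_sq_fcoeff {f f' : ℝ → ℂ} (hf : ∀ t, HasDerivAt f (f' t) t)
    (hf' : Continuous f') (hp : f (2 * Real.pi) = f 0) :
    HasSum (fun k : ℤ => (k : ℝ) * ‖fcoeff f k‖ ^ 2)
      ((2 * Real.pi)⁻¹ * ∫ t in (0)..(2 * Real.pi), cross (f t) (f' t)) := by
  have hc : Continuous f := continuous_iff_continuousAt.2 fun t => (hf t).continuousAt
  have m1 := memLp_period_of_continuous hc 2
  have m2 := memLp_period_of_continuous hf' 2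
  -- Polarisation: `|f - i f'|² = |f|² + |f'|² + 2 f × f'`. On the Fourier side `(1 + k)² - 1 - k² =
  -- 2k`, so Parseval for the three squares gives the signed series.
  have m3 : MemLp (fun t => f t + (-Complex.I) * f' t) 2 periodMeasure :=
    memLp_period_of_continuous (hc.add (continuous_const.mul hf')) 2
  have e3 : ∀ k : ℤ, ‖fcoeff (fun t => f t + (-Complex.I) * f' t) k‖ ^ 2 =
      (1 + (k : ℝ)) ^ 2 * ‖fcoeff f k‖ ^ 2 := fun k => by
    rw [fcoeff_add m1 (m2.const_mul _), fcoeff_const_mul, fcoeff_deriv hf hf' hp]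
    have : fcoeff f k + -Complex.I * (Complex.I * k * fcoeff f k) =
        (((1 + (k : ℝ) : ℝ)) : ℂ) * fcoeff f k := by
      push_cast
      linear_combination (-(k : ℂ) * fcoeff f k) * Complex.I_sq
    rw [this, norm_mul, mul_pow, Complex.norm_real, Real.norm_eq_abs, sq_abs]
  have e2 : ∀ k : ℤ, ‖fcoeff f' k‖ ^ 2 = (k : ℝ) ^ 2 * ‖fcoeff f k‖ ^ 2 := fun k => by
    rw [fcoeff_deriv hf hf' hp, norm_mul, norm_mul, Complex.norm_I, one_mul, Complex.norm_intCast,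
      mul_pow, sq_abs]
  have h := ((hasSum_sq_fcoeff m3).sub ((hasSum_sq_fcoeff m1).add (hasSum_sq_fcoeff m2))).mul_left (1 / 2)
  have hA : (fun k : ℤ => (k : ℝ) * ‖fcoeff f k‖ ^ 2) = fun k : ℤ =>
      1 / 2 * (‖fcoeff (fun t => f t + (-Complex.I) * f' t) k‖ ^ 2 -
        (‖fcoeff f k‖ ^ 2 + ‖fcoeff f' k‖ ^ 2)) := by
    funext k
    rw [e3, e2]
    ring
  rw [hA]
  refine hasSum_of_eq h ?_
  rw [← mul_add, ← mul_sub, ← intervalIntegral.integral_add, ← intervalIntegral.integral_sub,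
    mul_left_comm, ← intervalIntegral.integral_const_mul (1 / 2)]
  · congr 1
    refine intervalIntegral.integral_congr fun t _ => ?_
    simp only [← Complex.normSq_eq_norm_sq, Complex.normSq_apply, cross]
    simp
    ring
  all_goals exact Continuous.intervalIntegrable (by fun_prop) _ _

/-- Differentiation of Fourier coefficients with respect to a parameter. -/
theorem hasDerivAt_fcoeff {F : ℝ × ℝ → ℂ} (hF : ContDiff ℝ ∞ F) (k : ℤ) (s : ℝ) :
    HasDerivAt (fun s => fcoeff (fun t => F (t, s)) k) (fcoeff (fun t => partialSnd F (t, s)) k) s := by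
  simp only [fcoeff_eq_integral]
  obtain ⟨C, hC⟩ := (((isCompact_Icc (a := (0 : ℝ)) (b := 2 * Real.pi)).prod
    (isCompact_closedBall s 1)).image (contDiff_partialSnd hF).continuous).isBounded.exists_norm_le
  have hcf := continuous_fourier_coe (-k)
  have hcF := hF.continuous
  have hcF2 := (contDiff_partialSnd hF).continuous
  refine HasDerivAt.fun_const_smul (2 * Real.pi)⁻¹
    (intervalIntegral.hasDerivAt_integral_of_dominated_loc_of_deriv_le (bound := fun _ => C)
    (F' := fun s t => fourier (-k) (t : AddCircle (2 * Real.pi - 0)) • partialSnd F (t, s))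
    (Metric.closedBall_mem_nhds s one_pos) (Eventually.of_forall fun x => ?_) ?_ ?_ ?_
    intervalIntegrable_const ?_).2
  · exact (hcf.smul (by fun_prop)).aestronglyMeasurable
  · exact (hcf.smul (by fun_prop)).intervalIntegrable _ _
  · exact (hcf.smul (by fun_prop)).aestronglyMeasurable
  · refine Eventually.of_forall fun t ht x hx => ?_
    rw [norm_smul, norm_fourier_apply, one_mul]
    rw [uIoc_of_le Real.two_pi_pos.le] at ht
    exact hC _ ⟨(t, x), ⟨Ioc_subset_Icc_self ht, hx⟩, rfl⟩
  · exact Eventually.of_forall fun t ht x hx => (hasDerivAt_partialSnd hF t x).fun_const_smul _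

/-- The squared length of the first order jet of a function on a strip. -/
def jetSq (F : ℝ × ℝ → ℂ) (p : ℝ × ℝ) : ℝ :=
  ‖F p‖ ^ 2 + ‖partialFst F p‖ ^ 2 + ‖partialSnd F p‖ ^ 2

theorem continuous_jetSq {F : ℝ × ℝ → ℂ} (hF : ContDiff ℝ ∞ F) : Continuous (jetSq F) := by
  have h1 := hF.continuous
  have h2 := (contDiff_partialFst hF).continuous
  have h3 := (contDiff_partialSnd hF).continuous
  unfold jetSq; fun_prop

/-- The `H^{1/2}` norm of the boundary values is controlled by the `H¹` norm in the strip. -/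
theorem sum_fcoeff_le {F : ℝ × ℝ → ℂ} (hF : ContDiff ℝ ∞ F)
    (hp : ∀ t s, F (t + 2 * Real.pi, s) = F (t, s)) {δ : ℝ} (hδ : 0 < δ) (S : Finset ℤ) :
    ∑ k ∈ S, (1 + |(k : ℝ)|) * ‖fcoeff (fun t => F (t, 0)) k‖ ^ 2 ≤
      (2 * (1 / δ + 1)) * ((2 * Real.pi)⁻¹ *
        ∫ p in Icc 0 (2 * Real.pi) ×ˢ Icc (-δ) 0, jetSq F p) := by
  set K := 2 * (1 / δ + 1) with hK
  have hK1 : 1 ≤ K := by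
    have : 0 < 1 / δ := by positivity
    rw [hK]; linarith
  have h1 := contDiff_partialFst hF
  have h2 := contDiff_partialSnd hF
  set c : ℤ → ℝ → ℂ := fun k s => fcoeff (fun t => F (t, s)) k with hc
  set d : ℤ → ℝ → ℂ := fun k s => fcoeff (fun t => partialSnd F (t, s)) k with hd
  have hcd : ∀ k s, HasDerivAt (c k) (d k s) s := fun k s => hasDerivAt_fcoeff hF k s
  have hcc : ∀ k, Continuous (c k) := fun k =>
    continuous_iff_continuousAt.2 fun s => (hcd k s).continuousAt
  have hdc : ∀ k, Continuous (d k) := fun k =>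
    continuous_iff_continuousAt.2 fun s => (hasDerivAt_fcoeff h2 k s).continuousAt
  set q : ℤ → ℝ → ℝ := fun k s => K * (‖c k s‖ ^ 2 + (k : ℝ) ^ 2 * ‖c k s‖ ^ 2 + ‖d k s‖ ^ 2) with hq
  have hqc : ∀ k, Continuous (q k) := fun k => by
    have := hcc k; have := hdc k
    simp only [hq]; fun_prop
  set G : ℝ → ℝ := fun s => K * ((2 * Real.pi)⁻¹ * ∫ t in (0)..(2 * Real.pi), jetSq F (t, s)) with hG
  have hj := continuous_jetSq hF
  have hGc : Continuous G := by
    refine continuous_const.mul (continuous_const.mul ?_)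
    exact intervalIntegral.continuous_parametric_intervalIntegral_of_continuous'
      (f := fun s t => jetSq F (t, s)) (by fun_prop) _ _
  have hsumq : ∀ s, HasSum (fun k => q k s) (G s) := fun s => by
    have m1 := hasSum_sq_fcoeff (g := fun t => F (t, s)) (memLp_period_of_continuous
      (hF.continuous.comp (by fun_prop : Continuous fun t : ℝ => (t, s))) 2)
    have m2 := hasSum_sq_fcoeff (g := fun t => partialFst F (t, s)) (memLp_period_of_continuous
      (h1.continuous.comp (by fun_prop : Continuous fun t : ℝ => (t, s))) 2)
    have m3 := hasSum_sq_fcoeff (g := fun t => partialSnd F (t, s)) (memLp_period_of_continuous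
      (h2.continuous.comp (by fun_prop : Continuous fun t : ℝ => (t, s))) 2)
    have e2 : ∀ k : ℤ, ‖fcoeff (fun t => partialFst F (t, s)) k‖ ^ 2 =
        (k : ℝ) ^ 2 * ‖c k s‖ ^ 2 := fun k => by
      rw [fcoeff_deriv (f := fun t => F (t, s)) (fun t => hasDerivAt_partialFst hF t s)
        (h1.continuous.comp (by fun_prop)) (by simpa using hp 0 s),
        norm_mul, norm_mul, Complex.norm_I, one_mul, Complex.norm_intCast, mul_pow, sq_abs]
    simp only [e2] at m2
    have h := ((m1.add m2).add m3).mul_left K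
    refine hasSum_of_eq h ?_
    rw [hG]
    simp only [jetSq]
    rw [← mul_add, ← mul_add, intervalIntegral.integral_add, intervalIntegral.integral_add]
    all_goals
      have := h1.continuous; have := h2.continuous; have := hF.continuous
      exact Continuous.intervalIntegrable (by fun_prop) _ _
  -- The weight `1 + s / δ` is `1` at the boundary and `0` at depth `δ`, so the boundary value is
  -- the integral of the derivative of `(1 + s / δ) ‖c k s‖²`. With `m = 1 + |k|`, the bounds `2 m
  -- ‖c‖ ‖d‖ ≤ m² ‖c‖² + ‖d‖²` and `m² ≤ 2 (1 + k²)` leave the tangential and normal derivatives,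
  -- with the constant `K`.
  have hk : ∀ k : ℤ, (1 + |(k : ℝ)|) * ‖c k 0‖ ^ 2 ≤ ∫ s in (-δ)..0, q k s := by
    intro k
    set m := 1 + |(k : ℝ)| with hm
    have hm1 : 1 ≤ m := by rw [hm]; linarith [abs_nonneg (k : ℝ)]
    have hder : ∀ s ∈ uIcc (-δ) 0, HasDerivAt (fun s => m * ((1 + s / δ) * ‖c k s‖ ^ 2))
        (m * ((1 / δ) * ‖c k s‖ ^ 2 + (1 + s / δ) * (2 * inner ℝ (c k s) (d k s)))) s := fun s _ =>
      ((((hasDerivAt_id s).div_const δ).const_add 1).fun_mul (hcd k s).norm_sq).const_mul m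
    have hcont : Continuous fun s => m * ((1 / δ) * ‖c k s‖ ^ 2 +
        (1 + s / δ) * (2 * inner ℝ (c k s) (d k s))) := by
      have := hcc k; have := hdc k
      fun_prop
    have hft := intervalIntegral.integral_eq_sub_of_hasDerivAt hder (hcont.intervalIntegrable _ _)
    have e0 : m * ((1 + 0 / δ) * ‖c k 0‖ ^ 2) - m * ((1 + -δ / δ) * ‖c k (-δ)‖ ^ 2) =
        m * ‖c k 0‖ ^ 2 := by
      field_simp; ring
    rw [e0] at hft
    rw [← hft]
    refine intervalIntegral.integral_mono_on (by linarith) (hcont.intervalIntegrable _ _)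
      ((hqc k).intervalIntegrable _ _) fun s hs => ?_
    have hin := abs_le.1 (abs_real_inner_le_norm (c k s) (d k s))
    have hs0 : 0 ≤ 1 + s / δ := by
      have : -1 ≤ s / δ := by rw [le_div_iff₀ hδ]; linarith [hs.1]
      linarith
    have hs1 : 1 + s / δ ≤ 1 := by
      have : s / δ ≤ 0 := div_nonpos_of_nonpos_of_nonneg hs.2 hδ.le
      linarith
    set x := ‖c k s‖ with hx
    set y := ‖d k s‖ with hy
    have hx0 : 0 ≤ x := norm_nonneg _
    have hy0 : 0 ≤ y := norm_nonneg _
    have hsq : m ^ 2 ≤ 2 * (1 + (k : ℝ) ^ 2) := by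
      rw [hm]; nlinarith [sq_nonneg (1 - |(k : ℝ)|), sq_abs (k : ℝ)]
    have hinv : 0 < 1 / δ := by positivity
    have s1 : (1 + s / δ) * (2 * inner ℝ (c k s) (d k s)) ≤ 2 * (x * y) := by
      have hxy : 0 ≤ x * y := mul_nonneg hx0 hy0
      calc (1 + s / δ) * (2 * inner ℝ (c k s) (d k s)) ≤ (1 + s / δ) * (2 * (x * y)) := by
            gcongr; exact hin.2
        _ ≤ 1 * (2 * (x * y)) := by gcongr
        _ = _ := one_mul _
    calc m * ((1 / δ) * x ^ 2 + (1 + s / δ) * (2 * inner ℝ (c k s) (d k s)))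
        ≤ m * ((1 / δ) * x ^ 2 + 2 * (x * y)) := by gcongr
      _ ≤ (1 / δ) * (m ^ 2 * x ^ 2) + (m ^ 2 * x ^ 2 + y ^ 2) := by
          have a1 : m * x ^ 2 ≤ m ^ 2 * x ^ 2 := by
            gcongr; nlinarith
          have a2 : 2 * (m * x) * y ≤ (m * x) ^ 2 + y ^ 2 := two_mul_le_add_sq _ _
          nlinarith [mul_le_mul_of_nonneg_left a1 hinv.le]
      _ = (1 / δ + 1) * (m ^ 2 * x ^ 2) + y ^ 2 := by ring
      _ ≤ (1 / δ + 1) * (2 * (1 + (k : ℝ) ^ 2) * x ^ 2) + K * y ^ 2 := by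
          gcongr
          nlinarith [sq_nonneg y]
      _ = K * (x ^ 2 + (k : ℝ) ^ 2 * x ^ 2 + y ^ 2) := by rw [hK]; ring
  calc ∑ k ∈ S, (1 + |(k : ℝ)|) * ‖c k 0‖ ^ 2 ≤ ∑ k ∈ S, ∫ s in (-δ)..0, q k s :=
        Finset.sum_le_sum fun k _ => hk k
    _ = ∫ s in (-δ)..0, ∑ k ∈ S, q k s :=
        (intervalIntegral.integral_finsetSum fun k _ => (hqc k).intervalIntegrable _ _).symm
    _ ≤ ∫ s in (-δ)..0, G s := by
        refine intervalIntegral.integral_mono_on (by linarith)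
          ((continuous_finsetSum _ fun k _ => hqc k).intervalIntegrable _ _)
          (hGc.intervalIntegrable _ _) fun s _ => sum_le_hasSum S (fun k _ => ?_) (hsumq s)
        simp only [hq]; positivity
    _ = K * ((2 * Real.pi)⁻¹ * ∫ p in Icc 0 (2 * Real.pi) ×ˢ Icc (-δ) 0, jetSq F p) := by
        rw [hG, intervalIntegral.integral_const_mul, intervalIntegral.integral_const_mul]
        congr 2
        rw [Measure.volume_eq_prod, ← Measure.prod_restrict, integral_prod_symm _ (by
            rw [Measure.prod_restrict]
            exact hj.continuousOn.integrableOn_compact (isCompact_Icc.prod isCompact_Icc)),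
          intervalIntegral.integral_of_le (by linarith), integral_Icc_eq_integral_Ioc]
        refine integral_congr_ae (Eventually.of_forall fun s => ?_)
        simp only
        rw [intervalIntegral.integral_of_le Real.two_pi_pos.le, integral_Icc_eq_integral_Ioc]

/-! ### Traces on boundary curves -/

/-- The `H¹` norm on `D` of a smooth function. -/
def h1Norm (D : Set ℂ) (φ : ℂ → ℂ) : ENNReal :=
  eLpNorm φ 2 (volume.restrict D) + eLpNorm (fun x => fderiv ℝ φ x 1) 2 (volume.restrict D) +
    eLpNorm (fun x => fderiv ℝ φ x Complex.I) 2 (volume.restrict D)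

/-- The `H¹` distance on `D` of a smooth function to `u`. -/
def h1Err (D : Set ℂ) (u φ : ℂ → ℂ) : ENNReal :=
  eLpNorm (fun x => φ x - u x) 2 (volume.restrict D) +
    eLpNorm (fun x => fderiv ℝ φ x 1 - weakDeriv D 1 u x) 2 (volume.restrict D) +
    eLpNorm (fun x => fderiv ℝ φ x Complex.I - weakDeriv D Complex.I u x) 2 (volume.restrict D)

theorem H1Tendsto.tendsto_h1Err {D : Set ℂ} {u : ℂ → ℂ} {φ : ℕ → ℂ → ℂ} (h : H1Tendsto D φ u) :
    Tendsto (fun n => h1Err D u (φ n)) atTop (𝓝 0) := by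
  have := (h.2.1.add (h.2.2 1 (by simp))).add (h.2.2 Complex.I (by simp))
  simpa [h1Err] using this

theorem eLpNorm_sub_le_of_sub {μ : Measure ℂ} {f g w : ℂ → ℂ} (hf : AEStronglyMeasurable f μ)
    (hg : AEStronglyMeasurable g μ) (hw : AEStronglyMeasurable w μ) :
    eLpNorm (fun x => f x - g x) 2 μ ≤
      eLpNorm (fun x => f x - w x) 2 μ + eLpNorm (fun x => g x - w x) 2 μ := by
  have h := eLpNorm_sub_le (p := 2) (hf.sub hw) (hg.sub hw) (by norm_num)
  have e : f - w - (g - w) = fun x => f x - g x := by funext x; simp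
  rw [e] at h
  exact h

theorem h1Norm_sub_le {D : Set ℂ} {u φ ψ : ℂ → ℂ} (hu : MemH1 D u) (hφ : ContDiff ℝ ∞ φ)
    (hψ : ContDiff ℝ ∞ ψ) : h1Norm D (fun x => φ x - ψ x) ≤ h1Err D u φ + h1Err D u ψ := by
  have hc : ∀ {f : ℂ → ℂ} (_ : ContDiff ℝ ∞ f) (e : ℂ),
      AEStronglyMeasurable (fun x => fderiv ℝ f x e) (volume.restrict D) := fun hf e =>
    (continuous_fderiv_apply_of_contDiff hf (by simp) e).aestronglyMeasurable
  have hd : ∀ e, (fun x => fderiv ℝ (fun y => φ y - ψ y) x e) =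
      fun x => fderiv ℝ φ x e - fderiv ℝ ψ x e := fun e => by
    funext x
    rw [fderiv_fun_sub (hφ.differentiable (by simp) x) (hψ.differentiable (by simp) x)]
    rfl
  rw [h1Norm, hd, hd, h1Err, h1Err]
  have h0 := eLpNorm_sub_le_of_sub (μ := volume.restrict D) hφ.continuous.aestronglyMeasurable
    hψ.continuous.aestronglyMeasurable hu.1.1
  have h1 := eLpNorm_sub_le_of_sub (hc hφ 1) (hc hψ 1) hu.isWeakDeriv_one.1.1
  have h2 := eLpNorm_sub_le_of_sub (hc hφ Complex.I) (hc hψ Complex.I) hu.isWeakDeriv_I.1.1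
  refine (add_le_add (add_le_add h0 h1) h2).trans (le_of_eq ?_)
  ring

theorem h1Norm_lt_top {D : Set ℂ} (hb : Bornology.IsBounded D) {φ : ℂ → ℂ} (hφ : ContDiff ℝ ∞ φ) :
    h1Norm D φ < ⊤ := by
  have h : ∀ e, eLpNorm (fun x => fderiv ℝ φ x e) 2 (volume.restrict D) < ⊤ := fun e =>
    (memLp_of_continuous hb (continuous_fderiv_apply_of_contDiff hφ (by simp) e) 2).2
  exact ENNReal.add_lt_top.2 ⟨ENNReal.add_lt_top.2
    ⟨(memLp_of_continuous hb hφ.continuous 2).2, h 1⟩, h Complex.I⟩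

theorem lintegral_jet_le (D : Set ℂ) {φ : ℂ → ℂ} (hφ : ContDiff ℝ ∞ φ) :
    ∫⁻ x in D, ENNReal.ofReal (‖φ x‖ ^ 2 + ‖fderiv ℝ φ x 1‖ ^ 2 + ‖fderiv ℝ φ x Complex.I‖ ^ 2) ≤
      h1Norm D φ ^ 2 := by
  have hc : ∀ e, Continuous fun x => fderiv ℝ φ x e :=
    fun e => continuous_fderiv_apply_of_contDiff hφ (by simp) e
  have e : ∀ x, ENNReal.ofReal (‖φ x‖ ^ 2 + ‖fderiv ℝ φ x 1‖ ^ 2 + ‖fderiv ℝ φ x Complex.I‖ ^ 2) =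
      ‖φ x‖ₑ ^ 2 + ‖fderiv ℝ φ x 1‖ₑ ^ 2 + ‖fderiv ℝ φ x Complex.I‖ₑ ^ 2 := fun x => by
    rw [ENNReal.ofReal_add (by positivity) (by positivity),
      ENNReal.ofReal_add (by positivity) (by positivity)]
    simp only [ENNReal.ofReal_pow (norm_nonneg _), ofReal_norm]
  simp only [e]
  have hm0 : Measurable fun x => ‖φ x‖ₑ ^ 2 := hφ.continuous.enorm.measurable.pow_const 2
  have hm1 : Measurable fun x => ‖fderiv ℝ φ x 1‖ₑ ^ 2 := (hc 1).enorm.measurable.pow_const 2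
  have hm01 : Measurable fun x => ‖φ x‖ₑ ^ 2 + ‖fderiv ℝ φ x 1‖ₑ ^ 2 := hm0.add hm1
  rw [lintegral_add_left hm01, lintegral_add_left hm0, ← eLpNorm_two_sq, ← eLpNorm_two_sq,
    ← eLpNorm_two_sq, h1Norm]
  generalize eLpNorm φ 2 (volume.restrict D) = a
  generalize eLpNorm (fun x => fderiv ℝ φ x 1) 2 (volume.restrict D) = b
  generalize eLpNorm (fun x => fderiv ℝ φ x Complex.I) 2 (volume.restrict D) = c
  have : (a + b + c) ^ 2 = a ^ 2 + b ^ 2 + c ^ 2 + (2 * a * b + 2 * a * c + 2 * b * c) := by ring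
  rw [this]
  exact le_self_add

namespace IsCollar

variable {D : Set ℂ} {γ : ℝ → ℂ} {δ : ℝ}

/-- The `H¹` norm in the collar coordinates is controlled by the `H¹` norm. -/
theorem exists_lintegral_jetSq_le (h : IsCollar D γ δ) : ∃ C : NNReal, ∀ φ : ℂ → ℂ, ContDiff ℝ ∞ φ →
    ∫⁻ p in collarRect δ, ENNReal.ofReal (jetSq (fun p => φ (tube γ p)) p) ≤ C * h1Norm D φ ^ 2 := by
  obtain ⟨C₀, hC₀⟩ := h.exists_setLIntegral_comp_le
  have hK : IsCompact (Icc 0 (2 * Real.pi) ×ˢ Icc (-δ) (0 : ℝ)) := isCompact_Icc.prod isCompact_Icc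
  obtain ⟨A, hA⟩ := (hK.image (contDiff_partialFst h.contDiff).continuous).isBounded.exists_norm_le
  obtain ⟨B, hB⟩ := (hK.image (contDiff_partialSnd h.contDiff).continuous).isBounded.exists_norm_le
  set K : NNReal := Real.toNNReal (1 + 2 * A ^ 2 + 2 * B ^ 2) with hKdef
  refine ⟨K * C₀, fun φ hφ => ?_⟩
  have hest : ∀ (M : ℝ) (z a b : ℂ), ‖z‖ ≤ M → ‖z.re • a + z.im • b‖ ^ 2 ≤
      2 * M ^ 2 * (‖a‖ ^ 2 + ‖b‖ ^ 2) := by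
    intro M z a b hz
    have hM : 0 ≤ M := (norm_nonneg _).trans hz
    have h1 : ‖z.re • a + z.im • b‖ ≤ M * (‖a‖ + ‖b‖) := by
      refine (norm_add_le _ _).trans ?_
      rw [norm_smul, norm_smul, Real.norm_eq_abs, Real.norm_eq_abs, mul_add]
      gcongr
      · exact (Complex.abs_re_le_norm z).trans hz
      · exact (Complex.abs_im_le_norm z).trans hz
    calc ‖z.re • a + z.im • b‖ ^ 2 ≤ (M * (‖a‖ + ‖b‖)) ^ 2 := by gcongr
      _ ≤ _ := by nlinarith [mul_nonneg (sq_nonneg M) (sq_nonneg (‖a‖ - ‖b‖))]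
  calc ∫⁻ p in collarRect δ, ENNReal.ofReal (jetSq (fun p => φ (tube γ p)) p)
      ≤ ∫⁻ p in collarRect δ, K * ENNReal.ofReal (‖φ (tube γ p)‖ ^ 2 +
          ‖fderiv ℝ φ (tube γ p) 1‖ ^ 2 + ‖fderiv ℝ φ (tube γ p) Complex.I‖ ^ 2) := by
        refine setLIntegral_mono' (measurableSet_collarRect δ) fun p hp => ?_
        have hpK : p ∈ Icc 0 (2 * Real.pi) ×ˢ Icc (-δ) (0 : ℝ) :=
          ⟨Ico_subset_Icc_self hp.1, Ioo_subset_Icc_self hp.2⟩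
        rw [hKdef, ← ENNReal.ofReal, ← ENNReal.ofReal_mul (by positivity)]
        refine ENNReal.ofReal_le_ofReal ?_
        have e1 := hest A _ (fderiv ℝ φ (tube γ p) 1) (fderiv ℝ φ (tube γ p) Complex.I)
          (hA _ ⟨p, hpK, rfl⟩)
        have e2 := hest B _ (fderiv ℝ φ (tube γ p) 1) (fderiv ℝ φ (tube γ p) Complex.I)
          (hB _ ⟨p, hpK, rfl⟩)
        rw [jetSq]
        simp only [partialFst, partialSnd, h.fderiv_comp hφ] at e1 e2 ⊢
        nlinarith [sq_nonneg ‖φ (tube γ p)‖, sq_nonneg A, sq_nonneg B,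
          mul_nonneg (sq_nonneg A) (sq_nonneg ‖φ (tube γ p)‖),
          mul_nonneg (sq_nonneg B) (sq_nonneg ‖φ (tube γ p)‖),
          sq_nonneg ‖fderiv ℝ φ (tube γ p) 1‖, sq_nonneg ‖fderiv ℝ φ (tube γ p) Complex.I‖]
    _ = K * ∫⁻ p in collarRect δ, ENNReal.ofReal (‖φ (tube γ p)‖ ^ 2 +
          ‖fderiv ℝ φ (tube γ p) 1‖ ^ 2 + ‖fderiv ℝ φ (tube γ p) Complex.I‖ ^ 2) :=
        lintegral_const_mul' _ _ (by simp)
    _ ≤ K * (C₀ * h1Norm D φ ^ 2) := by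
        gcongr
        exact (hC₀ fun x => ENNReal.ofReal (‖φ x‖ ^ 2 + ‖fderiv ℝ φ x 1‖ ^ 2 +
          ‖fderiv ℝ φ x Complex.I‖ ^ 2)).trans (mul_le_mul_right (lintegral_jet_le D hφ) _)
    _ = ((K * C₀ : NNReal) : ENNReal) * h1Norm D φ ^ 2 := by
        rw [ENNReal.coe_mul, mul_assoc]

/-- The boundary values of smooth functions are controlled in `H^{1/2}` by the `H¹` norm. -/
theorem exists_sum_fcoeff_le (h : IsCollar D γ δ) : ∃ C : NNReal, ∀ φ : ℂ → ℂ, ContDiff ℝ ∞ φ →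
    ∀ S : Finset ℤ, ENNReal.ofReal (∑ k ∈ S, (1 + |(k : ℝ)|) * ‖fcoeff (fun t => φ (γ t)) k‖ ^ 2) ≤
      C * h1Norm D φ ^ 2 := by
  obtain ⟨C, hC⟩ := h.exists_lintegral_jetSq_le
  set K : NNReal := Real.toNNReal ((2 * (1 / δ + 1)) * (2 * Real.pi)⁻¹) with hK
  refine ⟨K * C, fun φ hφ S => ?_⟩
  have hF := h.contDiff_comp hφ
  have hs := sum_fcoeff_le hF (fun t s => congrArg φ (h.periodic t s)) h.pos S
  have e0 : (fun t => φ (tube γ (t, 0))) = fun t => φ (γ t) := by funext t; simp [tube]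
  rw [e0, ← mul_assoc (2 * (1 / δ + 1))] at hs
  have hδ := h.pos
  refine (ENNReal.ofReal_le_ofReal hs).trans ?_
  rw [ENNReal.ofReal_mul (by positivity), ENNReal.coe_mul, mul_assoc (K : ENNReal)]
  refine mul_le_mul_right ((le_of_eq ?_).trans (hC φ hφ)) _
  rw [← setIntegral_congr_set (collarRect_ae_eq δ), ofReal_integral_eq_lintegral_ofReal]
  · exact ((continuous_jetSq hF).continuousOn.integrableOn_compact
      (isCompact_Icc.prod isCompact_Icc)).congr_set_ae (collarRect_ae_eq δ)
  · exact Eventually.of_forall fun p => by simp only [jetSq, Pi.zero_apply]; positivity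

/-- By Parseval the `L²` norm of the boundary values is a sum of squared coefficients, smaller than
the weighted sum already estimated. -/
theorem exists_eLpNorm_trace_le (h : IsCollar D γ δ) (hγ : Continuous γ) :
    ∃ C : NNReal, ∀ φ : ℂ → ℂ, ContDiff ℝ ∞ φ →
      eLpNorm (fun t => φ (γ t)) 2 periodMeasure ≤ C * h1Norm D φ := by
  obtain ⟨C, hC⟩ := h.exists_sum_fcoeff_le
  set K : NNReal := Real.toNNReal (2 * Real.pi) * C with hK
  refine ⟨NNReal.sqrt K, fun φ hφ => ?_⟩
  have hm := memLp_period_of_continuous (hφ.continuous.comp hγ) 2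
  rw [← ENNReal.pow_le_pow_left_iff two_ne_zero, mul_pow, ← ENNReal.coe_pow, NNReal.sq_sqrt]
  have hsum : HasSum (fun k => ‖fcoeff (fun t => φ (γ t)) k‖ ^ 2) _ := hasSum_sq_fcoeff hm
  have hnn : ∀ k, 0 ≤ ‖fcoeff (fun t => φ (γ t)) k‖ ^ 2 := fun k => by positivity
  have e1 : eLpNorm (fun t => φ (γ t)) 2 periodMeasure ^ 2 = ENNReal.ofReal (2 * Real.pi) *
      ∑' k, ENNReal.ofReal (‖fcoeff (fun t => φ (γ t)) k‖ ^ 2) := by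
    rw [← ENNReal.ofReal_tsum_of_nonneg hnn hsum.summable, hsum.tsum_eq,
      ← ENNReal.ofReal_mul (by positivity), ← mul_assoc, mul_inv_cancel₀ (by positivity), one_mul,
      intervalIntegral.integral_of_le Real.two_pi_pos.le, eLpNorm_two_sq,
      ofReal_integral_eq_lintegral_ofReal]
    · refine lintegral_congr fun t => ?_
      rw [ENNReal.ofReal_pow (norm_nonneg _), ofReal_norm]
    · exact (memLp_two_iff_integrable_sq_norm hm.1).1 hm
    · exact Eventually.of_forall fun _ => by positivity
  rw [e1, hK, ENNReal.coe_mul, mul_assoc]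
  refine mul_le_mul_right ?_ _
  rw [ENNReal.tsum_eq_iSup_sum]
  refine iSup_le fun S => ?_
  rw [← ENNReal.ofReal_sum_of_nonneg fun k _ => hnn k]
  refine (ENNReal.ofReal_le_ofReal (Finset.sum_le_sum fun k _ => ?_)).trans (hC φ hφ S)
  nlinarith [hnn k, abs_nonneg (k : ℝ), mul_nonneg (abs_nonneg (k : ℝ)) (hnn k)]

/-- Existence of traces. -/
theorem exists_trace (h : IsCollar D γ δ) (hγ : Continuous γ) {u : ℂ → ℂ} (hu : MemH1 D u)
    {φ : ℕ → ℂ → ℂ} (hφ : H1Tendsto D φ u) : ∃ g, MemLp g 2 periodMeasure ∧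
      Tendsto (fun n => eLpNorm (fun t => φ n (γ t) - g t) 2 periodMeasure) atTop (𝓝 0) := by
  obtain ⟨C, hC⟩ := h.exists_eLpNorm_trace_le hγ
  have hm : ∀ n, MemLp (fun t => φ n (γ t)) 2 periodMeasure := fun n =>
    memLp_period_of_continuous ((hφ.1 n).continuous.comp hγ) 2
  have ht : Tendsto (fun n => (C : ENNReal) * h1Err D u (φ n)) atTop (𝓝 0) := by
    have := ENNReal.Tendsto.const_mul (a := (C : ENNReal)) hφ.tendsto_h1Err
      (Or.inr ENNReal.coe_ne_top)
    rwa [mul_zero] at this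
  have hcau : CauchySeq fun n => (hm n).toLp (fun t => φ n (γ t)) := by
    rw [EMetric.cauchySeq_iff]
    intro ε hε
    have hε2 : 0 < ε / 2 := ENNReal.half_pos hε.ne'
    obtain ⟨n₀, hn₀⟩ := eventually_atTop.1 (ht.eventually_lt_const hε2)
    refine ⟨n₀, fun n hn m hm' => ?_⟩
    rw [Lp.edist_toLp_toLp]
    have hsub : ((fun t => φ n (γ t)) - fun t => φ m (γ t)) =
        fun t => φ n (γ t) - φ m (γ t) := rfl
    rw [hsub]
    calc eLpNorm (fun t => φ n (γ t) - φ m (γ t)) 2 periodMeasure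
        ≤ C * h1Norm D (fun x => φ n x - φ m x) :=
          hC (fun x => φ n x - φ m x) ((hφ.1 n).sub (hφ.1 m))
      _ ≤ C * (h1Err D u (φ n) + h1Err D u (φ m)) := by
          gcongr; exact h1Norm_sub_le hu (hφ.1 n) (hφ.1 m)
      _ = C * h1Err D u (φ n) + C * h1Err D u (φ m) := mul_add _ _ _
      _ < ε / 2 + ε / 2 := ENNReal.add_lt_add (hn₀ n hn) (hn₀ m hm')
      _ = ε := ENNReal.add_halves ε
  obtain ⟨g, hg⟩ := cauchySeq_tendsto_of_complete hcau
  refine ⟨g, Lp.memLp g, ?_⟩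
  rw [tendsto_iff_edist_tendsto_0] at hg
  refine hg.congr fun n => ?_
  rw [Lp.edist_def]
  refine eLpNorm_congr_ae ?_
  filter_upwards [(hm n).coeFn_toLp] with t ht
  simp [ht]

/-- Convergence in `H^{1/2}` of the boundary values. -/
theorem exists_sum_fcoeff_sub_le (h : IsCollar D γ δ) (hγ : Continuous γ) :
    ∃ C : NNReal, ∀ {u : ℂ → ℂ} {φ : ℕ → ℂ → ℂ} {g : ℝ → ℂ}, MemH1 D u → H1Tendsto D φ u →
      MemLp g 2 periodMeasure →
      Tendsto (fun n => eLpNorm (fun t => φ n (γ t) - g t) 2 periodMeasure) atTop (𝓝 0) →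
      ∀ (n : ℕ) (S : Finset ℤ), ENNReal.ofReal (∑ k ∈ S, (1 + |(k : ℝ)|) *
        ‖fcoeff (fun t => φ n (γ t)) k - fcoeff g k‖ ^ 2) ≤ C * h1Err D u (φ n) ^ 2 := by
  obtain ⟨C, hC⟩ := h.exists_sum_fcoeff_le
  refine ⟨C, fun {u φ g} hu hφ hg ht n S => ?_⟩
  have hm : ∀ n, MemLp (fun t => φ n (γ t)) 2 periodMeasure := fun n =>
    memLp_period_of_continuous ((hφ.1 n).continuous.comp hγ) 2
  have hk := fun k => tendsto_fcoeff hm hg ht k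
  -- For a finite set of frequencies the bound for `φ n - φ m` passes to the limit `m → ∞`, because
  -- each Fourier coefficient converges.
  have h1 : Tendsto (fun m => ENNReal.ofReal (∑ k ∈ S, (1 + |(k : ℝ)|) *
      ‖fcoeff (fun t => φ n (γ t)) k - fcoeff (fun t => φ m (γ t)) k‖ ^ 2)) atTop
      (𝓝 (ENNReal.ofReal (∑ k ∈ S, (1 + |(k : ℝ)|) *
        ‖fcoeff (fun t => φ n (γ t)) k - fcoeff g k‖ ^ 2))) :=
    (ENNReal.continuous_ofReal.tendsto _).comp (tendsto_finsetSum _ fun k _ =>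
      (((tendsto_const_nhds.sub (hk k)).norm.pow 2).const_mul _))
  have h2 : Tendsto (fun m => (C : ENNReal) * (h1Err D u (φ n) + h1Err D u (φ m)) ^ 2) atTop
      (𝓝 (C * h1Err D u (φ n) ^ 2)) := by
    have h3 : Tendsto (fun m => h1Err D u (φ n) + h1Err D u (φ m)) atTop (𝓝 (h1Err D u (φ n))) := by
      simpa using hφ.tendsto_h1Err.const_add (h1Err D u (φ n))
    exact ENNReal.Tendsto.const_mul (((ENNReal.continuous_pow 2).tendsto _).comp h3)
      (Or.inr ENNReal.coe_ne_top)
  refine le_of_tendsto_of_tendsto' h1 h2 fun m => ?_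
  have h3 := hC _ ((hφ.1 n).sub (hφ.1 m)) S
  simp only [fcoeff_sub (hm n) (hm m)] at h3
  refine h3.trans ?_
  gcongr
  exact h1Norm_sub_le hu (hφ.1 n) (hφ.1 m)

end IsCollar

/-- Young's inequality with a free parameter: the part proportional to the fixed `‖b‖²` gets an
arbitrarily small coefficient. -/
theorem abs_sq_sub_sq_le {θ : ℝ} (hθ : 0 < θ) (a b : ℂ) :
    |‖a‖ ^ 2 - ‖b‖ ^ 2| ≤ (1 + 1 / θ) * ‖a - b‖ ^ 2 + θ * ‖b‖ ^ 2 := by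
  have h1 : |‖a‖ - ‖b‖| ≤ ‖a - b‖ := abs_norm_sub_norm_le a b
  set x := ‖a - b‖
  have hx : 0 ≤ x := (abs_nonneg _).trans h1
  have h2 : 2 * (x * ‖b‖) ≤ 1 / θ * x ^ 2 + θ * ‖b‖ ^ 2 := by
    have h3 : 0 ≤ 1 / θ * (x - θ * ‖b‖) ^ 2 := by positivity
    have h4 : 1 / θ * (x - θ * ‖b‖) ^ 2 = 1 / θ * x ^ 2 + θ * ‖b‖ ^ 2 - 2 * (x * ‖b‖) := by
      field_simp; ring
    linarith
  have h5 : |‖a‖ ^ 2 - ‖b‖ ^ 2| = |‖a‖ - ‖b‖| * (‖a‖ + ‖b‖) := by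
    rw [sq_sub_sq, abs_mul, mul_comm, abs_of_nonneg (by positivity : 0 ≤ ‖a‖ + ‖b‖)]
  rw [h5]
  have h6 : ‖a‖ + ‖b‖ ≤ x + 2 * ‖b‖ := by linarith [(abs_le.1 h1).2]
  calc |‖a‖ - ‖b‖| * (‖a‖ + ‖b‖) ≤ x * (x + 2 * ‖b‖) := by gcongr
    _ ≤ _ := by linarith [h2]

theorem _root_.HasSum.tendsto_finset {ι : Type*} {f : ι → ℝ} {a : ℝ} (h : HasSum f a) :
    Tendsto (fun S : Finset ι => ∑ k ∈ S, f k) atTop (𝓝 a) := by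
  rwa [HasSum, SummationFilter.unconditional_filter] at h

/-- Convergence of quadratic expressions which are controlled by a weighted `ℓ²` norm. -/
theorem tendsto_tsum_int_mul_sq {a : ℕ → ℤ → ℂ} {b : ℤ → ℂ} {r : ℕ → ℝ} {d : ℕ → ℝ}
    (hd : ∀ n, HasSum (fun k : ℤ => (k : ℝ) * ‖a n k‖ ^ 2) (d n))
    (hb : Summable fun k : ℤ => (1 + |(k : ℝ)|) * ‖b k‖ ^ 2)
    (hr : ∀ᶠ n in atTop, ∀ S : Finset ℤ, ∑ k ∈ S, (1 + |(k : ℝ)|) * ‖a n k - b k‖ ^ 2 ≤ r n)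
    (hr0 : Tendsto r atTop (𝓝 0)) : Tendsto d atTop (𝓝 (∑' k : ℤ, (k : ℝ) * ‖b k‖ ^ 2)) := by
  have hb' : Summable fun k : ℤ => (k : ℝ) * ‖b k‖ ^ 2 := by
    refine Summable.of_norm_bounded hb fun k => ?_
    rw [norm_mul, Real.norm_eq_abs, Real.norm_eq_abs, abs_of_nonneg (by positivity : 0 ≤ ‖b k‖ ^ 2)]
    gcongr
    linarith
  set W := ∑' k : ℤ, (1 + |(k : ℝ)|) * ‖b k‖ ^ 2 with hW
  have hW0 : 0 ≤ W := tsum_nonneg fun k => by positivity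
  rw [Metric.tendsto_atTop']
  intro ε hε
  -- With this choice the fixed weighted sum `W` contributes at most `ε / 2`; the other half is left
  -- to `r n`.
  set θ := ε / (2 * (W + 1)) with hθ
  have hθ0 : 0 < θ := by positivity
  have hev : ∀ᶠ n in atTop, (1 + 1 / θ) * r n < ε / 2 := by
    have : Tendsto (fun n => (1 + 1 / θ) * r n) atTop (𝓝 0) := by simpa using hr0.const_mul (1 + 1 / θ)
    exact this.eventually_lt_const (half_pos hε)
  obtain ⟨n₀, hn₀⟩ := eventually_atTop.1 (hev.and hr)
  refine ⟨n₀, fun n hn => ?_⟩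
  obtain ⟨h1, h2⟩ := hn₀ n hn.le
  rw [Real.dist_eq]
  have hlim : Tendsto (fun S : Finset ℤ => |(∑ k ∈ S, (k : ℝ) * ‖a n k‖ ^ 2) -
      ∑ k ∈ S, (k : ℝ) * ‖b k‖ ^ 2|) atTop (𝓝 |d n - ∑' k : ℤ, (k : ℝ) * ‖b k‖ ^ 2|) :=
    (((hd n).tendsto_finset).sub hb'.hasSum.tendsto_finset).abs
  refine (le_of_tendsto' hlim fun S => ?_ : _ ≤ (1 + 1 / θ) * r n + θ * W).trans_lt ?_
  · rw [← Finset.sum_sub_distrib]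
    calc |∑ k ∈ S, ((k : ℝ) * ‖a n k‖ ^ 2 - (k : ℝ) * ‖b k‖ ^ 2)|
        ≤ ∑ k ∈ S, |(k : ℝ) * ‖a n k‖ ^ 2 - (k : ℝ) * ‖b k‖ ^ 2| := Finset.abs_sum_le_sum_abs _ _
      _ ≤ ∑ k ∈ S, ((1 + 1 / θ) * ((1 + |(k : ℝ)|) * ‖a n k - b k‖ ^ 2) +
            θ * ((1 + |(k : ℝ)|) * ‖b k‖ ^ 2)) := by
          refine Finset.sum_le_sum fun k _ => ?_
          rw [← mul_sub, abs_mul]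
          calc |(k : ℝ)| * |‖a n k‖ ^ 2 - ‖b k‖ ^ 2|
              ≤ (1 + |(k : ℝ)|) * ((1 + 1 / θ) * ‖a n k - b k‖ ^ 2 + θ * ‖b k‖ ^ 2) := by
                gcongr
                · linarith
                · exact abs_sq_sub_sq_le hθ0 _ _
            _ = _ := by ring
      _ = (1 + 1 / θ) * ∑ k ∈ S, (1 + |(k : ℝ)|) * ‖a n k - b k‖ ^ 2 +
            θ * ∑ k ∈ S, (1 + |(k : ℝ)|) * ‖b k‖ ^ 2 := by
          rw [Finset.sum_add_distrib, Finset.mul_sum, Finset.mul_sum]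
      _ ≤ (1 + 1 / θ) * r n + θ * W := by
          gcongr
          · exact h2 S
          · exact hb.sum_le_tsum S fun k _ => by positivity
  · have : θ * W ≤ ε / 2 := by
      rw [hθ, div_mul_eq_mul_div, div_le_iff₀ (by positivity)]
      nlinarith
    linarith

/-- For a complex number `c`, `c × (i k c) = k |c|²`. -/
theorem curveDegree_eq_tsum (g : ℝ → ℂ) : curveDegree g = ∑' k : ℤ, (k : ℝ) * ‖fcoeff g k‖ ^ 2 := by
  rw [curveDegree, crossDuality, ← mul_assoc, one_div, inv_mul_cancel₀ (by positivity), one_mul]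
  refine tsum_congr fun k => ?_
  rw [derivCoeff, ← Complex.normSq_eq_norm_sq, Complex.normSq_apply]
  simp [cross]
  ring

namespace IsCollar

variable {D : Set ℂ} {γ : ℝ → ℂ} {δ : ℝ}

/-- Traces belong to `H^{1/2}`, and the degree of the trace is the limit of the degrees of the
approximations. -/
theorem memHHalf_and_tendsto (h : IsCollar D γ δ) (hγ : Continuous γ) (hb : Bornology.IsBounded D)
    {u : ℂ → ℂ} {φ : ℕ → ℂ → ℂ} {g : ℝ → ℂ} (hu : MemH1 D u) (hφ : H1Tendsto D φ u)
    (hg : MemLp g 2 periodMeasure)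
    (ht : Tendsto (fun n => eLpNorm (fun t => φ n (γ t) - g t) 2 periodMeasure) atTop (𝓝 0)) :
    MemHHalf g ∧ Tendsto (fun n => (2 * Real.pi)⁻¹ * sliceDegree (fun p => φ n (tube γ p)) 0) atTop
      (𝓝 (curveDegree g)) := by
  obtain ⟨C, hC⟩ := h.exists_sum_fcoeff_sub_le hγ
  obtain ⟨C', hC'⟩ := h.exists_sum_fcoeff_le
  have hfin : ∀ᶠ n in atTop, h1Err D u (φ n) < 1 :=
    hφ.tendsto_h1Err.eventually_lt_const zero_lt_one
  have hr : ∀ n, h1Err D u (φ n) < 1 → ∀ S : Finset ℤ, ∑ k ∈ S, (1 + |(k : ℝ)|) *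
      ‖fcoeff (fun t => φ n (γ t)) k - fcoeff g k‖ ^ 2 ≤ (C * h1Err D u (φ n) ^ 2).toReal := by
    intro n hn S
    refine (ENNReal.ofReal_le_iff_le_toReal ?_).1 (hC hu hφ hg ht n S)
    exact ENNReal.mul_ne_top ENNReal.coe_ne_top (ENNReal.pow_ne_top (hn.trans (by simp)).ne)
  have hr0 : Tendsto (fun n => (C * h1Err D u (φ n) ^ 2).toReal) atTop (𝓝 0) := by
    have : Tendsto (fun n => C * h1Err D u (φ n) ^ 2) atTop (𝓝 0) := by
      simpa using ENNReal.Tendsto.const_mul (a := (C : ENNReal))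
        (((ENNReal.continuous_pow 2).tendsto _).comp hφ.tendsto_h1Err) (Or.inr ENNReal.coe_ne_top)
    exact (ENNReal.continuousAt_toReal (by simp)).tendsto.comp this
  have hsum : Summable fun k : ℤ => (1 + |(k : ℝ)|) * ‖fcoeff g k‖ ^ 2 := by
    obtain ⟨n, hn⟩ := hfin.exists
    refine summable_of_sum_le (c := 2 * (C' * h1Norm D (φ n) ^ 2).toReal +
      2 * (C * h1Err D u (φ n) ^ 2).toReal) (fun k => by positivity) fun S => ?_
    have h1 : ∑ k ∈ S, (1 + |(k : ℝ)|) * ‖fcoeff (fun t => φ n (γ t)) k‖ ^ 2 ≤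
        (C' * h1Norm D (φ n) ^ 2).toReal :=
      (ENNReal.ofReal_le_iff_le_toReal (ENNReal.mul_ne_top ENNReal.coe_ne_top
        (ENNReal.pow_ne_top (h1Norm_lt_top hb (hφ.1 n)).ne))).1 (hC' _ (hφ.1 n) S)
    refine le_trans ?_ (add_le_add (mul_le_mul_of_nonneg_left h1 zero_le_two)
      (mul_le_mul_of_nonneg_left (hr n hn S) zero_le_two))
    rw [Finset.mul_sum, Finset.mul_sum, ← Finset.sum_add_distrib]
    refine Finset.sum_le_sum fun k _ => ?_
    set a := fcoeff (fun t => φ n (γ t)) k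
    have h2 : ‖fcoeff g k‖ ≤ ‖a‖ + ‖a - fcoeff g k‖ := by
      have := norm_sub_norm_le (fcoeff g k) a
      rw [norm_sub_rev] at this
      linarith
    have h3 : ‖fcoeff g k‖ ^ 2 ≤ 2 * ‖a‖ ^ 2 + 2 * ‖a - fcoeff g k‖ ^ 2 := by
      calc ‖fcoeff g k‖ ^ 2 ≤ (‖a‖ + ‖a - fcoeff g k‖) ^ 2 := by gcongr
        _ ≤ _ := by nlinarith [sq_nonneg (‖a‖ - ‖a - fcoeff g k‖)]
    calc (1 + |(k : ℝ)|) * ‖fcoeff g k‖ ^ 2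
        ≤ (1 + |(k : ℝ)|) * (2 * ‖a‖ ^ 2 + 2 * ‖a - fcoeff g k‖ ^ 2) := by gcongr
      _ = _ := by ring
  refine ⟨⟨hg, hsum⟩, ?_⟩
  rw [curveDegree_eq_tsum]
  refine tendsto_tsum_int_mul_sq (a := fun n k => fcoeff (fun t => φ n (γ t)) k) (fun n => ?_) hsum
    (hfin.mono fun n hn => hr n hn) hr0
  have hF := h.contDiff_comp (hφ.1 n)
  have e0 : ∀ t, φ n (tube γ (t, 0)) = φ n (γ t) := fun t => by simp [tube]
  have := hasSum_int_mul_sq_fcoeff (f := fun t => φ n (tube γ (t, 0)))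
    (fun t => hasDerivAt_partialFst hF t 0)
    ((contDiff_partialFst hF).continuous.comp (by fun_prop)) (by
      simpa using congrArg (φ n) (h.periodic 0 0))
  simp only [e0] at this
  simpa only [sliceDegree, e0] using this

end IsCollar

/-! ### The degree formula for maps with values in the circle -/

theorem integral_abs_bilin_le {α : Type*} [MeasurableSpace α] {μ : Measure α}
    (B : ℂ →L[ℝ] ℂ →L[ℝ] ℝ) {u v : α → ℂ} (hu : MemLp u 2 μ) (hv : MemLp v 2 μ) :
    ∫ x, |B (u x) (v x)| ∂μ ≤ ‖B‖ * (eLpNorm u 2 μ).toReal * (eLpNorm v 2 μ).toReal := by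
  have h1 : ∫ x, |B (u x) (v x)| ∂μ = (eLpNorm (fun x => B (u x) (v x)) 1 μ).toReal := by
    rw [eLpNorm_one_eq_lintegral_enorm, ← integral_norm_eq_lintegral_enorm (integrable_bilin B hu hv).1]
    rfl
  rw [h1]
  refine ((ENNReal.toReal_mono ?_ (eLpNorm_bilin_le B hu.1 hv.1)).trans_eq ?_)
  · exact (ENNReal.mul_lt_top (ENNReal.mul_lt_top ENNReal.coe_lt_top hu.2) hv.2).ne
  · simp

/-- The Jacobians of smooth approximations of a map with values in the circle tend to zero. -/
theorem MemH1Circle.tendsto_integral_abs_jacobian {U : Set ℂ} (hU : IsOpen U)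
    (hb : Bornology.IsBounded U) {u : ℂ → ℂ} (hu : MemH1Circle U u) {φ : ℕ → ℂ → ℂ}
    (hφ : H1Tendsto U φ u) :
    Tendsto (fun n => ∫ x in U, |cross (fderiv ℝ (φ n) x 1) (fderiv ℝ (φ n) x Complex.I)|) atTop
      (𝓝 0) := by
  set w := weakDeriv U 1 u
  set z := weakDeriv U Complex.I u
  have hw : MemLp w 2 (volume.restrict U) := hu.1.isWeakDeriv_one.1
  have hz : MemLp z 2 (volume.restrict U) := hu.1.isWeakDeriv_I.1
  have hdw : ∀ n, MemLp (fun x => fderiv ℝ (φ n) x 1 - w x) 2 (volume.restrict U) :=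
    fun n => (hφ.memLp_fderiv hb n 1).sub hw
  have hdz : ∀ n, MemLp (fun x => fderiv ℝ (φ n) x Complex.I - z x) 2 (volume.restrict U) :=
    fun n => (hφ.memLp_fderiv hb n Complex.I).sub hz
  have tw := (ENNReal.tendsto_toReal ENNReal.zero_ne_top).comp (hφ.2.2 1 (by simp))
  have tz := (ENNReal.tendsto_toReal ENNReal.zero_ne_top).comp (hφ.2.2 Complex.I (by simp))
  simp only [Function.comp_def, ENNReal.toReal_zero] at tw tz
  refine squeeze_zero (fun n => integral_nonneg fun x => abs_nonneg _) (g := fun n =>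
    ‖crossL‖ * (eLpNorm (fun x => fderiv ℝ (φ n) x 1 - w x) 2 (volume.restrict U)).toReal *
        (eLpNorm (fun x => fderiv ℝ (φ n) x Complex.I - z x) 2 (volume.restrict U)).toReal +
      ‖crossL‖ * (eLpNorm w 2 (volume.restrict U)).toReal *
        (eLpNorm (fun x => fderiv ℝ (φ n) x Complex.I - z x) 2 (volume.restrict U)).toReal +
      ‖crossL‖ * (eLpNorm (fun x => fderiv ℝ (φ n) x 1 - w x) 2 (volume.restrict U)).toReal *
        (eLpNorm z 2 (volume.restrict U)).toReal) (fun n => ?_) ?_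
  · have i1 := (integrable_bilin crossL (hdw n) (hdz n)).abs
    have i2 := (integrable_bilin crossL hw (hdz n)).abs
    have i3 := (integrable_bilin crossL (hdw n) hz).abs
    have i12 : Integrable (fun x => |crossL (fderiv ℝ (φ n) x 1 - w x)
        (fderiv ℝ (φ n) x Complex.I - z x)| + |crossL (w x) (fderiv ℝ (φ n) x Complex.I - z x)|)
        (volume.restrict U) := i1.add i2
    refine le_trans (integral_mono_ae
      (integrable_bilin crossL (hφ.memLp_fderiv hb n 1) (hφ.memLp_fderiv hb n Complex.I)).abs
      (i12.add i3) ?_) ?_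
    · filter_upwards [hu.jacobian_ae_eq_zero hU hb hφ] with x hx
      simp only [crossL_apply, Pi.add_apply]
      -- The Jacobian of the limit is zero, so every remaining term of the expansion contains a
      -- difference that tends to zero in `L²`.
      have e : cross (fderiv ℝ (φ n) x 1) (fderiv ℝ (φ n) x Complex.I) =
          cross (fderiv ℝ (φ n) x 1 - w x) (fderiv ℝ (φ n) x Complex.I - z x) +
            cross (w x) (fderiv ℝ (φ n) x Complex.I - z x) +
            cross (fderiv ℝ (φ n) x 1 - w x) (z x) := by
        have : cross (w x) (z x) = 0 := hx
        simp only [cross, Complex.sub_re, Complex.sub_im] at this ⊢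
        linear_combination this
      rw [e]
      exact abs_add_three _ _ _
    · have e := integral_add i12 i3
      simp only [Pi.add_apply]
      rw [e, integral_add i1 i2]
      exact add_le_add (add_le_add (integral_abs_bilin_le _ (hdw n) (hdz n))
        (integral_abs_bilin_le _ hw (hdz n))) (integral_abs_bilin_le _ (hdw n) hz)
  · have := (((tw.mul tz).const_mul ‖crossL‖).add
      (tz.const_mul (‖crossL‖ * (eLpNorm w 2 (volume.restrict U)).toReal))).add
      ((tw.const_mul ‖crossL‖).mul_const (eLpNorm z 2 (volume.restrict U)).toReal)
    simp only [mul_zero, zero_mul, add_zero] at this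
    refine this.congr fun n => by ring

namespace PerforatedDomain

variable {N : ℕ} {P : PerforatedDomain N} {i : Fin N} {V : ℂ → ℝ}

/-- The form of a map with values in the circle is the limit of the degree integrals of smooth
approximations on the boundary of the hole. -/
theorem IsPotential.tendsto_sliceDegree (h : P.IsPotential i V) {u : ℂ → ℂ}
    (hu : MemH1Circle P.dom u) {φ : ℕ → ℂ → ℂ} (hφ : H1Tendsto P.dom φ u) {δ : ℝ} {η : ℂ → ℝ}
    (hδ : IsCollar P.dom (P.inner i) δ) (hη : ContDiff ℝ ∞ η) (hηs : HasCompactSupport η)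
    (h1 : ∀ p ∈ frontier (P.hole i), ∀ᶠ x in 𝓝 p, η x = 1)
    (h0 : ∀ p ∈ frontier P.dom \ frontier (P.hole i), ∀ᶠ x in 𝓝 p, η x = 0)
    (hδ0 : ∀ t, η (tube (P.inner i) (t, -δ)) = 0)
    (hz : ∀ x ∈ P.dom \ tube (P.inner i) '' collarRect δ, ∀ᶠ y in 𝓝 x, η y = 0) :
    Tendsto (fun n => sliceDegree (fun p => φ n (tube (P.inner i) p)) 0) atTop
      (𝓝 (P.bulkForm V u u)) := by
  have hb := P.isBounded_dom
  have hcu := hu.1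
  have hηd : ∀ e, Continuous fun x => fderiv ℝ η x e := fun e =>
    (hη.continuous_fderiv (by simp)).clm_apply continuous_const
  have hηC : ∀ e, ∃ C, ∀ x, |fderiv ℝ η x e| ≤ C := fun e =>
    exists_bound_of_compactSupport (hηd e) (hηs.fderiv_apply ℝ e)
  obtain ⟨C, hC⟩ := exists_bound_of_compactSupport hη.continuous hηs
  obtain ⟨C1, hC1⟩ := hηC 1
  obtain ⟨CI, hCI⟩ := hηC Complex.I
  have mφ := fun n => hφ.memLp hb n
  have m1 := fun n => hφ.memLp_fderiv hb n 1
  have mI := fun n => hφ.memLp_fderiv hb n Complex.I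
  have t1 := tendsto_integral_bdd_bilin crossL (hηd 1).aestronglyMeasurable
    (Eventually.of_forall hC1) hcu.1 hcu.isWeakDeriv_I.1 mφ mI hφ.2.1 (hφ.2.2 Complex.I (by simp))
  have t2 := tendsto_integral_bdd_bilin crossL (hηd Complex.I).aestronglyMeasurable
    (Eventually.of_forall hCI) hcu.1 hcu.isWeakDeriv_one.1 mφ m1 hφ.2.1 (hφ.2.2 1 (by simp))
  have t3 := tendsto_integral_bdd_bilin crossL hη.continuous.aestronglyMeasurable
    (Eventually.of_forall hC) hcu.isWeakDeriv_one.1 hcu.isWeakDeriv_I.1 m1 mI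
    (hφ.2.2 1 (by simp)) (hφ.2.2 Complex.I (by simp))
  simp only [crossL_apply] at t1 t2 t3
  have hjac : ∫ x in P.dom, η x * cross (weakDeriv P.dom 1 u x) (weakDeriv P.dom Complex.I u x) = 0 := by
    refine integral_eq_zero_of_ae ?_
    filter_upwards [hu.jacobian_ae_eq_zero P.isOpen_dom hb hφ] with x hx
    simp [hx]
  rw [hjac] at t3
  have j1 := integrable_bdd_bilin crossL (hηd 1).aestronglyMeasurable (Eventually.of_forall hC1)
    hcu.1 hcu.isWeakDeriv_I.1
  have j2 := integrable_bdd_bilin crossL (hηd Complex.I).aestronglyMeasurable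
    (Eventually.of_forall hCI) hcu.1 hcu.isWeakDeriv_one.1
  simp only [crossL_apply] at j1 j2
  rw [h.bulkForm_eq_neg hu (hη.of_le (by simp)) hηs h1 h0, integral_sub j1 j2]
  -- The Jacobian term in Green's formula is added to both sides: it is present for the
  -- approximations and disappears in the limit.
  have t := ((t1.sub t2).add (t3.const_mul 2)).neg
  rw [mul_zero, add_zero] at t
  refine t.congr fun n => ?_
  have hg := hδ.integral_green P.isOpen_dom.measurableSet (hφ.1 n) hη (fun t => ?_) hδ0 hz
  · rw [neg_eq_iff_eq_neg, ← hg]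
    have i1 := integrable_bdd_bilin crossL (hηd 1).aestronglyMeasurable
      (Eventually.of_forall hC1) (mφ n) (mI n)
    have i2 := integrable_bdd_bilin crossL (hηd Complex.I).aestronglyMeasurable
      (Eventually.of_forall hCI) (mφ n) (m1 n)
    have i3 := (integrable_bdd_bilin crossL hη.continuous.aestronglyMeasurable
      (Eventually.of_forall hC) (m1 n) (mI n)).const_mul 2
    simp only [crossL_apply] at i1 i2 i3
    have i12 : Integrable (fun x => fderiv ℝ η x 1 * cross (φ n x) (fderiv ℝ (φ n) x Complex.I) -
      fderiv ℝ η x Complex.I * cross (φ n x) (fderiv ℝ (φ n) x 1)) (volume.restrict P.dom) := i1.sub i2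
    rw [integral_add i12 i3, integral_sub i1 i2, integral_const_mul]
  · have hγ := (P.smooth_hole i).isBoundaryParam
    exact (h1 _ (hγ.mem_frontier t)).self_of_nhds

/-- First part of the proposition: for maps with values in the circle the approximate bulk degree is
the degree. -/
theorem hasDegree_abdeg {V : Fin N → ℂ → ℝ} (hV : P.IsPotential i (V i)) {u : ℂ → ℂ}
    (hu : MemH1Circle P.dom u) : P.HasDegree i u (P.abdeg V u i) := by
  obtain ⟨δ, η, hδ, hη, hηs, h1, h0, hδ0, hz⟩ := P.exists_collar i
  have hγ : Continuous (P.inner i) := (P.smooth_hole i).isBoundaryParam.contDiff.continuous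
  refine ⟨?_, ?_⟩
  · obtain ⟨φ, hφ⟩ := P.exists_h1Tendsto hu.1
    obtain ⟨g, hg, ht⟩ := hδ.exists_trace hγ hu.1 hφ
    exact ⟨g, hg, φ, hφ.1, hφ.2.1, hφ.2.2, ht⟩
  -- Each trace comes with its own approximating sequence. The limit of the slice degrees along that
  -- sequence is always the bulk form, so all traces have the same degree.
  · rintro g ⟨hg, φ, hs, hL, hd, ht⟩
    have hφ : H1Tendsto P.dom φ u := ⟨hs, hL, hd⟩
    obtain ⟨hh, hlim⟩ := hδ.memHHalf_and_tendsto hγ P.isBounded_dom hu.1 hφ hg ht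
    refine ⟨hh, tendsto_nhds_unique hlim ?_⟩
    rw [abdeg_eq, one_div]
    exact (hV.tendsto_sliceDegree hu hφ hδ hη hηs h1 h0 hδ0 hz).const_mul _

end PerforatedDomain

/-! ### Integrality of the degree of maps with values in the circle -/

/-- The winding number of a closed curve is an integer. -/
theorem exists_int_integral_div {f f' : ℝ → ℂ} (hf : ∀ t, HasDerivAt f (f' t) t)
    (hf' : Continuous f') (h0 : ∀ t, f t ≠ 0) {T : ℝ} (hp : f T = f 0) :
    ∃ k : ℤ, ∫ t in (0)..T, cross (f t) (f' t) / ‖f t‖ ^ 2 = 2 * Real.pi * k := by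
  have hc : Continuous f := continuous_iff_continuousAt.2 fun t => (hf t).continuousAt
  have hq : Continuous fun t => f' t / f t := hf'.div hc h0
  set G : ℝ → ℂ := fun t => ∫ x in (0)..t, f' x / f x with hG
  have hGd : ∀ t, HasDerivAt G (f' t / f t) t := fun t =>
    intervalIntegral.integral_hasDerivAt_right (hq.intervalIntegrable _ _)
      (hq.stronglyMeasurableAtFilter _ _) hq.continuousAt
  -- `G` is a lift of the logarithm: `f exp(-G)` is constant, so closedness of the curve makes
  -- `exp(-G T) = 1`.
  have hE : ∀ t, HasDerivAt (fun t => f t * Complex.exp (-G t)) 0 t := fun t => by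
    have h := (hf t).fun_mul (hGd t).fun_neg.cexp
    have e : f' t * Complex.exp (-G t) + f t * (Complex.exp (-G t) * -(f' t / f t)) = 0 := by
      have e1 : f t * (Complex.exp (-G t) * -(f' t / f t)) =
          -(Complex.exp (-G t) * (f t * (f' t / f t))) := by ring
      rw [e1, mul_div_cancel₀ _ (h0 t)]
      ring
    rwa [e] at h
  have hconst := is_const_of_deriv_eq_zero (fun t => (hE t).differentiableAt)
    (fun t => (hE t).deriv) T 0
  have hG0 : G 0 = 0 := by simp [hG]
  rw [hG0, neg_zero, Complex.exp_zero, hp] at hconst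
  have h1 : Complex.exp (-G T) = 1 := mul_left_cancel₀ (h0 0) hconst
  obtain ⟨k, hk⟩ := Complex.exp_eq_one_iff.1 h1
  refine ⟨-k, ?_⟩
  have him : ∀ t, cross (f t) (f' t) / ‖f t‖ ^ 2 = Complex.imCLM (f' t / f t) := fun t => by
    rw [Complex.imCLM_apply, Complex.div_im, ← Complex.normSq_eq_norm_sq, cross]
    ring
  simp only [him]
  rw [ContinuousLinearMap.intervalIntegral_comp_comm _ (hq.intervalIntegrable _ _)]
  have h2 : G T = -(k * (2 * Real.pi * Complex.I)) := by rw [← hk, neg_neg]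
  change (G T).im = _
  rw [h2]
  simp
  ring

/-- If `‖f t₀‖ < 1/2`, the energy bound keeps `‖f‖ ≤ 3/4` on an interval of length `r = 1 / (16 a)`.
There the modulus defect is at least `1/16` pointwise, so its integral is at least `1 / (256 a)`,
more than allowed. As `a ≥ 1`, the interval fits into one period. -/
theorem half_le_norm_of_integral_le {f f' : ℝ → ℂ} (hf : ∀ t, HasDerivAt f (f' t) t)
    (hf' : Continuous f') (hp : Function.Periodic f (2 * Real.pi))
    (hp' : Function.Periodic f' (2 * Real.pi)) {a b : ℝ} (ha1 : 1 ≤ a)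
    (ha : ∫ t in (0)..(2 * Real.pi), ‖f' t‖ ^ 2 ≤ a)
    (hb : ∫ t in (0)..(2 * Real.pi), (1 - ‖f t‖) ^ 2 ≤ b) (hab : b < 1 / (256 * a)) (t₀ : ℝ) :
    1 / 2 ≤ ‖f t₀‖ := by
  by_contra hcon
  push Not at hcon
  have hc : Continuous f := continuous_iff_continuousAt.2 fun t => (hf t).continuousAt
  have ha0 : 0 < a := by linarith
  set r := 1 / (16 * a) with hr
  have hr0 : 0 < r := by positivity
  have hr1 : r ≤ 2 * Real.pi := by
    have : r ≤ 1 := by rw [hr, div_le_one (by positivity)]; linarith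
    linarith [Real.pi_gt_three]
  have hsub : ∀ k : ℝ → ℝ, Continuous k → (∀ t, 0 ≤ k t) → Function.Periodic k (2 * Real.pi) →
      ∫ t in t₀..(t₀ + r), k t ≤ ∫ t in (0)..(2 * Real.pi), k t := by
    intro k hk hk0 hkp
    have e := hkp.intervalIntegral_add_eq 0 t₀
    rw [zero_add] at e
    rw [e]
    exact intervalIntegral.integral_mono_interval le_rfl (by linarith) (by linarith)
      (Eventually.of_forall hk0) (hk.intervalIntegrable _ _)
  have ha' := (hsub (fun t => ‖f' t‖ ^ 2) (by fun_prop) (fun t => by positivity)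
    (fun t => by simp only [hp' t])).trans ha
  have hb' := (hsub (fun t => (1 - ‖f t‖) ^ 2) (by fun_prop) (fun t => by positivity)
    (fun t => by simp only [hp t])).trans hb
  have hclose : ∀ t ∈ Icc t₀ (t₀ + r), ‖f t‖ ≤ 3 / 4 := by
    intro t ht
    have h1 : ‖f t - f t₀‖ ≤ 1 / 4 := by
      rw [← intervalIntegral.integral_eq_sub_of_hasDerivAt (fun x _ => hf x)
        (hf'.intervalIntegrable _ _)]
      calc ‖∫ x in t₀..t, f' x‖ ≤ ∫ x in t₀..t, ‖f' x‖ :=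
            intervalIntegral.norm_integral_le_integral_norm ht.1
        _ ≤ ∫ x in t₀..(t₀ + r), ‖f' x‖ :=
            intervalIntegral.integral_mono_interval le_rfl ht.1 ht.2
              (Eventually.of_forall fun x => norm_nonneg _) (hf'.norm.intervalIntegrable _ _)
        -- Young's inequality balanced so that each of the two terms integrates to at most `1/8`.
        _ ≤ ∫ x in t₀..(t₀ + r), (1 / (8 * a) * ‖f' x‖ ^ 2 + 2 * a) := by
            refine intervalIntegral.integral_mono_on (by linarith) (hf'.norm.intervalIntegrable _ _)
              (Continuous.intervalIntegrable (by fun_prop) _ _) fun x _ => ?_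
            have h3 : 0 ≤ 1 / (8 * a) * (‖f' x‖ - 4 * a) ^ 2 := by positivity
            have h4 : 1 / (8 * a) * (‖f' x‖ - 4 * a) ^ 2 =
                1 / (8 * a) * ‖f' x‖ ^ 2 + 2 * a - ‖f' x‖ := by field_simp; ring
            linarith
        _ = 1 / (8 * a) * (∫ x in t₀..(t₀ + r), ‖f' x‖ ^ 2) + r * (2 * a) := by
            rw [intervalIntegral.integral_add (Continuous.intervalIntegrable (by fun_prop) _ _)
              intervalIntegrable_const, intervalIntegral.integral_const_mul,
              intervalIntegral.integral_const, add_sub_cancel_left, smul_eq_mul]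
        _ ≤ 1 / (8 * a) * a + r * (2 * a) := by gcongr
        _ = 1 / 4 := by rw [hr]; field_simp; norm_num
    have := norm_sub_norm_le (f t) (f t₀)
    linarith
  have hlow : r * (1 / 16) ≤ ∫ t in t₀..(t₀ + r), (1 - ‖f t‖) ^ 2 := by
    have h1 : ∫ t in t₀..(t₀ + r), (1 / 16 : ℝ) = r * (1 / 16) := by
      rw [intervalIntegral.integral_const, add_sub_cancel_left, smul_eq_mul]
    rw [← h1]
    refine intervalIntegral.integral_mono_on (by linarith) intervalIntegrable_const
      (Continuous.intervalIntegrable (by fun_prop) _ _) fun t ht => ?_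
    nlinarith [hclose t ht]
  have : r * (1 / 16) = 1 / (256 * a) := by rw [hr]; field_simp; norm_num
  linarith

/-- A closed curve close to the unit circle has an almost integral degree. -/
theorem exists_int_abs_sub_le {f f' : ℝ → ℂ} (hf : ∀ t, HasDerivAt f (f' t) t)
    (hf' : Continuous f') (hp : Function.Periodic f (2 * Real.pi))
    (hp' : Function.Periodic f' (2 * Real.pi)) {a b θ : ℝ} (hθ : 0 < θ) (ha1 : 1 ≤ a)
    (ha : ∫ t in (0)..(2 * Real.pi), ‖f' t‖ ^ 2 ≤ a)
    (hb : ∫ t in (0)..(2 * Real.pi), (1 - ‖f t‖) ^ 2 ≤ b) (hab : b < 1 / (256 * a)) :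
    ∃ k : ℤ, |(∫ t in (0)..(2 * Real.pi), cross (f t) (f' t)) - 2 * Real.pi * k| ≤
      θ / 2 * a + 9 / (2 * θ) * b := by
  have hlow := half_le_norm_of_integral_le hf hf' hp hp' ha1 ha hb hab
  have hc : Continuous f := continuous_iff_continuousAt.2 fun t => (hf t).continuousAt
  have h0 : ∀ t, f t ≠ 0 := fun t => norm_pos_iff.1 (by linarith [hlow t])
  obtain ⟨k, hk⟩ := exists_int_integral_div hf hf' h0 (T := 2 * Real.pi) (by simpa using hp 0)
  refine ⟨k, ?_⟩
  have hcc : Continuous fun t => cross (f t) (f' t) := continuous_cross hc hf'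
  have hcd : Continuous fun t => cross (f t) (f' t) / ‖f t‖ ^ 2 :=
    hcc.div (by fun_prop) fun t => by simpa using h0 t
  rw [← hk, ← intervalIntegral.integral_sub (hcc.intervalIntegrable _ _) (hcd.intervalIntegrable _ _)]
  calc |∫ t in (0)..(2 * Real.pi), (cross (f t) (f' t) - cross (f t) (f' t) / ‖f t‖ ^ 2)|
      ≤ ∫ t in (0)..(2 * Real.pi), |cross (f t) (f' t) - cross (f t) (f' t) / ‖f t‖ ^ 2| :=
        intervalIntegral.abs_integral_le_integral_abs Real.two_pi_pos.le
    _ ≤ ∫ t in (0)..(2 * Real.pi), (θ / 2 * ‖f' t‖ ^ 2 + 9 / (2 * θ) * (1 - ‖f t‖) ^ 2) := by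
        refine intervalIntegral.integral_mono_on Real.two_pi_pos.le
          ((hcc.sub hcd).abs.intervalIntegrable _ _)
          (Continuous.intervalIntegrable (by fun_prop) _ _) fun t _ => ?_
        have hx := hlow t
        have hcr := abs_cross_le (f t) (f' t)
        set x := ‖f t‖
        set y := ‖f' t‖
        have hy : 0 ≤ y := norm_nonneg _
        have hx0 : 0 < x := by linarith
        -- The factor `3` is from `1 + x ≤ 3 x`, valid as `x ≥ 1/2`. Its square over `2 θ` is the
        -- coefficient of `b`.
        have e1 : |cross (f t) (f' t) - cross (f t) (f' t) / x ^ 2| ≤ 3 * |1 - x| * y := by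
          have e2 : cross (f t) (f' t) - cross (f t) (f' t) / x ^ 2 =
              cross (f t) (f' t) * (-((1 - x) * (1 + x)) / x ^ 2) := by field_simp; ring
          rw [e2, abs_mul, abs_div, abs_neg, abs_mul, abs_of_pos (by positivity : 0 < x ^ 2),
            abs_of_pos (by positivity : 0 < 1 + x), ← mul_div_assoc, div_le_iff₀ (by positivity)]
          calc |cross (f t) (f' t)| * (|1 - x| * (1 + x)) ≤ (x * y) * (|1 - x| * (3 * x)) := by
                gcongr; linarith
            _ = 3 * |1 - x| * y * x ^ 2 := by ring
        refine e1.trans ?_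
        have h3 : 0 ≤ 1 / (2 * θ) * (θ * y - 3 * |1 - x|) ^ 2 := by positivity
        have h4 : 1 / (2 * θ) * (θ * y - 3 * |1 - x|) ^ 2 =
            θ / 2 * y ^ 2 + 9 / (2 * θ) * |1 - x| ^ 2 - 3 * |1 - x| * y := by field_simp; ring
        rw [sq_abs] at h4
        linarith
    _ = θ / 2 * (∫ t in (0)..(2 * Real.pi), ‖f' t‖ ^ 2) +
          9 / (2 * θ) * ∫ t in (0)..(2 * Real.pi), (1 - ‖f t‖) ^ 2 := by
        rw [intervalIntegral.integral_add (Continuous.intervalIntegrable (by fun_prop) _ _)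
          (Continuous.intervalIntegrable (by fun_prop) _ _), intervalIntegral.integral_const_mul,
          intervalIntegral.integral_const_mul]
    _ ≤ θ / 2 * a + 9 / (2 * θ) * b := by gcongr

theorem integral_slices {k : ℝ × ℝ → ℝ} (hk : Continuous k) {δ : ℝ} (hδ : 0 < δ) :
    ∫ s in (-δ)..0, ∫ t in (0)..(2 * Real.pi), k (t, s) = ∫ p in collarRect δ, k p := by
  rw [setIntegral_congr_set (collarRect_ae_eq δ), Measure.volume_eq_prod, ← Measure.prod_restrict,
    integral_prod_symm _ (by
      rw [Measure.prod_restrict]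
      exact hk.continuousOn.integrableOn_compact (isCompact_Icc.prod isCompact_Icc)),
    intervalIntegral.integral_of_le (by linarith), integral_Icc_eq_integral_Ioc]
  refine integral_congr_ae (Eventually.of_forall fun s => ?_)
  simp only
  rw [intervalIntegral.integral_of_le Real.two_pi_pos.le, integral_Icc_eq_integral_Ioc]

/-- The choice of a good slice. -/
theorem exists_slice {j k : ℝ × ℝ → ℝ} (hj : Continuous j) (hk : Continuous k)
    (hj0 : ∀ p, 0 ≤ j p) (hk0 : ∀ p, 0 ≤ k p) {δ A β : ℝ} (hδ : 0 < δ) (hA : 0 < A) (hβ : 0 < β)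
    (h1 : ∫ p in collarRect δ, j p ≤ A) (h2 : ∫ p in collarRect δ, k p ≤ β) :
    ∃ s ∈ Ioo (-δ) 0, (∫ t in (0)..(2 * Real.pi), j (t, s)) ≤ 2 * A / δ ∧
      (∫ t in (0)..(2 * Real.pi), k (t, s)) ≤ 2 * β / δ := by
  rw [← integral_slices hj hδ] at h1
  rw [← integral_slices hk hδ] at h2
  have hcont : ∀ {l : ℝ × ℝ → ℝ}, Continuous l →
      Continuous fun s => ∫ t in (0)..(2 * Real.pi), l (t, s) := fun {l} hl =>
    intervalIntegral.continuous_parametric_intervalIntegral_of_continuous'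
      (f := fun s t => l (t, s)) (by fun_prop) _ _
  have hcj := hcont hj
  have hck := hcont hk
  have hnn : ∀ {l : ℝ × ℝ → ℝ}, (∀ p, 0 ≤ l p) → ∀ s, 0 ≤ ∫ t in (0)..(2 * Real.pi), l (t, s) :=
    fun hl s => intervalIntegral.integral_nonneg Real.two_pi_pos.le fun t _ => hl _
  by_contra hcon
  push Not at hcon
  -- If every slice violated one of the two bounds, the normalised sum would exceed `2 / δ` on the
  -- whole interval. Its integral would exceed `2`, whereas each of the two terms integrates to at
  -- most `1`.
  have hpos : ∀ s ∈ Ioo (-δ) 0, 0 < (∫ t in (0)..(2 * Real.pi), j (t, s)) / A +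
      (∫ t in (0)..(2 * Real.pi), k (t, s)) / β - 2 / δ := by
    intro s hs
    have hj1 := hnn hj0 s
    have hk1 := hnn hk0 s
    by_cases hle : (∫ t in (0)..(2 * Real.pi), j (t, s)) ≤ 2 * A / δ
    · have h3 := hcon s hs hle
      have : 2 / δ < (∫ t in (0)..(2 * Real.pi), k (t, s)) / β := by
        rw [lt_div_iff₀ hβ]; calc 2 / δ * β = 2 * β / δ := by ring
          _ < _ := h3
      have : 0 ≤ (∫ t in (0)..(2 * Real.pi), j (t, s)) / A := by positivity
      linarith
    · push Not at hle
      have : 2 / δ < (∫ t in (0)..(2 * Real.pi), j (t, s)) / A := by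
        rw [lt_div_iff₀ hA]; calc 2 / δ * A = 2 * A / δ := by ring
          _ < _ := hle
      have : 0 ≤ (∫ t in (0)..(2 * Real.pi), k (t, s)) / β := by positivity
      linarith
  have hc1 : Continuous fun s => (∫ t in (0)..(2 * Real.pi), j (t, s)) / A := hcj.div_const A
  have hc2 : Continuous fun s => (∫ t in (0)..(2 * Real.pi), k (t, s)) / β := hck.div_const β
  have hc12 : Continuous fun s => (∫ t in (0)..(2 * Real.pi), j (t, s)) / A +
      (∫ t in (0)..(2 * Real.pi), k (t, s)) / β := hc1.add hc2
  have hc3 : Continuous fun s => (∫ t in (0)..(2 * Real.pi), j (t, s)) / A +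
      (∫ t in (0)..(2 * Real.pi), k (t, s)) / β - 2 / δ := hc12.sub continuous_const
  have hint := intervalIntegral.intervalIntegral_pos_of_pos_on
    (hc3.intervalIntegrable (-δ) 0) hpos (by linarith)
  rw [intervalIntegral.integral_sub (hc12.intervalIntegrable _ _) intervalIntegrable_const,
    intervalIntegral.integral_add (hc1.intervalIntegrable _ _) (hc2.intervalIntegrable _ _),
    intervalIntegral.integral_div, intervalIntegral.integral_div, intervalIntegral.integral_const,
    smul_eq_mul] at hint
  have e1 : (∫ s in (-δ)..0, ∫ t in (0)..(2 * Real.pi), j (t, s)) / A ≤ 1 := (div_le_one hA).2 h1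
  have e2 : (∫ s in (-δ)..0, ∫ t in (0)..(2 * Real.pi), k (t, s)) / β ≤ 1 := (div_le_one hβ).2 h2
  have e3 : (0 - -δ) * (2 / δ) = 2 := by field_simp; ring
  linarith

theorem integral_collarRect_le_toReal {k : ℝ × ℝ → ℝ} (hk : Continuous k) (hk0 : ∀ p, 0 ≤ k p)
    {δ : ℝ} {B : ENNReal} (hB : B ≠ ⊤) (h : ∫⁻ p in collarRect δ, ENNReal.ofReal (k p) ≤ B) :
    ∫ p in collarRect δ, k p ≤ B.toReal := by
  rw [integral_eq_lintegral_of_nonneg_ae (Eventually.of_forall hk0) hk.aestronglyMeasurable]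
  exact ENNReal.toReal_mono hB h

theorem h1Norm_le {D : Set ℂ} {u φ : ℂ → ℂ} (hu : MemH1 D u) (hφ : ContDiff ℝ ∞ φ) :
    h1Norm D φ ≤ h1Err D u φ + (eLpNorm u 2 (volume.restrict D) +
      eLpNorm (weakDeriv D 1 u) 2 (volume.restrict D) +
      eLpNorm (weakDeriv D Complex.I u) 2 (volume.restrict D)) := by
  have key : ∀ {f w : ℂ → ℂ}, AEStronglyMeasurable f (volume.restrict D) →
      AEStronglyMeasurable w (volume.restrict D) → eLpNorm f 2 (volume.restrict D) ≤
        eLpNorm (fun x => f x - w x) 2 (volume.restrict D) + eLpNorm w 2 (volume.restrict D) := by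
    intro f w hf hw
    have h := eLpNorm_add_le (p := 2) (hf.sub hw) hw (by norm_num)
    rwa [sub_add_cancel] at h
  have hc : ∀ e, AEStronglyMeasurable (fun x => fderiv ℝ φ x e) (volume.restrict D) := fun e =>
    (continuous_fderiv_apply_of_contDiff hφ (by simp) e).aestronglyMeasurable
  rw [h1Norm, h1Err]
  refine (add_le_add (add_le_add (key hφ.continuous.aestronglyMeasurable hu.1.1)
    (key (hc 1) hu.isWeakDeriv_one.1.1)) (key (hc Complex.I) hu.isWeakDeriv_I.1.1)).trans (le_of_eq ?_)
  ring

theorem lintegral_one_sub_norm_sq_le {D : Set ℂ} {u φ : ℂ → ℂ} (hu : MemH1Circle D u) :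
    ∫⁻ x in D, ENNReal.ofReal ((1 - ‖φ x‖) ^ 2) ≤
      eLpNorm (fun x => φ x - u x) 2 (volume.restrict D) ^ 2 := by
  rw [eLpNorm_two_sq]
  refine lintegral_mono_ae ?_
  filter_upwards [hu.2] with x hx
  rw [← ofReal_norm, ← ENNReal.ofReal_pow (norm_nonneg _)]
  refine ENNReal.ofReal_le_ofReal ?_
  have h := abs_norm_sub_norm_le (u x) (φ x)
  rw [hx, norm_sub_rev] at h
  rw [← sq_abs]
  gcongr

namespace PerforatedDomain

variable {N : ℕ} {P : PerforatedDomain N} {i : Fin N}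

/-- The approximate bulk degree of a map with values in the circle is an integer. -/
theorem exists_int_abdeg_eq {V : Fin N → ℂ → ℝ} (hV : P.IsPotential i (V i)) {u : ℂ → ℂ}
    (hu : MemH1Circle P.dom u) : ∃ d : ℤ, P.abdeg V u i = d := by
  obtain ⟨δ, η, hδ, hη, hηs, h1, h0, hδ0, hz⟩ := P.exists_collar i
  obtain ⟨φ, hφ⟩ := P.exists_h1Tendsto hu.1
  have hlim := hV.tendsto_sliceDegree hu hφ hδ hη hηs h1 h0 hδ0 hz
  have hJ := hu.tendsto_integral_abs_jacobian P.isOpen_dom P.isBounded_dom hφ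
  obtain ⟨C, hC⟩ := hδ.exists_lintegral_jetSq_le
  obtain ⟨C₀, hC₀⟩ := hδ.exists_setLIntegral_comp_le
  have hδp := hδ.pos
  set M : ENNReal := eLpNorm u 2 (volume.restrict P.dom) +
    eLpNorm (weakDeriv P.dom 1 u) 2 (volume.restrict P.dom) +
    eLpNorm (weakDeriv P.dom Complex.I u) 2 (volume.restrict P.dom) with hM
  have hMt : M ≠ ⊤ := ENNReal.add_ne_top.2 ⟨ENNReal.add_ne_top.2
    ⟨hu.1.1.2.ne, hu.1.isWeakDeriv_one.1.2.ne⟩, hu.1.isWeakDeriv_I.1.2.ne⟩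
  have hCt : (C : ENNReal) * (1 + M) ^ 2 ≠ ⊤ := ENNReal.mul_ne_top ENNReal.coe_ne_top
    (ENNReal.pow_ne_top (ENNReal.add_ne_top.2 ⟨ENNReal.one_ne_top, hMt⟩))
  -- The first term bounds the collar energy of every `φ n` at `H¹` distance less than `1` from `u`;
  -- adding `δ` makes `A` positive. The maximum with `1` below meets the hypothesis `1 ≤ a` of the
  -- slice lemmas.
  set A : ℝ := (C * (1 + M) ^ 2).toReal + δ with hA
  have hA0 : 0 < A := by positivity
  set a : ℝ := max 1 (2 * A / δ) with ha
  have ha1 : 1 ≤ a := le_max_left _ _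
  have ha0 : 0 < a := by linarith
  -- The integers are closed in `ℝ`, so approximation by integers to any accuracy is enough.
  suffices hmem : P.abdeg V u i ∈ closure (range ((↑) : ℤ → ℝ)) by
    rw [Int.isClosedEmbedding_coe_real.isClosed_range.closure_eq] at hmem
    obtain ⟨d, hd⟩ := hmem
    exact ⟨d, hd.symm⟩
  rw [Metric.mem_closure_iff]
  intro ε' hε'
  obtain ⟨ε, hε, hεε'⟩ : ∃ ε > 0, 3 * ε ≤ ε' := ⟨ε' / 3, by positivity, by linarith⟩
  set θ := ε / a with hθ
  have hθ0 : 0 < θ := by positivity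
  -- The first condition bounds one half of the slice error, the other half being `θ / 2 * a = ε /
  -- 2`. The second keeps the slice away from the origin.
  obtain ⟨b, hb0, hb1, hb2⟩ : ∃ b > 0, 9 / (2 * θ) * b ≤ ε / 2 ∧ b < 1 / (256 * a) := by
    refine ⟨min (ε * θ / 9) (1 / (512 * a)), by positivity, ?_, ?_⟩
    · calc 9 / (2 * θ) * min (ε * θ / 9) (1 / (512 * a)) ≤ 9 / (2 * θ) * (ε * θ / 9) := by
            gcongr; exact min_le_left _ _
        _ = ε / 2 := by field_simp
    · refine (min_le_right _ _).trans_lt ?_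
      gcongr
      norm_num
  have hev1 : ∀ᶠ n in atTop, h1Err P.dom u (φ n) < 1 :=
    hφ.tendsto_h1Err.eventually_lt_const zero_lt_one
  have hev2 : ∀ᶠ n in atTop, C₀ * eLpNorm (fun x => φ n x - u x) 2 (volume.restrict P.dom) ^ 2 <
      ENNReal.ofReal (b * δ / 2) := by
    have : Tendsto (fun n => C₀ * eLpNorm (fun x => φ n x - u x) 2 (volume.restrict P.dom) ^ 2) atTop
        (𝓝 0) := by
      have := ENNReal.Tendsto.const_mul (a := (C₀ : ENNReal))
        (((ENNReal.continuous_pow 2).tendsto _).comp hφ.2.1) (Or.inr ENNReal.coe_ne_top)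
      simpa using this
    exact this.eventually_lt_const (ENNReal.ofReal_pos.2 (by positivity))
  have hev3 := (Metric.tendsto_nhds.1 hlim) ε hε
  have hev4 : ∀ᶠ n in atTop,
      ∫ x in P.dom, |cross (fderiv ℝ (φ n) x 1) (fderiv ℝ (φ n) x Complex.I)| < ε / 2 :=
    hJ.eventually_lt_const (half_pos hε)
  obtain ⟨n, hn1, hn2, hn3, hn4⟩ := (hev1.and (hev2.and (hev3.and hev4))).exists
  set F : ℝ × ℝ → ℂ := fun p => φ n (tube (P.inner i) p) with hF
  have hFs : ContDiff ℝ ∞ F := hδ.contDiff_comp (hφ.1 n)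
  have hFc := hFs.continuous
  have hF1 := (contDiff_partialFst hFs).continuous
  have hint1 : ∫ p in collarRect δ, jetSq F p ≤ A := by
    refine (integral_collarRect_le_toReal (continuous_jetSq hFs)
      (fun p => by unfold jetSq; positivity) hCt ?_).trans (by rw [hA]; linarith)
    refine (hC _ (hφ.1 n)).trans ?_
    gcongr
    exact (h1Norm_le hu.1 (hφ.1 n)).trans (add_le_add hn1.le le_rfl)
  have hint2 : ∫ p in collarRect δ, (1 - ‖F p‖) ^ 2 ≤ b * δ / 2 := by
    refine (integral_collarRect_le_toReal (by fun_prop) (fun p => by positivity)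
      ENNReal.ofReal_ne_top (B := ENNReal.ofReal (b * δ / 2)) ?_).trans_eq
      (ENNReal.toReal_ofReal (by positivity))
    refine ((hC₀ fun x => ENNReal.ofReal ((1 - ‖φ n x‖) ^ 2)).trans ?_).trans hn2.le
    gcongr
    exact lintegral_one_sub_norm_sq_le hu
  obtain ⟨s, hs, hs1, hs2⟩ := exists_slice (continuous_jetSq hFs)
    (by fun_prop : Continuous fun p => (1 - ‖F p‖) ^ 2) (fun p => by unfold jetSq; positivity)
    (fun p => by positivity) hδp hA0 (by positivity) hint1 hint2
  have hsl : Continuous fun t : ℝ => (t, s) := by fun_prop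
  obtain ⟨k, hk⟩ := exists_int_abs_sub_le (f := fun t => F (t, s)) (f' := fun t => partialFst F (t, s))
    (fun t => hasDerivAt_partialFst hFs t s) (hF1.comp hsl)
    (fun t => congrArg (φ n) (hδ.periodic t s))
    (fun t => periodic_partialFst hFs (fun t s => congrArg (φ n) (hδ.periodic t s)) t s) hθ0 ha1
    (by
      refine le_trans ?_ (hs1.trans (le_max_right _ _))
      refine intervalIntegral.integral_mono_on Real.two_pi_pos.le
        (((hF1.comp hsl).norm.pow 2).intervalIntegrable _ _)
        (((continuous_jetSq hFs).comp hsl).intervalIntegrable _ _) fun t _ => ?_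
      simp only [jetSq]
      nlinarith [sq_nonneg ‖F (t, s)‖, sq_nonneg ‖partialSnd F (t, s)‖])
    (by
      refine hs2.trans_eq ?_
      field_simp) hb2
  have hk' : |sliceDegree F s - 2 * Real.pi * k| ≤ ε := by
    refine hk.trans ?_
    have : θ / 2 * a = ε / 2 := by rw [hθ]; field_simp
    linarith
  have hdiff := hδ.abs_sliceDegree_sub_le (hφ.1 n)
    (integrable_bilin crossL (hφ.memLp_fderiv P.isBounded_dom n 1)
      (hφ.memLp_fderiv P.isBounded_dom n Complex.I)) hs.1 hs.2
  rw [Real.dist_eq, abs_sub_comm] at hn3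
  -- One `ε` each for the approximation of `u`, for the passage from the boundary to the good slice,
  -- and for the distance of the slice degree to a winding number.
  have htot : |P.bulkForm (V i) u u - 2 * Real.pi * k| ≤ 3 * ε := by
    have e : P.bulkForm (V i) u u - 2 * Real.pi * k = (P.bulkForm (V i) u u - sliceDegree F 0) +
        (sliceDegree F 0 - sliceDegree F s) + (sliceDegree F s - 2 * Real.pi * k) := by ring
    rw [e]
    refine (abs_add_three _ _ _).trans ?_
    linarith
  refine ⟨k, mem_range_self k, ?_⟩
  have e2 : P.abdeg V u i - k = 1 / (2 * Real.pi) * (P.bulkForm (V i) u u - 2 * Real.pi * k) := by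
    rw [abdeg_eq]
    have := Real.pi_ne_zero
    field_simp
  rw [Real.dist_eq, e2, abs_mul, abs_of_pos (by positivity)]
  have hpi : 1 / (2 * Real.pi) < 1 := by
    rw [div_lt_one (by positivity)]
    linarith [Real.pi_gt_three]
  calc 1 / (2 * Real.pi) * |P.bulkForm (V i) u u - 2 * Real.pi * k|
      ≤ 1 / (2 * Real.pi) * (3 * ε) := by gcongr
    _ < 1 * (3 * ε) := by gcongr
    _ ≤ ε' := by linarith

end PerforatedDomain

/-! ### Compactness -/

/-- Weak sequential compactness of bounded sets of square integrable functions. -/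
theorem exists_weak_limit {U : Set ℂ} {x : ℕ → ℂ → ℂ} {R : ℝ}
    (hx : ∀ n, MemLp (x n) 2 (volume.restrict U))
    (hR : ∀ n, eLpNorm (x n) 2 (volume.restrict U) ≤ ENNReal.ofReal R) :
    ∃ y : ℂ → ℂ, MemLp y 2 (volume.restrict U) ∧ ∃ ms : ℕ → ℕ, StrictMono ms ∧
      ∀ ψ : ℂ → ℝ, MemLp ψ 2 (volume.restrict U) →
        Tendsto (fun n => ∫ z in U, ψ z • x (ms n) z) atTop (𝓝 (∫ z in U, ψ z • y z)) := by
  set E := Lp ℂ 2 (volume.restrict U)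
  -- Separability of `L²` makes closed balls of the dual weak-* sequentially compact. The Riesz
  -- isometry transfers the sequence there and the limit back.
  have : SecondCountableTopology E := Lp.SecondCountableTopology (p_ne_top := ⟨by norm_num⟩)
  set X : ℕ → E := fun n => (hx n).toLp (x n) with hX
  set f : ℕ → WeakDual ℂ E := fun n => StrongDual.toWeakDual (InnerProductSpace.toDual ℂ E (X n))
  have hmem : ∀ n, f n ∈ WeakDual.toStrongDual ⁻¹' Metric.closedBall (0 : StrongDual ℂ E) (max R 0) := by
    intro n
    rw [mem_preimage, mem_closedBall_zero_iff]
    change ‖InnerProductSpace.toDual ℂ E (X n)‖ ≤ _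
    rw [LinearIsometryEquiv.norm_map, hX, Lp.norm_toLp]
    refine ENNReal.toReal_le_of_le_ofReal (le_max_right _ _) ((hR n).trans ?_)
    exact ENNReal.ofReal_le_ofReal (le_max_left _ _)
  obtain ⟨g, -, ms, hms, hlim⟩ := WeakDual.isSeqCompact_closedBall ℂ E 0 (max R 0) hmem
  set Y : E := (InnerProductSpace.toDual ℂ E).symm (WeakDual.toStrongDual g) with hY
  refine ⟨Y, Lp.memLp Y, ms, hms, fun ψ hψ => ?_⟩
  have hψ' : MemLp (fun z => (ψ z : ℂ)) 2 (volume.restrict U) := hψ.ofReal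
  have h1 : Tendsto (fun n => inner ℂ (X (ms n)) (hψ'.toLp _)) atTop (𝓝 (inner ℂ Y (hψ'.toLp _))) := by
    have h2 := (WeakDual.eval_continuous (hψ'.toLp (fun z => (ψ z : ℂ)))).tendsto g |>.comp hlim
    have h3 : inner ℂ Y (hψ'.toLp (fun z => (ψ z : ℂ))) = g (hψ'.toLp (fun z => (ψ z : ℂ))) := by
      rw [hY, InnerProductSpace.toDual_symm_apply]
      rfl
    rw [h3]
    exact h2
  have h4 : ∀ (Z : E) (z : ℂ → ℂ), Z =ᵐ[volume.restrict U] z →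
      conj (inner ℂ Z (hψ'.toLp (fun z => (ψ z : ℂ)))) = ∫ a in U, ψ a • z a := by
    intro Z z hz
    rw [L2.inner_def, ← integral_conj]
    refine integral_congr_ae ?_
    filter_upwards [hz, hψ'.coeFn_toLp] with a h1 h2
    rw [h1, h2]
    simp [mul_comm]
  have h5 := (Complex.continuous_conj.tendsto _).comp h1
  rw [h4 Y Y (by rfl)] at h5
  refine h5.congr fun n => ?_
  exact h4 _ _ (hx _).coeFn_toLp

/-! ### Translation estimates and strong convergence in `L²` -/

theorem enorm_sq_add_three_le (a b c : ℂ) :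
    ‖a + b + c‖ₑ ^ 2 ≤ 3 * (‖a‖ₑ ^ 2 + ‖b‖ₑ ^ 2 + ‖c‖ₑ ^ 2) := by
  have e : ∀ z : ℂ, ‖z‖ₑ ^ 2 = ENNReal.ofReal (‖z‖ ^ 2) := fun z => by
    rw [ENNReal.ofReal_pow (norm_nonneg _), ofReal_norm]
  have h3 : (3 : ENNReal) = ENNReal.ofReal 3 := by norm_num
  rw [e, e, e, e, h3, ← ENNReal.ofReal_add (by positivity) (by positivity),
    ← ENNReal.ofReal_add (by positivity) (by positivity), ← ENNReal.ofReal_mul (by norm_num)]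
  refine ENNReal.ofReal_le_ofReal ?_
  have h := norm_add₃_le (a := a) (b := b) (c := c)
  calc ‖a + b + c‖ ^ 2 ≤ (‖a‖ + ‖b‖ + ‖c‖) ^ 2 := by gcongr
    _ ≤ _ := by nlinarith [sq_nonneg (‖a‖ - ‖b‖), sq_nonneg (‖a‖ - ‖c‖), sq_nonneg (‖b‖ - ‖c‖)]

/-- Meant for the boundary layer, where translates leave the domain. From `‖a‖² ≤ 2 + 2 (1 - ‖a‖)²`,
the distance is controlled by the measure of the layer, the modulus defect of `a` and the norm of
`b` alone. -/
theorem enorm_sq_sub_le (a b : ℂ) :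
    ‖a - b‖ₑ ^ 2 ≤ 4 + 4 * ENNReal.ofReal ((1 - ‖a‖) ^ 2) + 2 * ‖b‖ₑ ^ 2 := by
  have e : ∀ z : ℂ, ‖z‖ₑ ^ 2 = ENNReal.ofReal (‖z‖ ^ 2) := fun z => by
    rw [ENNReal.ofReal_pow (norm_nonneg _), ofReal_norm]
  have h4 : (4 : ENNReal) = ENNReal.ofReal 4 := by norm_num
  have h2 : (2 : ENNReal) = ENNReal.ofReal 2 := by norm_num
  rw [e, e, h4, h2, ← ENNReal.ofReal_mul (by norm_num), ← ENNReal.ofReal_mul (by norm_num),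
    ← ENNReal.ofReal_add (by norm_num) (by positivity), ← ENNReal.ofReal_add (by positivity) (by positivity)]
  refine ENNReal.ofReal_le_ofReal ?_
  have h := norm_sub_le a b
  calc ‖a - b‖ ^ 2 ≤ (‖a‖ + ‖b‖) ^ 2 := by gcongr
    _ ≤ _ := by nlinarith [sq_nonneg (‖a‖ - ‖b‖), sq_nonneg (‖a‖ - 2)]

theorem setLIntegral_translate_le {K U : Set ℂ} {z : ℂ} (h : ∀ x ∈ K, x - z ∈ U) (f : ℂ → ENNReal) :
    ∫⁻ x in K, f (x - z) ≤ ∫⁻ x in U, f x := by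
  rw [← (measurePreserving_sub_right volume z).setLIntegral_comp_preimage_emb
    (MeasurableEquiv.subRight z).measurableEmbedding f U]
  exact lintegral_mono_set fun x hx => h x hx

theorem eLpNorm_translate_le {K U : Set ℂ} {z : ℂ} (h : ∀ x ∈ K, x - z ∈ U) (f : ℂ → ℂ) :
    eLpNorm (fun x => f (x - z)) 2 (volume.restrict K) ≤ eLpNorm f 2 (volume.restrict U) := by
  rw [← ENNReal.pow_le_pow_left_iff two_ne_zero, eLpNorm_two_sq, eLpNorm_two_sq]
  exact setLIntegral_translate_le h fun x => ‖f x‖ₑ ^ 2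

/-- The translation estimate for smooth functions. -/
theorem eLpNorm_translate_sub_le_smooth {K U : Set ℂ} {y : ℂ}
    (h : ∀ x ∈ K, ∀ t ∈ Icc (0 : ℝ) 1, x - t • y ∈ U) {φ : ℂ → ℂ} (hφ : ContDiff ℝ ∞ φ) :
    eLpNorm (fun x => φ (x - y) - φ x) 2 (volume.restrict K) ≤
      ‖y‖ₑ * (eLpNorm (fun x => fderiv ℝ φ x 1) 2 (volume.restrict U) +
        eLpNorm (fun x => fderiv ℝ φ x Complex.I) 2 (volume.restrict U)) := by
  have hc : ∀ e, Continuous fun x => fderiv ℝ φ x e :=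
    fun e => continuous_fderiv_apply_of_contDiff hφ (by simp) e
  -- The increment is the integral of the derivative along the segment; Jensen on the unit interval
  -- squares it under the integral.
  have hpt : ∀ x, ‖φ (x - y) - φ x‖ₑ ^ 2 ≤
      ∫⁻ t in Ioc (0 : ℝ) 1, ‖fderiv ℝ φ (x - t • y) y‖ₑ ^ 2 := by
    intro x
    have hd : ∀ t ∈ uIcc (0 : ℝ) 1, HasDerivAt (fun t : ℝ => φ (x - t • y))
        (-fderiv ℝ φ (x - t • y) y) t := fun t _ => by
      have h1 : HasDerivAt (fun t : ℝ => x - t • y) (-y) t := by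
        simpa using ((hasDerivAt_id t).smul_const y).const_sub x
      have h2 := (hφ.differentiable (by simp) (x - t • y)).hasFDerivAt.comp_hasDerivAt t h1
      simpa [Function.comp_def] using h2
    have hcd : Continuous fun t : ℝ => fderiv ℝ φ (x - t • y) y := (hc y).comp (by fun_prop)
    have hft := intervalIntegral.integral_eq_sub_of_hasDerivAt hd (hcd.neg.intervalIntegrable _ _)
    simp only [one_smul, zero_smul, sub_zero] at hft
    have hprob : IsProbabilityMeasure (volume.restrict (Ioc (0 : ℝ) 1)) :=
      ⟨by simp⟩
    have h1 : ‖φ (x - y) - φ x‖ₑ ≤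
        eLpNorm (fun t : ℝ => fderiv ℝ φ (x - t • y) y) 1 (volume.restrict (Ioc (0 : ℝ) 1)) := by
      rw [← hft, intervalIntegral.integral_of_le zero_le_one, eLpNorm_one_eq_lintegral_enorm]
      refine (enorm_integral_le_lintegral_enorm _).trans_eq ?_
      simp
    have h2 := eLpNorm_le_eLpNorm_of_exponent_le (p := 1) (q := 2) (by norm_num)
      (hcd.aestronglyMeasurable (μ := volume.restrict (Ioc (0 : ℝ) 1)))
    rw [← eLpNorm_two_sq]
    gcongr
    exact h1.trans h2
  have hdir : eLpNorm (fun x => fderiv ℝ φ x y) 2 (volume.restrict U) ≤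
      ‖y‖ₑ * (eLpNorm (fun x => fderiv ℝ φ x 1) 2 (volume.restrict U) +
        eLpNorm (fun x => fderiv ℝ φ x Complex.I) 2 (volume.restrict U)) := by
    have e : (fun x => fderiv ℝ φ x y) =
        (y.re • fun x => fderiv ℝ φ x 1) + (y.im • fun x => fderiv ℝ φ x Complex.I) := by
      funext x
      simp only [Pi.add_apply, Pi.smul_apply]
      rw [← map_smul, ← map_smul, ← map_add]
      congr 1
      apply Complex.ext <;> simp
    rw [e, mul_add]
    refine (eLpNorm_add_le ((hc 1).aestronglyMeasurable.const_smul _)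
      ((hc Complex.I).aestronglyMeasurable.const_smul _) (by norm_num)).trans ?_
    rw [eLpNorm_const_smul, eLpNorm_const_smul]
    have hre : ‖y.re‖ₑ ≤ ‖y‖ₑ := by
      rw [← ofReal_norm, ← ofReal_norm]; exact ENNReal.ofReal_le_ofReal (Complex.abs_re_le_norm y)
    have him : ‖y.im‖ₑ ≤ ‖y‖ₑ := by
      rw [← ofReal_norm, ← ofReal_norm]; exact ENNReal.ofReal_le_ofReal (Complex.abs_im_le_norm y)
    gcongr
  refine le_trans ?_ hdir
  rw [← ENNReal.pow_le_pow_left_iff two_ne_zero, eLpNorm_two_sq, eLpNorm_two_sq]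
  calc ∫⁻ x in K, ‖φ (x - y) - φ x‖ₑ ^ 2
      ≤ ∫⁻ x in K, ∫⁻ t in Ioc (0 : ℝ) 1, ‖fderiv ℝ φ (x - t • y) y‖ₑ ^ 2 := lintegral_mono hpt
    _ = ∫⁻ t in Ioc (0 : ℝ) 1, ∫⁻ x in K, ‖fderiv ℝ φ (x - t • y) y‖ₑ ^ 2 := by
        refine lintegral_lintegral_swap (Measurable.aemeasurable ?_)
        have : Continuous fun p : ℂ × ℝ => fderiv ℝ φ (p.1 - p.2 • y) y := (hc y).comp (by fun_prop)
        exact this.enorm.measurable.pow_const 2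
    _ ≤ ∫⁻ t in Ioc (0 : ℝ) 1, ∫⁻ x in U, ‖fderiv ℝ φ x y‖ₑ ^ 2 := by
        refine setLIntegral_mono' measurableSet_Ioc fun t ht => ?_
        exact setLIntegral_translate_le (fun x hx => h x hx t (Ioc_subset_Icc_self ht))
          fun x => ‖fderiv ℝ φ x y‖ₑ ^ 2
    _ = ∫⁻ x in U, ‖fderiv ℝ φ x y‖ₑ ^ 2 := by simp

/-- The translation estimate. -/
theorem MemH1.eLpNorm_translate_sub_le {K U : Set ℂ} (hU : MeasurableSet U) {y : ℂ}
    (h : ∀ x ∈ K, ∀ t ∈ Icc (0 : ℝ) 1, x - t • y ∈ U) {u : ℂ → ℂ} (hu : MemH1 U u)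
    {φ : ℕ → ℂ → ℂ} (hφ : H1Tendsto U φ u) :
    eLpNorm (fun x => U.indicator u (x - y) - U.indicator u x) 2 (volume.restrict K) ≤
      ‖y‖ₑ * (eLpNorm (weakDeriv U 1 u) 2 (volume.restrict U) +
        eLpNorm (weakDeriv U Complex.I u) 2 (volume.restrict U)) := by
  have hx0 : ∀ x ∈ K, x ∈ U := fun x hx => by simpa using h x hx 0 (by simp)
  have hx1 : ∀ x ∈ K, x - y ∈ U := fun x hx => by simpa using h x hx 1 (by simp)
  set g := U.indicator u with hg
  have hgm : AEStronglyMeasurable g volume := (aestronglyMeasurable_indicator_iff hU).2 hu.1.1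
  have hgy : AEStronglyMeasurable (fun x => g (x - y)) volume :=
    hgm.comp_measurePreserving (measurePreserving_sub_right volume y)
  have hU0 : ∀ f : ℂ → ℂ, eLpNorm (fun x => f x - g x) 2 (volume.restrict U) =
      eLpNorm (fun x => f x - u x) 2 (volume.restrict U) := fun f => by
    refine eLpNorm_congr_ae ?_
    filter_upwards [ae_restrict_mem hU] with x hx
    simp [hg, hx]
  have hd : ∀ (f w : ℂ → ℂ), AEStronglyMeasurable f (volume.restrict U) →
      AEStronglyMeasurable w (volume.restrict U) → eLpNorm f 2 (volume.restrict U) ≤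
        eLpNorm (fun x => f x - w x) 2 (volume.restrict U) + eLpNorm w 2 (volume.restrict U) := by
    intro f w hf hw
    have h := eLpNorm_add_le (p := 2) (hf.sub hw) hw (by norm_num)
    rwa [sub_add_cancel] at h
  have hc : ∀ n e, AEStronglyMeasurable (fun x => fderiv ℝ (φ n) x e) (volume.restrict U) :=
    fun n e => (continuous_fderiv_apply_of_contDiff (hφ.1 n) (by simp) e).aestronglyMeasurable
  set B := eLpNorm (weakDeriv U 1 u) 2 (volume.restrict U) +
        eLpNorm (weakDeriv U Complex.I u) 2 (volume.restrict U)
  have hn : ∀ n, eLpNorm (fun x => g (x - y) - g x) 2 (volume.restrict K) ≤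
      2 * eLpNorm (fun x => φ n x - u x) 2 (volume.restrict U) + ‖y‖ₑ *
        (eLpNorm (fun x => fderiv ℝ (φ n) x 1 - weakDeriv U 1 u x) 2 (volume.restrict U) +
          eLpNorm (fun x => fderiv ℝ (φ n) x Complex.I - weakDeriv U Complex.I u x) 2
            (volume.restrict U)) + ‖y‖ₑ * B := by
    intro n
    have hφc := (hφ.1 n).continuous
    have hφy : Continuous fun x => φ n (x - y) := hφc.comp (by fun_prop)
    have e : (fun x => g (x - y) - g x) = (fun x => φ n (x - y) - φ n x) +
        ((fun x => φ n x - g x) - fun x => φ n (x - y) - g (x - y)) := by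
      funext x
      simp only [Pi.add_apply, Pi.sub_apply]
      ring
    have m1 : AEStronglyMeasurable (fun x => φ n x - g x) (volume.restrict K) :=
      (hφc.aestronglyMeasurable.sub hgm).restrict
    have m2 : AEStronglyMeasurable (fun x => φ n (x - y) - g (x - y)) (volume.restrict K) :=
      (hφy.aestronglyMeasurable.sub hgy).restrict
    rw [e]
    refine (eLpNorm_add_le (hφy.sub hφc).aestronglyMeasurable (m1.sub m2) (by norm_num)).trans ?_
    have t1 := eLpNorm_translate_sub_le_smooth h (hφ.1 n)
    have t2 := eLpNorm_sub_le (p := 2) m1 m2 (by norm_num)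
    have t3 : eLpNorm (fun x => φ n x - g x) 2 (volume.restrict K) ≤
        eLpNorm (fun x => φ n x - u x) 2 (volume.restrict U) := by
      rw [← hU0]
      exact eLpNorm_mono_measure _ (Measure.restrict_mono hx0 le_rfl)
    have t4 : eLpNorm (fun x => φ n (x - y) - g (x - y)) 2 (volume.restrict K) ≤
        eLpNorm (fun x => φ n x - u x) 2 (volume.restrict U) := by
      rw [← hU0]
      exact eLpNorm_translate_le hx1 fun x => φ n x - g x
    have t5 := hd _ _ (hc n 1) hu.isWeakDeriv_one.1.1
    have t6 := hd _ _ (hc n Complex.I) hu.isWeakDeriv_I.1.1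
    refine (add_le_add (t1.trans (mul_le_mul_right (add_le_add t5 t6) _))
      (t2.trans (add_le_add t3 t4))).trans (le_of_eq ?_)
    ring
  have hlim : Tendsto (fun n => 2 * eLpNorm (fun x => φ n x - u x) 2 (volume.restrict U) + ‖y‖ₑ *
        (eLpNorm (fun x => fderiv ℝ (φ n) x 1 - weakDeriv U 1 u x) 2 (volume.restrict U) +
          eLpNorm (fun x => fderiv ℝ (φ n) x Complex.I - weakDeriv U Complex.I u x) 2
            (volume.restrict U)) + ‖y‖ₑ * B) atTop (𝓝 (2 * 0 + ‖y‖ₑ * (0 + 0) + ‖y‖ₑ * B)) :=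
    ((ENNReal.Tendsto.const_mul hφ.2.1 (Or.inr (by norm_num))).add (ENNReal.Tendsto.const_mul
      ((hφ.2.2 1 (by simp)).add (hφ.2.2 Complex.I (by simp))) (Or.inr enorm_ne_top))).add_const _
  simp only [mul_zero, add_zero, zero_add] at hlim
  exact ge_of_tendsto' hlim hn

-- The convolution at `x` is a pairing with `k (x - ·)`, so weak convergence gives pointwise
-- convergence. The kernel is bounded, hence so are the convolutions, uniformly, and dominated
-- convergence applies as `U` has finite measure.
open Convolution ContinuousLinearMap in
theorem tendsto_lintegral_convolution_sub {U : Set ℂ} (hU : MeasurableSet U) (hb : volume U ≠ ⊤)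
    {k : ℂ → ℝ} (hk : IsKernel k) {u : ℕ → ℂ → ℂ} {v : ℂ → ℂ} {R : ENNReal} (hR : R ≠ ⊤)
    (hu : ∀ n, MemLp (u n) 2 (volume.restrict U))
    (huR : ∀ n, eLpNorm (u n) 2 (volume.restrict U) ≤ R) (hv : MemLp v 2 (volume.restrict U))
    (hw : ∀ ψ : ℂ → ℝ, MemLp ψ 2 (volume.restrict U) →
      Tendsto (fun n => ∫ z in U, ψ z • u n z) atTop (𝓝 (∫ z in U, ψ z • v z))) :
    Tendsto (fun n => ∫⁻ x in U, ‖(k ⋆[lsmul ℝ ℝ, volume] U.indicator (u n)) x -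
      (k ⋆[lsmul ℝ ℝ, volume] U.indicator v) x‖ₑ ^ 2) atTop (𝓝 0) := by
  have hfin : IsFiniteMeasure (volume.restrict U) := ⟨by simpa using hb.lt_top⟩
  have hform : ∀ (f : ℂ → ℂ) x, (k ⋆[lsmul ℝ ℝ, volume] U.indicator f) x =
      ∫ t in U, k (x - t) • f t := by
    intro f x
    rw [convolution_eq_swap, ← integral_indicator hU]
    congr 1 with t
    by_cases ht : t ∈ U <;> simp [ht]
  have hloc : ∀ {f : ℂ → ℂ}, MemLp f 2 (volume.restrict U) →
      LocallyIntegrable (U.indicator f) volume := fun hf =>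
    ((memLp_indicator_iff_restrict hU).2 hf).locallyIntegrable (by norm_num)
  have hcont : ∀ {f : ℂ → ℂ}, MemLp f 2 (volume.restrict U) →
      Continuous (k ⋆[lsmul ℝ ℝ, volume] U.indicator f) := fun hf =>
    hk.hasCompactSupport.continuous_convolution_left _ hk.continuous (hloc hf)
  obtain ⟨C, hC⟩ := exists_bound_of_compactSupport hk.continuous hk.hasCompactSupport
  have hkx : ∀ x, Continuous fun t => k (x - t) := fun x => hk.continuous.comp (by fun_prop)
  have hkL : ∀ x, MemLp (fun t => k (x - t)) 2 (volume.restrict U) := fun x =>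
    MemLp.of_bound (hkx x).aestronglyMeasurable C (Eventually.of_forall fun t => hC (x - t))
  set c : ENNReal := volume U ^ (1 / (1 : ENNReal).toReal - 1 / (2 : ENNReal).toReal) with hc
  have hcf : c ≠ ⊤ := ENNReal.rpow_ne_top_of_nonneg (by norm_num) hb
  set M : ENNReal := ENNReal.ofReal C * (R * c) with hM
  have hMf : M ≠ ⊤ := ENNReal.mul_ne_top ENNReal.ofReal_ne_top (ENNReal.mul_ne_top hR hcf)
  have hbound : ∀ n x, ‖(k ⋆[lsmul ℝ ℝ, volume] U.indicator (u n)) x‖ₑ ≤ M := by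
    intro n x
    rw [hform]
    refine (enorm_integral_le_lintegral_enorm _).trans ?_
    calc ∫⁻ t in U, ‖k (x - t) • u n t‖ₑ ≤ ∫⁻ t in U, ENNReal.ofReal C * ‖u n t‖ₑ := by
          refine lintegral_mono fun t => ?_
          rw [enorm_smul]
          gcongr
          rw [← ofReal_norm]
          exact ENNReal.ofReal_le_ofReal (hC _)
      _ = ENNReal.ofReal C * eLpNorm (u n) 1 (volume.restrict U) := by
          rw [lintegral_const_mul' _ _ ENNReal.ofReal_ne_top, eLpNorm_one_eq_lintegral_enorm]
      _ ≤ M := by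
          rw [hM]
          gcongr
          refine (eLpNorm_le_eLpNorm_mul_rpow_measure_univ (p := 1) (q := 2) (by norm_num)
            (hu n).1).trans ?_
          rw [Measure.restrict_apply_univ]
          gcongr
          exact huR n
  have hpt : ∀ x, Tendsto (fun n => (k ⋆[lsmul ℝ ℝ, volume] U.indicator (u n)) x) atTop
      (𝓝 ((k ⋆[lsmul ℝ ℝ, volume] U.indicator v) x)) := fun x => by
    simp only [hform]
    exact hw _ (hkL x)
  have hboundv : ∀ x, ‖(k ⋆[lsmul ℝ ℝ, volume] U.indicator v) x‖ₑ ≤ M := fun x =>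
    le_of_tendsto' (hpt x).enorm fun n => hbound n x
  have h0 : ∫⁻ _ in U, (0 : ENNReal) = 0 := by simp
  rw [← h0]
  refine tendsto_lintegral_of_dominated_convergence' (fun _ => (M + M) ^ 2)
    (fun n => (((hcont (hu n)).sub (hcont hv)).enorm.measurable.pow_const 2).aemeasurable)
    (fun n => Eventually.of_forall fun x => ?_) ?_ (Eventually.of_forall fun x => ?_)
  · refine pow_le_pow_left' ?_ 2
    exact (enorm_sub_le).trans (add_le_add (hbound n x) (hboundv x))
  · rw [lintegral_const, Measure.restrict_apply_univ]
    exact ENNReal.mul_ne_top (ENNReal.pow_ne_top (ENNReal.add_ne_top.2 ⟨hMf, hMf⟩)) hb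
  · have h := ((hpt x).sub_const ((k ⋆[lsmul ℝ ℝ, volume] U.indicator v) x)).enorm
    rw [sub_self, enorm_zero] at h
    simpa using ENNReal.Tendsto.pow (n := 2) h

open Convolution ContinuousLinearMap in
/-- Strong convergence of weakly convergent bounded sequences of `H¹(U)` with modulus tending
to one. -/
theorem tendsto_eLpNorm_of_weak {U : Set ℂ} (hU : IsOpen U) (hb : Bornology.IsBounded U)
    {u : ℕ → ℂ → ℂ} {v : ℂ → ℂ} {R B : ENNReal} (hR : R ≠ ⊤) (hB : B ≠ ⊤)
    (hu : ∀ n, MemH1 U (u n)) (huφ : ∀ n, ∃ φ, H1Tendsto U φ (u n))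
    (huR : ∀ n, eLpNorm (u n) 2 (volume.restrict U) ≤ R)
    (huB : ∀ n, eLpNorm (weakDeriv U 1 (u n)) 2 (volume.restrict U) +
      eLpNorm (weakDeriv U Complex.I (u n)) 2 (volume.restrict U) ≤ B)
    (hone : Tendsto (fun n => ∫⁻ x in U, ENNReal.ofReal ((1 - ‖u n x‖) ^ 2)) atTop (𝓝 0))
    (hv : MemLp v 2 (volume.restrict U))
    (hw : ∀ ψ : ℂ → ℝ, MemLp ψ 2 (volume.restrict U) →
      Tendsto (fun n => ∫ z in U, ψ z • u n z) atTop (𝓝 (∫ z in U, ψ z • v z))) :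
    Tendsto (fun n => eLpNorm (fun x => u n x - v x) 2 (volume.restrict U)) atTop (𝓝 0) := by
  have hUm := hU.measurableSet
  have hfin : volume U ≠ ⊤ := hb.measure_lt_top.ne
  have hfinm : IsFiniteMeasure (volume.restrict U) := ⟨by simpa using hfin.lt_top⟩
  have hpos : ∀ m : ℕ, (0 : ℝ) < 1 / ((m : ℝ) + 1) := fun m => by positivity
  set r : ℕ → ℝ := fun m => 1 / ((m : ℝ) + 1) with hr
  have hr0 : Tendsto r atTop (𝓝 0) := tendsto_one_div_add_atTop_nhds_zero_nat
  set b : ℕ → ContDiffBump (0 : ℂ) := fun m => ⟨r m / 2, r m, half_pos (hpos m), half_lt_self (hpos m)⟩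
  set k : ℕ → ℂ → ℝ := fun m => (b m).normed volume with hk
  have hkk : ∀ m, IsKernel (k m) := fun m => ⟨(b m).continuous_normed, (b m).hasCompactSupport_normed,
    (b m).nonneg_normed, (b m).integral_normed⟩
  have hsupp : ∀ m y, k m y ≠ 0 → ‖y‖ ≤ r m := by
    intro m y hy
    have h1 : y ∈ tsupport (k m) := subset_tsupport _ hy
    rw [hk, (b m).tsupport_normed_eq, mem_closedBall_zero_iff] at h1
    exact h1
  set T : ℕ → Set ℂ := fun m => Metric.cthickening (r m) Uᶜ with hT
  have hTm : ∀ m, MeasurableSet (T m) := fun m => Metric.isClosed_cthickening.measurableSet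
  have hK : ∀ m, ∀ x ∈ (T m)ᶜ, ∀ z, ‖z‖ ≤ r m → x - z ∈ U := by
    intro m x hx z hz
    by_contra h
    refine hx (Metric.mem_cthickening_of_dist_le x (x - z) _ _ h ?_)
    rwa [dist_eq_norm, sub_sub_cancel]
  have hTU : ∀ m, (T m)ᶜ ⊆ U := fun m x hx => by simpa using hK m x hx 0 (norm_zero.trans_le (hpos m).le)
  have hgL : ∀ {f : ℂ → ℂ}, MemLp f 2 (volume.restrict U) → MemLp (U.indicator f) 2 volume :=
    fun hf => (memLp_indicator_iff_restrict hUm).2 hf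
  have hloc : ∀ {f : ℂ → ℂ}, MemLp f 2 (volume.restrict U) →
      LocallyIntegrable (U.indicator f) volume := fun hf => (hgL hf).locallyIntegrable (by norm_num)
  set a : ℕ → ENNReal := fun m =>
    ∫⁻ x, ‖(k m ⋆[lsmul ℝ ℝ, volume] U.indicator v) x - U.indicator v x‖ₑ ^ 2 with ha
  have ha0 : Tendsto a atTop (𝓝 0) := by
    have h := tendsto_convolution_L2 (hgL hv) hkk hr0 hsupp
    rwa [tendsto_eLpNorm_two_iff] at h
  set d : ℕ → ENNReal := fun m => volume (T m ∩ U) with hd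
  -- The closed thickenings of the complement shrink to the complement itself, which does not meet
  -- `U`.
  have hd0 : Tendsto d atTop (𝓝 0) := by
    have h := tendsto_measure_cthickening_of_isClosed (μ := volume.restrict U) (s := Uᶜ)
      ⟨1, one_pos, measure_ne_top _ _⟩ hU.isClosed_compl
    rw [Measure.restrict_apply hUm.compl, compl_inter_self, measure_empty] at h
    refine (h.comp hr0).congr fun m => ?_
    rw [Function.comp_apply, Measure.restrict_apply (hTm m)]
  set c : ℕ → ENNReal := fun m => ∫⁻ x in T m ∩ U, ‖v x‖ₑ ^ 2 with hc
  have hc0 : Tendsto c atTop (𝓝 0) := by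
    have h1 : ∫⁻ x in U, ‖v x‖ₑ ^ 2 ≠ ⊤ := by
      rw [← eLpNorm_two_sq]; exact ENNReal.pow_ne_top hv.2.ne
    have h2 := tendsto_setLIntegral_zero (μ := volume.restrict U) h1 (l := atTop) (s := T) ?_
    · refine h2.congr fun m => ?_
      rw [Measure.restrict_restrict (hTm m)]
    · refine hd0.congr fun m => ?_
      rw [Function.comp_apply, Measure.restrict_apply (hTm m)]
  set o : ℕ → ℕ → ENNReal := fun m n => ∫⁻ x in U, ‖(k m ⋆[lsmul ℝ ℝ, volume] U.indicator (u n)) x -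
      (k m ⋆[lsmul ℝ ℝ, volume] U.indicator v) x‖ₑ ^ 2 with ho
  have ho0 : ∀ m, Tendsto (o m) atTop (𝓝 0) := fun m =>
    tendsto_lintegral_convolution_sub hUm hfin (hkk m) hR (fun n => (hu n).1) huR hv hw
  set e : ℕ → ENNReal := fun n => ∫⁻ x in U, ENNReal.ofReal ((1 - ‖u n x‖) ^ 2) with he
  set β : ℕ → ENNReal := fun m => (ENNReal.ofReal (r m) * B) ^ 2 with hβ
  have hβ0 : Tendsto β atTop (𝓝 0) := by
    have h1 : Tendsto (fun m => ENNReal.ofReal (r m) * B) atTop (𝓝 (ENNReal.ofReal 0 * B)) :=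
      ENNReal.Tendsto.mul_const (ENNReal.tendsto_ofReal hr0) (Or.inr hB)
    rw [ENNReal.ofReal_zero, zero_mul] at h1
    simpa using ENNReal.Tendsto.pow (n := 2) h1
  have hconv : ∀ m n, ∫⁻ x in (T m)ᶜ, ‖(k m ⋆[lsmul ℝ ℝ, volume] U.indicator (u n)) x -
      U.indicator (u n) x‖ₑ ^ 2 ≤ β m := by
    intro m n
    refine (hkk m).lintegral_convolution_sub_le (hloc (hu n).1) _ fun y hy => ?_
    obtain ⟨φ, hφ⟩ := huφ n
    have hy' := hsupp m y hy
    rw [← eLpNorm_two_sq]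
    refine pow_le_pow_left' (((hu n).eLpNorm_translate_sub_le hUm (K := (T m)ᶜ) (y := y)
      (fun x hx t ht => hK m x hx _ ?_) hφ).trans ?_) 2
    · rw [norm_smul, Real.norm_of_nonneg ht.1]
      exact (mul_le_of_le_one_left (norm_nonneg y) ht.2).trans hy'
    · refine mul_le_mul' ?_ (huB n)
      rw [← ofReal_norm]
      exact ENNReal.ofReal_le_ofReal hy'
  -- Away from the layer `T m` both mollifications are inserted: `β m` is the translation estimate,
  -- uniform in `n`; `o m n` is weak convergence; `a m` is the mollification error of the limit. In
  -- the layer only the modulus is used.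
  have hmain : ∀ m n, ∫⁻ x in U, ‖u n x - v x‖ₑ ^ 2 ≤
      (3 * (β m + a m) + (4 * d m + 2 * c m)) + (3 * o m n + 4 * e n) := by
    intro m n
    have hvm : AEStronglyMeasurable v (volume.restrict (T m ∩ U)) := 
      hv.1.mono_measure (Measure.restrict_mono inter_subset_right le_rfl)
    have hcm : ∀ {f : ℂ → ℂ}, MemLp f 2 (volume.restrict U) → Measurable
        (k m ⋆[lsmul ℝ ℝ, volume] U.indicator f) := fun hf =>
      ((hkk m).hasCompactSupport.continuous_convolution_left _ (hkk m).continuous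
        (hloc hf)).measurable
    have hsplit : ∫⁻ x in U, ‖u n x - v x‖ₑ ^ 2 =
        (∫⁻ x in T m ∩ U, ‖u n x - v x‖ₑ ^ 2) + ∫⁻ x in (T m)ᶜ, ‖u n x - v x‖ₑ ^ 2 := by
      rw [← lintegral_inter_add_sdiff (μ := volume) _ U (hTm m), inter_comm, sdiff_eq,
        inter_eq_right.2 (hTU m)]
    have hin : ∫⁻ x in (T m)ᶜ, ‖u n x - v x‖ₑ ^ 2 ≤ 3 * (β m + o m n + a m) := by
      have hgu : AEMeasurable (U.indicator (u n)) (volume.restrict (T m)ᶜ) :=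
        (hgL (hu n).1).1.aemeasurable.restrict
      have hgv : AEMeasurable (U.indicator v) (volume.restrict (T m)ᶜ) :=
        (hgL hv).1.aemeasurable.restrict
      have m1 : AEMeasurable (fun x => ‖(k m ⋆[lsmul ℝ ℝ, volume] U.indicator (u n)) x -
          U.indicator (u n) x‖ₑ ^ 2) (volume.restrict (T m)ᶜ) :=
        ((hcm (hu n).1).aemeasurable.sub hgu).enorm.pow_const 2
      have m2 : Measurable (fun x => ‖(k m ⋆[lsmul ℝ ℝ, volume] U.indicator (u n)) x -
          (k m ⋆[lsmul ℝ ℝ, volume] U.indicator v) x‖ₑ ^ 2) :=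
        ((hcm (hu n).1).sub (hcm hv)).enorm.pow_const 2
      calc ∫⁻ x in (T m)ᶜ, ‖u n x - v x‖ₑ ^ 2
          ≤ ∫⁻ x in (T m)ᶜ, 3 * (‖(k m ⋆[lsmul ℝ ℝ, volume] U.indicator (u n)) x -
              U.indicator (u n) x‖ₑ ^ 2 + ‖(k m ⋆[lsmul ℝ ℝ, volume] U.indicator (u n)) x -
              (k m ⋆[lsmul ℝ ℝ, volume] U.indicator v) x‖ₑ ^ 2 +
              ‖(k m ⋆[lsmul ℝ ℝ, volume] U.indicator v) x - U.indicator v x‖ₑ ^ 2) := by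
            refine setLIntegral_mono' (hTm m).compl fun x hx => ?_
            have hxU := hTU m hx
            rw [indicator_of_mem hxU, indicator_of_mem hxU, ← enorm_neg (_ - u n x)]
            refine le_trans (le_of_eq ?_) (enorm_sq_add_three_le _ _ _)
            congr 2
            ring
        _ = 3 * ((∫⁻ x in (T m)ᶜ, ‖(k m ⋆[lsmul ℝ ℝ, volume] U.indicator (u n)) x -
              U.indicator (u n) x‖ₑ ^ 2) + (∫⁻ x in (T m)ᶜ, ‖(k m ⋆[lsmul ℝ ℝ, volume] U.indicator (u n)) x -
              (k m ⋆[lsmul ℝ ℝ, volume] U.indicator v) x‖ₑ ^ 2) + ∫⁻ x in (T m)ᶜ,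
              ‖(k m ⋆[lsmul ℝ ℝ, volume] U.indicator v) x - U.indicator v x‖ₑ ^ 2) := by
            rw [lintegral_const_mul' _ _ (by norm_num), lintegral_add_left' (by exact m1.add m2.aemeasurable),
              lintegral_add_left' m1]
        _ ≤ _ := by
            gcongr
            · exact hconv m n
            · exact lintegral_mono_set (hTU m)
            · exact setLIntegral_le_lintegral _ _
    have hout : ∫⁻ x in T m ∩ U, ‖u n x - v x‖ₑ ^ 2 ≤ 4 * d m + 4 * e n + 2 * c m := by
      calc ∫⁻ x in T m ∩ U, ‖u n x - v x‖ₑ ^ 2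
          ≤ ∫⁻ x in T m ∩ U, (4 + 4 * ENNReal.ofReal ((1 - ‖u n x‖) ^ 2) + 2 * ‖v x‖ₑ ^ 2) :=
            lintegral_mono fun x => enorm_sq_sub_le _ _
        _ = 4 * d m + 4 * (∫⁻ x in T m ∩ U, ENNReal.ofReal ((1 - ‖u n x‖) ^ 2)) + 2 * c m := by
            rw [lintegral_add_right' _ ((hvm.aemeasurable.enorm.pow_const 2).const_mul 2),
              lintegral_add_left measurable_const, lintegral_const_mul' _ _ (by norm_num),
              lintegral_const_mul' _ _ (by norm_num), lintegral_const, Measure.restrict_apply_univ]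
        _ ≤ _ := by
            gcongr
            exact lintegral_mono_set inter_subset_right
    rw [hsplit]
    refine (add_le_add hout hin).trans (le_of_eq ?_)
    ring
  rw [tendsto_eLpNorm_two_iff, ENNReal.tendsto_nhds_zero]
  intro ε hε
  have hA : Tendsto (fun m => 3 * (β m + a m) + (4 * d m + 2 * c m)) atTop (𝓝 0) := by
    have h := (ENNReal.Tendsto.const_mul (a := (3 : ENNReal)) (hβ0.add ha0) (Or.inr (by norm_num))).add
      ((ENNReal.Tendsto.const_mul (a := (4 : ENNReal)) hd0 (Or.inr (by norm_num))).add
        (ENNReal.Tendsto.const_mul (a := (2 : ENNReal)) hc0 (Or.inr (by norm_num))))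
    simpa using h
  have hε2 : 0 < ε / 2 := ENNReal.half_pos hε.ne'
  -- The mollification scale is fixed first, by the terms independent of `n`; only then does `n`
  -- tend to infinity.
  obtain ⟨m, hm⟩ := (ENNReal.tendsto_nhds_zero.1 hA _ hε2).exists
  have hO : Tendsto (fun n => 3 * o m n + 4 * e n) atTop (𝓝 0) := by
    have h := (ENNReal.Tendsto.const_mul (a := (3 : ENNReal)) (ho0 m) (Or.inr (by norm_num))).add
      (ENNReal.Tendsto.const_mul (a := (4 : ENNReal)) hone (Or.inr (by norm_num)))
    simpa using h
  filter_upwards [ENNReal.tendsto_nhds_zero.1 hO _ hε2] with n hn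
  refine (hmain m n).trans ((add_le_add hm hn).trans_eq (ENNReal.add_halves ε))

/-- A test function and its derivative are both in `L²`, so each side of the defining identity is a
weakly continuous pairing. -/
theorem isWeakDeriv_of_weak {U : Set ℂ} {e : ℂ} {u w : ℕ → ℂ → ℂ} {v g : ℂ → ℂ}
    (h : ∀ n, IsWeakDeriv U e (u n) (w n)) (hg : MemLp g 2 (volume.restrict U))
    (hu : ∀ ψ : ℂ → ℝ, MemLp ψ 2 (volume.restrict U) →
      Tendsto (fun n => ∫ z in U, ψ z • u n z) atTop (𝓝 (∫ z in U, ψ z • v z)))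
    (hw : ∀ ψ : ℂ → ℝ, MemLp ψ 2 (volume.restrict U) →
      Tendsto (fun n => ∫ z in U, ψ z • w n z) atTop (𝓝 (∫ z in U, ψ z • g z))) :
    IsWeakDeriv U e v g := by
  refine ⟨hg, fun φ hφ hφs hφU => ?_⟩
  have h1 := hu (fun x => fderiv ℝ φ x e)
    ((continuous_fderiv_apply_of_contDiff hφ (by simp) e).memLp_of_hasCompactSupport
      (hφs.fderiv_apply ℝ e))
  have h2 := (hw φ (hφ.continuous.memLp_of_hasCompactSupport hφs)).neg
  refine tendsto_nhds_unique h1 (h2.congr fun n => ?_)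
  exact ((h n).2 φ hφ hφs hφU).symm

theorem ofReal_one_sub_norm_sq_le (a b : ℂ) :
    ENNReal.ofReal ((1 - ‖a‖) ^ 2) ≤ 2 * ENNReal.ofReal ((1 - ‖b‖) ^ 2) + 2 * ‖b - a‖ₑ ^ 2 := by
  have h2 : (2 : ENNReal) = ENNReal.ofReal 2 := by norm_num
  rw [← ofReal_norm, ← ENNReal.ofReal_pow (norm_nonneg _), h2, ← ENNReal.ofReal_mul (by norm_num),
    ← ENNReal.ofReal_mul (by norm_num), ← ENNReal.ofReal_add (by positivity) (by positivity)]
  refine ENNReal.ofReal_le_ofReal ?_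
  have h := abs_norm_sub_norm_le b a
  have h' : (‖b‖ - ‖a‖) ^ 2 ≤ ‖b - a‖ ^ 2 := by
    rw [← sq_abs]
    gcongr
  nlinarith [sq_nonneg ((1 - ‖b‖) - (‖b‖ - ‖a‖))]

/-- The limit in `L²` of maps whose modulus tends to one has modulus one. -/
theorem ae_norm_eq_one_of_tendsto {U : Set ℂ} {u : ℕ → ℂ → ℂ} {v : ℂ → ℂ}
    (hu : ∀ n, MemLp (u n) 2 (volume.restrict U)) (hv : MemLp v 2 (volume.restrict U))
    (hone : Tendsto (fun n => ∫⁻ x in U, ENNReal.ofReal ((1 - ‖u n x‖) ^ 2)) atTop (𝓝 0))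
    (h : Tendsto (fun n => eLpNorm (fun x => u n x - v x) 2 (volume.restrict U)) atTop (𝓝 0)) :
    ∀ᵐ x ∂volume.restrict U, ‖v x‖ = 1 := by
  rw [tendsto_eLpNorm_two_iff] at h
  have hm : AEMeasurable (fun x => ENNReal.ofReal ((1 - ‖v x‖) ^ 2)) (volume.restrict U) :=
    ((aemeasurable_const.sub hv.1.norm.aemeasurable).pow_const 2).ennreal_ofReal
  have hlim := (ENNReal.Tendsto.const_mul (a := (2 : ENNReal)) hone (Or.inr (by norm_num))).add
    (ENNReal.Tendsto.const_mul (a := (2 : ENNReal)) h (Or.inr (by norm_num)))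
  rw [mul_zero, add_zero] at hlim
  have h0 : ∫⁻ x in U, ENNReal.ofReal ((1 - ‖v x‖) ^ 2) ≤ 0 := by
    refine ge_of_tendsto' hlim fun n => ?_
    have hd : AEMeasurable (fun x => 2 * ‖u n x - v x‖ₑ ^ 2) (volume.restrict U) :=
      (((hu n).1.aemeasurable.sub hv.1.aemeasurable).enorm.pow_const 2).const_mul 2
    rw [← lintegral_const_mul' _ _ (by norm_num), ← lintegral_const_mul' _ _ (by norm_num),
      ← lintegral_add_right' _ hd]
    exact lintegral_mono fun x => ofReal_one_sub_norm_sq_le _ _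
  filter_upwards [(lintegral_eq_zero_iff' hm).1 (le_antisymm h0 zero_le)] with x hx
  have h1 : (1 - ‖v x‖) ^ 2 ≤ 0 := ENNReal.ofReal_eq_zero.1 hx
  have h2 : 1 - ‖v x‖ = 0 := pow_eq_zero_iff two_ne_zero |>.1 (le_antisymm h1 (sq_nonneg _))
  linarith

/-- Compactness of bounded sequences of `H¹(U)` with modulus tending to one. -/
theorem exists_subseq_tendsto_circle {U : Set ℂ} (hU : IsOpen U) (hb : Bornology.IsBounded U)
    {u : ℕ → ℂ → ℂ} {R B : ENNReal} (hR : R ≠ ⊤) (hB : B ≠ ⊤)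
    (hu : ∀ n, MemH1 U (u n)) (huφ : ∀ n, ∃ φ, H1Tendsto U φ (u n))
    (huR : ∀ n, eLpNorm (u n) 2 (volume.restrict U) ≤ R)
    (huB : ∀ n, eLpNorm (weakDeriv U 1 (u n)) 2 (volume.restrict U) +
      eLpNorm (weakDeriv U Complex.I (u n)) 2 (volume.restrict U) ≤ B)
    (hone : Tendsto (fun n => ∫⁻ x in U, ENNReal.ofReal ((1 - ‖u n x‖) ^ 2)) atTop (𝓝 0)) :
    ∃ v, MemH1Circle U v ∧ ∃ ms : ℕ → ℕ, StrictMono ms ∧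
      Tendsto (fun n => eLpNorm (fun x => u (ms n) x - v x) 2 (volume.restrict U)) atTop (𝓝 0) := by
  obtain ⟨v, hv, m₁, hm₁, hw₁⟩ := exists_weak_limit (R := R.toReal) (fun n => (hu n).1)
    fun n => (huR n).trans_eq (ENNReal.ofReal_toReal hR).symm
  obtain ⟨g₁, hg₁, m₂, hm₂, hw₂⟩ := exists_weak_limit (R := B.toReal)
    (x := fun n => weakDeriv U 1 (u (m₁ n))) (fun n => (hu _).isWeakDeriv_one.1)
    fun n => (le_self_add.trans (huB _)).trans_eq (ENNReal.ofReal_toReal hB).symm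
  obtain ⟨g₂, hg₂, m₃, hm₃, hw₃⟩ := exists_weak_limit (R := B.toReal)
    (x := fun n => weakDeriv U Complex.I (u (m₁ (m₂ n)))) (fun n => (hu _).isWeakDeriv_I.1)
    fun n => (le_add_self.trans (huB _)).trans_eq (ENNReal.ofReal_toReal hB).symm
  set ms : ℕ → ℕ := fun n => m₁ (m₂ (m₃ n)) with hms
  have hmono : StrictMono ms := hm₁.comp (hm₂.comp hm₃)
  have hwv : ∀ ψ : ℂ → ℝ, MemLp ψ 2 (volume.restrict U) →
      Tendsto (fun n => ∫ z in U, ψ z • u (ms n) z) atTop (𝓝 (∫ z in U, ψ z • v z)) :=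
    fun ψ hψ => (hw₁ ψ hψ).comp (hm₂.comp hm₃).tendsto_atTop
  have hvH : MemH1 U v := ⟨hv,
    ⟨g₁, isWeakDeriv_of_weak (fun n => (hu (ms n)).isWeakDeriv_one) hg₁ hwv
      fun ψ hψ => (hw₂ ψ hψ).comp hm₃.tendsto_atTop⟩,
    ⟨g₂, isWeakDeriv_of_weak (fun n => (hu (ms n)).isWeakDeriv_I) hg₂ hwv hw₃⟩⟩
  have hone' := hone.comp hmono.tendsto_atTop
  have hlim := tendsto_eLpNorm_of_weak hU hb hR hB (fun n => hu (ms n)) (fun n => huφ (ms n))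
    (fun n => huR _) (fun n => huB _) hone' hv hwv
  exact ⟨v, ⟨hvH, ae_norm_eq_one_of_tendsto (fun n => (hu (ms n)).1) hv hone' hlim⟩, ms, hmono, hlim⟩

theorem le_one_add_of_sq_le {x X : ENNReal} (h : x ^ 2 ≤ X) : x ≤ 1 + X := by
  rcases le_total x 1 with h1 | h1
  · exact h1.trans le_self_add
  · exact (le_self_pow₀ h1 two_ne_zero).trans (h.trans le_add_self)

/-! ### Consequences of the energy bound and asymptotic integrality -/

namespace PerforatedDomain

variable {N : ℕ} {P : PerforatedDomain N} {Λ ε : ℝ} {u : ℂ → ℂ}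

theorem lintegral_le_of_energy_le (h : P.energy ε u ≤ ENNReal.ofReal Λ) {f : ℂ → ℝ}
    (hf : ∀ x, f x ≤ ‖weakDeriv P.dom 1 u x‖ ^ 2 + ‖weakDeriv P.dom Complex.I u x‖ ^ 2
      + 1 / (2 * ε ^ 2) * (1 - ‖u x‖ ^ 2) ^ 2) :
    ∫⁻ x in P.dom, ENNReal.ofReal (f x) ≤ ENNReal.ofReal (2 * Λ) := by
  have h1 : ∫⁻ x in P.dom, ENNReal.ofReal (f x) ≤ 2 * P.energy ε u := by
    rw [energy, ← mul_assoc, one_div, ENNReal.mul_inv_cancel (by norm_num) (by norm_num), one_mul]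
    exact lintegral_mono fun x => ENNReal.ofReal_le_ofReal (hf x)
  refine h1.trans ?_
  rw [ENNReal.ofReal_mul (by norm_num), show ENNReal.ofReal 2 = 2 by norm_num]
  gcongr

theorem eLpNorm_weakDeriv_le_of_energy_le (h : P.energy ε u ≤ ENNReal.ofReal Λ) {e : ℂ}
    (he : e ∈ ({1, Complex.I} : Set ℂ)) :
    eLpNorm (weakDeriv P.dom e u) 2 (volume.restrict P.dom) ≤ 1 + ENNReal.ofReal (2 * Λ) := by
  refine le_one_add_of_sq_le ?_
  rw [eLpNorm_two_sq]
  refine le_trans (le_of_eq ?_) (lintegral_le_of_energy_le h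
    (f := fun x => ‖weakDeriv P.dom e u x‖ ^ 2) fun x => ?_)
  · refine lintegral_congr fun x => ?_
    rw [ENNReal.ofReal_pow (norm_nonneg _), ofReal_norm]
  · have h3 : 0 ≤ 1 / (2 * ε ^ 2) * (1 - ‖u x‖ ^ 2) ^ 2 := by positivity
    have h1 := sq_nonneg ‖weakDeriv P.dom 1 u x‖
    have h2 := sq_nonneg ‖weakDeriv P.dom Complex.I u x‖
    rcases he with rfl | rfl <;> linarith

/-- The potential term of the energy controls `(1 - ‖u‖²)²`, which dominates `(1 - ‖u‖)²` because
the remaining factor `(1 + ‖u‖)²` is at least `1`. -/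
theorem lintegral_one_sub_norm_le_of_energy_le (hε : 0 < ε) (h : P.energy ε u ≤ ENNReal.ofReal Λ) :
    ∫⁻ x in P.dom, ENNReal.ofReal ((1 - ‖u x‖) ^ 2) ≤
      ENNReal.ofReal (2 * ε ^ 2) * ENNReal.ofReal (2 * Λ) := by
  have h1 := lintegral_le_of_energy_le h (f := fun x => 1 / (2 * ε ^ 2) * (1 - ‖u x‖ ^ 2) ^ 2)
    fun x => le_add_of_nonneg_left (by positivity)
  refine le_trans ?_ (mul_le_mul_right h1 _)
  rw [← lintegral_const_mul' _ _ ENNReal.ofReal_ne_top]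
  refine lintegral_mono fun x => ?_
  rw [← ENNReal.ofReal_mul (by positivity)]
  refine ENNReal.ofReal_le_ofReal ?_
  rw [← mul_assoc, mul_one_div_cancel (by positivity), one_mul]
  have h0 := norm_nonneg (u x)
  have e : (1 - ‖u x‖ ^ 2) ^ 2 = (1 - ‖u x‖) ^ 2 * (1 + ‖u x‖) ^ 2 := by ring
  rw [e]
  exact le_mul_of_one_le_right (sq_nonneg _) (by nlinarith)

theorem eLpNorm_le_of_lintegral_le {U : Set ℂ} {u : ℂ → ℂ} {X : ENNReal}
    (h : ∫⁻ x in U, ENNReal.ofReal ((1 - ‖u x‖) ^ 2) ≤ X) :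
    eLpNorm u 2 (volume.restrict U) ≤ 1 + (2 * volume U + 2 * X) := by
  refine le_one_add_of_sq_le ?_
  rw [eLpNorm_two_sq]
  calc ∫⁻ x in U, ‖u x‖ₑ ^ 2 ≤ ∫⁻ x in U, (2 + 2 * ENNReal.ofReal ((1 - ‖u x‖) ^ 2)) := by
        refine lintegral_mono fun x => ?_
        have h2 : (2 : ENNReal) = ENNReal.ofReal 2 := by norm_num
        rw [← ofReal_norm, ← ENNReal.ofReal_pow (norm_nonneg _), h2,
          ← ENNReal.ofReal_mul (by norm_num), ← ENNReal.ofReal_add (by norm_num) (by positivity)]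
        exact ENNReal.ofReal_le_ofReal (by nlinarith [sq_nonneg (‖u x‖ - 2)])
    _ = 2 * volume U + 2 * ∫⁻ x in U, ENNReal.ofReal ((1 - ‖u x‖) ^ 2) := by
        rw [lintegral_add_left measurable_const, lintegral_const, Measure.restrict_apply_univ,
          lintegral_const_mul' _ _ (by norm_num)]
    _ ≤ _ := by gcongr

/-- The approximate bulk degrees of maps of bounded energy are asymptotically integers. -/
theorem tendsto_infDist_abdeg {V : Fin N → ℂ → ℝ} (hV : ∀ i, P.IsPotential i (V i))
    (hΛ : 0 < Λ) {u : ℝ → ℂ → ℂ} (hu : ∀ ε, 0 < ε → MemH1 P.dom (u ε))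
    (hE : ∀ ε, 0 < ε → P.energy ε (u ε) ≤ ENNReal.ofReal Λ) :
    Tendsto (fun ε => Metric.infDist (WithLp.toLp 2 (P.abdeg V (u ε))) (intLattice N))
      (𝓝[>] 0) (𝓝 0) := by
  -- It suffices that every sequence of parameters tending to zero has a subsequence with the
  -- desired limit. The limit map may depend on the subsequence, but its bulk degree is always a
  -- lattice point.
  refine tendsto_of_subseq_tendsto fun ns hns => ?_
  have hev : ∀ᶠ n in atTop, ns n ∈ Ioo (0 : ℝ) 1 := hns (Ioo_mem_nhdsGT one_pos)
  obtain ⟨K, hK⟩ := eventually_atTop.1 hev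
  set ε : ℕ → ℝ := fun n => ns (n + K) with hεdef
  have hε : ∀ n, ε n ∈ Ioo (0 : ℝ) 1 := fun n => hK _ (Nat.le_add_left _ _)
  have hε0 : Tendsto ε atTop (𝓝 0) :=
    (tendsto_add_atTop_iff_nat K).2 (hns.mono_right nhdsWithin_le_nhds)
  set w : ℕ → ℂ → ℂ := fun n => u (ε n) with hw
  have hwH : ∀ n, MemH1 P.dom (w n) := fun n => hu _ (hε n).1
  have hwE : ∀ n, P.energy (ε n) (w n) ≤ ENNReal.ofReal Λ := fun n => hE _ (hε n).1
  have hvol : volume P.dom ≠ ⊤ := P.isBounded_dom.measure_lt_top.ne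
  have hone : ∀ n, ∫⁻ x in P.dom, ENNReal.ofReal ((1 - ‖w n x‖) ^ 2) ≤
      ENNReal.ofReal (2 * ε n ^ 2) * ENNReal.ofReal (2 * Λ) := fun n =>
    lintegral_one_sub_norm_le_of_energy_le (hε n).1 (hwE n)
  have hone0 : Tendsto (fun n => ∫⁻ x in P.dom, ENNReal.ofReal ((1 - ‖w n x‖) ^ 2)) atTop (𝓝 0) := by
    have h1 : Tendsto (fun n => ENNReal.ofReal (2 * ε n ^ 2) * ENNReal.ofReal (2 * Λ)) atTop
        (𝓝 (ENNReal.ofReal (2 * 0 ^ 2) * ENNReal.ofReal (2 * Λ))) :=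
      ENNReal.Tendsto.mul_const (ENNReal.tendsto_ofReal ((hε0.pow 2).const_mul 2))
        (Or.inr ENNReal.ofReal_ne_top)
    have h2 : ENNReal.ofReal (2 * 0 ^ 2) * ENNReal.ofReal (2 * Λ) = 0 := by simp
    rw [h2] at h1
    exact tendsto_of_tendsto_of_tendsto_of_le_of_le tendsto_const_nhds h1 (fun n => zero_le) hone
  have hone1 : ∀ n, ∫⁻ x in P.dom, ENNReal.ofReal ((1 - ‖w n x‖) ^ 2) ≤
      ENNReal.ofReal 2 * ENNReal.ofReal (2 * Λ) := fun n => by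
    refine (hone n).trans (mul_le_mul_left (ENNReal.ofReal_le_ofReal ?_) _)
    nlinarith [(hε n).1, (hε n).2]
  obtain ⟨v, hv, ms, hms, hlim⟩ := exists_subseq_tendsto_circle P.isOpen_dom P.isBounded_dom
    (R := 1 + (2 * volume P.dom + 2 * (ENNReal.ofReal 2 * ENNReal.ofReal (2 * Λ))))
    (B := (1 + ENNReal.ofReal (2 * Λ)) + (1 + ENNReal.ofReal (2 * Λ)))
    (by finiteness) (by finiteness) hwH (fun n => P.exists_h1Tendsto (hwH n))
    (fun n => eLpNorm_le_of_lintegral_le (hone1 n))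
    (fun n => add_le_add (eLpNorm_weakDeriv_le_of_energy_le (hwE n) (by simp))
      (eLpNorm_weakDeriv_le_of_energy_le (hwE n) (by simp))) hone0
  refine ⟨fun n => ms n + K, ?_⟩
  set Dv := ∫ x in P.dom, (‖weakDeriv P.dom 1 v x‖ ^ 2 + ‖weakDeriv P.dom Complex.I v x‖ ^ 2)
  -- The Lipschitz estimate needs one bound for the Dirichlet integrals of the sequence and of the
  -- limit. Taking the maximum avoids lower semicontinuity of the energy.
  have hDv : Dv ≤ 2 * max Λ (Dv / 2) := by linarith [le_max_right Λ (Dv / 2)]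
  have habdeg : ∀ i, Tendsto (fun n => P.abdeg V (w (ms n)) i) atTop (𝓝 (P.abdeg V v i)) := by
    intro i
    simp only [abdeg_eq]
    refine Tendsto.const_mul _ (tendsto_iff_dist_tendsto_zero.2 ?_)
    have h1 : Tendsto (fun n => 4 * P.c1Norm (V i) * Real.sqrt (max Λ (Dv / 2)) *
        (eLpNorm (fun x => w (ms n) x - v x) 2 (volume.restrict P.dom)).toReal) atTop (𝓝 0) := by
      have h2 := ((ENNReal.tendsto_toReal ENNReal.zero_ne_top).comp hlim).const_mul
        (4 * P.c1Norm (V i) * Real.sqrt (max Λ (Dv / 2)))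
      rwa [ENNReal.toReal_zero, mul_zero] at h2
    refine squeeze_zero (fun n => dist_nonneg) (fun n => ?_) h1
    rw [Real.dist_eq]
    exact (hV i).abs_bulkForm_sub_le (hwH _) hv.1
      ((P.integral_norm_sq_le_of_energy_le hΛ (hwH _) (hwE _)).trans
        (by linarith [le_max_left Λ (Dv / 2)])) hDv
  have hmem : WithLp.toLp 2 (P.abdeg V v) ∈ intLattice N := by
    choose d hd using fun i => exists_int_abdeg_eq (hV i) hv
    exact ⟨d, hd⟩
  have hvec : Tendsto (fun n => WithLp.toLp 2 (P.abdeg V (w (ms n)))) atTop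
      (𝓝 (WithLp.toLp 2 (P.abdeg V v) : EuclideanSpace ℝ (Fin N))) :=
    ((PiLp.continuous_toLp 2 _).tendsto _).comp (tendsto_pi_nhds.2 habdeg)
  exact squeeze_zero (fun n => Metric.infDist_nonneg) (fun n => Metric.infDist_le_dist_of_mem hmem)
    (tendsto_iff_dist_tendsto_zero.1 hvec)

end PerforatedDomain

end GinzburgLandau

end

theorem propositionP3p1 (N : ℕ) (hN : 1 ≤ N) (P : GinzburgLandau.PerforatedDomain N)
    (V : Fin N → ℂ → ℝ) (hV : ∀ i, P.IsPotential i (V i)) :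
    -- the norm of `V i` is finite and the integral which defines `abdeg` converges
    (∀ i, P.C1Bounded (V i) ∧
      ∀ u, GinzburgLandau.MemH1 P.dom u → IntegrableOn (P.abdegIntegrand (V i) u) P.dom) ∧
    -- first assertion
    (∀ u, GinzburgLandau.MemH1Circle P.dom u → ∀ i, P.HasDegree i u (P.abdeg V u i)) ∧
    -- second assertion
    (∀ Λ ε : ℝ, 0 < Λ → 0 < ε → ∀ u v : ℂ → ℂ, P.MemJ u → P.MemJ v →
      P.energy ε u ≤ ENNReal.ofReal Λ → P.energy ε v ≤ ENNReal.ofReal Λ →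
      ∀ i, |P.abdeg V u i - P.abdeg V v i| ≤
        2 / Real.pi * P.c1Norm (V i) * Real.sqrt Λ *
          (eLpNorm (fun x => u x - v x) 2 (volume.restrict P.dom)).toReal) ∧
    -- third assertion
    (∀ Λ : ℝ, 0 < Λ → ∀ u : ℝ → ℂ → ℂ,
      (∀ ε, 0 < ε → P.MemJ (u ε) ∧ P.energy ε (u ε) ≤ ENNReal.ofReal Λ) →
      Tendsto (fun ε => Metric.infDist (WithLp.toLp 2 (P.abdeg V (u ε)))
        (GinzburgLandau.intLattice N)) (𝓝[>] 0) (𝓝 0)) := by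
  refine ⟨fun i => ⟨(hV i).c1Bounded, fun u hu => (hV i).integrableOn_abdegIntegrand hu⟩,
    fun u hu i => GinzburgLandau.PerforatedDomain.hasDegree_abdeg (hV i) hu,
    fun Λ ε hΛ _ u v hu hv hEu hEv i => P.abs_abdeg_sub_le (hV i) hΛ hu.1 hv.1 hEu hEv,
    fun Λ hΛ u hu => GinzburgLandau.PerforatedDomain.tendsto_infDist_abdeg hV hΛ
      (fun ε hε => (hu ε hε).1.1) fun ε hε => (hu ε hε).2⟩
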